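/- **Graphs in $\mathsf{Cat}$ and pseudodouble categories.** A graph in $\mathsf{Cat}$ is a parallel pair of functors $\mathrm{dom},\mathrm{cod}\colon D_1\rightrightarrows D_0$ between (small) categories; objects and morphisms of $D_0$ are called 0-cells and vertical 1-cells, objects and morphisms of $D_1$ are called horizontal 1-cells and 2-cells. $\mathsf{Grph}(\mathsf{Cat})=[\cdot\rightrightarrows\cdot,\mathsf{Cat}]$ is the 2-category of these graphs, of pairs of functors $F=(F_0,F_1)$ commuting strictly with $\mathrm{dom},\mathrm{cod}$, and of pairs $\theta=(\theta_0,\theta_1)\colon F\to G$ of natural transformations $\theta_i\colon F_i\to G_i$ with $\mathrm{dom}\cdot\theta_1=\theta_0\cdot\mathrm{dom}$, $\mathrm{cod}\cdot\theta_1=\theta_0\cdot\mathrm{cod}$. A pseudodouble category is a graph $D$ in $\mathsf{Cat}$ with a horizontal unit functor $1\colon D_0\to D_1$, a horizontal composition functor $(s,r)\mapsto s\cdot r$ on composable pairs, and globular natural isomorphisms $\lambda\colon 1\cdot r\to r$, $\rho\colon r\cdot 1\to r$, $\alpha\colon (t\cdot s)\cdot r\to t\cdot(s\cdot r)$ satisfying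 $\lambda_1=\rho_1$, the three unit triangles and the pentagon. A lax functor $F\colon D\to E$ of pseudodouble categories is a morphism of graphs with globular natural comparisons $e^F\colon 1_{Fx}\to F1_x$ and $m^F\colon Fs\cdot Fr\to F(s\cdot r)$ satisfying the unit and associativity conditions; for an oplax functor the comparisons $e^F$, $m^F$ point the other way. For lax functors $H\colon A\to B$, $K\colon C\to D$ and oplax functors $F\colon A\to C$, $G\colon B\to D$, a 2-cell $\omega\colon GH\to KF$ of $\mathsf{Grph}(\mathsf{Cat})$ is a generalized vertical transformation if, for all $x$ and all composable $r,s$, $$e^K_{Fx}\circ 1_{\omega_x}\circ e^G_{Hx}=Ke^F_x\circ\omega_{1_x}\circ Ge^H_x,\qquad m^K\circ(\omega_s\cdot\omega_r)\circ m^G=Km^F\circ\omega_{s\cdot r}\circ Gm^H .$$ $\mathsf{PsDbCat}$ is the double category of pseudodouble categories, lax functors (horizontally), oplax functors (vertically) and generalized vertical transformations. **Algebras.** The free internal category 2-monad $\mathfrak F=(\mathfrak F,m,e)$ on $\mathsf{Grph}(\mathsf{Cat})$ leaves $D_0$ unchanged, and $(\mathfrak FD)_1$ consists of composable strings $(r_1,\dots,r_n)$,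 $n\ge 0$, of horizontal 1-cells and of horizontally composable strings of 2-cells (of vertical 1-cells for $n=0$); $m$ is concatenation and $e$ sends $r$ to $(r)$. A pseudo-$\mathfrak F$-algebra is a graph $D$ with $a\colon\mathfrak FD\to D$ and invertible 2-cells $\eta\colon 1\to a e$, $\mu\colon a\cdot\mathfrak Fa\to a m$ satisfying the two unit laws and the associativity law of a lax algebra. A lax algebra morphism $(D,a)\to(E,b)$ is a graph morphism $h$ with a 2-cell $\varphi\colon b\cdot\mathfrak Fh\to h\cdot a$ compatible with $\eta$ and $\mu$; it is a pseudomorphism if $\varphi$ is invertible. An oplax morphism is a graph morphism $f$ with a 2-cell $\zeta\colon f\cdot a\to b\cdot\mathfrak Ff$, similarly compatible. For lax morphisms $(h,\varphi)$, $(k,\psi)$ and oplax morphisms $(f,\zeta)$, $(g,\xi)$ in a square with structure maps $a,b,c,d$ at the corners, a 2-cell $\omega\colon gh\to kf$ is a generalized algebra 2-cell if $$(k\cdot\zeta)\circ(\omega\cdot a)\circ(g\cdot\varphi)=(\psi\cdot\mathfrak Ff)\circ(d\cdot\mathfrak F\omega)\circ(\xi\cdot\mathfrak Fh).$$ $\mathsf{Ps}\text{-}\mathfrak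 F\text{-}\mathsf{Alg}$ is the double category of pseudo-$\mathfrak F$-algebras, lax morphisms (horizontally), oplax morphisms (vertically) and generalized algebra 2-cells. A pseudo-$\mathfrak F$-algebra is called normal if $a$ is the identity on 0-cells and vertical 1-cells and $\eta$ is the identity there. An algebra 2-cell between lax morphisms is a generalized algebra 2-cell whose two oplax sides are identities, and two algebras are called equivalent if there are pseudomorphisms $f,k$ between them, in opposite directions, and invertible algebra 2-cells $1\cong kf$, $fk\cong 1$. An equivalence of double categories is a strong double functor $\Phi$ that has a quasi-inverse strong double functor $\Psi$ with invertible vertical transformations $1\cong\Psi\Phi$ and $\Phi\Psi\cong 1$. **Theorem.** There is a strict double functor $\Phi\colon\mathsf{PsDbCat}\to\mathsf{Ps}\text{-}\mathfrak F\text{-}\mathsf{Alg}$ which is the identity on underlying graphs, graph morphisms and 2-cells of $\mathsf{Grph}(\mathsf{Cat})$, which sends a pseudodouble category to the normal pseudo-algebra with $$a()=1,\qquad a(r_1,\dots,r_{n+1})=r_{n+1}\cdot a(r_1,\dots,r_n)$$ (likewise on 2-cells) and $\eta_r=\rho_r^{-1}$, and which sends a lax functor $F$ to the lax algebra morphism $(F,\varphi)$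 with $\varphi_{()}=e^F$, $\varphi_{r_1,\dots,r_{n+1}}=m^F\circ(\mathrm{id}\cdot\varphi_{r_1,\dots,r_n})$, and dually for oplax functors. It has the following properties. 1. $\Phi$ is an equivalence of double categories from $\mathsf{PsDbCat}$ to the full sub-double category of $\mathsf{Ps}\text{-}\mathfrak F\text{-}\mathsf{Alg}$ on the normal pseudo-$\mathfrak F$-algebras. 2. For pseudodouble categories $D,E$ and a morphism $F$ of their underlying graphs, $\Phi$ is a bijection from the lax functor structures on $F$ to the lax algebra morphism structures on $F$, and from the oplax functor structures on $F$ to the oplax algebra morphism structures on $F$. 3. For lax functors $H,K$ and oplax functors $F,G$ as above, a 2-cell $\omega\colon GH\to KF$ of $\mathsf{Grph}(\mathsf{Cat})$ is a generalized vertical transformation if and only if it is a generalized algebra 2-cell between the corresponding algebra morphisms. 4. Every normal pseudo-$\mathfrak F$-algebra on a graph $D$ is isomorphic to $\Phi$ of a pseudodouble category on the same graph $D$, by an invertible pseudomorphism over $\mathrm{id}_D$. 5. Every pseudo-$\mathfrak F$-algebra, normal or not, is equivalent to $\Phi$ of a pseudodouble category. -/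

import Mathlib

open CategoryTheory

universe u v w u₀ v₀ u₁ v₁

namespace DblPsAlg

/-- The type of all members of a family `H x y`: a member together with its two endpoints. -/
structure HObj {C : Type u₀} (H : C → C → Type u₁) where
  {src : C}
  {tgt : C}
  hom : H src tgt

/-- A graph in `Cat`: a parallel pair of functors `dom, cod : D₁ ⥤ D₀`.  The category `D₀` is `Ob`;
the objects of `D₁` (horizontal 1-cells) are sorted by their endpoints, `Hor x y` being the fibre
over `(x, y)`, and `D₁` itself is the category `HObj Hor`.  Hence `dom` and `cod` are given on
objects by `src` and `tgt`, and only their action on morphisms (2-cells) is a datum. -/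
structure CatGraph where
  Ob : Type u₀
  [cat₀ : Category.{v₀} Ob]
  Hor : Ob → Ob → Type u₁
  [cat₁ : Category.{v₁} (HObj Hor)]
  dom : ∀ {r s : HObj Hor}, (r ⟶ s) → (r.src ⟶ s.src)
  cod : ∀ {r s : HObj Hor}, (r ⟶ s) → (r.tgt ⟶ s.tgt)
  dom_id : ∀ r : HObj Hor, dom (𝟙 r) = 𝟙 r.src
  cod_id : ∀ r : HObj Hor, cod (𝟙 r) = 𝟙 r.tgt
  dom_comp : ∀ {r s t : HObj Hor} (φ : r ⟶ s) (ψ : s ⟶ t), dom (φ ≫ ψ) = dom φ ≫ dom ψ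
  cod_comp : ∀ {r s t : HObj Hor} (φ : r ⟶ s) (ψ : s ⟶ t), cod (φ ≫ ψ) = cod φ ≫ cod ψ

attribute [instance] CatGraph.cat₀ CatGraph.cat₁
attribute [simp] CatGraph.dom_id CatGraph.cod_id CatGraph.dom_comp CatGraph.cod_comp

/-- The category `D₁` of horizontal 1-cells and 2-cells. -/
abbrev CatGraph.One (D : CatGraph.{u₀, v₀, u₁, v₁}) : Type (max u₀ u₁) := HObj D.Hor

/-- The functor `dom : D₁ ⥤ D₀`. -/
def CatGraph.domFunctor (D : CatGraph.{u₀, v₀, u₁, v₁}) : D.One ⥤ D.Ob where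
  obj r := r.src
  map φ := D.dom φ

/-- The functor `cod : D₁ ⥤ D₀`. -/
def CatGraph.codFunctor (D : CatGraph.{u₀, v₀, u₁, v₁}) : D.One ⥤ D.Ob where
  obj r := r.tgt
  map φ := D.cod φ

/-- Morphisms of graphs in `Cat`: functors `F₀`, `F₁` strictly commuting with `dom` and `cod`. -/
structure GraphHom (D E : CatGraph.{u₀, v₀, u₁, v₁}) where
  F₀ : D.Ob ⥤ E.Ob
  obj₁ : ∀ {x y : D.Ob}, D.Hor x y → E.Hor (F₀.obj x) (F₀.obj y)
  map₁ : ∀ {r s : D.One}, (r ⟶ s) → (HObj.mk (H := E.Hor) (obj₁ r.hom) ⟶ ⟨obj₁ s.hom⟩)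
  map₁_id : ∀ r : D.One, map₁ (𝟙 r) = 𝟙 _
  map₁_comp : ∀ {r s t : D.One} (φ : r ⟶ s) (ψ : s ⟶ t), map₁ (φ ≫ ψ) = map₁ φ ≫ map₁ ψ
  dom_map₁ : ∀ {r s : D.One} (φ : r ⟶ s), E.dom (map₁ φ) = F₀.map (D.dom φ)
  cod_map₁ : ∀ {r s : D.One} (φ : r ⟶ s), E.cod (map₁ φ) = F₀.map (D.cod φ)

attribute [simp] GraphHom.map₁_id GraphHom.map₁_comp GraphHom.dom_map₁ GraphHom.cod_map₁

/-- The functor `F₁ : D₁ ⥤ E₁`. -/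
def GraphHom.F₁ {D E : CatGraph.{u₀, v₀, u₁, v₁}} (F : GraphHom D E) : D.One ⥤ E.One where
  obj r := ⟨F.obj₁ r.hom⟩
  map φ := F.map₁ φ

/-- 2-cells of graphs in `Cat`: natural transformations `θ₀`, `θ₁` with
`dom · θ₁ = θ₀ · dom` and `cod · θ₁ = θ₀ · cod`. -/
@[ext]
structure GraphCell {D E : CatGraph.{u₀, v₀, u₁, v₁}} (F K : GraphHom D E) where
  app₀ : ∀ x : D.Ob, F.F₀.obj x ⟶ K.F₀.obj x
  app₁ : ∀ r : D.One, HObj.mk (H := E.Hor) (F.obj₁ r.hom) ⟶ ⟨K.obj₁ r.hom⟩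
  nat₀ : ∀ {x y : D.Ob} (f : x ⟶ y), F.F₀.map f ≫ app₀ y = app₀ x ≫ K.F₀.map f
  nat₁ : ∀ {r s : D.One} (φ : r ⟶ s), F.map₁ φ ≫ app₁ s = app₁ r ≫ K.map₁ φ
  dom_app : ∀ r : D.One, E.dom (app₁ r) = app₀ r.src
  cod_app : ∀ r : D.One, E.cod (app₁ r) = app₀ r.tgt

attribute [simp] GraphCell.dom_app GraphCell.cod_app

instance graphHomCategory (D E : CatGraph.{u₀, v₀, u₁, v₁}) : Category (GraphHom D E) where
  Hom F K := GraphCell F K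
  id F :=
    { app₀ := fun x => 𝟙 _
      app₁ := fun r => 𝟙 _
      nat₀ := by simp
      nat₁ := by simp
      dom_app := by simp
      cod_app := by simp }
  comp θ κ :=
    { app₀ := fun x => θ.app₀ x ≫ κ.app₀ x
      app₁ := fun r => θ.app₁ r ≫ κ.app₁ r
      nat₀ := fun f => by rw [reassoc_of% θ.nat₀, κ.nat₀, Category.assoc]
      nat₁ := fun f => by rw [reassoc_of% θ.nat₁, κ.nat₁, Category.assoc]
      dom_app := by simp
      cod_app := by simp }
  id_comp θ := by ext <;> simp
  comp_id θ := by ext <;> simp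
  assoc θ κ ν := by ext <;> simp

instance catGraphCategoryStruct : CategoryStruct CatGraph.{u₀, v₀, u₁, v₁} where
  Hom D E := GraphHom D E
  id D :=
    { F₀ := 𝟭 D.Ob
      obj₁ := fun r => r
      map₁ := fun φ => φ
      map₁_id := fun r => rfl
      map₁_comp := fun φ ψ => rfl
      dom_map₁ := fun φ => rfl
      cod_map₁ := fun φ => rfl }
  comp F K :=
    { F₀ := F.F₀ ⋙ K.F₀
      obj₁ := fun r => K.obj₁ (F.obj₁ r)
      map₁ := fun φ => K.map₁ (F.map₁ φ)
      map₁_id := fun r => by simp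
      map₁_comp := fun φ ψ => by simp
      dom_map₁ := fun φ => by simp
      cod_map₁ := fun φ => by simp }

instance graphHomCategory' (D E : CatGraph.{u₀, v₀, u₁, v₁}) : Category (D ⟶ E) :=
  graphHomCategory D E

section lemmas

variable {A B C D : CatGraph.{u₀, v₀, u₁, v₁}}

@[simp] theorem id_app₀ (F : A ⟶ B) (x : A.Ob) : GraphCell.app₀ (𝟙 F) x = 𝟙 (F.F₀.obj x) := rfl

@[simp] theorem id_app₁ (F : A ⟶ B) (r : A.One) : GraphCell.app₁ (𝟙 F) r = 𝟙 _ := rfl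

@[simp] theorem comp_app₀ {F K L : A ⟶ B} (θ : F ⟶ K) (κ : K ⟶ L) (x : A.Ob) :
    GraphCell.app₀ (θ ≫ κ) x = GraphCell.app₀ θ x ≫ GraphCell.app₀ κ x := rfl

@[simp] theorem comp_app₁ {F K L : A ⟶ B} (θ : F ⟶ K) (κ : K ⟶ L) (r : A.One) :
    GraphCell.app₁ (θ ≫ κ) r = GraphCell.app₁ θ r ≫ GraphCell.app₁ κ r := rfl

theorem graphCell_ext {F K : A ⟶ B} {θ κ : F ⟶ K}
    (h₀ : ∀ x, GraphCell.app₀ θ x = GraphCell.app₀ κ x)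
    (h₁ : ∀ r, GraphCell.app₁ θ r = GraphCell.app₁ κ r) : θ = κ :=
  GraphCell.ext (funext h₀) (funext h₁)

end lemmas

/-- The 2-category `Grph(Cat)`, that is `[· ⇉ ·, Cat]`. -/
instance catGraphBicategory : Bicategory CatGraph.{u₀, v₀, u₁, v₁} where
  toCategoryStruct := catGraphCategoryStruct
  homCategory D E := graphHomCategory' D E
  whiskerLeft F _ _ θ :=
    { app₀ := fun x => GraphCell.app₀ θ (F.F₀.obj x)
      app₁ := fun r => GraphCell.app₁ θ ⟨F.obj₁ r.hom⟩
      nat₀ := fun f => GraphCell.nat₀ θ _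
      nat₁ := fun f => GraphCell.nat₁ θ _
      dom_app := fun r => GraphCell.dom_app θ _
      cod_app := fun r => GraphCell.cod_app θ _ }
  whiskerRight θ K :=
    { app₀ := fun x => K.F₀.map (GraphCell.app₀ θ x)
      app₁ := fun r => K.map₁ (GraphCell.app₁ θ r)
      nat₀ := fun f => by
        have h := congrArg K.F₀.map (GraphCell.nat₀ θ f)
        rw [Functor.map_comp, Functor.map_comp] at h
        exact h
      nat₁ := fun f => by
        have h := congrArg K.map₁ (GraphCell.nat₁ θ f)
        rw [GraphHom.map₁_comp, GraphHom.map₁_comp] at h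
        exact h
      dom_app := fun r => by simp
      cod_app := fun r => by simp }
  associator F K L := eqToIso rfl
  leftUnitor F := eqToIso rfl
  rightUnitor F := eqToIso rfl
  whiskerLeft_id F K := rfl
  whiskerLeft_comp F _ _ _ θ κ := rfl
  id_whiskerLeft θ := by
    apply graphCell_ext <;> intro x <;>
    exact ((Category.id_comp _).trans (Category.comp_id _)).symm
  comp_whiskerLeft F K _ _ θ := by
    apply graphCell_ext <;> intro x <;>
    exact ((Category.id_comp _).trans (Category.comp_id _)).symm
  id_whiskerRight F K := by
    apply graphCell_ext <;> intro x
    · exact K.F₀.map_id _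
    · exact K.map₁_id _
  comp_whiskerRight θ κ K := by
    apply graphCell_ext <;> intro x
    · exact K.F₀.map_comp _ _
    · exact K.map₁_comp _ _
  whiskerRight_id θ := by
    apply graphCell_ext <;> intro x <;>
    exact ((Category.id_comp _).trans (Category.comp_id _)).symm
  whiskerRight_comp θ K L := by
    apply graphCell_ext <;> intro x <;>
    exact ((Category.id_comp _).trans (Category.comp_id _)).symm
  whisker_assoc F _ _ θ K := by
    apply graphCell_ext <;> intro x <;>
    exact ((Category.id_comp _).trans (Category.comp_id _)).symm
  whisker_exchange θ κ := by
    apply graphCell_ext <;> intro x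
    · exact (GraphCell.nat₀ κ _).symm
    · exact (GraphCell.nat₁ κ _).symm
  pentagon F K L M := by
    apply graphCell_ext <;> intro x
    · exact congrArg₂ (· ≫ ·) (M.F₀.map_id _) (Category.id_comp _)
    · exact congrArg₂ (· ≫ ·) (M.map₁_id _) (Category.id_comp _)
  triangle F K := by
    apply graphCell_ext <;> intro x
    · exact (Category.id_comp _).trans (K.F₀.map_id _).symm
    · exact (Category.id_comp _).trans (K.map₁_id _).symm

instance catGraphStrict : Bicategory.Strict CatGraph.{u₀, v₀, u₁, v₁} where
  id_comp _ := rfl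
  comp_id _ := rfl
  assoc _ _ _ := rfl
  leftUnitor_eqToIso _ := rfl
  rightUnitor_eqToIso _ := rfl
  associator_eqToIso _ _ _ := rfl


/-- The structure of a pseudodouble category on a graph in `Cat`.  Horizontal composition is written
in the order `comp s r` for `r : x ⇸ y`, `s : y ⇸ z`. -/
structure PseudoDblStr (D : CatGraph.{u₀, v₀, u₁, v₁}) where
  /-- the horizontal unit functor -/
  one : ∀ x : D.Ob, D.Hor x x
  oneMap : ∀ {x y : D.Ob}, (x ⟶ y) → (HObj.mk (one x) ⟶ HObj.mk (one y))
  dom_oneMap : ∀ {x y : D.Ob} (f : x ⟶ y), D.dom (oneMap f) = f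
  cod_oneMap : ∀ {x y : D.Ob} (f : x ⟶ y), D.cod (oneMap f) = f
  oneMap_id : ∀ x : D.Ob, oneMap (𝟙 x) = 𝟙 _
  oneMap_comp : ∀ {x y z : D.Ob} (f : x ⟶ y) (g : y ⟶ z), oneMap (f ≫ g) = oneMap f ≫ oneMap g
  /-- the horizontal composition functor, on composable pairs -/
  comp : ∀ {x y z : D.Ob}, D.Hor y z → D.Hor x y → D.Hor x z
  hcomp : ∀ {x y z x' y' z' : D.Ob} {s : D.Hor y z} {r : D.Hor x y} {s' : D.Hor y' z'}
    {r' : D.Hor x' y'} (ψ : HObj.mk s ⟶ HObj.mk s') (φ : HObj.mk r ⟶ HObj.mk r'),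
    D.dom ψ = D.cod φ → (HObj.mk (comp s r) ⟶ HObj.mk (comp s' r'))
  dom_hcomp : ∀ {x y z x' y' z' : D.Ob} {s : D.Hor y z} {r : D.Hor x y} {s' : D.Hor y' z'}
    {r' : D.Hor x' y'} (ψ : HObj.mk s ⟶ HObj.mk s') (φ : HObj.mk r ⟶ HObj.mk r')
    (h : D.dom ψ = D.cod φ), D.dom (hcomp ψ φ h) = D.dom φ
  cod_hcomp : ∀ {x y z x' y' z' : D.Ob} {s : D.Hor y z} {r : D.Hor x y} {s' : D.Hor y' z'}
    {r' : D.Hor x' y'} (ψ : HObj.mk s ⟶ HObj.mk s') (φ : HObj.mk r ⟶ HObj.mk r')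
    (h : D.dom ψ = D.cod φ), D.cod (hcomp ψ φ h) = D.cod ψ
  hcomp_id : ∀ {x y z : D.Ob} (s : D.Hor y z) (r : D.Hor x y),
    hcomp (𝟙 (HObj.mk s)) (𝟙 (HObj.mk r)) (by simp) = 𝟙 _
  hcomp_comp : ∀ {x y z x' y' z' x'' y'' z'' : D.Ob} {s : D.Hor y z} {r : D.Hor x y}
    {s' : D.Hor y' z'} {r' : D.Hor x' y'} {s'' : D.Hor y'' z''} {r'' : D.Hor x'' y''}
    (ψ : HObj.mk s ⟶ HObj.mk s') (φ : HObj.mk r ⟶ HObj.mk r') (h : D.dom ψ = D.cod φ)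
    (ψ' : HObj.mk s' ⟶ HObj.mk s'') (φ' : HObj.mk r' ⟶ HObj.mk r'') (h' : D.dom ψ' = D.cod φ'),
    hcomp (ψ ≫ ψ') (φ ≫ φ') (by simp [h, h']) = hcomp ψ φ h ≫ hcomp ψ' φ' h'
  /-- the left unitor -/
  lam : ∀ {x y : D.Ob} (r : D.Hor x y), HObj.mk (comp (one y) r) ≅ HObj.mk r
  dom_lam : ∀ {x y : D.Ob} (r : D.Hor x y), D.dom (lam r).hom = 𝟙 x
  cod_lam : ∀ {x y : D.Ob} (r : D.Hor x y), D.cod (lam r).hom = 𝟙 y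
  lam_nat : ∀ {x y x' y' : D.Ob} {r : D.Hor x y} {r' : D.Hor x' y'}
    (φ : HObj.mk r ⟶ HObj.mk r'),
    hcomp (oneMap (D.cod φ)) φ (dom_oneMap _) ≫ (lam r').hom = (lam r).hom ≫ φ
  /-- the right unitor -/
  rho : ∀ {x y : D.Ob} (r : D.Hor x y), HObj.mk (comp r (one x)) ≅ HObj.mk r
  dom_rho : ∀ {x y : D.Ob} (r : D.Hor x y), D.dom (rho r).hom = 𝟙 x
  cod_rho : ∀ {x y : D.Ob} (r : D.Hor x y), D.cod (rho r).hom = 𝟙 y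
  rho_nat : ∀ {x y x' y' : D.Ob} {r : D.Hor x y} {r' : D.Hor x' y'}
    (φ : HObj.mk r ⟶ HObj.mk r'),
    hcomp φ (oneMap (D.dom φ)) (cod_oneMap _).symm ≫ (rho r').hom = (rho r).hom ≫ φ
  /-- the associator -/
  alpha : ∀ {w x y z : D.Ob} (t : D.Hor y z) (s : D.Hor x y) (r : D.Hor w x),
    HObj.mk (comp (comp t s) r) ≅ HObj.mk (comp t (comp s r))
  dom_alpha : ∀ {w x y z : D.Ob} (t : D.Hor y z) (s : D.Hor x y) (r : D.Hor w x),
    D.dom (alpha t s r).hom = 𝟙 w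
  cod_alpha : ∀ {w x y z : D.Ob} (t : D.Hor y z) (s : D.Hor x y) (r : D.Hor w x),
    D.cod (alpha t s r).hom = 𝟙 z
  alpha_nat : ∀ {w x y z w' x' y' z' : D.Ob} {t : D.Hor y z} {s : D.Hor x y} {r : D.Hor w x}
    {t' : D.Hor y' z'} {s' : D.Hor x' y'} {r' : D.Hor w' x'}
    (χ : HObj.mk t ⟶ HObj.mk t') (ψ : HObj.mk s ⟶ HObj.mk s') (φ : HObj.mk r ⟶ HObj.mk r')
    (h : D.dom χ = D.cod ψ) (h' : D.dom ψ = D.cod φ),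
    hcomp (hcomp χ ψ h) φ ((dom_hcomp _ _ _).trans h') ≫ (alpha t' s' r').hom =
      (alpha t s r).hom ≫ hcomp χ (hcomp ψ φ h') (h.trans (cod_hcomp _ _ _).symm)
  /-- the five coherence conditions -/
  unit_unit : ∀ x : D.Ob, (lam (one x)).hom ≫ (rho (one x)).inv = 𝟙 _
  left_left : ∀ {x y z : D.Ob} (s : D.Hor y z) (r : D.Hor x y),
    (alpha (one z) s r).hom ≫ (lam (comp s r)).hom =
      hcomp (lam s).hom (𝟙 (HObj.mk r)) (by simp [dom_lam])
  right_right : ∀ {x y z : D.Ob} (s : D.Hor y z) (r : D.Hor x y),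
    (alpha s r (one x)).hom ≫ hcomp (𝟙 (HObj.mk s)) (rho r).hom (by simp [cod_rho]) =
      (rho (comp s r)).hom
  triangle : ∀ {x y z : D.Ob} (s : D.Hor y z) (r : D.Hor x y),
    (alpha s (one y) r).hom ≫ hcomp (𝟙 (HObj.mk s)) (lam r).hom (by simp [cod_lam]) =
      hcomp (rho s).hom (𝟙 (HObj.mk r)) (by simp [dom_rho])
  pentagon : ∀ {v w x y z : D.Ob} (t : D.Hor y z) (s : D.Hor x y) (r : D.Hor w x)
    (q : D.Hor v w),
    (alpha (comp t s) r q).hom ≫ (alpha t s (comp r q)).hom =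
      hcomp (alpha t s r).hom (𝟙 (HObj.mk q)) (by simp [dom_alpha]) ≫
        (alpha t (comp s r) q).hom ≫
          hcomp (𝟙 (HObj.mk t)) (alpha s r q).hom (by simp [cod_alpha])

attribute [simp] PseudoDblStr.dom_oneMap PseudoDblStr.cod_oneMap PseudoDblStr.oneMap_id
  PseudoDblStr.dom_hcomp PseudoDblStr.cod_hcomp PseudoDblStr.hcomp_id
  PseudoDblStr.dom_lam PseudoDblStr.cod_lam PseudoDblStr.dom_rho PseudoDblStr.cod_rho
  PseudoDblStr.dom_alpha PseudoDblStr.cod_alpha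

/-- A graph morphism between (the underlying graphs of) pseudodouble categories, made a lax
functor: `unit` and `mul` are the globular comparison transformations
`1 ∘ F₀ → F₁ ∘ 1` and `F₁ s · F₁ r → F₁ (s · r)`. -/
@[ext]
structure LaxStr {D E : CatGraph.{u₀, v₀, u₁, v₁}} (P : PseudoDblStr D) (Q : PseudoDblStr E)
    (F : D ⟶ E) where
  unit : ∀ x : D.Ob, HObj.mk (Q.one (F.F₀.obj x)) ⟶ HObj.mk (F.obj₁ (P.one x))
  dom_unit : ∀ x, E.dom (unit x) = 𝟙 _
  cod_unit : ∀ x, E.cod (unit x) = 𝟙 _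
  unit_nat : ∀ {x y : D.Ob} (f : x ⟶ y),
    Q.oneMap (F.F₀.map f) ≫ unit y = unit x ≫ F.map₁ (P.oneMap f)
  mul : ∀ {x y z : D.Ob} (s : D.Hor y z) (r : D.Hor x y),
    HObj.mk (Q.comp (F.obj₁ s) (F.obj₁ r)) ⟶ HObj.mk (F.obj₁ (P.comp s r))
  dom_mul : ∀ {x y z : D.Ob} (s : D.Hor y z) (r : D.Hor x y), E.dom (mul s r) = 𝟙 _
  cod_mul : ∀ {x y z : D.Ob} (s : D.Hor y z) (r : D.Hor x y), E.cod (mul s r) = 𝟙 _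
  mul_nat : ∀ {x y z x' y' z' : D.Ob} {s : D.Hor y z} {r : D.Hor x y} {s' : D.Hor y' z'}
    {r' : D.Hor x' y'} (ψ : HObj.mk s ⟶ HObj.mk s') (φ : HObj.mk r ⟶ HObj.mk r')
    (h : D.dom ψ = D.cod φ),
    Q.hcomp (F.map₁ ψ) (F.map₁ φ) (by simp [h]) ≫ mul s' r' = mul s r ≫ F.map₁ (P.hcomp ψ φ h)
  left : ∀ {x y : D.Ob} (r : D.Hor x y),
    Q.hcomp (unit y) (𝟙 (HObj.mk (F.obj₁ r))) (by simp [dom_unit]) ≫ mul (P.one y) r =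
      (Q.lam (F.obj₁ r)).hom ≫ F.map₁ (P.lam r).inv
  right : ∀ {x y : D.Ob} (r : D.Hor x y),
    Q.hcomp (𝟙 (HObj.mk (F.obj₁ r))) (unit x) (by simp [cod_unit]) ≫ mul r (P.one x) =
      (Q.rho (F.obj₁ r)).hom ≫ F.map₁ (P.rho r).inv
  assoc : ∀ {w x y z : D.Ob} (t : D.Hor y z) (s : D.Hor x y) (r : D.Hor w x),
    Q.hcomp (mul t s) (𝟙 (HObj.mk (F.obj₁ r))) (by simp [dom_mul]) ≫ mul (P.comp t s) r ≫
        F.map₁ (P.alpha t s r).hom =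
      (Q.alpha (F.obj₁ t) (F.obj₁ s) (F.obj₁ r)).hom ≫
        Q.hcomp (𝟙 (HObj.mk (F.obj₁ t))) (mul s r) (by simp [cod_mul]) ≫ mul t (P.comp s r)

/-- A graph morphism made an oplax functor: the comparisons of a lax functor, reversed. -/
@[ext]
structure OplaxStr {D E : CatGraph.{u₀, v₀, u₁, v₁}} (P : PseudoDblStr D) (Q : PseudoDblStr E)
    (F : D ⟶ E) where
  unit : ∀ x : D.Ob, HObj.mk (F.obj₁ (P.one x)) ⟶ HObj.mk (Q.one (F.F₀.obj x))
  dom_unit : ∀ x, E.dom (unit x) = 𝟙 _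
  cod_unit : ∀ x, E.cod (unit x) = 𝟙 _
  unit_nat : ∀ {x y : D.Ob} (f : x ⟶ y),
    F.map₁ (P.oneMap f) ≫ unit y = unit x ≫ Q.oneMap (F.F₀.map f)
  mul : ∀ {x y z : D.Ob} (s : D.Hor y z) (r : D.Hor x y),
    HObj.mk (F.obj₁ (P.comp s r)) ⟶ HObj.mk (Q.comp (F.obj₁ s) (F.obj₁ r))
  dom_mul : ∀ {x y z : D.Ob} (s : D.Hor y z) (r : D.Hor x y), E.dom (mul s r) = 𝟙 _
  cod_mul : ∀ {x y z : D.Ob} (s : D.Hor y z) (r : D.Hor x y), E.cod (mul s r) = 𝟙 _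
  mul_nat : ∀ {x y z x' y' z' : D.Ob} {s : D.Hor y z} {r : D.Hor x y} {s' : D.Hor y' z'}
    {r' : D.Hor x' y'} (ψ : HObj.mk s ⟶ HObj.mk s') (φ : HObj.mk r ⟶ HObj.mk r')
    (h : D.dom ψ = D.cod φ),
    F.map₁ (P.hcomp ψ φ h) ≫ mul s' r' = mul s r ≫ Q.hcomp (F.map₁ ψ) (F.map₁ φ) (by simp [h])
  left : ∀ {x y : D.Ob} (r : D.Hor x y),
    mul (P.one y) r ≫ Q.hcomp (unit y) (𝟙 (HObj.mk (F.obj₁ r))) (by simp [dom_unit]) =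
      F.map₁ (P.lam r).hom ≫ (Q.lam (F.obj₁ r)).inv
  right : ∀ {x y : D.Ob} (r : D.Hor x y),
    mul r (P.one x) ≫ Q.hcomp (𝟙 (HObj.mk (F.obj₁ r))) (unit x) (by simp [cod_unit]) =
      F.map₁ (P.rho r).hom ≫ (Q.rho (F.obj₁ r)).inv
  assoc : ∀ {w x y z : D.Ob} (t : D.Hor y z) (s : D.Hor x y) (r : D.Hor w x),
    F.map₁ (P.alpha t s r).inv ≫ mul (P.comp t s) r ≫
        Q.hcomp (mul t s) (𝟙 (HObj.mk (F.obj₁ r))) (by simp [dom_mul]) =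
      mul t (P.comp s r) ≫ Q.hcomp (𝟙 (HObj.mk (F.obj₁ t))) (mul s r) (by simp [cod_mul]) ≫
        (Q.alpha (F.obj₁ t) (F.obj₁ s) (F.obj₁ r)).inv

attribute [simp] LaxStr.dom_unit LaxStr.cod_unit LaxStr.dom_mul LaxStr.cod_mul
  OplaxStr.dom_unit OplaxStr.cod_unit OplaxStr.dom_mul OplaxStr.cod_mul

/-- For lax functors `h : A → B`, `k : C → D` and oplax functors `f : A → C`, `g : B → D`, a 2-cell
`θ : g ∘ h ⟶ k ∘ f` of graphs in `Cat` is a generalized vertical transformation. -/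
structure IsGenTransf {A B C D : CatGraph.{u₀, v₀, u₁, v₁}} {P : PseudoDblStr A}
    {Q : PseudoDblStr B} {R : PseudoDblStr C} {S : PseudoDblStr D}
    {H : A ⟶ B} {F : A ⟶ C} {G : B ⟶ D} {K : C ⟶ D}
    (h : LaxStr P Q H) (f : OplaxStr P R F) (g : OplaxStr Q S G) (k : LaxStr R S K)
    (θ : H ≫ G ⟶ F ≫ K) : Prop where
  unit : ∀ x : A.Ob,
    g.unit (H.F₀.obj x) ≫ S.oneMap (GraphCell.app₀ θ x) ≫ k.unit (F.F₀.obj x) =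
      G.map₁ (h.unit x) ≫ GraphCell.app₁ θ ⟨P.one x⟩ ≫ K.map₁ (f.unit x)
  mul : ∀ {x y z : A.Ob} (s : A.Hor y z) (r : A.Hor x y),
    g.mul (H.obj₁ s) (H.obj₁ r) ≫
        S.hcomp (GraphCell.app₁ θ ⟨s⟩) (GraphCell.app₁ θ ⟨r⟩) (by simp) ≫
          k.mul (F.obj₁ s) (F.obj₁ r) =
      G.map₁ (h.mul s r) ≫ GraphCell.app₁ θ ⟨P.comp s r⟩ ≫ K.map₁ (f.mul s r)

theorem LaxStr.mul_nat_assoc {D E : CatGraph.{u₀, v₀, u₁, v₁}} {P : PseudoDblStr D}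
    {Q : PseudoDblStr E} {F : D ⟶ E} (f : LaxStr P Q F) {x y z x' y' z' : D.Ob} {s : D.Hor y z}
    {r : D.Hor x y} {s' : D.Hor y' z'} {r' : D.Hor x' y'} (ψ : HObj.mk s ⟶ HObj.mk s')
    (φ : HObj.mk r ⟶ HObj.mk r') (h : D.dom ψ = D.cod φ) {t : E.One}
    (χ : HObj.mk (F.obj₁ (P.comp s' r')) ⟶ t) :
    Q.hcomp (F.map₁ ψ) (F.map₁ φ) (by simp [h]) ≫ f.mul s' r' ≫ χ =
      f.mul s r ≫ F.map₁ (P.hcomp ψ φ h) ≫ χ := by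
  rw [← Category.assoc, f.mul_nat ψ φ h, Category.assoc]

theorem OplaxStr.mul_nat_assoc {D E : CatGraph.{u₀, v₀, u₁, v₁}} {P : PseudoDblStr D}
    {Q : PseudoDblStr E} {F : D ⟶ E} (f : OplaxStr P Q F) {x y z x' y' z' : D.Ob} {s : D.Hor y z}
    {r : D.Hor x y} {s' : D.Hor y' z'} {r' : D.Hor x' y'} (ψ : HObj.mk s ⟶ HObj.mk s')
    (φ : HObj.mk r ⟶ HObj.mk r') (h : D.dom ψ = D.cod φ) {t : E.One}
    (χ : HObj.mk (Q.comp (F.obj₁ s') (F.obj₁ r')) ⟶ t) :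
    F.map₁ (P.hcomp ψ φ h) ≫ f.mul s' r' ≫ χ =
      f.mul s r ≫ Q.hcomp (F.map₁ ψ) (F.map₁ φ) (by simp [h]) ≫ χ := by
  rw [← Category.assoc, f.mul_nat ψ φ h, Category.assoc]

theorem LaxStr.unit_nat_assoc {D E : CatGraph.{u₀, v₀, u₁, v₁}} {P : PseudoDblStr D}
    {Q : PseudoDblStr E} {F : D ⟶ E} (f : LaxStr P Q F) {x y : D.Ob} (g : x ⟶ y) {t : E.One}
    (χ : HObj.mk (F.obj₁ (P.one y)) ⟶ t) :
    Q.oneMap (F.F₀.map g) ≫ f.unit y ≫ χ = f.unit x ≫ F.map₁ (P.oneMap g) ≫ χ := by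
  rw [← Category.assoc, f.unit_nat g, Category.assoc]


namespace PseudoDblStr

variable {D : CatGraph.{u₀, v₀, u₁, v₁}} (P : PseudoDblStr D)

theorem hcomp_congr {x y z x' y' z' : D.Ob} {s : D.Hor y z} {r : D.Hor x y} {s' : D.Hor y' z'}
    {r' : D.Hor x' y'} {ψ ψ' : HObj.mk s ⟶ HObj.mk s'} {φ φ' : HObj.mk r ⟶ HObj.mk r'}
    (e : ψ = ψ') (e' : φ = φ') (h : D.dom ψ = D.cod φ) (h' : D.dom ψ' = D.cod φ') :
    P.hcomp ψ φ h = P.hcomp ψ' φ' h' := by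
  subst e; subst e'; rfl

theorem hcomp_comp_left {x y z y' z' y'' z'' : D.Ob} {s : D.Hor y z} {r : D.Hor x y}
    {s' : D.Hor y' z'} {s'' : D.Hor y'' z''} {r' : D.Hor x y'} {r'' : D.Hor x y''}
    (ψ : HObj.mk s ⟶ HObj.mk s') (ψ' : HObj.mk s' ⟶ HObj.mk s'')
    (φ : HObj.mk r ⟶ HObj.mk r') (φ' : HObj.mk r' ⟶ HObj.mk r'')
    (χ : HObj.mk r ⟶ HObj.mk r'') (e : φ ≫ φ' = χ)
    (h : D.dom ψ = D.cod φ) (h' : D.dom ψ' = D.cod φ') (h'' : D.dom (ψ ≫ ψ') = D.cod χ) :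
    P.hcomp (ψ ≫ ψ') χ h'' = P.hcomp ψ φ h ≫ P.hcomp ψ' φ' h' := by
  subst e; exact P.hcomp_comp ψ φ h ψ' φ' h'

end PseudoDblStr

section laxcomp

variable {A B C D : CatGraph.{u₀, v₀, u₁, v₁}} {P : PseudoDblStr A} {Q : PseudoDblStr B}
  {R : PseudoDblStr C} {S : PseudoDblStr D}

/-- The identity lax functor. -/
def LaxStr.id (P : PseudoDblStr A) : LaxStr P P (𝟙 A) where
  unit x := 𝟙 _
  dom_unit x := A.dom_id _
  cod_unit x := A.cod_id _
  unit_nat f := (Category.comp_id _).trans (Category.id_comp _).symm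
  mul s r := 𝟙 _
  dom_mul s r := A.dom_id _
  cod_mul s r := A.cod_id _
  mul_nat ψ φ h := (Category.comp_id _).trans (Category.id_comp _).symm
  left r := by
    change P.hcomp (𝟙 _) (𝟙 _) _ ≫ 𝟙 _ = (P.lam r).hom ≫ (P.lam r).inv
    rw [P.hcomp_id, Iso.hom_inv_id, Category.comp_id]
  right r := by
    change P.hcomp (𝟙 _) (𝟙 _) _ ≫ 𝟙 _ = (P.rho r).hom ≫ (P.rho r).inv
    rw [P.hcomp_id, Iso.hom_inv_id, Category.comp_id]
  assoc t s r := by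
    change P.hcomp (𝟙 _) (𝟙 _) _ ≫ 𝟙 _ ≫ (P.alpha t s r).hom =
      (P.alpha t s r).hom ≫ P.hcomp (𝟙 _) (𝟙 _) _ ≫ 𝟙 _
    rw [P.hcomp_id, P.hcomp_id]
    simp

/-- The composite of lax functors. -/
def LaxStr.comp {F : A ⟶ B} {K : B ⟶ C} (h : LaxStr P Q F) (k : LaxStr Q R K) :
    LaxStr P R (F ≫ K) where
  unit x := k.unit (F.F₀.obj x) ≫ K.map₁ (h.unit x)
  dom_unit x := by
    rw [C.dom_comp, k.dom_unit, K.dom_map₁, h.dom_unit, K.F₀.map_id]; exact Category.comp_id _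
  cod_unit x := by
    rw [C.cod_comp, k.cod_unit, K.cod_map₁, h.cod_unit, K.F₀.map_id]; exact Category.comp_id _
  unit_nat {x y} f := by
    change R.oneMap (K.F₀.map (F.F₀.map f)) ≫ k.unit _ ≫ K.map₁ (h.unit _) =
      (k.unit _ ≫ K.map₁ (h.unit _)) ≫ K.map₁ (F.map₁ (P.oneMap f))
    rw [← Category.assoc, k.unit_nat, Category.assoc, ← K.map₁_comp, h.unit_nat, K.map₁_comp,
      Category.assoc]
  mul s r := k.mul (F.obj₁ s) (F.obj₁ r) ≫ K.map₁ (h.mul s r)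
  dom_mul s r := by
    rw [C.dom_comp, k.dom_mul, K.dom_map₁, h.dom_mul, K.F₀.map_id]; exact Category.comp_id _
  cod_mul s r := by
    rw [C.cod_comp, k.cod_mul, K.cod_map₁, h.cod_mul, K.F₀.map_id]; exact Category.comp_id _
  mul_nat {_ _ _ _ _ _ s r s' r'} ψ φ hc := by
    change R.hcomp (K.map₁ (F.map₁ ψ)) (K.map₁ (F.map₁ φ)) _ ≫ k.mul _ _ ≫ K.map₁ (h.mul s' r') =
      (k.mul _ _ ≫ K.map₁ (h.mul s r)) ≫ K.map₁ (F.map₁ (P.hcomp ψ φ hc))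
    rw [← Category.assoc, k.mul_nat (F.map₁ ψ) (F.map₁ φ) (by simp [hc]), Category.assoc,
      ← K.map₁_comp, h.mul_nat ψ φ hc, K.map₁_comp, Category.assoc]
  left {x y} r := by
    change R.hcomp (k.unit _ ≫ K.map₁ (h.unit y)) (𝟙 (HObj.mk (K.obj₁ (F.obj₁ r)))) _ ≫
      k.mul _ _ ≫ K.map₁ (h.mul _ _) = (R.lam (K.obj₁ (F.obj₁ r))).hom ≫ K.map₁ (F.map₁ (P.lam r).inv)
    rw [R.hcomp_comp_left _ _ (𝟙 _) (K.map₁ (𝟙 (HObj.mk (F.obj₁ r)))) _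
        (by rw [K.map₁_id]; exact Category.comp_id _) (by simp) (by simp), Category.assoc,
      k.mul_nat_assoc _ _ (by simp),
      ← K.map₁_comp, h.left, reassoc_of% (k.left (F.obj₁ r)), ← K.map₁_comp,
      Iso.inv_hom_id_assoc]
  right {x y} r := by
    change R.hcomp (𝟙 (HObj.mk (K.obj₁ (F.obj₁ r)))) (k.unit _ ≫ K.map₁ (h.unit x)) _ ≫
      k.mul _ _ ≫ K.map₁ (h.mul _ _) = (R.rho (K.obj₁ (F.obj₁ r))).hom ≫ K.map₁ (F.map₁ (P.rho r).inv)
    have e : 𝟙 (HObj.mk (K.obj₁ (F.obj₁ r))) ≫ K.map₁ (𝟙 (HObj.mk (F.obj₁ r))) = 𝟙 _ := by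
      rw [K.map₁_id]; exact Category.comp_id _
    rw [R.hcomp_congr e.symm rfl _ (by simp), R.hcomp_comp _ _ (by simp) _ _ (by simp),
      Category.assoc,
      k.mul_nat_assoc _ _ (by simp),
      ← K.map₁_comp, h.right, reassoc_of% (k.right (F.obj₁ r)), ← K.map₁_comp,
      Iso.inv_hom_id_assoc]
  assoc {w x y z} t s r := by
    change R.hcomp (k.mul _ _ ≫ K.map₁ (h.mul t s)) (𝟙 (HObj.mk (K.obj₁ (F.obj₁ r)))) _ ≫
        (k.mul _ _ ≫ K.map₁ (h.mul _ _)) ≫ K.map₁ (F.map₁ (P.alpha t s r).hom) =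
      (R.alpha _ _ _).hom ≫
        R.hcomp (𝟙 (HObj.mk (K.obj₁ (F.obj₁ t)))) (k.mul _ _ ≫ K.map₁ (h.mul s r)) _ ≫
          k.mul _ _ ≫ K.map₁ (h.mul _ _)
    have e : 𝟙 (HObj.mk (K.obj₁ (F.obj₁ t))) ≫ K.map₁ (𝟙 (HObj.mk (F.obj₁ t))) = 𝟙 _ := by
      rw [K.map₁_id]; exact Category.comp_id _
    rw [R.hcomp_comp_left _ _ (𝟙 _) (K.map₁ (𝟙 (HObj.mk (F.obj₁ r)))) _
        (by rw [K.map₁_id]; exact Category.comp_id _) (by simp) (by simp),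
      R.hcomp_congr e.symm rfl _ (by simp), R.hcomp_comp _ _ (by simp) _ _ (by simp)]
    simp only [Category.assoc]
    rw [k.mul_nat_assoc _ _ (by simp), k.mul_nat_assoc _ _ (by simp)]
    simp only [← K.map₁_comp]
    rw [h.assoc, K.map₁_comp, reassoc_of% (k.assoc (F.obj₁ t) (F.obj₁ s) (F.obj₁ r))]

/-- The identity oplax functor. -/
def OplaxStr.id (P : PseudoDblStr A) : OplaxStr P P (𝟙 A) where
  unit x := 𝟙 _
  dom_unit x := A.dom_id _
  cod_unit x := A.cod_id _
  unit_nat f := (Category.comp_id _).trans (Category.id_comp _).symm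
  mul s r := 𝟙 _
  dom_mul s r := A.dom_id _
  cod_mul s r := A.cod_id _
  mul_nat ψ φ h := (Category.comp_id _).trans (Category.id_comp _).symm
  left r := by
    change 𝟙 _ ≫ P.hcomp (𝟙 _) (𝟙 _) _ = (P.lam r).hom ≫ (P.lam r).inv
    rw [P.hcomp_id, Iso.hom_inv_id, Category.comp_id]
  right r := by
    change 𝟙 _ ≫ P.hcomp (𝟙 _) (𝟙 _) _ = (P.rho r).hom ≫ (P.rho r).inv
    rw [P.hcomp_id, Iso.hom_inv_id, Category.comp_id]
  assoc t s r := by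
    change (P.alpha t s r).inv ≫ 𝟙 _ ≫ P.hcomp (𝟙 _) (𝟙 _) _ =
      𝟙 _ ≫ P.hcomp (𝟙 _) (𝟙 _) _ ≫ (P.alpha t s r).inv
    rw [P.hcomp_id, P.hcomp_id]
    simp

/-- The composite of oplax functors. -/
def OplaxStr.comp {F : A ⟶ B} {K : B ⟶ C} (h : OplaxStr P Q F) (k : OplaxStr Q R K) :
    OplaxStr P R (F ≫ K) where
  unit x := K.map₁ (h.unit x) ≫ k.unit (F.F₀.obj x)
  dom_unit x := by
    rw [C.dom_comp, k.dom_unit, K.dom_map₁, h.dom_unit, K.F₀.map_id]; exact Category.comp_id _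
  cod_unit x := by
    rw [C.cod_comp, k.cod_unit, K.cod_map₁, h.cod_unit, K.F₀.map_id]; exact Category.comp_id _
  unit_nat {x y} f := by
    change K.map₁ (F.map₁ (P.oneMap f)) ≫ K.map₁ (h.unit _) ≫ k.unit _ =
      (K.map₁ (h.unit _) ≫ k.unit _) ≫ R.oneMap (K.F₀.map (F.F₀.map f))
    rw [← Category.assoc, ← K.map₁_comp, h.unit_nat, K.map₁_comp, Category.assoc, k.unit_nat,
      Category.assoc]
  mul s r := K.map₁ (h.mul s r) ≫ k.mul (F.obj₁ s) (F.obj₁ r)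
  dom_mul s r := by
    rw [C.dom_comp, k.dom_mul, K.dom_map₁, h.dom_mul, K.F₀.map_id]; exact Category.comp_id _
  cod_mul s r := by
    rw [C.cod_comp, k.cod_mul, K.cod_map₁, h.cod_mul, K.F₀.map_id]; exact Category.comp_id _
  mul_nat {_ _ _ _ _ _ s r s' r'} ψ φ hc := by
    change K.map₁ (F.map₁ (P.hcomp ψ φ hc)) ≫ K.map₁ (h.mul s' r') ≫ k.mul _ _ =
      (K.map₁ (h.mul s r) ≫ k.mul _ _) ≫ R.hcomp (K.map₁ (F.map₁ ψ)) (K.map₁ (F.map₁ φ)) _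
    rw [← Category.assoc, ← K.map₁_comp, h.mul_nat ψ φ hc, K.map₁_comp, Category.assoc,
      k.mul_nat (F.map₁ ψ) (F.map₁ φ) (by simp [hc]), Category.assoc]
  left {x y} r := by
    change (K.map₁ (h.mul _ _) ≫ k.mul _ _) ≫
      R.hcomp (K.map₁ (h.unit y) ≫ k.unit _) (𝟙 (HObj.mk (K.obj₁ (F.obj₁ r)))) _ =
      K.map₁ (F.map₁ (P.lam r).hom) ≫ (R.lam (K.obj₁ (F.obj₁ r))).inv
    rw [R.hcomp_comp_left _ _ (K.map₁ (𝟙 (HObj.mk (F.obj₁ r)))) (𝟙 _) _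
        (by rw [K.map₁_id]; exact Category.comp_id _) (by simp) (by simp), Category.assoc,
      ← Category.assoc (k.mul _ _), ← k.mul_nat _ _ (by simp), Category.assoc, ← Category.assoc,
      ← K.map₁_comp, h.left, k.left, ← Category.assoc, ← K.map₁_comp, Category.assoc,
      Iso.inv_hom_id, Category.comp_id]
  right {x y} r := by
    change (K.map₁ (h.mul _ _) ≫ k.mul _ _) ≫
      R.hcomp (𝟙 (HObj.mk (K.obj₁ (F.obj₁ r)))) (K.map₁ (h.unit x) ≫ k.unit _) _ =
      K.map₁ (F.map₁ (P.rho r).hom) ≫ (R.rho (K.obj₁ (F.obj₁ r))).inv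
    have e : K.map₁ (𝟙 (HObj.mk (F.obj₁ r))) ≫ 𝟙 (HObj.mk (K.obj₁ (F.obj₁ r))) = 𝟙 _ := by
      rw [K.map₁_id]; exact Category.comp_id _
    rw [R.hcomp_congr e.symm rfl _ (by simp), R.hcomp_comp _ _ (by simp) _ _ (by simp),
      Category.assoc,
      ← Category.assoc (k.mul _ _), ← k.mul_nat _ _ (by simp), Category.assoc, ← Category.assoc,
      ← K.map₁_comp, h.right, k.right, ← Category.assoc, ← K.map₁_comp, Category.assoc,
      Iso.inv_hom_id, Category.comp_id]
  assoc {w x y z} t s r := by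
    change K.map₁ (F.map₁ (P.alpha t s r).inv) ≫ (K.map₁ (h.mul _ _) ≫ k.mul _ _) ≫
        R.hcomp (K.map₁ (h.mul t s) ≫ k.mul _ _) (𝟙 (HObj.mk (K.obj₁ (F.obj₁ r)))) _ =
      (K.map₁ (h.mul _ _) ≫ k.mul _ _) ≫
        R.hcomp (𝟙 (HObj.mk (K.obj₁ (F.obj₁ t)))) (K.map₁ (h.mul s r) ≫ k.mul _ _) _ ≫
          (R.alpha _ _ _).inv
    have e : K.map₁ (𝟙 (HObj.mk (F.obj₁ t))) ≫ 𝟙 (HObj.mk (K.obj₁ (F.obj₁ t))) = 𝟙 _ := by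
      rw [K.map₁_id]; exact Category.comp_id _
    rw [R.hcomp_comp_left _ _ (K.map₁ (𝟙 (HObj.mk (F.obj₁ r)))) (𝟙 _) _
        (by rw [K.map₁_id]; exact Category.comp_id _) (by simp) (by simp),
      R.hcomp_congr e.symm rfl _ (by simp), R.hcomp_comp _ _ (by simp) _ _ (by simp)]
    simp only [Category.assoc]
    rw [← k.mul_nat_assoc _ _ (by simp), ← k.mul_nat_assoc _ _ (by simp), ← k.assoc]
    simp only [← reassoc_of% K.map₁_comp]
    rw [h.assoc]

theorem LaxStr.id_comp {F : A ⟶ B} (h : LaxStr P Q F) : (LaxStr.id P).comp h = h := by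
  apply LaxStr.ext
  · funext x
    exact (congrArg (h.unit x ≫ ·) (F.map₁_id _)).trans (Category.comp_id _)
  · funext x y z s r
    exact (congrArg (h.mul s r ≫ ·) (F.map₁_id _)).trans (Category.comp_id _)

theorem LaxStr.comp_id {F : A ⟶ B} (h : LaxStr P Q F) : h.comp (LaxStr.id Q) = h := by
  apply LaxStr.ext
  · funext x; exact Category.id_comp _
  · funext x y z s r; exact Category.id_comp _

theorem LaxStr.comp_assoc {F : A ⟶ B} {K : B ⟶ C} {L : C ⟶ D} (h : LaxStr P Q F)
    (k : LaxStr Q R K) (l : LaxStr R S L) : (h.comp k).comp l = h.comp (k.comp l) := by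
  apply LaxStr.ext
  · funext x
    exact (congrArg (l.unit _ ≫ ·) (L.map₁_comp _ _)).trans (Category.assoc _ _ _).symm
  · funext x y z s r
    exact (congrArg (l.mul _ _ ≫ ·) (L.map₁_comp _ _)).trans (Category.assoc _ _ _).symm

theorem OplaxStr.id_comp {F : A ⟶ B} (h : OplaxStr P Q F) : (OplaxStr.id P).comp h = h := by
  apply OplaxStr.ext
  · funext x
    exact (congrArg (· ≫ h.unit x) (F.map₁_id _)).trans (Category.id_comp _)
  · funext x y z s r
    exact (congrArg (· ≫ h.mul s r) (F.map₁_id _)).trans (Category.id_comp _)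

theorem OplaxStr.comp_id {F : A ⟶ B} (h : OplaxStr P Q F) : h.comp (OplaxStr.id Q) = h := by
  apply OplaxStr.ext
  · funext x; exact Category.comp_id _
  · funext x y z s r; exact Category.comp_id _

theorem OplaxStr.comp_assoc {F : A ⟶ B} {K : B ⟶ C} {L : C ⟶ D} (h : OplaxStr P Q F)
    (k : OplaxStr Q R K) (l : OplaxStr R S L) : (h.comp k).comp l = h.comp (k.comp l) := by
  apply OplaxStr.ext
  · funext x
    exact (congrArg (· ≫ l.unit _) (L.map₁_comp _ _)).trans (Category.assoc _ _ _)
  · funext x y z s r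
    exact (congrArg (· ≫ l.mul _ _) (L.map₁_comp _ _)).trans (Category.assoc _ _ _)

end laxcomp


section transf

variable {A B C D A' B' : CatGraph.{u₀, v₀, u₁, v₁}} {P : PseudoDblStr A} {Q : PseudoDblStr B}
  {R : PseudoDblStr C} {S : PseudoDblStr D} {P' : PseudoDblStr A'} {Q' : PseudoDblStr B'}

theorem IsGenTransf.vid {H : A ⟶ B} (h : LaxStr P Q H) :
    IsGenTransf h (OplaxStr.id P) (OplaxStr.id Q) h (𝟙 H) where
  unit x := by
    change 𝟙 _ ≫ Q.oneMap (𝟙 (H.F₀.obj x)) ≫ h.unit x =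
      h.unit x ≫ 𝟙 _ ≫ H.map₁ (𝟙 (HObj.mk (P.one x)))
    rw [Q.oneMap_id, H.map₁_id]; simp
  mul s r := by
    change 𝟙 _ ≫ Q.hcomp (𝟙 _) (𝟙 _) _ ≫ h.mul s r =
      h.mul s r ≫ 𝟙 _ ≫ H.map₁ (𝟙 (HObj.mk (P.comp s r)))
    rw [Q.hcomp_id, H.map₁_id]; simp

theorem IsGenTransf.hid {F : A ⟶ B} (f : OplaxStr P Q F) :
    IsGenTransf (LaxStr.id P) f f (LaxStr.id Q) (𝟙 F) where
  unit x := by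
    change f.unit x ≫ Q.oneMap (𝟙 (F.F₀.obj x)) ≫ 𝟙 _ =
      F.map₁ (𝟙 (HObj.mk (P.one x))) ≫ 𝟙 _ ≫ f.unit x
    rw [Q.oneMap_id, F.map₁_id]; simp
  mul s r := by
    change f.mul s r ≫ Q.hcomp (𝟙 _) (𝟙 _) _ ≫ 𝟙 _ =
      F.map₁ (𝟙 (HObj.mk (P.comp s r))) ≫ 𝟙 _ ≫ f.mul s r
    rw [Q.hcomp_id, F.map₁_id]; simp

/-- Vertical composition: `(ψ ∘ φ)ᵢ = ψᵢ Fᵢ ∘ Kᵢ φᵢ`. -/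
theorem IsGenTransf.vcomp {H : A ⟶ B} {F : A ⟶ C} {G : B ⟶ D} {K : C ⟶ D} {F' : C ⟶ A'}
    {G' : D ⟶ B'} {L : A' ⟶ B'} {h : LaxStr P Q H} {f : OplaxStr P R F} {g : OplaxStr Q S G}
    {k : LaxStr R S K} {f' : OplaxStr R P' F'} {g' : OplaxStr S Q' G'} {l : LaxStr P' Q' L}
    {θ : H ≫ G ⟶ F ≫ K} {κ : K ≫ G' ⟶ F' ≫ L}
    (hθ : IsGenTransf h f g k θ) (hκ : IsGenTransf k f' g' l κ) :
    IsGenTransf h (f.comp f') (g.comp g') l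
      (Bicategory.whiskerRight θ G' ≫ Bicategory.whiskerLeft F κ) where
  unit x := by
    have e₁ : G'.map₁ (g.unit _ ≫ S.oneMap (GraphCell.app₀ θ x) ≫ k.unit (F.F₀.obj x)) =
      G'.map₁ (G.map₁ (h.unit x) ≫ GraphCell.app₁ θ ⟨P.one x⟩ ≫ K.map₁ (f.unit x)) :=
      congrArg G'.map₁ (hθ.unit x)
    have e₂ : g'.unit _ ≫ Q'.oneMap (GraphCell.app₀ κ (F.F₀.obj x)) ≫ l.unit _ =
      G'.map₁ (k.unit (F.F₀.obj x)) ≫ GraphCell.app₁ κ ⟨R.one (F.F₀.obj x)⟩ ≫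
        L.map₁ (f'.unit (F.F₀.obj x)) := hκ.unit (F.F₀.obj x)
    have e₃ : G'.map₁ (K.map₁ (f.unit x)) ≫ GraphCell.app₁ κ ⟨R.one (F.F₀.obj x)⟩ =
      GraphCell.app₁ κ ⟨F.obj₁ (P.one x)⟩ ≫ L.map₁ (F'.map₁ (f.unit x)) :=
      GraphCell.nat₁ κ (f.unit x)
    change (G'.map₁ (g.unit _) ≫ g'.unit _) ≫
      Q'.oneMap (G'.F₀.map (GraphCell.app₀ θ x) ≫ GraphCell.app₀ κ (F.F₀.obj x)) ≫ l.unit _ =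
      G'.map₁ (G.map₁ (h.unit x)) ≫
        (G'.map₁ (GraphCell.app₁ θ ⟨P.one x⟩) ≫ GraphCell.app₁ κ ⟨F.obj₁ (P.one x)⟩) ≫
          L.map₁ (F'.map₁ (f.unit x) ≫ f'.unit _)
    simp only [GraphHom.map₁_comp] at e₁
    simp only [Q'.oneMap_comp, L.map₁_comp, Category.assoc]
    have c₀ : G'.map₁ (S.oneMap (GraphCell.app₀ θ x)) ≫ g'.unit (K.F₀.obj (F.F₀.obj x)) =
      g'.unit (G.F₀.obj (H.F₀.obj x)) ≫ Q'.oneMap (G'.F₀.map (GraphCell.app₀ θ x)) :=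
      g'.unit_nat _
    rw [← reassoc_of% c₀, e₂, reassoc_of% e₁, reassoc_of% e₃]
  mul {x y z} s r := by
    have e₁ : G'.map₁ (g.mul (H.obj₁ s) (H.obj₁ r) ≫
        S.hcomp (GraphCell.app₁ θ ⟨s⟩) (GraphCell.app₁ θ ⟨r⟩) (by simp) ≫
          k.mul (F.obj₁ s) (F.obj₁ r)) =
      G'.map₁ (G.map₁ (h.mul s r) ≫ GraphCell.app₁ θ ⟨P.comp s r⟩ ≫ K.map₁ (f.mul s r)) :=
      congrArg G'.map₁ (hθ.mul s r)
    have e₂ : g'.mul (K.obj₁ (F.obj₁ s)) (K.obj₁ (F.obj₁ r)) ≫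
        Q'.hcomp (GraphCell.app₁ κ ⟨F.obj₁ s⟩) (GraphCell.app₁ κ ⟨F.obj₁ r⟩) (by simp) ≫
          l.mul (F'.obj₁ (F.obj₁ s)) (F'.obj₁ (F.obj₁ r)) =
      G'.map₁ (k.mul (F.obj₁ s) (F.obj₁ r)) ≫ GraphCell.app₁ κ ⟨R.comp (F.obj₁ s) (F.obj₁ r)⟩ ≫
        L.map₁ (f'.mul (F.obj₁ s) (F.obj₁ r)) := hκ.mul (F.obj₁ s) (F.obj₁ r)
    have e₃ : G'.map₁ (K.map₁ (f.mul s r)) ≫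
        GraphCell.app₁ κ ⟨R.comp (F.obj₁ s) (F.obj₁ r)⟩ =
      GraphCell.app₁ κ ⟨F.obj₁ (P.comp s r)⟩ ≫ L.map₁ (F'.map₁ (f.mul s r)) :=
      GraphCell.nat₁ κ (f.mul s r)
    have c₁ : D.dom (GraphCell.app₁ θ ⟨s⟩) = D.cod (GraphCell.app₁ θ ⟨r⟩) := by simp
    have c₂ : B'.dom (G'.map₁ (GraphCell.app₁ θ ⟨s⟩)) = B'.cod (G'.map₁ (GraphCell.app₁ θ ⟨r⟩)) := by
      simp
    have c₃ : B'.dom (GraphCell.app₁ κ ⟨F.obj₁ s⟩) = B'.cod (GraphCell.app₁ κ ⟨F.obj₁ r⟩) := by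
      simp
    have c₄ := Q'.hcomp_comp _ _ c₂ _ _ c₃
    have c₅ : G'.map₁ (S.hcomp (GraphCell.app₁ θ ⟨s⟩) (GraphCell.app₁ θ ⟨r⟩) c₁) ≫
        g'.mul (K.obj₁ (F.obj₁ s)) (K.obj₁ (F.obj₁ r)) =
      g'.mul (G.obj₁ (H.obj₁ s)) (G.obj₁ (H.obj₁ r)) ≫
        Q'.hcomp (G'.map₁ (GraphCell.app₁ θ ⟨s⟩)) (G'.map₁ (GraphCell.app₁ θ ⟨r⟩)) c₂ :=
      g'.mul_nat _ _ c₁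
    change (G'.map₁ (g.mul (H.obj₁ s) (H.obj₁ r)) ≫ g'.mul _ _) ≫
      Q'.hcomp (G'.map₁ (GraphCell.app₁ θ ⟨s⟩) ≫ GraphCell.app₁ κ ⟨F.obj₁ s⟩)
        (G'.map₁ (GraphCell.app₁ θ ⟨r⟩) ≫ GraphCell.app₁ κ ⟨F.obj₁ r⟩) _ ≫ l.mul _ _ =
      G'.map₁ (G.map₁ (h.mul s r)) ≫
        (G'.map₁ (GraphCell.app₁ θ ⟨P.comp s r⟩) ≫ GraphCell.app₁ κ ⟨F.obj₁ (P.comp s r)⟩) ≫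
          L.map₁ (F'.map₁ (f.mul s r) ≫ f'.mul (F.obj₁ s) (F.obj₁ r))
    simp only [GraphHom.map₁_comp] at e₁
    simp only [L.map₁_comp, Category.assoc]
    refine (congrArg (fun t => _ ≫ _ ≫ t ≫ _) c₄).trans ?_
    simp only [Category.assoc]
    rw [← reassoc_of% c₅, e₂, reassoc_of% e₁, reassoc_of% e₃]

/-- Horizontal composition: `(ψ · φ)ᵢ = Sᵢ φᵢ ∘ ψᵢ Pᵢ`. -/
theorem IsGenTransf.hcomp {H : A ⟶ B} {F : A ⟶ C} {G : B ⟶ D} {K : C ⟶ D} {H' : B ⟶ A'}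
    {L : A' ⟶ B'} {K' : D ⟶ B'} {h : LaxStr P Q H} {f : OplaxStr P R F} {g : OplaxStr Q S G}
    {k : LaxStr R S K} {h' : LaxStr Q P' H'} {l : OplaxStr P' Q' L} {k' : LaxStr S Q' K'}
    {θ : H ≫ G ⟶ F ≫ K} {κ : H' ≫ L ⟶ G ≫ K'}
    (hθ : IsGenTransf h f g k θ) (hκ : IsGenTransf h' g l k' κ) :
    IsGenTransf (h.comp h') f l (k.comp k')
      (Bicategory.whiskerLeft H κ ≫ Bicategory.whiskerRight θ K') where
  unit x := by
    have e₁ : K'.map₁ (g.unit _ ≫ S.oneMap (GraphCell.app₀ θ x) ≫ k.unit (F.F₀.obj x)) =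
      K'.map₁ (G.map₁ (h.unit x) ≫ GraphCell.app₁ θ ⟨P.one x⟩ ≫ K.map₁ (f.unit x)) :=
      congrArg K'.map₁ (hθ.unit x)
    have e₂ : l.unit _ ≫ Q'.oneMap (GraphCell.app₀ κ (H.F₀.obj x)) ≫ k'.unit _ =
      L.map₁ (h'.unit (H.F₀.obj x)) ≫ GraphCell.app₁ κ ⟨Q.one (H.F₀.obj x)⟩ ≫
        K'.map₁ (g.unit (H.F₀.obj x)) := hκ.unit (H.F₀.obj x)
    have e₃ : L.map₁ (H'.map₁ (h.unit x)) ≫ GraphCell.app₁ κ ⟨H.obj₁ (P.one x)⟩ =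
      GraphCell.app₁ κ ⟨Q.one (H.F₀.obj x)⟩ ≫ K'.map₁ (G.map₁ (h.unit x)) :=
      GraphCell.nat₁ κ (h.unit x)
    change l.unit _ ≫
      Q'.oneMap (GraphCell.app₀ κ (H.F₀.obj x) ≫ K'.F₀.map (GraphCell.app₀ θ x)) ≫
        k'.unit _ ≫ K'.map₁ (k.unit (F.F₀.obj x)) =
      L.map₁ (h'.unit (H.F₀.obj x) ≫ H'.map₁ (h.unit x)) ≫
        (GraphCell.app₁ κ ⟨H.obj₁ (P.one x)⟩ ≫ K'.map₁ (GraphCell.app₁ θ ⟨P.one x⟩)) ≫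
          K'.map₁ (K.map₁ (f.unit x))
    simp only [GraphHom.map₁_comp] at e₁
    simp only [Q'.oneMap_comp, L.map₁_comp, Category.assoc]
    rw [k'.unit_nat_assoc, reassoc_of% e₂, e₁, reassoc_of% e₃]
  mul {x y z} s r := by
    have e₁ : K'.map₁ (g.mul (H.obj₁ s) (H.obj₁ r) ≫
        S.hcomp (GraphCell.app₁ θ ⟨s⟩) (GraphCell.app₁ θ ⟨r⟩) (by simp) ≫
          k.mul (F.obj₁ s) (F.obj₁ r)) =
      K'.map₁ (G.map₁ (h.mul s r) ≫ GraphCell.app₁ θ ⟨P.comp s r⟩ ≫ K.map₁ (f.mul s r)) :=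
      congrArg K'.map₁ (hθ.mul s r)
    have e₂ : l.mul (H'.obj₁ (H.obj₁ s)) (H'.obj₁ (H.obj₁ r)) ≫
        Q'.hcomp (GraphCell.app₁ κ ⟨H.obj₁ s⟩) (GraphCell.app₁ κ ⟨H.obj₁ r⟩) (by simp) ≫
          k'.mul (G.obj₁ (H.obj₁ s)) (G.obj₁ (H.obj₁ r)) =
      L.map₁ (h'.mul (H.obj₁ s) (H.obj₁ r)) ≫
        GraphCell.app₁ κ ⟨Q.comp (H.obj₁ s) (H.obj₁ r)⟩ ≫
          K'.map₁ (g.mul (H.obj₁ s) (H.obj₁ r)) := hκ.mul (H.obj₁ s) (H.obj₁ r)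
    have e₃ : L.map₁ (H'.map₁ (h.mul s r)) ≫ GraphCell.app₁ κ ⟨H.obj₁ (P.comp s r)⟩ =
      GraphCell.app₁ κ ⟨Q.comp (H.obj₁ s) (H.obj₁ r)⟩ ≫ K'.map₁ (G.map₁ (h.mul s r)) :=
      GraphCell.nat₁ κ (h.mul s r)
    have c₁ : D.dom (GraphCell.app₁ θ ⟨s⟩) = D.cod (GraphCell.app₁ θ ⟨r⟩) := by simp
    have c₂ : B'.dom (K'.map₁ (GraphCell.app₁ θ ⟨s⟩)) = B'.cod (K'.map₁ (GraphCell.app₁ θ ⟨r⟩)) := by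
      simp
    have c₃ : B'.dom (GraphCell.app₁ κ ⟨H.obj₁ s⟩) = B'.cod (GraphCell.app₁ κ ⟨H.obj₁ r⟩) := by
      simp
    have c₄ := Q'.hcomp_comp _ _ c₃ _ _ c₂
    have c₅ : Q'.hcomp (K'.map₁ (GraphCell.app₁ θ ⟨s⟩)) (K'.map₁ (GraphCell.app₁ θ ⟨r⟩)) c₂ ≫
        k'.mul ((F ≫ K).obj₁ s) ((F ≫ K).obj₁ r) =
      k'.mul (G.obj₁ (H.obj₁ s)) (G.obj₁ (H.obj₁ r)) ≫
        K'.map₁ (S.hcomp (GraphCell.app₁ θ ⟨s⟩) (GraphCell.app₁ θ ⟨r⟩) c₁) :=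
      k'.mul_nat _ _ c₁
    change l.mul _ _ ≫
      Q'.hcomp (GraphCell.app₁ κ ⟨H.obj₁ s⟩ ≫ K'.map₁ (GraphCell.app₁ θ ⟨s⟩))
        (GraphCell.app₁ κ ⟨H.obj₁ r⟩ ≫ K'.map₁ (GraphCell.app₁ θ ⟨r⟩)) _ ≫
        k'.mul _ _ ≫ K'.map₁ (k.mul _ _) =
      L.map₁ (h'.mul (H.obj₁ s) (H.obj₁ r) ≫ H'.map₁ (h.mul s r)) ≫
        (GraphCell.app₁ κ ⟨H.obj₁ (P.comp s r)⟩ ≫ K'.map₁ (GraphCell.app₁ θ ⟨P.comp s r⟩)) ≫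
          K'.map₁ (K.map₁ (f.mul s r))
    simp only [GraphHom.map₁_comp] at e₁
    simp only [L.map₁_comp, Category.assoc]
    refine (congrArg (fun t => _ ≫ t ≫ _) c₄).trans ?_
    simp only [Category.assoc]
    rw [reassoc_of% c₅, reassoc_of% e₂, e₁, reassoc_of% e₃]

end transf


section twomonad

open Bicategory

/-- A 2-monad on a 2-category: a strict 2-functor `T` with 2-natural transformations `e : 1 → T`
and `m : T T → T` satisfying the monad laws on the nose. -/
structure TwoMonad (B : Type u) [Bicategory.{w, v} B] [Bicategory.Strict B] where
  T : StrictPseudofunctor B B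
  e : ∀ X : B, X ⟶ T.obj X
  m : ∀ X : B, T.obj (T.obj X) ⟶ T.obj X
  e_nat : ∀ {X Y : B} (f : X ⟶ Y), f ≫ e Y = e X ≫ T.map f
  e_nat₂ : ∀ {X Y : B} {f g : X ⟶ Y} (θ : f ⟶ g),
    θ ▷ e Y ≫ eqToHom (e_nat g) = eqToHom (e_nat f) ≫ e X ◁ T.map₂ θ
  m_nat : ∀ {X Y : B} (f : X ⟶ Y), T.map (T.map f) ≫ m Y = m X ≫ T.map f
  m_nat₂ : ∀ {X Y : B} {f g : X ⟶ Y} (θ : f ⟶ g),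
    T.map₂ (T.map₂ θ) ▷ m Y ≫ eqToHom (m_nat g) = eqToHom (m_nat f) ≫ m X ◁ T.map₂ θ
  e_m : ∀ X : B, e (T.obj X) ≫ m X = 𝟙 (T.obj X)
  map_e_m : ∀ X : B, T.map (e X) ≫ m X = 𝟙 (T.obj X)
  m_m : ∀ X : B, T.map (m X) ≫ m X = m (T.obj X) ≫ m X

variable {B : Type u} [Bicategory.{w, v} B] [Bicategory.Strict B]

namespace TwoMonad

variable (M : TwoMonad B)

theorem e_nat_assoc {X Y Z : B} (f : X ⟶ Y) (h : M.T.obj Y ⟶ Z) :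
    f ≫ M.e Y ≫ h = M.e X ≫ M.T.map f ≫ h := by
  rw [← Strict.assoc, M.e_nat, Strict.assoc]

theorem m_nat_assoc {X Y Z : B} (f : X ⟶ Y) (h : M.T.obj Y ⟶ Z) :
    M.T.map (M.T.map f) ≫ M.m Y ≫ h = M.m X ≫ M.T.map f ≫ h := by
  rw [← Strict.assoc, M.m_nat, Strict.assoc]

theorem e_m_assoc {X Y : B} (h : M.T.obj X ⟶ Y) : M.e (M.T.obj X) ≫ M.m X ≫ h = h := by
  rw [← Strict.assoc, M.e_m, Strict.id_comp]

theorem map_e_m_assoc {X Y : B} (h : M.T.obj X ⟶ Y) : M.T.map (M.e X) ≫ M.m X ≫ h = h := by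
  rw [← Strict.assoc, M.map_e_m, Strict.id_comp]

theorem m_m_assoc {X Y : B} (h : M.T.obj X ⟶ Y) :
    M.T.map (M.m X) ≫ M.m X ≫ h = M.m (M.T.obj X) ≫ M.m X ≫ h := by
  rw [← Strict.assoc, M.m_m, Strict.assoc]

theorem map_comp_assoc {X Y Z W : B} (f : X ⟶ Y) (g : Y ⟶ Z) (h : M.T.obj Z ⟶ W) :
    M.T.map (f ≫ g) ≫ h = M.T.map f ≫ M.T.map g ≫ h := by
  rw [M.T.map_comp, Strict.assoc]

end TwoMonad

variable {M : TwoMonad B}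

/-- Lax algebra structure on an object `X`: `a : T X → X`, `η : 1 → a ∘ e`, `μ : a ∘ T a → a ∘ m`. -/
structure LaxAlg (M : TwoMonad B) (X : B) where
  a : M.T.obj X ⟶ X
  η : 𝟙 X ⟶ M.e X ≫ a
  μ : M.T.map a ≫ a ⟶ M.m X ≫ a
  left_unit : a ◁ η ≫
      eqToHom (show a ≫ M.e X ≫ a = M.e (M.T.obj X) ≫ M.T.map a ≫ a from M.e_nat_assoc a a) ≫
      M.e (M.T.obj X) ◁ μ =
    eqToHom (show a ≫ 𝟙 X = M.e (M.T.obj X) ≫ M.m X ≫ a by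
      rw [M.e_m_assoc, Strict.comp_id])
  right_unit : M.T.map₂ η ▷ a ≫
      eqToHom (show M.T.map (M.e X ≫ a) ≫ a = M.T.map (M.e X) ≫ M.T.map a ≫ a from
        M.map_comp_assoc _ _ _) ≫
      M.T.map (M.e X) ◁ μ =
    eqToHom (show M.T.map (𝟙 X) ≫ a = M.T.map (M.e X) ≫ M.m X ≫ a by
      rw [M.map_e_m_assoc, M.T.map_id, Strict.id_comp])
  assoc : M.T.map (M.T.map a) ◁ μ ≫
      eqToHom (show M.T.map (M.T.map a) ≫ M.m X ≫ a = M.m (M.T.obj X) ≫ M.T.map a ≫ a from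
        M.m_nat_assoc a a) ≫
      M.m (M.T.obj X) ◁ μ =
    eqToHom (show M.T.map (M.T.map a) ≫ M.T.map a ≫ a = M.T.map (M.T.map a ≫ a) ≫ a from
        (M.map_comp_assoc _ _ _).symm) ≫
      M.T.map₂ μ ▷ a ≫
      eqToHom (show M.T.map (M.m X ≫ a) ≫ a = M.T.map (M.m X) ≫ M.T.map a ≫ a from
        M.map_comp_assoc _ _ _) ≫
      M.T.map (M.m X) ◁ μ ≫
      eqToHom (show M.T.map (M.m X) ≫ M.m X ≫ a = M.m (M.T.obj X) ≫ M.m X ≫ a from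
        M.m_m_assoc a)

/-- A pseudo-algebra is a lax algebra with invertible `η` and `μ`. -/
structure LaxAlg.IsPseudo {X : B} (A : LaxAlg M X) : Prop where
  isIso_η : IsIso A.η
  isIso_μ : IsIso A.μ

/-- Lax algebra morphism structure on `f`: a 2-cell `φ : b ∘ T f → f ∘ a`. -/
@[ext]
structure LaxMor {X Y : B} (A : LaxAlg M X) (A' : LaxAlg M Y) (f : X ⟶ Y) where
  φ : M.T.map f ≫ A'.a ⟶ A.a ≫ f
  unit : f ◁ A'.η ≫
      eqToHom (show f ≫ M.e Y ≫ A'.a = M.e X ≫ M.T.map f ≫ A'.a from M.e_nat_assoc f A'.a) ≫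
      M.e X ◁ φ =
    eqToHom (show f ≫ 𝟙 Y = 𝟙 X ≫ f by rw [Strict.comp_id, Strict.id_comp]) ≫
      A.η ▷ f ≫ eqToHom (Strict.assoc _ _ _)
  mul : M.T.map (M.T.map f) ◁ A'.μ ≫
      eqToHom (show M.T.map (M.T.map f) ≫ M.m Y ≫ A'.a = M.m X ≫ M.T.map f ≫ A'.a from
        M.m_nat_assoc f A'.a) ≫
      M.m X ◁ φ =
    eqToHom (show M.T.map (M.T.map f) ≫ M.T.map A'.a ≫ A'.a =
        M.T.map (M.T.map f ≫ A'.a) ≫ A'.a from (M.map_comp_assoc _ _ _).symm) ≫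
      M.T.map₂ φ ▷ A'.a ≫
      eqToHom (show M.T.map (A.a ≫ f) ≫ A'.a = M.T.map A.a ≫ M.T.map f ≫ A'.a from
        M.map_comp_assoc _ _ _) ≫
      M.T.map A.a ◁ φ ≫
      eqToHom (Strict.assoc _ _ _).symm ≫ A.μ ▷ f ≫ eqToHom (Strict.assoc _ _ _)

/-- Oplax algebra morphism structure on `f`: a 2-cell `ζ : f ∘ a → b ∘ T f`. -/
@[ext]
structure OplaxMor {X Y : B} (A : LaxAlg M X) (A' : LaxAlg M Y) (f : X ⟶ Y) where
  ζ : A.a ≫ f ⟶ M.T.map f ≫ A'.a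
  unit : A.η ▷ f ≫ eqToHom (Strict.assoc _ _ _) ≫ M.e X ◁ ζ =
    eqToHom (show 𝟙 X ≫ f = f ≫ 𝟙 Y by rw [Strict.comp_id, Strict.id_comp]) ≫
      f ◁ A'.η ≫
      eqToHom (show f ≫ M.e Y ≫ A'.a = M.e X ≫ M.T.map f ≫ A'.a from M.e_nat_assoc f A'.a)
  mul : A.μ ▷ f ≫ eqToHom (Strict.assoc _ _ _) ≫ M.m X ◁ ζ =
    eqToHom (Strict.assoc _ _ _) ≫ M.T.map A.a ◁ ζ ≫
      eqToHom (show M.T.map A.a ≫ M.T.map f ≫ A'.a = M.T.map (A.a ≫ f) ≫ A'.a from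
        (M.map_comp_assoc _ _ _).symm) ≫
      M.T.map₂ ζ ▷ A'.a ≫
      eqToHom (show M.T.map (M.T.map f ≫ A'.a) ≫ A'.a =
        M.T.map (M.T.map f) ≫ M.T.map A'.a ≫ A'.a from M.map_comp_assoc _ _ _) ≫
      M.T.map (M.T.map f) ◁ A'.μ ≫
      eqToHom (show M.T.map (M.T.map f) ≫ M.m Y ≫ A'.a = M.m X ≫ M.T.map f ≫ A'.a from
        M.m_nat_assoc f A'.a)

/-- For lax morphisms `(h, φ) : W → X`, `(k, ψ) : Y → Z` and oplax morphisms `(f, ζ) : W → Y`,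
`(g, ξ) : X → Z`, a 2-cell `ω : g ∘ h ⟶ k ∘ f` is a generalized 2-cell of lax algebras. -/
def IsAlgCell {W X Y Z : B} {A : LaxAlg M W} {A' : LaxAlg M X} {C : LaxAlg M Y} {D : LaxAlg M Z}
    {h : W ⟶ X} {f : W ⟶ Y} {g : X ⟶ Z} {k : Y ⟶ Z}
    (φ : LaxMor A A' h) (ζ : OplaxMor A C f) (ξ : OplaxMor A' D g) (ψ : LaxMor C D k)
    (ω : h ≫ g ⟶ f ≫ k) : Prop :=
  φ.φ ▷ g ≫ eqToHom (Strict.assoc _ _ _) ≫ A.a ◁ ω ≫ eqToHom (Strict.assoc _ _ _).symm ≫ ζ.ζ ▷ k =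
    eqToHom (Strict.assoc _ _ _) ≫ M.T.map h ◁ ξ.ζ ≫
      eqToHom (show M.T.map h ≫ M.T.map g ≫ D.a = M.T.map (h ≫ g) ≫ D.a from
        (M.map_comp_assoc _ _ _).symm) ≫
      M.T.map₂ ω ▷ D.a ≫
      eqToHom (show M.T.map (f ≫ k) ≫ D.a = M.T.map f ≫ M.T.map k ≫ D.a from
        M.map_comp_assoc _ _ _) ≫
      M.T.map f ◁ ψ.φ ≫ eqToHom (Strict.assoc _ _ _).symm

end twomonad


section algcomp

open Bicategory

variable {B : Type u} [Bicategory.{w, v} B] [Bicategory.Strict B] {M : TwoMonad B}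

theorem whiskerLeft_congr_left {X Y Z : B} {f f' : X ⟶ Y} (e : f = f') {g h : Y ⟶ Z} (θ : g ⟶ h) :
    f ◁ θ = eqToHom (by rw [e]) ≫ f' ◁ θ ≫ eqToHom (by rw [e]) := by
  subst e; simp

theorem whiskerRight_congr_right {X Y Z : B} {f f' : X ⟶ Y} (θ : f ⟶ f') {g h : Y ⟶ Z}
    (e : g = h) : θ ▷ g = eqToHom (by rw [e]) ≫ θ ▷ h ≫ eqToHom (by rw [e]) := by
  subst e; simp

attribute [local simp] Strict.associator_eqToIso Strict.leftUnitor_eqToIso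
  Strict.rightUnitor_eqToIso StrictPseudofunctor.mapComp_eq_eqToIso
  PrelaxFunctor.map₂_eqToHom

/-- The identity lax morphism. -/
def LaxMor.id {X : B} (A : LaxAlg M X) : LaxMor A A (𝟙 X) where
  φ := eqToHom (by rw [M.T.map_id, Strict.id_comp, Strict.comp_id])
  unit := by simp
  mul := by 
    rw [whiskerLeft_congr_left (show M.T.map (M.T.map (𝟙 X)) = 𝟙 _ by simp [M.T.map_id])]
    simp

/-- The composite of lax morphisms. -/
def LaxMor.comp {X Y Z : B} {A : LaxAlg M X} {A' : LaxAlg M Y} {A'' : LaxAlg M Z}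
    {f : X ⟶ Y} {g : Y ⟶ Z} (p : LaxMor A A' f) (q : LaxMor A' A'' g) : LaxMor A A'' (f ≫ g) where
  φ := eqToHom (M.map_comp_assoc _ _ _) ≫ M.T.map f ◁ q.φ ≫ eqToHom (Strict.assoc _ _ _).symm ≫
    p.φ ▷ g ≫ eqToHom (Strict.assoc _ _ _)
  unit := by
    have hp := congrArg (· ▷ g) p.unit
    have hq := congrArg (f ◁ ·) q.unit
    have e := whiskerLeft_congr_left (M.e_nat f).symm q.φ
    simp at hp hq e ⊢
    rw [eqToHom_comp_iff, comp_eqToHom_iff] at e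
    rw [eqToHom_comp_iff] at hp
    simp only [← Category.assoc] at hp
    rw [comp_eqToHom_iff] at hp
    rw [e]
    simp at hp ⊢
    rw [reassoc_of% hq]
    simp
    rw [reassoc_of% hp]
    simp
  mul := by 
    have hp := congrArg (· ▷ g) p.mul
    have hq := congrArg (M.T.map (M.T.map f) ◁ ·) q.mul
    have e := whiskerLeft_congr_left (M.m_nat f).symm q.φ
    have e2 := whiskerLeft_congr_left (M.T.map_comp A.a f).symm q.φ
    have e3 := whiskerLeft_congr_left (M.T.map_comp (M.T.map f) A'.a).symm q.φ
    have e4 := whisker_exchange (M.T.map₂ p.φ) q.φ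
    have e5 := whiskerLeft_congr_left (show M.T.map (M.T.map (f ≫ g)) = M.T.map (M.T.map f) ≫ M.T.map (M.T.map g) by simp [M.T.map_comp]) A''.μ
    simp at hp hq e e2 e3 e4 e5 ⊢
    rw [eqToHom_comp_iff, comp_eqToHom_iff] at e e2 e3
    rw [eqToHom_comp_iff] at hp
    simp only [← Category.assoc] at hp e4
    rw [comp_eqToHom_iff] at hp e4
    rw [e5, e, e2]
    rw [e3] at hq
    simp at hp hq e4 ⊢
    rw [reassoc_of% hq]
    simp
    rw [reassoc_of% hp]
    simp
    rw [reassoc_of% e4]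
    simp

/-- The identity oplax morphism. -/
def OplaxMor.id {X : B} (A : LaxAlg M X) : OplaxMor A A (𝟙 X) where
  ζ := eqToHom (by rw [M.T.map_id, Strict.id_comp, Strict.comp_id])
  unit := by simp
  mul := by
    rw [whiskerLeft_congr_left (show M.T.map (M.T.map (𝟙 X)) = 𝟙 _ by simp [M.T.map_id])]
    simp

/-- The composite of oplax morphisms. -/
def OplaxMor.comp {X Y Z : B} {A : LaxAlg M X} {A' : LaxAlg M Y} {A'' : LaxAlg M Z}
    {f : X ⟶ Y} {g : Y ⟶ Z} (p : OplaxMor A A' f) (q : OplaxMor A' A'' g) :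
    OplaxMor A A'' (f ≫ g) where
  ζ := eqToHom (Strict.assoc _ _ _).symm ≫ p.ζ ▷ g ≫ eqToHom (Strict.assoc _ _ _) ≫
    M.T.map f ◁ q.ζ ≫ eqToHom (M.map_comp_assoc _ _ _).symm
  unit := by
    have hp := congrArg (· ▷ g) p.unit
    have hq := congrArg (f ◁ ·) q.unit
    have e := whiskerLeft_congr_left (M.e_nat f).symm q.ζ
    simp at hp hq e ⊢
    rw [eqToHom_comp_iff, comp_eqToHom_iff] at e
    simp only [← Category.assoc] at hp
    rw [comp_eqToHom_iff] at hp
    rw [e]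
    simp at hp hq ⊢
    rw [reassoc_of% hp]
    simp
    rw [reassoc_of% hq]
    simp
  mul := by
    have hp := congrArg (· ▷ g) p.mul
    have hq := congrArg (M.T.map (M.T.map f) ◁ ·) q.mul
    have e := whiskerLeft_congr_left (M.m_nat f).symm q.ζ
    have e2 := whiskerLeft_congr_left (M.T.map_comp A.a f).symm q.ζ
    have e3 := whiskerLeft_congr_left (M.T.map_comp (M.T.map f) A'.a).symm q.ζ
    have e4 := whisker_exchange (M.T.map₂ p.ζ) q.ζ
    have e5 := whiskerLeft_congr_left (show M.T.map (M.T.map (f ≫ g)) =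
      M.T.map (M.T.map f) ≫ M.T.map (M.T.map g) by simp [M.T.map_comp]) A''.μ
    simp at hp hq e e2 e3 e4 e5 ⊢
    rw [eqToHom_comp_iff, comp_eqToHom_iff] at e e2 e3
    simp only [← Category.assoc] at hp e4
    rw [comp_eqToHom_iff] at hp e4
    rw [e5, e, e2]
    rw [e3] at hq
    simp at hp hq e4 ⊢
    rw [reassoc_of% hp]
    simp
    rw [reassoc_of% hq]
    simp
    rw [reassoc_of% e4]
    simp

theorem LaxMor.id_comp_φ {X Y : B} {A : LaxAlg M X} {A' : LaxAlg M Y} {f : X ⟶ Y}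
    (p : LaxMor A A' f) : ((LaxMor.id A).comp p).φ =
      eqToHom (by rw [Strict.id_comp]) ≫ p.φ ≫ eqToHom (by rw [Strict.id_comp]) := by
  simp [LaxMor.comp, LaxMor.id]
  rw [whiskerLeft_congr_left (M.T.map_id _)]
  simp

theorem LaxMor.comp_id_φ {X Y : B} {A : LaxAlg M X} {A' : LaxAlg M Y} {f : X ⟶ Y}
    (p : LaxMor A A' f) : (p.comp (LaxMor.id A')).φ =
      eqToHom (by rw [Strict.comp_id]) ≫ p.φ ≫ eqToHom (by rw [Strict.comp_id]) := by
  simp [LaxMor.comp, LaxMor.id]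

theorem LaxMor.comp_assoc_φ {X Y Z W : B} {A : LaxAlg M X} {A' : LaxAlg M Y} {C : LaxAlg M Z}
    {D : LaxAlg M W} {f : X ⟶ Y} {g : Y ⟶ Z} {h : Z ⟶ W} (p : LaxMor A A' f) (q : LaxMor A' C g)
    (r : LaxMor C D h) : ((p.comp q).comp r).φ =
      eqToHom (by rw [Strict.assoc]) ≫ (p.comp (q.comp r)).φ ≫
        eqToHom (by rw [Strict.assoc]) := by
  simp [LaxMor.comp]
  rw [whiskerLeft_congr_left (M.T.map_comp _ _)]
  simp

theorem OplaxMor.id_comp_ζ {X Y : B} {A : LaxAlg M X} {A' : LaxAlg M Y} {f : X ⟶ Y}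
    (p : OplaxMor A A' f) : ((OplaxMor.id A).comp p).ζ =
      eqToHom (by rw [Strict.id_comp]) ≫ p.ζ ≫ eqToHom (by rw [Strict.id_comp]) := by
  simp [OplaxMor.comp, OplaxMor.id]
  rw [whiskerLeft_congr_left (M.T.map_id _)]
  simp

theorem OplaxMor.comp_id_ζ {X Y : B} {A : LaxAlg M X} {A' : LaxAlg M Y} {f : X ⟶ Y}
    (p : OplaxMor A A' f) : (p.comp (OplaxMor.id A')).ζ =
      eqToHom (by rw [Strict.comp_id]) ≫ p.ζ ≫ eqToHom (by rw [Strict.comp_id]) := by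
  simp [OplaxMor.comp, OplaxMor.id]

theorem OplaxMor.comp_assoc_ζ {X Y Z W : B} {A : LaxAlg M X} {A' : LaxAlg M Y} {C : LaxAlg M Z}
    {D : LaxAlg M W} {f : X ⟶ Y} {g : Y ⟶ Z} {h : Z ⟶ W} (p : OplaxMor A A' f)
    (q : OplaxMor A' C g) (r : OplaxMor C D h) : ((p.comp q).comp r).ζ =
      eqToHom (by rw [Strict.assoc]) ≫ (p.comp (q.comp r)).ζ ≫
        eqToHom (by rw [Strict.assoc]) := by
  simp [OplaxMor.comp]
  rw [whiskerLeft_congr_left (M.T.map_comp _ _)]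
  simp

theorem IsAlgCell.vid {X Y : B} {A : LaxAlg M X} {A' : LaxAlg M Y} {h : X ⟶ Y}
    (p : LaxMor A A' h) : IsAlgCell p (OplaxMor.id A) (OplaxMor.id A') p
      (eqToHom (by rw [Strict.comp_id, Strict.id_comp])) := by
  simp [IsAlgCell, OplaxMor.id]
  rw [whiskerLeft_congr_left (M.T.map_id _)]
  simp

theorem IsAlgCell.hid {X Y : B} {A : LaxAlg M X} {A' : LaxAlg M Y} {f : X ⟶ Y}
    (p : OplaxMor A A' f) : IsAlgCell (LaxMor.id A) p p (LaxMor.id A')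
      (eqToHom (by rw [Strict.comp_id, Strict.id_comp])) := by
  simp [IsAlgCell, LaxMor.id]
  rw [whiskerLeft_congr_left (M.T.map_id _)]
  simp

theorem IsAlgCell.vcomp {X Y Z W U V : B} {A : LaxAlg M X} {A' : LaxAlg M Y} {C : LaxAlg M Z}
    {D : LaxAlg M W} {E : LaxAlg M U} {F : LaxAlg M V} {h : X ⟶ Y} {f : X ⟶ Z} {g : Y ⟶ W}
    {k : Z ⟶ W} {f' : Z ⟶ U} {g' : W ⟶ V} {l : U ⟶ V}
    {φ : LaxMor A A' h} {ζ : OplaxMor A C f} {ξ : OplaxMor A' D g} {ψ : LaxMor C D k}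
    {ζ' : OplaxMor C E f'} {ξ' : OplaxMor D F g'} {χ : LaxMor E F l}
    {ω : h ≫ g ⟶ f ≫ k} {ω' : k ≫ g' ⟶ f' ≫ l}
    (hω : IsAlgCell φ ζ ξ ψ ω) (hω' : IsAlgCell ψ ζ' ξ' χ ω') :
    IsAlgCell φ (ζ.comp ζ') (ξ.comp ξ') χ
      (eqToHom (Strict.assoc _ _ _).symm ≫ ω ▷ g' ≫ eqToHom (Strict.assoc _ _ _) ≫ f ◁ ω' ≫
        eqToHom (Strict.assoc _ _ _).symm) := by
  have hp := congrArg (· ▷ g') hω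
  have hq := congrArg (M.T.map f ◁ ·) hω'
  have e1 := whisker_exchange ζ.ζ ω'
  have e2 := whisker_exchange (M.T.map₂ ω) ξ'.ζ
  have e3 := whiskerLeft_congr_left (M.T.map_comp h g) ξ'.ζ
  have e4 := whiskerLeft_congr_left (M.T.map_comp f k) ξ'.ζ
  have e5 := whiskerLeft_congr_left (M.T.map_comp f f') χ.φ
  unfold IsAlgCell at *
  simp [OplaxMor.comp] at hp hq e1 e2 e3 e4 e5 ⊢
  rw [eqToHom_comp_iff] at e1
  simp only [← Category.assoc] at hp e1 e2 hq
  rw [comp_eqToHom_iff] at e1 e2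
  rw [e3, e4] at e2
  simp at hp hq e1 e2 ⊢
  rw [eqToHom_comp_iff] at e2
  rw [reassoc_of% e1]
  simp
  rw [reassoc_of% hp]
  simp
  rw [reassoc_of% hq, e5]
  simp
  rw [reassoc_of% e2]
  simp

theorem IsAlgCell.hcomp {X Y Z W U V : B} {A : LaxAlg M X} {A' : LaxAlg M Y} {C : LaxAlg M Z}
    {D : LaxAlg M W} {E : LaxAlg M U} {F : LaxAlg M V} {h : X ⟶ Y} {f : X ⟶ Z} {g : Y ⟶ W}
    {k : Z ⟶ W} {h' : Y ⟶ U} {l : U ⟶ V} {k' : W ⟶ V}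
    {φ : LaxMor A A' h} {ζ : OplaxMor A C f} {ξ : OplaxMor A' D g} {ψ : LaxMor C D k}
    {φ' : LaxMor A' E h'} {χ : OplaxMor E F l} {ψ' : LaxMor D F k'}
    {ω : h ≫ g ⟶ f ≫ k} {ω' : h' ≫ l ⟶ g ≫ k'}
    (hω : IsAlgCell φ ζ ξ ψ ω) (hω' : IsAlgCell φ' ξ χ ψ' ω') :
    IsAlgCell (φ.comp φ') ζ χ (ψ.comp ψ')
      (eqToHom (Strict.assoc _ _ _) ≫ h ◁ ω' ≫ eqToHom (Strict.assoc _ _ _).symm ≫ ω ▷ k' ≫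
        eqToHom (Strict.assoc _ _ _)) := by
  have hp := congrArg (· ▷ k') hω
  have hq := congrArg (M.T.map h ◁ ·) hω'
  have e1 := (whisker_exchange φ.φ ω').symm
  have e2 := whisker_exchange (M.T.map₂ ω) ψ'.φ
  have e3 := whiskerLeft_congr_left (M.T.map_comp h g) ψ'.φ
  have e4 := whiskerLeft_congr_left (M.T.map_comp f k) ψ'.φ
  have e5 := whiskerLeft_congr_left (M.T.map_comp h h') χ.ζ
  unfold IsAlgCell at *
  simp [LaxMor.comp] at hp hq e1 e2 e3 e4 e5 ⊢
  rw [eqToHom_comp_iff] at e1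
  simp only [← Category.assoc] at hp e1 e2 hq
  rw [comp_eqToHom_iff] at e1 e2
  rw [e3, e4] at e2
  simp at hp hq e1 e2 ⊢
  rw [eqToHom_comp_iff] at e2
  rw [reassoc_of% e1]
  simp
  rw [reassoc_of% hp]
  simp
  rw [reassoc_of% hq, e5]
  simp
  rw [reassoc_of% e2]
  simp
end algcomp


/-- The 2-category `Grph(Cat)` at a fixed pair of universe levels. -/
abbrev Grph := CatGraph.{u, v, u, v}

section paste

variable {A B C D A' B' : CatGraph.{u₀, v₀, u₁, v₁}}

/-- Vertical pasting of squares: `(κ F) ∘ (G' θ)`. -/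
def vpaste {H : A ⟶ B} {F : A ⟶ C} {G : B ⟶ D} {K : C ⟶ D} {F' : C ⟶ A'} {G' : D ⟶ B'}
    {L : A' ⟶ B'} (θ : H ≫ G ⟶ F ≫ K) (κ : K ≫ G' ⟶ F' ≫ L) : H ≫ G ≫ G' ⟶ (F ≫ F') ≫ L :=
  Bicategory.whiskerRight θ G' ≫ Bicategory.whiskerLeft F κ

/-- Horizontal pasting of squares: `(K' θ) ∘ (κ H)`. -/
def hpaste {H : A ⟶ B} {F : A ⟶ C} {G : B ⟶ D} {K : C ⟶ D} {H' : B ⟶ A'} {L : A' ⟶ B'}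
    {K' : D ⟶ B'} (θ : H ≫ G ⟶ F ≫ K) (κ : H' ≫ L ⟶ G ≫ K') : (H ≫ H') ≫ L ⟶ F ≫ K ≫ K' :=
  Bicategory.whiskerLeft H κ ≫ Bicategory.whiskerRight θ K'

theorem id_vpaste {H : A ⟶ B} {F : A ⟶ C} {G : B ⟶ D} {K : C ⟶ D} (θ : H ≫ G ⟶ F ≫ K) :
    vpaste (F := 𝟙 A) (G := 𝟙 B) (𝟙 H) θ = θ := by
  apply graphCell_ext <;> intro x
  · exact (congrArg (· ≫ GraphCell.app₀ θ x) (G.F₀.map_id _)).trans (Category.id_comp _)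
  · exact (congrArg (· ≫ GraphCell.app₁ θ x) (G.map₁_id _)).trans (Category.id_comp _)

theorem vpaste_id {H : A ⟶ B} {F : A ⟶ C} {G : B ⟶ D} {K : C ⟶ D} (θ : H ≫ G ⟶ F ≫ K) :
    vpaste (F' := 𝟙 C) (G' := 𝟙 D) θ (𝟙 K) = θ := by
  apply graphCell_ext <;> intro x <;> exact Category.comp_id _

theorem vpaste_assoc {A'' B'' : CatGraph.{u₀, v₀, u₁, v₁}} {H : A ⟶ B} {F : A ⟶ C} {G : B ⟶ D}
    {K : C ⟶ D} {F' : C ⟶ A'} {G' : D ⟶ B'} {L : A' ⟶ B'} {F'' : A' ⟶ A''} {G'' : B' ⟶ B''}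
    {L' : A'' ⟶ B''} (θ : H ≫ G ⟶ F ≫ K) (κ : K ≫ G' ⟶ F' ≫ L) (ν : L ≫ G'' ⟶ F'' ≫ L') :
    vpaste (F := F ≫ F') (G := G ≫ G') (vpaste θ κ) ν =
      vpaste (F' := F' ≫ F'') (G' := G' ≫ G'') θ (vpaste κ ν) := by
  apply graphCell_ext <;> intro x
  · exact (congrArg (· ≫ _) (G''.F₀.map_comp _ _)).trans (Category.assoc _ _ _)
  · exact (congrArg (· ≫ _) (G''.map₁_comp _ _)).trans (Category.assoc _ _ _)

theorem id_hpaste {H : A ⟶ B} {F : A ⟶ C} {G : B ⟶ D} {K : C ⟶ D} (θ : H ≫ G ⟶ F ≫ K) :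
    hpaste (H := 𝟙 A) (K := 𝟙 C) (𝟙 F) θ = θ := by
  apply graphCell_ext <;> intro x
  · exact (congrArg (GraphCell.app₀ θ x ≫ ·) (K.F₀.map_id _)).trans (Category.comp_id _)
  · exact (congrArg (GraphCell.app₁ θ x ≫ ·) (K.map₁_id _)).trans (Category.comp_id _)

theorem hpaste_id {H : A ⟶ B} {F : A ⟶ C} {G : B ⟶ D} {K : C ⟶ D} (θ : H ≫ G ⟶ F ≫ K) :
    hpaste (H' := 𝟙 B) (K' := 𝟙 D) θ (𝟙 G) = θ := by
  apply graphCell_ext <;> intro x <;> exact Category.id_comp _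

theorem hpaste_assoc {A'' B'' : CatGraph.{u₀, v₀, u₁, v₁}} {H : A ⟶ B} {F : A ⟶ C} {G : B ⟶ D}
    {K : C ⟶ D} {H' : B ⟶ A'} {L : A' ⟶ B'} {K' : D ⟶ B'} {H'' : A' ⟶ A''} {M : A'' ⟶ B''}
    {K'' : B' ⟶ B''} (θ : H ≫ G ⟶ F ≫ K) (κ : H' ≫ L ⟶ G ≫ K') (ν : H'' ≫ M ⟶ L ≫ K'') :
    hpaste (H := H ≫ H') (K := K ≫ K') (hpaste θ κ) ν =
      hpaste (H' := H' ≫ H'') (K' := K' ≫ K'') θ (hpaste κ ν) := by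
  apply graphCell_ext <;> intro x
  · exact (congrArg (_ ≫ ·) (K''.F₀.map_comp _ _)).trans (Category.assoc _ _ _).symm
  · have e := K''.map₁_comp (GraphCell.app₁ κ ⟨H.obj₁ x.hom⟩) (K'.map₁ (GraphCell.app₁ θ x))
    exact (congrArg (GraphCell.app₁ ν ⟨H'.obj₁ (H.obj₁ x.hom)⟩ ≫ ·) e).trans
      (Category.assoc _ _ _).symm

theorem hpaste_vpaste {A'' B'' C'' : CatGraph.{u₀, v₀, u₁, v₁}} {H : A ⟶ B} {F : A ⟶ C}
    {G : B ⟶ D} {K : C ⟶ D} {F' : C ⟶ A'} {G' : D ⟶ B'} {L : A' ⟶ B'} {H' : B ⟶ A''}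
    {M : A'' ⟶ B''} {K' : D ⟶ B''} {M' : B'' ⟶ C''} {L' : B' ⟶ C''}
    (θ : H ≫ G ⟶ F ≫ K) (κ : K ≫ G' ⟶ F' ≫ L) (θ' : H' ≫ M ⟶ G ≫ K')
    (κ' : K' ≫ M' ⟶ G' ≫ L') :
    hpaste (F := F ≫ F') (G := G ≫ G') (L := M ≫ M') (vpaste θ κ) (vpaste θ' κ') =
      vpaste (H := H ≫ H') (K := K ≫ K') (L := L ≫ L') (hpaste θ θ') (hpaste κ κ') := by
  apply graphCell_ext <;> intro x
  · have a := M'.F₀.map_comp (GraphCell.app₀ θ' (H.F₀.obj x)) (K'.F₀.map (GraphCell.app₀ θ x))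
    have b := L'.F₀.map_comp (G'.F₀.map (GraphCell.app₀ θ x)) (GraphCell.app₀ κ (F.F₀.obj x))
    have c := GraphCell.nat₀ κ' (GraphCell.app₀ θ x)
    refine (congrArg (_ ≫ ·) b).trans (Eq.trans ?_ (congrArg (· ≫ _) a).symm)
    refine (Category.assoc _ _ _).trans (Eq.trans ?_ (Category.assoc _ _ _).symm)
    refine congrArg (_ ≫ ·) ?_
    refine (Category.assoc _ _ _).symm.trans (Eq.trans ?_ (Category.assoc _ _ _))
    exact congrArg (· ≫ _) c.symm
  · have a := M'.map₁_comp (GraphCell.app₁ θ' ⟨H.obj₁ x.hom⟩) (K'.map₁ (GraphCell.app₁ θ x))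
    have b := L'.map₁_comp (G'.map₁ (GraphCell.app₁ θ x)) (GraphCell.app₁ κ ⟨F.obj₁ x.hom⟩)
    have c := GraphCell.nat₁ κ' (GraphCell.app₁ θ x)
    refine (congrArg (_ ≫ ·) b).trans (Eq.trans ?_ (congrArg (· ≫ _) a).symm)
    refine (Category.assoc _ _ _).trans (Eq.trans ?_ (Category.assoc _ _ _).symm)
    refine congrArg (_ ≫ ·) ?_
    refine (Category.assoc _ _ _).symm.trans (Eq.trans ?_ (Category.assoc _ _ _))
    exact congrArg (· ≫ _) c.symm

end paste

/-- A double category whose objects, vertical and horizontal 1-cells and cells are those of the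
double category of squares `g ∘ h ⟶ k ∘ f` in `Grph(Cat)` with additional structure: structure
`Ob` on graphs, structures `Hor` and `Ver` on graph morphisms, and a condition `IsCell` on squares.
All compositions are those of the underlying graph morphisms and squares. -/
structure DispDbl where
  Ob : Grph.{u, v} → Type (max u v)
  Hor : ∀ {A B : Grph.{u, v}}, Ob A → Ob B → (A ⟶ B) → Type (max u v)
  hid : ∀ {A : Grph.{u, v}} (X : Ob A), Hor X X (𝟙 A)
  hcomp : ∀ {A B C : Grph.{u, v}} {X : Ob A} {Y : Ob B} {Z : Ob C} {F : A ⟶ B} {K : B ⟶ C},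
    Hor X Y F → Hor Y Z K → Hor X Z (F ≫ K)
  hid_hcomp : ∀ {A B : Grph.{u, v}} {X : Ob A} {Y : Ob B} {F : A ⟶ B} (f : Hor X Y F),
    hcomp (hid X) f = f
  hcomp_hid : ∀ {A B : Grph.{u, v}} {X : Ob A} {Y : Ob B} {F : A ⟶ B} (f : Hor X Y F),
    hcomp f (hid Y) = f
  hcomp_assoc : ∀ {A B C D : Grph.{u, v}} {X : Ob A} {Y : Ob B} {Z : Ob C} {W : Ob D}
    {F : A ⟶ B} {K : B ⟶ C} {L : C ⟶ D} (f : Hor X Y F) (k : Hor Y Z K) (l : Hor Z W L),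
    hcomp (hcomp f k) l = hcomp f (hcomp k l)
  Ver : ∀ {A B : Grph.{u, v}}, Ob A → Ob B → (A ⟶ B) → Type (max u v)
  vid : ∀ {A : Grph.{u, v}} (X : Ob A), Ver X X (𝟙 A)
  vcomp : ∀ {A B C : Grph.{u, v}} {X : Ob A} {Y : Ob B} {Z : Ob C} {F : A ⟶ B} {K : B ⟶ C},
    Ver X Y F → Ver Y Z K → Ver X Z (F ≫ K)
  vid_vcomp : ∀ {A B : Grph.{u, v}} {X : Ob A} {Y : Ob B} {F : A ⟶ B} (f : Ver X Y F),
    vcomp (vid X) f = f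
  vcomp_vid : ∀ {A B : Grph.{u, v}} {X : Ob A} {Y : Ob B} {F : A ⟶ B} (f : Ver X Y F),
    vcomp f (vid Y) = f
  vcomp_assoc : ∀ {A B C D : Grph.{u, v}} {X : Ob A} {Y : Ob B} {Z : Ob C} {W : Ob D}
    {F : A ⟶ B} {K : B ⟶ C} {L : C ⟶ D} (f : Ver X Y F) (k : Ver Y Z K) (l : Ver Z W L),
    vcomp (vcomp f k) l = vcomp f (vcomp k l)
  IsCell : ∀ {A B C D : Grph.{u, v}} {X : Ob A} {Y : Ob B} {Z : Ob C} {W : Ob D} {H : A ⟶ B}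
    {F : A ⟶ C} {G : B ⟶ D} {K : C ⟶ D} (_ : Hor X Y H) (_ : Ver X Z F) (_ : Ver Y W G)
    (_ : Hor Z W K) (_ : H ≫ G ⟶ F ≫ K), Prop
  isCell_vid : ∀ {A B : Grph.{u, v}} {X : Ob A} {Y : Ob B} {H : A ⟶ B} (h : Hor X Y H),
    IsCell h (vid X) (vid Y) h (𝟙 H)
  isCell_hid : ∀ {A B : Grph.{u, v}} {X : Ob A} {Y : Ob B} {F : A ⟶ B} (f : Ver X Y F),
    IsCell (hid X) f f (hid Y) (𝟙 F)
  isCell_vpaste : ∀ {A B C D A' B' : Grph.{u, v}} {X : Ob A} {Y : Ob B} {Z : Ob C} {W : Ob D}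
    {X' : Ob A'} {Y' : Ob B'} {H : A ⟶ B} {F : A ⟶ C} {G : B ⟶ D} {K : C ⟶ D} {F' : C ⟶ A'}
    {G' : D ⟶ B'} {L : A' ⟶ B'} {h : Hor X Y H} {f : Ver X Z F} {g : Ver Y W G} {k : Hor Z W K}
    {f' : Ver Z X' F'} {g' : Ver W Y' G'} {l : Hor X' Y' L} {θ : H ≫ G ⟶ F ≫ K}
    {κ : K ≫ G' ⟶ F' ≫ L},
    IsCell h f g k θ → IsCell k f' g' l κ → IsCell h (vcomp f f') (vcomp g g') l (vpaste θ κ)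
  isCell_hpaste : ∀ {A B C D A' B' : Grph.{u, v}} {X : Ob A} {Y : Ob B} {Z : Ob C} {W : Ob D}
    {X' : Ob A'} {Y' : Ob B'} {H : A ⟶ B} {F : A ⟶ C} {G : B ⟶ D} {K : C ⟶ D} {H' : B ⟶ A'}
    {L : A' ⟶ B'} {K' : D ⟶ B'} {h : Hor X Y H} {f : Ver X Z F} {g : Ver Y W G} {k : Hor Z W K}
    {h' : Hor Y X' H'} {l : Ver X' Y' L} {k' : Hor W Y' K'} {θ : H ≫ G ⟶ F ≫ K}
    {κ : H' ≫ L ⟶ G ≫ K'},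
    IsCell h f g k θ → IsCell h' g l k' κ → IsCell (hcomp h h') f l (hcomp k k') (hpaste θ κ)

namespace DispDbl

variable (𝒳 : DispDbl.{u, v})

/-- An object: a graph with structure. -/
structure Obj where
  {gr : Grph.{u, v}}
  str : 𝒳.Ob gr

/-- A vertical 1-cell: a graph morphism with structure. -/
structure VHom (X Y : 𝒳.Obj) where
  {mor : X.gr ⟶ Y.gr}
  str : 𝒳.Ver X.str Y.str mor

/-- A horizontal 1-cell: a graph morphism with structure. -/
structure HHom (X Y : 𝒳.Obj) where
  {mor : X.gr ⟶ Y.gr}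
  str : 𝒳.Hor X.str Y.str mor

instance : Category 𝒳.Obj where
  Hom X Y := 𝒳.VHom X Y
  id X := ⟨𝒳.vid X.str⟩
  comp f g := ⟨𝒳.vcomp f.str g.str⟩
  id_comp f := congrArg (VHom.mk (mor := f.mor)) (𝒳.vid_vcomp f.str)
  comp_id f := congrArg (VHom.mk (mor := f.mor)) (𝒳.vcomp_vid f.str)
  assoc f g h := congrArg (VHom.mk (mor := f.mor ≫ g.mor ≫ h.mor))
    (𝒳.vcomp_assoc f.str g.str h.str)

/-- A cell with top `r` and bottom `s`: two vertical 1-cells and a square satisfying the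
condition. -/
structure Cell (r s : HObj 𝒳.HHom) where
  left : r.src ⟶ s.src
  right : r.tgt ⟶ s.tgt
  sq : r.hom.mor ≫ right.mor ⟶ left.mor ≫ s.hom.mor
  isCell : 𝒳.IsCell r.hom.str left.str right.str s.hom.str sq

variable {𝒳} in
theorem Cell.ext {r s : HObj 𝒳.HHom} {φ ψ : 𝒳.Cell r s} (hl : φ.left = ψ.left)
    (hr : φ.right = ψ.right) (hs : φ.sq ≍ ψ.sq) : φ = ψ := by
  cases φ; cases ψ; cases hl; cases hr; cases hs; rfl

instance : Category (HObj 𝒳.HHom) where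
  Hom r s := 𝒳.Cell r s
  id r := ⟨𝟙 _, 𝟙 _, 𝟙 r.hom.mor, 𝒳.isCell_vid _⟩
  comp φ ψ := ⟨φ.left ≫ ψ.left, φ.right ≫ ψ.right, vpaste φ.sq ψ.sq,
    𝒳.isCell_vpaste φ.isCell ψ.isCell⟩
  id_comp φ := Cell.ext (Category.id_comp φ.left) (Category.id_comp φ.right)
    (heq_of_eq (id_vpaste φ.sq))
  comp_id φ := Cell.ext (Category.comp_id φ.left) (Category.comp_id φ.right)
    (heq_of_eq (vpaste_id φ.sq))
  assoc φ ψ χ := Cell.ext (Category.assoc φ.left ψ.left χ.left)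
    (Category.assoc φ.right ψ.right χ.right) (heq_of_eq (vpaste_assoc φ.sq ψ.sq χ.sq))

/-- The underlying graph in `Cat`. -/
def graph : CatGraph.{max (u + 1) (v + 1), max u v, max u v, max u v} where
  Ob := 𝒳.Obj
  Hor X Y := 𝒳.HHom X Y
  dom φ := Cell.left φ
  cod φ := Cell.right φ
  dom_id _ := rfl
  cod_id _ := rfl
  dom_comp _ _ := rfl
  cod_comp _ _ := rfl

variable {𝒳}

/-- The horizontal composite of horizontal 1-cells, in the order of application. -/
def HHom.comp {X Y Z : 𝒳.Obj} (s : 𝒳.HHom Y Z) (r : 𝒳.HHom X Y) : 𝒳.HHom X Z :=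
  ⟨𝒳.hcomp r.str s.str⟩

/-- The horizontal composite of cells. -/
def Cell.hcomp {X Y Z X' Y' Z' : 𝒳.Obj} {s : 𝒳.HHom Y Z} {r : 𝒳.HHom X Y} {s' : 𝒳.HHom Y' Z'}
    {r' : 𝒳.HHom X' Y'} (ψ : 𝒳.Cell ⟨s⟩ ⟨s'⟩) (φ : 𝒳.Cell ⟨r⟩ ⟨r'⟩) (h : ψ.left = φ.right) :
    𝒳.Cell ⟨s.comp r⟩ ⟨s'.comp r'⟩ where
  left := φ.left
  right := ψ.right
  sq := hpaste (K' := s'.mor) φ.sq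
    (ψ.sq ≫ eqToHom (congrArg (fun f : Y ⟶ Y' => f.mor ≫ s'.mor) h))
  isCell := 𝒳.isCell_hpaste φ.isCell (by
    obtain ⟨l, r, sq, c⟩ := φ
    dsimp only at h
    subst h
    rw [eqToHom_refl, Category.comp_id]
    exact ψ.isCell)

theorem Cell.hcomp_mk {X Y Z X' Y' Z' : 𝒳.Obj} {s : 𝒳.HHom Y Z} {r : 𝒳.HHom X Y}
    {s' : 𝒳.HHom Y' Z'} {r' : 𝒳.HHom X' Y'} (ψ : 𝒳.Cell ⟨s⟩ ⟨s'⟩) (l : X ⟶ X')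
    (sq : r.mor ≫ ψ.left.mor ⟶ l.mor ≫ r'.mor) (c : 𝒳.IsCell r.str l.str ψ.left.str r'.str sq) :
    Cell.hcomp ψ ⟨l, ψ.left, sq, c⟩ rfl =
      ⟨l, ψ.right, hpaste (K' := s'.mor) sq ψ.sq, 𝒳.isCell_hpaste c ψ.isCell⟩ :=
  Cell.ext rfl rfl (heq_of_eq (congrArg (hpaste (K' := s'.mor) sq) (Category.comp_id ψ.sq)))

/-- The identity square between equal horizontal 1-cells. -/
def Cell.ofEq {X Y : 𝒳.Obj} {F : X.gr ⟶ Y.gr} {a b : 𝒳.Hor X.str Y.str F} (h : a = b) :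
    𝒳.Cell ⟨(⟨a⟩ : 𝒳.HHom X Y)⟩ ⟨⟨b⟩⟩ where
  left := 𝟙 X
  right := 𝟙 Y
  sq := 𝟙 F
  isCell := by subst h; exact 𝒳.isCell_vid a

/-- The invertible identity square between equal horizontal 1-cells. -/
def Cell.isoOfEq {X Y : 𝒳.Obj} {F : X.gr ⟶ Y.gr} {a b : 𝒳.Hor X.str Y.str F} (h : a = b) :
    (HObj.mk (⟨a⟩ : 𝒳.HHom X Y) : HObj 𝒳.HHom) ≅ ⟨⟨b⟩⟩ where
  hom := Cell.ofEq h
  inv := Cell.ofEq h.symm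
  hom_inv_id := by subst h; exact Category.id_comp _
  inv_hom_id := by subst h; exact Category.id_comp _

theorem Cell.comp_ofEq {X Y X' Y' : 𝒳.Obj} {r : 𝒳.HHom X Y} {F : X'.gr ⟶ Y'.gr}
    {a b : 𝒳.Hor X'.str Y'.str F} (h : a = b) (φ : 𝒳.Cell ⟨r⟩ ⟨(⟨a⟩ : 𝒳.HHom X' Y')⟩) :
    (show (HObj.mk r : HObj 𝒳.HHom) ⟶ ⟨⟨a⟩⟩ from φ) ≫ Cell.ofEq h =
      (⟨φ.left, φ.right, φ.sq, h ▸ φ.isCell⟩ : 𝒳.Cell ⟨r⟩ ⟨(⟨b⟩ : 𝒳.HHom X' Y')⟩) :=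
  Cell.ext (Category.comp_id φ.left) (Category.comp_id φ.right) (heq_of_eq (vpaste_id φ.sq))

theorem Cell.ofEq_comp {X Y X' Y' : 𝒳.Obj} {s : 𝒳.HHom X' Y'} {F : X.gr ⟶ Y.gr}
    {a b : 𝒳.Hor X.str Y.str F} (h : a = b) (φ : 𝒳.Cell ⟨(⟨b⟩ : 𝒳.HHom X Y)⟩ ⟨s⟩) :
    (show (HObj.mk ⟨a⟩ : HObj 𝒳.HHom) ⟶ ⟨⟨b⟩⟩ from Cell.ofEq h) ≫ φ =
      (⟨φ.left, φ.right, φ.sq, h ▸ φ.isCell⟩ : 𝒳.Cell ⟨(⟨a⟩ : 𝒳.HHom X Y)⟩ ⟨s⟩) :=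
  Cell.ext (Category.id_comp φ.left) (Category.id_comp φ.right) (heq_of_eq (id_vpaste φ.sq))

theorem Cell.ofEq_ofEq {X Y : 𝒳.Obj} {F : X.gr ⟶ Y.gr} {a b c : 𝒳.Hor X.str Y.str F} (h : a = b)
    (h' : b = c) : (show (HObj.mk ⟨a⟩ : HObj 𝒳.HHom) ⟶ ⟨⟨b⟩⟩ from Cell.ofEq h) ≫ Cell.ofEq h' =
      Cell.ofEq (h.trans h') :=
  Cell.comp_ofEq h' (Cell.ofEq h)

theorem Cell.ofEq_hcomp_ofEq {X Y Z : 𝒳.Obj} {F : X.gr ⟶ Y.gr} {G : Y.gr ⟶ Z.gr}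
    {a b : 𝒳.Hor X.str Y.str F} {c d : 𝒳.Hor Y.str Z.str G} (h : a = b) (h' : c = d) :
    Cell.hcomp (Cell.ofEq h') (Cell.ofEq h) rfl =
      Cell.ofEq (congrArg₂ (fun p q => 𝒳.hcomp p q) h h') := by
  refine (Cell.hcomp_mk (r := ⟨a⟩) (r' := ⟨b⟩) (Cell.ofEq h') (𝟙 X) (𝟙 F)
    (Cell.ofEq h).isCell).trans (Cell.ext rfl rfl (heq_of_eq ?_))
  change hpaste (H := F) (K := F) (F := 𝟙 X.gr) (G := 𝟙 Y.gr) (H' := G) (K' := G) (L := 𝟙 Z.gr)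
    (𝟙 F) (𝟙 G) = 𝟙 (F ≫ G)
  apply graphCell_ext <;> intro x
  · exact (Category.id_comp _).trans (G.F₀.map_id _)
  · exact (Category.id_comp _).trans (G.map₁_id _)

/-- The horizontal identity cell on a vertical 1-cell. -/
def Cell.hid {X Y : 𝒳.Obj} (f : X ⟶ Y) : 𝒳.Cell ⟨(⟨𝒳.hid X.str⟩ : 𝒳.HHom X X)⟩ ⟨⟨𝒳.hid Y.str⟩⟩ :=
  ⟨f, f, 𝟙 f.mor, 𝒳.isCell_hid f.str⟩

theorem Cell.hid_comp {X Y Z : 𝒳.Obj} (f : X ⟶ Y) (g : Y ⟶ Z) :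
    Cell.hid (f ≫ g) = (show (HObj.mk (⟨𝒳.hid X.str⟩ : 𝒳.HHom X X) : HObj 𝒳.HHom) ⟶
      ⟨⟨𝒳.hid Y.str⟩⟩ from Cell.hid f) ≫ (Cell.hid g) := by
  refine Cell.ext rfl rfl (heq_of_eq ?_)
  change 𝟙 (f.mor ≫ g.mor) = vpaste (H := 𝟙 _) (K := 𝟙 _) (L := 𝟙 _) (𝟙 f.mor) (𝟙 g.mor)
  apply graphCell_ext <;> intro x
  · exact ((Category.comp_id _).trans (g.mor.F₀.map_id _)).symm
  · exact ((Category.comp_id _).trans (g.mor.map₁_id ⟨f.mor.obj₁ x.hom⟩)).symm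

theorem Cell.hcomp_comp {X Y Z X' Y' Z' X'' Y'' Z'' : 𝒳.Obj} {s : 𝒳.HHom Y Z} {r : 𝒳.HHom X Y}
    {s' : 𝒳.HHom Y' Z'} {r' : 𝒳.HHom X' Y'} {s'' : 𝒳.HHom Y'' Z''} {r'' : 𝒳.HHom X'' Y''}
    (ψ : HObj.mk s ⟶ HObj.mk s') (φ : HObj.mk r ⟶ HObj.mk r') (h : ψ.left = φ.right)
    (ψ' : HObj.mk s' ⟶ HObj.mk s'') (φ' : HObj.mk r' ⟶ HObj.mk r'') (h' : ψ'.left = φ'.right)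
    (h'' : (ψ ≫ ψ').left = (φ ≫ φ').right) :
    Cell.hcomp (ψ ≫ ψ') (φ ≫ φ') h'' =
      (show HObj.mk (s.comp r) ⟶ HObj.mk (s'.comp r') from Cell.hcomp ψ φ h) ≫
        (show HObj.mk (s'.comp r') ⟶ HObj.mk (s''.comp r'') from Cell.hcomp ψ' φ' h') := by
  obtain ⟨l, m, sq, c⟩ := φ
  obtain ⟨l', m', sq', c'⟩ := φ'
  dsimp only at h h'
  subst h h'
  rw [Cell.hcomp_mk ψ, Cell.hcomp_mk ψ']
  refine (Cell.hcomp_mk (ψ ≫ ψ') (l ≫ l') _ _).trans ?_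
  exact Cell.ext rfl rfl (heq_of_eq (hpaste_vpaste _ _ _ _))

theorem Cell.lam_nat {X Y X' Y' : 𝒳.Obj} {r : 𝒳.HHom X Y} {r' : 𝒳.HHom X' Y'}
    (φ : HObj.mk r ⟶ HObj.mk r') :
    (show (HObj.mk (HHom.comp ⟨𝒳.hid Y.str⟩ r) : HObj 𝒳.HHom) ⟶ ⟨HHom.comp ⟨𝒳.hid Y'.str⟩ r'⟩
        from Cell.hcomp (Cell.hid φ.right) φ rfl) ≫
        (show (HObj.mk (HHom.comp ⟨𝒳.hid Y'.str⟩ r') : HObj 𝒳.HHom) ⟶ ⟨r'⟩ from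
          Cell.ofEq (𝒳.hcomp_hid r'.str)) =
      (show (HObj.mk (HHom.comp ⟨𝒳.hid Y.str⟩ r) : HObj 𝒳.HHom) ⟶ ⟨r⟩ from
        Cell.ofEq (𝒳.hcomp_hid r.str)) ≫ φ := by
  obtain ⟨l, m, sq, c⟩ := φ
  refine (Cell.comp_ofEq (𝒳.hcomp_hid r'.str) _).trans
    (Eq.trans ?_ (Cell.ofEq_comp (𝒳.hcomp_hid r.str) _).symm)
  refine Cell.ext rfl rfl (heq_of_eq ?_)
  exact ((congrArg (hpaste (H' := 𝟙 _) (K' := 𝟙 _) sq) (Category.comp_id (𝟙 m.mor))).trans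
    (hpaste_id sq))

theorem Cell.rho_nat {X Y X' Y' : 𝒳.Obj} {r : 𝒳.HHom X Y} {r' : 𝒳.HHom X' Y'}
    (φ : HObj.mk r ⟶ HObj.mk r') :
    (show (HObj.mk (HHom.comp r ⟨𝒳.hid X.str⟩) : HObj 𝒳.HHom) ⟶ ⟨HHom.comp r' ⟨𝒳.hid X'.str⟩⟩
        from Cell.hcomp φ (Cell.hid φ.left) rfl) ≫
        (show (HObj.mk (HHom.comp r' ⟨𝒳.hid X'.str⟩) : HObj 𝒳.HHom) ⟶ ⟨r'⟩ from
          Cell.ofEq (𝒳.hid_hcomp r'.str)) =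
      (show (HObj.mk (HHom.comp r ⟨𝒳.hid X.str⟩) : HObj 𝒳.HHom) ⟶ ⟨r⟩ from
        Cell.ofEq (𝒳.hid_hcomp r.str)) ≫ φ := by
  refine (Cell.comp_ofEq (𝒳.hid_hcomp r'.str) _).trans
    (Eq.trans ?_ (Cell.ofEq_comp (𝒳.hid_hcomp r.str) _).symm)
  refine Cell.ext rfl rfl (heq_of_eq ?_)
  exact ((congrArg (hpaste (H := 𝟙 _) (K := 𝟙 _) (𝟙 φ.left.mor)) (Category.comp_id φ.sq)).trans
    (id_hpaste φ.sq))

theorem Cell.alpha_nat {W X Y Z W' X' Y' Z' : 𝒳.Obj} {t : 𝒳.HHom Y Z} {s : 𝒳.HHom X Y}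
    {r : 𝒳.HHom W X} {t' : 𝒳.HHom Y' Z'} {s' : 𝒳.HHom X' Y'} {r' : 𝒳.HHom W' X'}
    (χ : 𝒳.Cell ⟨t⟩ ⟨t'⟩) (ψ : 𝒳.Cell ⟨s⟩ ⟨s'⟩) (φ : 𝒳.Cell ⟨r⟩ ⟨r'⟩)
    (h : χ.left = ψ.right) (h' : ψ.left = φ.right) :
    (show (HObj.mk ((t.comp s).comp r) : HObj 𝒳.HHom) ⟶ ⟨(t'.comp s').comp r'⟩
        from Cell.hcomp (Cell.hcomp χ ψ h) φ h') ≫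
        (show (HObj.mk ((t'.comp s').comp r') : HObj 𝒳.HHom) ⟶ ⟨t'.comp (s'.comp r')⟩ from
          Cell.ofEq (𝒳.hcomp_assoc r'.str s'.str t'.str).symm) =
      (show (HObj.mk ((t.comp s).comp r) : HObj 𝒳.HHom) ⟶ ⟨t.comp (s.comp r)⟩ from
          Cell.ofEq (𝒳.hcomp_assoc r.str s.str t.str).symm) ≫
        (show (HObj.mk (t.comp (s.comp r)) : HObj 𝒳.HHom) ⟶ ⟨t'.comp (s'.comp r')⟩
          from Cell.hcomp χ (Cell.hcomp ψ φ h') h) := by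
  obtain ⟨l, m, sq, c⟩ := φ
  obtain ⟨l', m', sq', c'⟩ := ψ
  dsimp only at h h'
  subst h h'
  refine (Cell.comp_ofEq (𝒳.hcomp_assoc r'.str s'.str t'.str).symm _).trans
    (Eq.trans ?_ (Cell.ofEq_comp (𝒳.hcomp_assoc r.str s.str t.str).symm _).symm)
  refine Cell.ext rfl rfl (heq_of_eq ?_)
  have e₁ : (show s.mor ≫ χ.left.mor ⟶ l'.mor ≫ s'.mor from sq') ≫ 𝟙 _ = sq' := Category.comp_id sq'
  have e₂ := Category.comp_id χ.sq
  change hpaste (H' := s.mor ≫ t.mor) (K' := s'.mor ≫ t'.mor) sq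
    (hpaste (H := s.mor) (K := s'.mor) sq' (χ.sq ≫ 𝟙 _) ≫ 𝟙 _) =
    hpaste (H := r.mor ≫ s.mor) (K := r'.mor ≫ s'.mor)
      (hpaste (H := r.mor) (K := r'.mor) sq (sq' ≫ 𝟙 _)) (χ.sq ≫ 𝟙 _)
  rw [Category.comp_id, Category.comp_id, Category.comp_id]
  exact (hpaste_assoc _ _ _).symm

variable (𝒳)

/-- The (strict) double category of structured graphs. -/
def dbl : PseudoDblStr 𝒳.graph where
  one X := (⟨𝒳.hid X.str⟩ : 𝒳.HHom X X)
  oneMap f := Cell.hid f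
  dom_oneMap f := rfl
  cod_oneMap f := rfl
  oneMap_id X := rfl
  oneMap_comp {X Y Z} f g := Cell.hid_comp f g
  comp s r := HHom.comp s r
  hcomp ψ φ h := Cell.hcomp ψ φ h
  dom_hcomp _ _ _ := rfl
  cod_hcomp _ _ _ := rfl
  hcomp_id s r := Cell.ofEq_hcomp_ofEq (𝒳 := 𝒳) (rfl : r.str = r.str) (rfl : s.str = s.str)
  hcomp_comp ψ φ h ψ' φ' h' := Cell.hcomp_comp ψ φ h ψ' φ' h' _
  lam r := Cell.isoOfEq (𝒳.hcomp_hid r.str)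
  dom_lam r := rfl
  cod_lam r := rfl
  lam_nat φ := Cell.lam_nat φ
  rho r := Cell.isoOfEq (𝒳.hid_hcomp r.str)
  dom_rho r := rfl
  cod_rho r := rfl
  rho_nat φ := Cell.rho_nat φ
  alpha t s r := Cell.isoOfEq (𝒳.hcomp_assoc r.str s.str t.str).symm
  dom_alpha _ _ _ := rfl
  cod_alpha _ _ _ := rfl
  alpha_nat χ ψ φ h h' := Cell.alpha_nat χ ψ φ h h'
  unit_unit X := Cell.ofEq_ofEq (𝒳.hcomp_hid (𝒳.hid X.str)) (𝒳.hid_hcomp (𝒳.hid X.str)).symm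
  left_left s r := (Cell.ofEq_ofEq (𝒳.hcomp_assoc r.str s.str (𝒳.hid _)).symm
    (𝒳.hcomp_hid (𝒳.hcomp r.str s.str))).trans
      (Cell.ofEq_hcomp_ofEq (rfl : r.str = r.str) (𝒳.hcomp_hid s.str)).symm
  right_right s r :=
    (congrArg (fun c => (show (HObj.mk ((s.comp r).comp ⟨𝒳.hid _⟩) : HObj 𝒳.HHom) ⟶
        ⟨s.comp (r.comp ⟨𝒳.hid _⟩)⟩ from
        Cell.ofEq (𝒳.hcomp_assoc (𝒳.hid _) r.str s.str).symm) ≫ c)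
      (Cell.ofEq_hcomp_ofEq (𝒳.hid_hcomp r.str) (rfl : s.str = s.str))).trans
    (Cell.ofEq_ofEq (𝒳.hcomp_assoc (𝒳.hid _) r.str s.str).symm
      (congrArg₂ (fun p q => 𝒳.hcomp p q) (𝒳.hid_hcomp r.str) rfl))
  triangle s r :=
    ((congrArg (fun c => (show (HObj.mk (HHom.comp (s.comp ⟨𝒳.hid _⟩) r) : HObj 𝒳.HHom) ⟶
        ⟨s.comp (HHom.comp ⟨𝒳.hid _⟩ r)⟩ from
        Cell.ofEq (𝒳.hcomp_assoc r.str (𝒳.hid _) s.str).symm) ≫ c)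
      (Cell.ofEq_hcomp_ofEq (𝒳.hcomp_hid r.str) (rfl : s.str = s.str))).trans
    (Cell.ofEq_ofEq (𝒳.hcomp_assoc r.str (𝒳.hid _) s.str).symm
      (congrArg₂ (fun p q => 𝒳.hcomp p q) (𝒳.hcomp_hid r.str) rfl))).trans
    (Cell.ofEq_hcomp_ofEq (rfl : r.str = r.str) (𝒳.hid_hcomp s.str)).symm
  pentagon t s r q := by
    refine (Cell.ofEq_ofEq (𝒳.hcomp_assoc q.str r.str (𝒳.hcomp s.str t.str)).symm
      (𝒳.hcomp_assoc (𝒳.hcomp q.str r.str) s.str t.str).symm).trans (Eq.symm ?_)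
    have e₁ := Cell.ofEq_hcomp_ofEq (rfl : q.str = q.str) (𝒳.hcomp_assoc r.str s.str t.str).symm
    have e₂ := Cell.ofEq_hcomp_ofEq (𝒳.hcomp_assoc q.str r.str s.str).symm (rfl : t.str = t.str)
    have e₃ := Cell.ofEq_ofEq (𝒳.hcomp_assoc q.str (𝒳.hcomp r.str s.str) t.str).symm
      (congrArg₂ (fun a b => 𝒳.hcomp a b) (𝒳.hcomp_assoc q.str r.str s.str).symm
        (rfl : t.str = t.str))
    have e₄ := Cell.ofEq_ofEq (congrArg₂ (fun a b => 𝒳.hcomp a b) (rfl : q.str = q.str)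
      (𝒳.hcomp_assoc r.str s.str t.str).symm)
      ((𝒳.hcomp_assoc q.str (𝒳.hcomp r.str s.str) t.str).symm.trans
        (congrArg₂ (fun a b => 𝒳.hcomp a b) (𝒳.hcomp_assoc q.str r.str s.str).symm
        (rfl : t.str = t.str)))
    refine Eq.trans ?_ e₄
    exact congrArg₂ (fun (a : (HObj.mk (((t.comp s).comp r).comp q) : HObj 𝒳.HHom) ⟶
      ⟨(t.comp (s.comp r)).comp q⟩) (b : (HObj.mk ((t.comp (s.comp r)).comp q) : HObj 𝒳.HHom) ⟶
      ⟨t.comp (s.comp (r.comp q))⟩) => a ≫ b) e₁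
      ((congrArg (fun c => (show (HObj.mk ((t.comp (s.comp r)).comp q) : HObj 𝒳.HHom) ⟶
        ⟨t.comp ((s.comp r).comp q)⟩ from
        Cell.ofEq (𝒳.hcomp_assoc q.str (𝒳.hcomp r.str s.str) t.str).symm) ≫ c) e₂).trans e₃)

end DispDbl


namespace DispDbl

/-- The full sub-double category on the objects satisfying `p`. -/
def full (𝒳 : DispDbl.{u, v}) (p : ∀ A : Grph.{u, v}, 𝒳.Ob A → Prop) : DispDbl.{u, v} where
  Ob A := { X : 𝒳.Ob A // p A X }
  Hor X Y F := 𝒳.Hor X.1 Y.1 F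
  hid X := 𝒳.hid X.1
  hcomp f g := 𝒳.hcomp f g
  hid_hcomp f := 𝒳.hid_hcomp f
  hcomp_hid f := 𝒳.hcomp_hid f
  hcomp_assoc f g h := 𝒳.hcomp_assoc f g h
  Ver X Y F := 𝒳.Ver X.1 Y.1 F
  vid X := 𝒳.vid X.1
  vcomp f g := 𝒳.vcomp f g
  vid_vcomp f := 𝒳.vid_vcomp f
  vcomp_vid f := 𝒳.vcomp_vid f
  vcomp_assoc f g h := 𝒳.vcomp_assoc f g h
  IsCell h f g k θ := 𝒳.IsCell h f g k θ
  isCell_vid h := 𝒳.isCell_vid h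
  isCell_hid f := 𝒳.isCell_hid f
  isCell_vpaste h h' := 𝒳.isCell_vpaste h h'
  isCell_hpaste h h' := 𝒳.isCell_hpaste h h'

/-- A strict double functor which is the identity on the underlying graphs, graph morphisms and
squares. -/
structure DFunctor (𝒳 𝒴 : DispDbl.{u, v}) where
  obj : ∀ {A : Grph.{u, v}}, 𝒳.Ob A → 𝒴.Ob A
  hmap : ∀ {A B : Grph.{u, v}} {X : 𝒳.Ob A} {Y : 𝒳.Ob B} {F : A ⟶ B},
    𝒳.Hor X Y F → 𝒴.Hor (obj X) (obj Y) F
  hmap_id : ∀ {A : Grph.{u, v}} (X : 𝒳.Ob A), hmap (𝒳.hid X) = 𝒴.hid (obj X)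
  hmap_comp : ∀ {A B C : Grph.{u, v}} {X : 𝒳.Ob A} {Y : 𝒳.Ob B} {Z : 𝒳.Ob C} {F : A ⟶ B}
    {K : B ⟶ C} (f : 𝒳.Hor X Y F) (k : 𝒳.Hor Y Z K),
    hmap (𝒳.hcomp f k) = 𝒴.hcomp (hmap f) (hmap k)
  vmap : ∀ {A B : Grph.{u, v}} {X : 𝒳.Ob A} {Y : 𝒳.Ob B} {F : A ⟶ B},
    𝒳.Ver X Y F → 𝒴.Ver (obj X) (obj Y) F
  vmap_id : ∀ {A : Grph.{u, v}} (X : 𝒳.Ob A), vmap (𝒳.vid X) = 𝒴.vid (obj X)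
  vmap_comp : ∀ {A B C : Grph.{u, v}} {X : 𝒳.Ob A} {Y : 𝒳.Ob B} {Z : 𝒳.Ob C} {F : A ⟶ B}
    {K : B ⟶ C} (f : 𝒳.Ver X Y F) (k : 𝒳.Ver Y Z K),
    vmap (𝒳.vcomp f k) = 𝒴.vcomp (vmap f) (vmap k)
  cell : ∀ {A B C D : Grph.{u, v}} {X : 𝒳.Ob A} {Y : 𝒳.Ob B} {Z : 𝒳.Ob C} {W : 𝒳.Ob D}
    {H : A ⟶ B} {F : A ⟶ C} {G : B ⟶ D} {K : C ⟶ D} {h : 𝒳.Hor X Y H} {f : 𝒳.Ver X Z F}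
    {g : 𝒳.Ver Y W G} {k : 𝒳.Hor Z W K} {θ : H ≫ G ⟶ F ≫ K},
    𝒳.IsCell h f g k θ → 𝒴.IsCell (hmap h) (vmap f) (vmap g) (hmap k) θ

namespace DFunctor

variable {𝒳 𝒴 : DispDbl.{u, v}} (Φ : DFunctor 𝒳 𝒴)

/-- The functor on objects and vertical 1-cells. -/
def F₀ : 𝒳.Obj ⥤ 𝒴.Obj where
  obj X := ⟨Φ.obj X.str⟩
  map f := ⟨Φ.vmap f.str⟩
  map_id X := congrArg (VHom.mk (X := ⟨Φ.obj X.str⟩) (Y := ⟨Φ.obj X.str⟩) (mor := 𝟙 X.gr))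
    (Φ.vmap_id X.str)
  map_comp {X _ Z} f g := congrArg (VHom.mk (X := ⟨Φ.obj X.str⟩) (Y := ⟨Φ.obj Z.str⟩)
    (mor := f.mor ≫ g.mor)) (Φ.vmap_comp f.str g.str)

/-- The underlying morphism of graphs in `Cat`. -/
def graphHom : 𝒳.graph ⟶ 𝒴.graph where
  F₀ := Φ.F₀
  obj₁ r := ⟨Φ.hmap r.str⟩
  map₁ φ := (⟨Φ.F₀.map (Cell.left φ), Φ.F₀.map (Cell.right φ), Cell.sq φ,
    Φ.cell (Cell.isCell φ)⟩ : 𝒴.Cell _ _)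
  map₁_id _ := Cell.ext (Φ.F₀.map_id _) (Φ.F₀.map_id _) HEq.rfl
  map₁_comp _ _ := Cell.ext (Φ.F₀.map_comp _ _) (Φ.F₀.map_comp _ _) HEq.rfl
  dom_map₁ _ := rfl
  cod_map₁ _ := rfl

theorem map₁_ofEq {X Y : 𝒳.Obj} {F : X.gr ⟶ Y.gr} {a b : 𝒳.Hor X.str Y.str F} (h : a = b) :
    Φ.graphHom.map₁ (show (HObj.mk (⟨a⟩ : 𝒳.HHom X Y) : HObj 𝒳.HHom) ⟶ ⟨⟨b⟩⟩ from Cell.ofEq h) =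
      Cell.ofEq (X := Φ.F₀.obj X) (Y := Φ.F₀.obj Y) (congrArg (fun c => Φ.hmap c) h) :=
  Cell.ext (Φ.F₀.map_id _) (Φ.F₀.map_id _) HEq.rfl

/-- The comparison cell for units, an identity square. -/
def unitCell (X : 𝒳.Obj) : 𝒴.Cell ⟨(⟨𝒴.hid (Φ.obj X.str)⟩ : 𝒴.HHom (Φ.F₀.obj X) (Φ.F₀.obj X))⟩
    ⟨(⟨Φ.hmap (𝒳.hid X.str)⟩ : 𝒴.HHom (Φ.F₀.obj X) (Φ.F₀.obj X))⟩ :=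
  Cell.ofEq (X := Φ.F₀.obj X) (Y := Φ.F₀.obj X) (Φ.hmap_id X.str).symm

/-- The comparison cell for composites, an identity square. -/
def compCell {X Y Z : 𝒳.Obj} (s : 𝒳.HHom Y Z) (r : 𝒳.HHom X Y) :
    𝒴.Cell ⟨(⟨𝒴.hcomp (Φ.hmap r.str) (Φ.hmap s.str)⟩ : 𝒴.HHom (Φ.F₀.obj X) (Φ.F₀.obj Z))⟩
    ⟨(⟨Φ.hmap (𝒳.hcomp r.str s.str)⟩ : 𝒴.HHom (Φ.F₀.obj X) (Φ.F₀.obj Z))⟩ :=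
  Cell.ofEq (X := Φ.F₀.obj X) (Y := Φ.F₀.obj Z) (Φ.hmap_comp r.str s.str).symm

/-- The double functor. -/
def laxStr : LaxStr 𝒳.dbl 𝒴.dbl Φ.graphHom where
  unit X := Φ.unitCell X
  dom_unit _ := rfl
  cod_unit _ := rfl
  unit_nat {X Y} f :=
    (Cell.comp_ofEq (X' := Φ.F₀.obj Y) (Y' := Φ.F₀.obj Y) (Φ.hmap_id Y.str).symm
      (Cell.hid (Φ.F₀.map f))).trans
      (Cell.ofEq_comp (X := Φ.F₀.obj X) (Y := Φ.F₀.obj X) (Φ.hmap_id X.str).symm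
        (Φ.graphHom.map₁ (Cell.hid f))).symm
  mul s r := Φ.compCell s r
  dom_mul _ _ := rfl
  cod_mul _ _ := rfl
  mul_nat {x y z x' y' z' s r s' r'} ψ φ h :=
    (Cell.comp_ofEq (X' := Φ.F₀.obj x') (Y' := Φ.F₀.obj z') (Φ.hmap_comp r'.str s'.str).symm
      _).trans
      (Cell.ofEq_comp (X := Φ.F₀.obj x) (Y := Φ.F₀.obj z) (Φ.hmap_comp r.str s.str).symm
        (Φ.graphHom.map₁ (Cell.hcomp ψ φ h))).symm
  left {X Y} r := by
    have e₁ := Cell.ofEq_hcomp_ofEq (X := Φ.F₀.obj X) (Y := Φ.F₀.obj Y) (Z := Φ.F₀.obj Y)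
      (rfl : Φ.hmap r.str = Φ.hmap r.str) (Φ.hmap_id Y.str).symm
    have e₂ := Φ.map₁_ofEq (𝒳.hcomp_hid r.str).symm
    have e₃ := Cell.ofEq_ofEq (X := Φ.F₀.obj X) (Y := Φ.F₀.obj Y)
      (congrArg₂ (fun p q => 𝒴.hcomp p q)
      (rfl : Φ.hmap r.str = Φ.hmap r.str) (Φ.hmap_id Y.str).symm)
      (Φ.hmap_comp r.str (𝒳.hid Y.str)).symm
    have e₄ := Cell.ofEq_ofEq (X := Φ.F₀.obj X) (Y := Φ.F₀.obj Y) (𝒴.hcomp_hid (Φ.hmap r.str))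
      (congrArg (fun c => Φ.hmap c) (𝒳.hcomp_hid r.str).symm)
    exact ((congrArg (· ≫ _) e₁).trans e₃).trans ((congrArg (_ ≫ ·) e₂).trans e₄).symm
  right {X Y} r := by
    have e₁ := Cell.ofEq_hcomp_ofEq (X := Φ.F₀.obj X) (Y := Φ.F₀.obj X) (Z := Φ.F₀.obj Y)
      (Φ.hmap_id X.str).symm (rfl : Φ.hmap r.str = Φ.hmap r.str)
    have e₂ := Φ.map₁_ofEq (𝒳.hid_hcomp r.str).symm
    have e₃ := Cell.ofEq_ofEq (X := Φ.F₀.obj X) (Y := Φ.F₀.obj Y)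
      (congrArg₂ (fun p q => 𝒴.hcomp p q)
      (Φ.hmap_id X.str).symm (rfl : Φ.hmap r.str = Φ.hmap r.str))
      (Φ.hmap_comp (𝒳.hid X.str) r.str).symm
    have e₄ := Cell.ofEq_ofEq (X := Φ.F₀.obj X) (Y := Φ.F₀.obj Y) (𝒴.hid_hcomp (Φ.hmap r.str))
      (congrArg (fun c => Φ.hmap c) (𝒳.hid_hcomp r.str).symm)
    exact ((congrArg (· ≫ _) e₁).trans e₃).trans ((congrArg (_ ≫ ·) e₂).trans e₄).symm
  assoc {W X Y Z} t s r := by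
    have e₁ := Cell.ofEq_hcomp_ofEq (X := Φ.F₀.obj W) (Y := Φ.F₀.obj X) (Z := Φ.F₀.obj Z)
      (rfl : Φ.hmap r.str = Φ.hmap r.str) (Φ.hmap_comp s.str t.str).symm
    have e₂ := Φ.map₁_ofEq (𝒳.hcomp_assoc r.str s.str t.str).symm
    have e₃ := Cell.ofEq_ofEq (X := Φ.F₀.obj W) (Y := Φ.F₀.obj Z)
      (Φ.hmap_comp r.str (𝒳.hcomp s.str t.str)).symm
      (congrArg (fun c => Φ.hmap c) (𝒳.hcomp_assoc r.str s.str t.str).symm)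
    have e₄ := Cell.ofEq_ofEq (X := Φ.F₀.obj W) (Y := Φ.F₀.obj Z)
      (congrArg₂ (fun p q => 𝒴.hcomp p q) (rfl : Φ.hmap r.str = Φ.hmap r.str)
        (Φ.hmap_comp s.str t.str).symm)
      ((Φ.hmap_comp r.str (𝒳.hcomp s.str t.str)).symm.trans
        (congrArg (fun c => Φ.hmap c) (𝒳.hcomp_assoc r.str s.str t.str).symm))
    have e₅ := Cell.ofEq_hcomp_ofEq (X := Φ.F₀.obj W) (Y := Φ.F₀.obj Y) (Z := Φ.F₀.obj Z)
      (Φ.hmap_comp r.str s.str).symm (rfl : Φ.hmap t.str = Φ.hmap t.str)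
    have e₆ := Cell.ofEq_ofEq (X := Φ.F₀.obj W) (Y := Φ.F₀.obj Z)
      (congrArg₂ (fun p q => 𝒴.hcomp p q) (Φ.hmap_comp r.str s.str).symm
        (rfl : Φ.hmap t.str = Φ.hmap t.str))
      (Φ.hmap_comp (𝒳.hcomp r.str s.str) t.str).symm
    have e₇ := Cell.ofEq_ofEq (X := Φ.F₀.obj W) (Y := Φ.F₀.obj Z)
      (𝒴.hcomp_assoc (Φ.hmap r.str) (Φ.hmap s.str) (Φ.hmap t.str)).symm
      ((congrArg₂ (fun p q => 𝒴.hcomp p q) (Φ.hmap_comp r.str s.str).symm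
        (rfl : Φ.hmap t.str = Φ.hmap t.str)).trans
      (Φ.hmap_comp (𝒳.hcomp r.str s.str) t.str).symm)
    refine (congrArg₂ (fun a b => a ≫ b) e₁ ((congrArg (_ ≫ ·) e₂).trans e₃)).trans (e₄.trans ?_)
    exact ((congrArg (_ ≫ ·) ((congrArg (· ≫ _) e₅).trans e₆)).trans e₇).symm

end DFunctor

end DispDbl


section equivalence

/-- A lax functor is strong if its comparison 2-cells are invertible. -/
structure LaxStr.IsStrong {D E : CatGraph.{u₀, v₀, u₁, v₁}} {P : PseudoDblStr D}
    {Q : PseudoDblStr E} {F : D ⟶ E} (f : LaxStr P Q F) : Prop where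
  isIso_unit : ∀ x : D.Ob, IsIso (f.unit x)
  isIso_mul : ∀ {x y z : D.Ob} (s : D.Hor y z) (r : D.Hor x y), IsIso (f.mul s r)

/-- Vertical transformations between lax functors. -/
def IsVertTransf {D E : CatGraph.{u₀, v₀, u₁, v₁}} {P : PseudoDblStr D} {Q : PseudoDblStr E}
    {F K : D ⟶ E} (f : LaxStr P Q F) (k : LaxStr P Q K) (θ : F ⟶ K) : Prop :=
  IsGenTransf f (OplaxStr.id P) (OplaxStr.id Q) k θ

/-- A lax functor `f` is an equivalence of double categories: it is strong and has a quasi-inverse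
`g`, a strong functor with invertible vertical transformations `1 ≅ g f` and `f g ≅ 1`. -/
def IsDblEquivalence {D E : CatGraph.{u₀, v₀, u₁, v₁}} {P : PseudoDblStr D} {Q : PseudoDblStr E}
    {F : D ⟶ E} (f : LaxStr P Q F) : Prop :=
  f.IsStrong ∧ ∃ (G : E ⟶ D) (g : LaxStr Q P G), g.IsStrong ∧
    (∃ θ : 𝟙 D ≅ F ≫ G, IsVertTransf (LaxStr.id P) (f.comp g) θ.hom) ∧
    (∃ κ : G ≫ F ≅ 𝟙 E, IsVertTransf (g.comp f) (LaxStr.id Q) κ.hom)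

end equivalence

/-- The double category of pseudodouble categories: lax functors horizontally, oplax functors
vertically, and generalized vertical transformations as cells. -/
def psDb : DispDbl.{u, v} where
  Ob A := PseudoDblStr A
  Hor P Q F := LaxStr P Q F
  hid P := LaxStr.id P
  hcomp f g := f.comp g
  hid_hcomp f := f.id_comp
  hcomp_hid f := f.comp_id
  hcomp_assoc f g h := f.comp_assoc g h
  Ver P Q F := OplaxStr P Q F
  vid P := OplaxStr.id P
  vcomp f g := f.comp g
  vid_vcomp f := f.id_comp
  vcomp_vid f := f.comp_id
  vcomp_assoc f g h := f.comp_assoc g h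
  IsCell h f g k θ := IsGenTransf h f g k θ
  isCell_vid h := IsGenTransf.vid h
  isCell_hid f := IsGenTransf.hid f
  isCell_vpaste h h' := IsGenTransf.vcomp h h'
  isCell_hpaste h h' := IsGenTransf.hcomp h h'

/-- The double category of lax algebras of a 2-monad on `Grph(Cat)`: lax morphisms horizontally,
oplax morphisms vertically, and generalized 2-cells. -/
def laxAlg (M : TwoMonad Grph.{u, v}) : DispDbl.{u, v} where
  Ob A := LaxAlg M A
  Hor P Q F := LaxMor P Q F
  hid P := LaxMor.id P
  hcomp f g := f.comp g
  hid_hcomp f := LaxMor.ext ((LaxMor.id_comp_φ f).trans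
    ((Category.id_comp _).trans (Category.comp_id _)))
  hcomp_hid f := LaxMor.ext ((LaxMor.comp_id_φ f).trans
    ((Category.id_comp _).trans (Category.comp_id _)))
  hcomp_assoc f g h := LaxMor.ext ((LaxMor.comp_assoc_φ f g h).trans
    ((Category.id_comp _).trans (Category.comp_id _)))
  Ver P Q F := OplaxMor P Q F
  vid P := OplaxMor.id P
  vcomp f g := f.comp g
  vid_vcomp f := OplaxMor.ext ((OplaxMor.id_comp_ζ f).trans
    ((Category.id_comp _).trans (Category.comp_id _)))
  vcomp_vid f := OplaxMor.ext ((OplaxMor.comp_id_ζ f).trans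
    ((Category.id_comp _).trans (Category.comp_id _)))
  vcomp_assoc f g h := OplaxMor.ext ((OplaxMor.comp_assoc_ζ f g h).trans
    ((Category.id_comp _).trans (Category.comp_id _)))
  IsCell h f g k θ := IsAlgCell h f g k θ
  isCell_vid h := IsAlgCell.vid h
  isCell_hid f := IsAlgCell.hid f
  isCell_vpaste {_ _ _ _ _ _ _ _ _ _ _ _ H F G K F' G' L _ _ _ _ _ _ _ θ κ} h h' := by
    have e := IsAlgCell.vcomp h h'
    have e' : 𝟙 (H ≫ G ≫ G') ≫ Bicategory.whiskerRight θ G' ≫ 𝟙 (F ≫ K ≫ G') ≫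
      Bicategory.whiskerLeft F κ ≫ 𝟙 ((F ≫ F') ≫ L) = vpaste θ κ := by
      apply graphCell_ext <;> intro x <;>
      exact (Category.id_comp _).trans
        (congrArg (_ ≫ ·) ((Category.id_comp _).trans (Category.comp_id _)))
    exact e' ▸ e
  isCell_hpaste {_ _ _ _ _ _ _ _ _ _ _ _ H F G K H' L K' _ _ _ _ _ _ _ θ κ} h h' := by
    have e := IsAlgCell.hcomp h h'
    have e' : 𝟙 ((H ≫ H') ≫ L) ≫ Bicategory.whiskerLeft H κ ≫ 𝟙 (H ≫ G ≫ K') ≫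
      Bicategory.whiskerRight θ K' ≫ 𝟙 (F ≫ K ≫ K') = hpaste θ κ := by
      apply graphCell_ext <;> intro x <;>
      exact (Category.id_comp _).trans
        (congrArg (_ ≫ ·) ((Category.id_comp _).trans (Category.comp_id _)))
    exact e' ▸ e

/-- The full sub-double category of pseudo-algebras. -/
def psAlg (M : TwoMonad Grph.{u, v}) : DispDbl.{u, v} :=
  (laxAlg M).full fun _ A => LaxAlg.IsPseudo A


section free

/-- Composable strings `x = x₀ ⇸ x₁ ⇸ ⋯ ⇸ xₙ = y` of horizontal 1-cells, `n ≥ 0`. -/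
inductive Str {Ob : Type u} (H : Ob → Ob → Type u) (x : Ob) : Ob → Type u
  | nil : Str H x x
  | snoc {y z : Ob} (p : Str H x y) (r : H y z) : Str H x z

/-- A type of 2-cells with prescribed corners, with its vertical domain and codomain maps. -/
structure CellType {Ob : Type u} [Category.{v} Ob] (x y x' y' : Ob) where
  T : Type v
  dom : T → (x ⟶ x')
  cod : T → (y ⟶ y')

variable (D : Grph.{u, v})

/-- Horizontally composable strings of 2-cells between strings of horizontal 1-cells of the same
length: between empty strings these are the vertical 1-cells, and a 2-cell between two non-empty
strings is a string of 2-cells between their initial parts together with a 2-cell between their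
last entries which is composable with it.  There are none between strings of different lengths. -/
def strCell {x x' : D.Ob} : ∀ {y y' : D.Ob}, Str D.Hor x y → Str D.Hor x' y' → CellType.{u, v} x y x' y'
  | _, _, .nil, .nil => ⟨x ⟶ x', fun f => f, fun f => f⟩
  | _, _, .snoc p r, .snoc q s =>
    ⟨{ c : (strCell p q).T × (HObj.mk r ⟶ HObj.mk s) // (strCell p q).cod c.1 = D.dom c.2 },
      fun c => (strCell p q).dom c.1.1, fun c => D.cod c.1.2⟩
  | _, _, .nil, .snoc _ _ => ⟨PEmpty, fun c => c.elim, fun c => c.elim⟩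
  | _, _, .snoc _ _, .nil => ⟨PEmpty, fun c => c.elim, fun c => c.elim⟩

variable {D}

/-- Vertical identities, entrywise. -/
def strId {x : D.Ob} : ∀ {y : D.Ob} (p : Str D.Hor x y),
    { c : (strCell D p p).T // (strCell D p p).dom c = 𝟙 x ∧ (strCell D p p).cod c = 𝟙 y }
  | _, .nil => ⟨𝟙 x, rfl, rfl⟩
  | _, .snoc p r => ⟨⟨((strId p).1, 𝟙 _), (strId p).2.2.trans (D.dom_id ⟨r⟩).symm⟩,
      (strId p).2.1, D.cod_id _⟩

/-- Vertical composition, entrywise. -/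
def strComp {x x' x'' : D.Ob} : ∀ {y y' y'' : D.Ob} {p : Str D.Hor x y} {q : Str D.Hor x' y'}
    {t : Str D.Hor x'' y''} (c : (strCell D p q).T) (d : (strCell D q t).T),
    { e : (strCell D p t).T // (strCell D p t).dom e = (strCell D p q).dom c ≫ (strCell D q t).dom d ∧
      (strCell D p t).cod e = (strCell D p q).cod c ≫ (strCell D q t).cod d }
  | _, _, _, .nil, .nil, .nil, c, d => ⟨c ≫ d, rfl, rfl⟩
  | _, _, _, .snoc _ _, .snoc _ _, .snoc _ _, c, d =>
    ⟨⟨((strComp c.1.1 d.1.1).1, c.1.2 ≫ d.1.2), by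
      rw [(strComp c.1.1 d.1.1).2.2, D.dom_comp, c.2, d.2]⟩,
      (strComp c.1.1 d.1.1).2.1, D.cod_comp _ _⟩
  | _, _, _, .nil, .snoc _ _, _, c, _ => c.elim
  | _, _, _, .snoc _ _, .nil, _, c, _ => c.elim
  | _, _, _, .nil, .nil, .snoc _ _, _, d => d.elim
  | _, _, _, .snoc _ _, .snoc _ _, .nil, _, d => d.elim

theorem strId_comp {x x' : D.Ob} : ∀ {y y' : D.Ob} {p : Str D.Hor x y} {q : Str D.Hor x' y'}
    (c : (strCell D p q).T), (strComp (strId p).1 c).1 = c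
  | _, _, .nil, .nil, c => Category.id_comp (obj := D.Ob) c
  | _, _, .snoc _ _, .snoc _ _, c =>
    Subtype.ext (Prod.ext (strId_comp c.1.1) (Category.id_comp c.1.2))
  | _, _, .nil, .snoc _ _, c => c.elim
  | _, _, .snoc _ _, .nil, c => c.elim

theorem strComp_id {x x' : D.Ob} : ∀ {y y' : D.Ob} {p : Str D.Hor x y} {q : Str D.Hor x' y'}
    (c : (strCell D p q).T), (strComp c (strId q).1).1 = c
  | _, _, .nil, .nil, c => Category.comp_id (obj := D.Ob) c
  | _, _, .snoc _ _, .snoc _ _, c =>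
    Subtype.ext (Prod.ext (strComp_id c.1.1) (Category.comp_id c.1.2))
  | _, _, .nil, .snoc _ _, c => c.elim
  | _, _, .snoc _ _, .nil, c => c.elim

theorem strComp_assoc {x x' x'' x''' : D.Ob} : ∀ {y y' y'' y''' : D.Ob} {p : Str D.Hor x y}
    {q : Str D.Hor x' y'} {t : Str D.Hor x'' y''} {w : Str D.Hor x''' y'''}
    (c : (strCell D p q).T) (d : (strCell D q t).T) (e : (strCell D t w).T),
    (strComp (strComp c d).1 e).1 = (strComp c (strComp d e).1).1
  | _, _, _, _, .nil, .nil, .nil, .nil, c, d, e =>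
    Category.assoc (obj := D.Ob) c d e
  | _, _, _, _, .snoc _ _, .snoc _ _, .snoc _ _, .snoc _ _, c, d, e =>
    Subtype.ext (Prod.ext (strComp_assoc c.1.1 d.1.1 e.1.1) (Category.assoc c.1.2 d.1.2 e.1.2))
  | _, _, _, _, .nil, .snoc _ _, _, _, c, _, _ => c.elim
  | _, _, _, _, .snoc _ _, .nil, _, _, c, _, _ => c.elim
  | _, _, _, _, .nil, .nil, .snoc _ _, _, _, d, _ => d.elim
  | _, _, _, _, .snoc _ _, .snoc _ _, .nil, _, _, d, _ => d.elim
  | _, _, _, _, .nil, .nil, .nil, .snoc _ _, _, _, e => e.elim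
  | _, _, _, _, .snoc _ _, .snoc _ _, .snoc _ _, .nil, _, _, e => e.elim

variable (D)

/-- The graph `𝔉 D` underlying the free internal category on `D`. -/
def freeGraph : Grph.{u, v} where
  Ob := D.Ob
  Hor := Str D.Hor
  cat₁ :=
    { Hom := fun p q => (strCell D p.hom q.hom).T
      id := fun p => (strId p.hom).1
      comp := fun c d => (strComp c d).1
      id_comp := fun c => strId_comp c
      comp_id := fun c => strComp_id c
      assoc := fun c d e => strComp_assoc c d e }
  dom {p q} c := (strCell D p.hom q.hom).dom c
  cod {p q} c := (strCell D p.hom q.hom).cod c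
  dom_id p := (strId p.hom).2.1
  cod_id p := (strId p.hom).2.2
  dom_comp c d := (strComp c d).2.1
  cod_comp c d := (strComp c d).2.2

variable {D} {E : Grph.{u, v}}

/-- The action of a graph morphism on strings of horizontal 1-cells. -/
def GraphHom.mapStr (F : GraphHom D E) {x : D.Ob} : ∀ {y : D.Ob}, Str D.Hor x y →
    Str E.Hor (F.F₀.obj x) (F.F₀.obj y)
  | _, .nil => .nil
  | _, .snoc p r => .snoc (F.mapStr p) (F.obj₁ r)

/-- The action of a graph morphism on strings of 2-cells. -/
def GraphHom.mapCell (F : GraphHom D E) {x x' : D.Ob} : ∀ {y y' : D.Ob} {p : Str D.Hor x y}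
    {q : Str D.Hor x' y'} (c : (strCell D p q).T),
    { d : (strCell E (F.mapStr p) (F.mapStr q)).T //
      (strCell E (F.mapStr p) (F.mapStr q)).dom d = F.F₀.map ((strCell D p q).dom c) ∧
      (strCell E (F.mapStr p) (F.mapStr q)).cod d = F.F₀.map ((strCell D p q).cod c) }
  | _, _, .nil, .nil, c => ⟨F.F₀.map (X := _) (Y := _) c, rfl, rfl⟩
  | _, _, .snoc _ _, .snoc _ _, c =>
    ⟨⟨((F.mapCell c.1.1).1, F.map₁ c.1.2), by
      rw [(F.mapCell c.1.1).2.2, F.dom_map₁, c.2]⟩,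
      (F.mapCell c.1.1).2.1, F.cod_map₁ _⟩
  | _, _, .nil, .snoc _ _, c => c.elim
  | _, _, .snoc _ _, .nil, c => c.elim

theorem GraphHom.mapCell_id (F : GraphHom D E) {x : D.Ob} : ∀ {y : D.Ob} (p : Str D.Hor x y),
    (F.mapCell (strId p).1).1 = (strId (F.mapStr p)).1
  | _, .nil => F.F₀.map_id x
  | _, .snoc p r => Subtype.ext (Prod.ext (F.mapCell_id p) (F.map₁_id ⟨r⟩))

theorem GraphHom.mapCell_comp (F : GraphHom D E) {x x' x'' : D.Ob} : ∀ {y y' y'' : D.Ob}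
    {p : Str D.Hor x y} {q : Str D.Hor x' y'} {t : Str D.Hor x'' y''} (c : (strCell D p q).T)
    (d : (strCell D q t).T),
    (F.mapCell (strComp c d).1).1 = (strComp (F.mapCell c).1 (F.mapCell d).1).1
  | _, _, _, .nil, .nil, .nil, c, d => F.F₀.map_comp (X := _) (Y := _) (Z := _) c d
  | _, _, _, .snoc _ _, .snoc _ _, .snoc _ _, c, d =>
    Subtype.ext (Prod.ext (F.mapCell_comp c.1.1 d.1.1) (F.map₁_comp c.1.2 d.1.2))
  | _, _, _, .nil, .snoc _ _, _, c, _ => c.elim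
  | _, _, _, .snoc _ _, .nil, _, c, _ => c.elim
  | _, _, _, .nil, .nil, .snoc _ _, _, d => d.elim
  | _, _, _, .snoc _ _, .snoc _ _, .nil, _, d => d.elim

/-- `𝔉` on graph morphisms. -/
def freeMap (F : D ⟶ E) : freeGraph D ⟶ freeGraph E where
  F₀ := GraphHom.F₀ (D := D) (E := E) F
  obj₁ p := GraphHom.mapStr F p
  map₁ c := (GraphHom.mapCell F c).1
  map₁_id p := GraphHom.mapCell_id F p.hom
  map₁_comp c d := GraphHom.mapCell_comp F c d
  dom_map₁ c := (GraphHom.mapCell F c).2.1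
  cod_map₁ c := (GraphHom.mapCell F c).2.2

/-- The components of a 2-cell of graphs at strings, entrywise. -/
def GraphCell.strApp {F K : GraphHom D E} (θ : GraphCell F K) {x : D.Ob} : ∀ {y : D.Ob} (p : Str D.Hor x y),
    { c : (strCell E (F.mapStr p) (K.mapStr p)).T //
      (strCell E (F.mapStr p) (K.mapStr p)).dom c = θ.app₀ x ∧
      (strCell E (F.mapStr p) (K.mapStr p)).cod c = θ.app₀ y }
  | _, .nil => ⟨θ.app₀ x, rfl, rfl⟩
  | _, .snoc p r => ⟨⟨((θ.strApp p).1, θ.app₁ ⟨r⟩), (θ.strApp p).2.2.trans (θ.dom_app ⟨r⟩).symm⟩,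
      (θ.strApp p).2.1, θ.cod_app ⟨r⟩⟩

theorem GraphCell.strApp_nat {F K : GraphHom D E} (θ : GraphCell F K) {x x' : D.Ob} : ∀ {y y' : D.Ob}
    {p : Str D.Hor x y} {q : Str D.Hor x' y'} (c : (strCell D p q).T),
    (strComp (F.mapCell c).1 (θ.strApp q).1).1 = (strComp (θ.strApp p).1 (K.mapCell c).1).1
  | _, _, .nil, .nil, c => θ.nat₀ c
  | _, _, .snoc _ _, .snoc _ _, c =>
    Subtype.ext (Prod.ext (θ.strApp_nat c.1.1) (θ.nat₁ c.1.2))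
  | _, _, .nil, .snoc _ _, c => c.elim
  | _, _, .snoc _ _, .nil, c => c.elim

/-- `𝔉` on 2-cells. -/
def freeMap₂ {F K : D ⟶ E} (θ : F ⟶ K) : freeMap F ⟶ freeMap K where
  app₀ x := GraphCell.app₀ θ x
  app₁ p := (GraphCell.strApp θ p.hom).1
  nat₀ f := GraphCell.nat₀ θ f
  nat₁ c := GraphCell.strApp_nat θ c
  dom_app p := (GraphCell.strApp θ p.hom).2.1
  cod_app p := (GraphCell.strApp θ p.hom).2.2

/-- Concatenation of strings. -/
def Str.append {Ob : Type u} {H : Ob → Ob → Type u} {x y : Ob} (p : Str H x y) :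
    ∀ {z : Ob}, Str H y z → Str H x z
  | _, .nil => p
  | _, .snoc q r => (p.append q).snoc r

/-- Concatenation of a string of strings. -/
def Str.join {Ob : Type u} {H : Ob → Ob → Type u} {x : Ob} :
    ∀ {y : Ob}, Str (Str H) x y → Str H x y
  | _, .nil => .nil
  | _, .snoc p q => p.join.append q

/-- Concatenation of strings of 2-cells. -/
def strAppend {x y x' y' : D.Ob} {p : Str D.Hor x y} {p' : Str D.Hor x' y'}
    (c : (strCell D p p').T) : ∀ {z z' : D.Ob} {q : Str D.Hor y z} {q' : Str D.Hor y' z'}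
    (d : (strCell D q q').T) (_ : (strCell D p p').cod c = (strCell D q q').dom d),
    { e : (strCell D (p.append q) (p'.append q')).T //
      (strCell D (p.append q) (p'.append q')).dom e = (strCell D p p').dom c ∧
      (strCell D (p.append q) (p'.append q')).cod e = (strCell D q q').cod d }
  | _, _, .nil, .nil, _, h => ⟨c, rfl, h⟩
  | _, _, .snoc _ _, .snoc _ _, d, h =>
    ⟨⟨((strAppend c d.1.1 h).1, d.1.2), (strAppend c d.1.1 h).2.2.trans d.2⟩,
      (strAppend c d.1.1 h).2.1, rfl⟩
  | _, _, .nil, .snoc _ _, d, _ => d.elim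
  | _, _, .snoc _ _, .nil, d, _ => d.elim

/-- Concatenation of a string of strings of 2-cells. -/
def strJoin {x x' : D.Ob} : ∀ {y y' : D.Ob} {p : Str (freeGraph D).Hor x y}
    {q : Str (freeGraph D).Hor x' y'} (c : (strCell (freeGraph D) p q).T),
    { e : (strCell D p.join q.join).T //
      (strCell D p.join q.join).dom e = (strCell (freeGraph D) p q).dom c ∧
      (strCell D p.join q.join).cod e = (strCell (freeGraph D) p q).cod c }
  | _, _, .nil, .nil, c => ⟨c, rfl, rfl⟩
  | _, _, .snoc _ _, .snoc _ _, c =>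
    let e := strAppend (strJoin c.1.1).1 c.1.2 ((strJoin c.1.1).2.2.trans c.2)
    ⟨e.1, e.2.1.trans (strJoin c.1.1).2.1, e.2.2⟩
  | _, _, .nil, .snoc _ _, c => c.elim
  | _, _, .snoc _ _, .nil, c => c.elim

theorem strAppend_congr {x y x' y' z z' : D.Ob} {p : Str D.Hor x y} {p' : Str D.Hor x' y'}
    {q : Str D.Hor y z} {q' : Str D.Hor y' z'} {c c₁ : (strCell D p p').T}
    {d d₁ : (strCell D q q').T} (hc : c = c₁) (hd : d = d₁)
    (h : (strCell D p p').cod c = (strCell D q q').dom d)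
    (h₁ : (strCell D p p').cod c₁ = (strCell D q q').dom d₁) :
    (strAppend c d h).1 = (strAppend c₁ d₁ h₁).1 := by
  subst hc hd; rfl

theorem strAppend_id {x y : D.Ob} (p : Str D.Hor x y) : ∀ {z : D.Ob} (q : Str D.Hor y z)
    (h : (strCell D p p).cod (strId p).1 = (strCell D q q).dom (strId q).1),
    (strAppend (strId p).1 (strId q).1 h).1 = (strId (p.append q)).1
  | _, .nil, _ => rfl
  | _, .snoc q _, h => Subtype.ext (Prod.ext (strAppend_id p q h) rfl)

theorem strAppend_comp {x y x' y' x'' y'' : D.Ob} {p : Str D.Hor x y} {p' : Str D.Hor x' y'}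
    {p'' : Str D.Hor x'' y''} (c : (strCell D p p').T) (c' : (strCell D p' p'').T) :
    ∀ {z z' z'' : D.Ob} {q : Str D.Hor y z} {q' : Str D.Hor y' z'} {q'' : Str D.Hor y'' z''}
    (d : (strCell D q q').T) (d' : (strCell D q' q'').T)
    (h : (strCell D p p').cod c = (strCell D q q').dom d)
    (h' : (strCell D p' p'').cod c' = (strCell D q' q'').dom d')
    (h'' : (strCell D p p'').cod (strComp c c').1 = (strCell D q q'').dom (strComp d d').1),
    (strAppend (strComp c c').1 (strComp d d').1 h'').1 =
      (strComp (strAppend c d h).1 (strAppend c' d' h').1).1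
  | _, _, _, .nil, .nil, .nil, _, _, _, _, _ => rfl
  | _, _, _, .snoc _ _, .snoc _ _, .snoc _ _, d, d', h, h', h'' =>
    Subtype.ext (Prod.ext (strAppend_comp c c' d.1.1 d'.1.1 h h' h'') rfl)
  | _, _, _, .nil, .snoc _ _, _, d, _, _, _, _ => d.elim
  | _, _, _, .snoc _ _, .nil, _, d, _, _, _, _ => d.elim
  | _, _, _, .nil, .nil, .snoc _ _, _, d, _, _, _ => d.elim
  | _, _, _, .snoc _ _, .snoc _ _, .nil, _, d, _, _, _ => d.elim

theorem strJoin_id {x : D.Ob} : ∀ {y : D.Ob} (p : Str (freeGraph D).Hor x y),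
    (strJoin (strId p).1).1 = (strId p.join).1
  | _, .nil => rfl
  | _, .snoc p q =>
    have e := strAppend_id p.join q ((strId p.join).2.2.trans (strId q).2.1.symm)
    (strAppend_congr (strJoin_id p) rfl _ _).trans e

theorem strJoin_comp {x x' x'' : D.Ob} : ∀ {y y' y'' : D.Ob} {p : Str (freeGraph D).Hor x y}
    {q : Str (freeGraph D).Hor x' y'} {t : Str (freeGraph D).Hor x'' y''}
    (c : (strCell (freeGraph D) p q).T) (d : (strCell (freeGraph D) q t).T),
    (strJoin (strComp c d).1).1 = (strComp (strJoin c).1 (strJoin d).1).1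
  | _, _, _, .nil, .nil, .nil, _, _ => rfl
  | _, _, _, .snoc p a, .snoc q b, .snoc t a', c, d => by
    have e := strAppend_comp (strJoin c.1.1).1 (strJoin d.1.1).1 c.1.2 d.1.2
      ((strJoin c.1.1).2.2.trans c.2) ((strJoin d.1.1).2.2.trans d.2)
      (((strComp (strJoin c.1.1).1 (strJoin d.1.1).1).2.2.trans
        (congrArg₂ (· ≫ ·) ((strJoin c.1.1).2.2.trans c.2) ((strJoin d.1.1).2.2.trans d.2))).trans
          (strComp (D := D) c.1.2 d.1.2).2.1.symm)
    exact (strAppend_congr (strJoin_comp c.1.1 d.1.1) rfl _ _).trans e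
  | _, _, _, .nil, .snoc _ _, _, d, _ => d.elim
  | _, _, _, .snoc _ _, .nil, _, d, _ => d.elim
  | _, _, _, .nil, .nil, .snoc _ _, _, d => d.elim
  | _, _, _, .snoc _ _, .snoc _ _, .nil, _, d => d.elim

variable (D)

/-- The unit `e : D → 𝔉 D`, strings of length one. -/
def freeUnit : D ⟶ freeGraph D where
  F₀ := 𝟭 D.Ob
  obj₁ r := .snoc .nil r
  map₁ φ := ⟨(D.dom φ, φ), rfl⟩
  map₁_id r := Subtype.ext (Prod.ext (D.dom_id r) rfl)
  map₁_comp φ ψ := Subtype.ext (Prod.ext (D.dom_comp φ ψ) rfl)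
  dom_map₁ _ := rfl
  cod_map₁ _ := rfl

/-- The multiplication `m : 𝔉 (𝔉 D) → 𝔉 D`, concatenation. -/
def freeMul : freeGraph (freeGraph D) ⟶ freeGraph D where
  F₀ := 𝟭 D.Ob
  obj₁ p := Str.join p
  map₁ c := (strJoin c).1
  map₁_id p := strJoin_id p.hom
  map₁_comp c d := strJoin_comp c d
  dom_map₁ c := (strJoin c).2.1
  cod_map₁ c := (strJoin c).2.2

end free


section free2

theorem graphHom_ext {A B : CatGraph.{u₀, v₀, u₁, v₁}} {F K : A ⟶ B}
    (h₀ : GraphHom.F₀ F = GraphHom.F₀ K)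
    (h₁ : ∀ {x y : A.Ob} (r : A.Hor x y), GraphHom.obj₁ F r ≍ GraphHom.obj₁ K r)
    (h₂ : ∀ {r s : A.One} (φ : r ⟶ s), GraphHom.map₁ F φ ≍ GraphHom.map₁ K φ) : F = K := by
  obtain ⟨F₀, F₁, F₂, _, _, _, _⟩ := F
  obtain ⟨K₀, K₁, K₂, _, _, _, _⟩ := K
  dsimp only at h₀
  subst h₀
  have e₁ : @F₁ = @K₁ := by
    funext x y r
    exact eq_of_heq (h₁ r)
  subst e₁
  have e₂ : @F₂ = @K₂ := by
    funext r s φ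
    exact eq_of_heq (h₂ φ)
  subst e₂
  rfl

theorem graphCell_eq_conj {A B : CatGraph.{u₀, v₀, u₁, v₁}} {F F' K K' : A ⟶ B} (hF : F = F')
    (hK : K = K') (θ : F ⟶ K) (κ : F' ⟶ K')
    (h₀ : ∀ x, GraphCell.app₀ θ x ≍ GraphCell.app₀ κ x)
    (h₁ : ∀ r, GraphCell.app₁ θ r ≍ GraphCell.app₁ κ r) :
    θ = eqToHom hF ≫ κ ≫ eqToHom hK.symm := by
  subst hF hK
  rw [eqToHom_refl, eqToHom_refl, Category.id_comp, Category.comp_id]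
  exact graphCell_ext (fun x => eq_of_heq (h₀ x)) (fun r => eq_of_heq (h₁ r))

variable {A B C D : Grph.{u, v}}

theorem heq_snoc {x x' y y' z z' : D.Ob} {p p₁ : Str D.Hor x y} {q q₁ : Str D.Hor x' y'}
    (hp : p = p₁) (hq : q = q₁) {r : D.Hor y z} {s : D.Hor y' z'} {c : (strCell D p q).T}
    {c₁ : (strCell D p₁ q₁).T} (hc : c ≍ c₁) (φ : HObj.mk r ⟶ HObj.mk s)
    (h : (strCell D p q).cod c = D.dom φ) (h₁ : (strCell D p₁ q₁).cod c₁ = D.dom φ) :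
    (show (strCell D (p.snoc r) (q.snoc s)).T from ⟨(c, φ), h⟩) ≍
      (show (strCell D (p₁.snoc r) (q₁.snoc s)).T from ⟨(c₁, φ), h₁⟩) := by
  subst hp hq
  cases eq_of_heq hc
  rfl

theorem heq_append {x x' y y' z z' : D.Ob} {p p₁ : Str D.Hor x y} {p' p₁' : Str D.Hor x' y'}
    {q q₁ : Str D.Hor y z} {q' q₁' : Str D.Hor y' z'} (hp : p = p₁) (hp' : p' = p₁')
    (hq : q = q₁) (hq' : q' = q₁') {c : (strCell D p p').T} {c₁ : (strCell D p₁ p₁').T}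
    {d : (strCell D q q').T} {d₁ : (strCell D q₁ q₁').T} (hc : c ≍ c₁) (hd : d ≍ d₁)
    (h : (strCell D p p').cod c = (strCell D q q').dom d)
    (h₁ : (strCell D p₁ p₁').cod c₁ = (strCell D q₁ q₁').dom d₁) :
    (strAppend c d h).1 ≍ (strAppend c₁ d₁ h₁).1 := by
  subst hp hp' hq hq'
  cases eq_of_heq hc
  cases eq_of_heq hd
  rfl

theorem mapStr_id {x : D.Ob} : ∀ {y : D.Ob} (p : Str D.Hor x y), GraphHom.mapStr (𝟙 D) p = p
  | _, .nil => rfl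
  | _, .snoc p r => congrArg (fun q => Str.snoc q r) (mapStr_id p)

theorem mapCell_id {x x' : D.Ob} : ∀ {y y' : D.Ob} {p : Str D.Hor x y} {q : Str D.Hor x' y'}
    (c : (strCell D p q).T), (GraphHom.mapCell (𝟙 D) c).1 ≍ c
  | _, _, .nil, .nil, _ => HEq.rfl
  | _, _, .snoc p _, .snoc q _, c => heq_snoc (mapStr_id p) (mapStr_id q) (mapCell_id c.1.1) c.1.2 _ _
  | _, _, .nil, .snoc _ _, c => c.elim
  | _, _, .snoc _ _, .nil, c => c.elim

theorem mapStr_comp (F : A ⟶ B) (K : B ⟶ C) {x : A.Ob} : ∀ {y : A.Ob} (p : Str A.Hor x y),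
    GraphHom.mapStr (F ≫ K) p = GraphHom.mapStr K (GraphHom.mapStr F p)
  | _, .nil => rfl
  | _, .snoc p r => congrArg (fun q => Str.snoc q (GraphHom.obj₁ K (GraphHom.obj₁ F r)))
      (mapStr_comp F K p)

theorem mapCell_comp (F : A ⟶ B) (K : B ⟶ C) {x x' : A.Ob} : ∀ {y y' : A.Ob}
    {p : Str A.Hor x y} {q : Str A.Hor x' y'} (c : (strCell A p q).T),
    (GraphHom.mapCell (F ≫ K) c).1 ≍ (GraphHom.mapCell K (GraphHom.mapCell F c).1).1
  | _, _, .nil, .nil, _ => HEq.rfl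
  | _, _, .snoc p _, .snoc q _, c =>
    heq_snoc (mapStr_comp F K p) (mapStr_comp F K q) (mapCell_comp F K c.1.1)
      (GraphHom.map₁ K (GraphHom.map₁ F c.1.2)) _ _
  | _, _, .nil, .snoc _ _, c => c.elim
  | _, _, .snoc _ _, .nil, c => c.elim

theorem strApp_id (F : A ⟶ B) {x : A.Ob} : ∀ {y : A.Ob} (p : Str A.Hor x y),
    (GraphCell.strApp (𝟙 F) p).1 = (strId (GraphHom.mapStr F p)).1
  | _, .nil => rfl
  | _, .snoc p _ => Subtype.ext (Prod.ext (strApp_id F p) rfl)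

theorem strApp_comp {F K L : A ⟶ B} (θ : F ⟶ K) (κ : K ⟶ L) {x : A.Ob} : ∀ {y : A.Ob}
    (p : Str A.Hor x y), (GraphCell.strApp (θ ≫ κ) p).1 =
      (strComp (GraphCell.strApp θ p).1 (GraphCell.strApp κ p).1).1
  | _, .nil => rfl
  | _, .snoc p _ => Subtype.ext (Prod.ext (strApp_comp θ κ p) rfl)

theorem strApp_whiskerLeft (F : A ⟶ B) {K K' : B ⟶ C} (θ : K ⟶ K') {x : A.Ob} : ∀ {y : A.Ob}
    (p : Str A.Hor x y), (GraphCell.strApp (Bicategory.whiskerLeft F θ) p).1 ≍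
      (GraphCell.strApp θ (GraphHom.mapStr F p)).1
  | _, .nil => HEq.rfl
  | _, .snoc p r => heq_snoc (mapStr_comp F K p) (mapStr_comp F K' p) (strApp_whiskerLeft F θ p)
      (GraphCell.app₁ θ ⟨GraphHom.obj₁ F r⟩) _ _

theorem strApp_whiskerRight {F F' : A ⟶ B} (θ : F ⟶ F') (K : B ⟶ C) {x : A.Ob} : ∀ {y : A.Ob}
    (p : Str A.Hor x y), (GraphCell.strApp (Bicategory.whiskerRight θ K) p).1 ≍
      (GraphHom.mapCell K (GraphCell.strApp θ p).1).1
  | _, .nil => HEq.rfl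
  | _, .snoc p r => heq_snoc (mapStr_comp F K p) (mapStr_comp F' K p) (strApp_whiskerRight θ K p)
      (GraphHom.map₁ K (GraphCell.app₁ θ ⟨r⟩)) _ _

theorem freeMap_id (D : Grph.{u, v}) : freeMap (𝟙 D) = 𝟙 (freeGraph D) :=
  graphHom_ext rfl (fun r => heq_of_eq (mapStr_id r)) (fun c => mapCell_id c)

theorem freeMap_comp (F : A ⟶ B) (K : B ⟶ C) : freeMap (F ≫ K) = freeMap F ≫ freeMap K :=
  graphHom_ext rfl (fun r => heq_of_eq (mapStr_comp F K r)) (fun c => mapCell_comp F K c)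

/-- The 2-functor `𝔉`. -/
def freeFunctor : StrictPseudofunctor Grph.{u, v} Grph.{u, v} :=
  StrictPseudofunctor.mk''
    { obj := freeGraph
      map := freeMap
      map₂ := freeMap₂
      map₂_id := fun F => graphCell_ext (fun _ => rfl) (fun p => strApp_id F p.hom)
      map₂_comp := fun θ κ => graphCell_ext (fun _ => rfl) (fun p => strApp_comp θ κ p.hom)
      map_id := freeMap_id
      map_comp := freeMap_comp
      map₂_whisker_left := fun F _ _ θ => graphCell_eq_conj (freeMap_comp F _) (freeMap_comp F _) _ _
        (fun _ => HEq.rfl) (fun p => strApp_whiskerLeft F θ p.hom)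
      map₂_whisker_right := fun θ K => graphCell_eq_conj (freeMap_comp _ K) (freeMap_comp _ K) _ _
        (fun _ => HEq.rfl) (fun p => strApp_whiskerRight θ K p.hom) }

end free2


section monad

variable {A B C D : Grph.{u, v}}

theorem mapStr_append (F : A ⟶ B) {x y : A.Ob} (p : Str A.Hor x y) : ∀ {z : A.Ob}
    (q : Str A.Hor y z), GraphHom.mapStr F (p.append q) =
      (GraphHom.mapStr F p).append (GraphHom.mapStr F q)
  | _, .nil => rfl
  | _, .snoc q r => congrArg (fun t => Str.snoc t (GraphHom.obj₁ F r)) (mapStr_append F p q)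

theorem mapCell_append (F : A ⟶ B) {x y x' y' : A.Ob} {p : Str A.Hor x y} {p' : Str A.Hor x' y'}
    (c : (strCell A p p').T) : ∀ {z z' : A.Ob} {q : Str A.Hor y z} {q' : Str A.Hor y' z'}
    (d : (strCell A q q').T) (h : (strCell A p p').cod c = (strCell A q q').dom d)
    (h' : (strCell B (GraphHom.mapStr F p) (GraphHom.mapStr F p')).cod (GraphHom.mapCell F c).1 =
      (strCell B (GraphHom.mapStr F q) (GraphHom.mapStr F q')).dom (GraphHom.mapCell F d).1),
    (GraphHom.mapCell F (strAppend c d h).1).1 ≍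
      (strAppend (GraphHom.mapCell F c).1 (GraphHom.mapCell F d).1 h').1
  | _, _, .nil, .nil, _, _, _ => HEq.rfl
  | _, _, .snoc q _, .snoc q' _, d, h, h' =>
    heq_snoc (mapStr_append F p q) (mapStr_append F p' q') (mapCell_append F c d.1.1 h h')
      (GraphHom.map₁ F d.1.2) _ _
  | _, _, .nil, .snoc _ _, d, _, _ => d.elim
  | _, _, .snoc _ _, .nil, d, _, _ => d.elim

theorem join_mapStr (F : A ⟶ B) {x : A.Ob} : ∀ {y : A.Ob} (p : Str (freeGraph A).Hor x y),
    (Str.join (GraphHom.mapStr (freeMap F) p) : Str B.Hor _ _) =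
      GraphHom.mapStr F (Str.join p)
  | _, .nil => rfl
  | _, .snoc p q => (congrArg (fun t => Str.append t (GraphHom.mapStr F q)) (join_mapStr F p)).trans
      (mapStr_append F (Str.join p) q).symm

theorem strJoin_mapCell (F : A ⟶ B) {x x' : A.Ob} : ∀ {y y' : A.Ob}
    {p : Str (freeGraph A).Hor x y} {q : Str (freeGraph A).Hor x' y'}
    (c : (strCell (freeGraph A) p q).T),
    (strJoin (GraphHom.mapCell (freeMap F) c).1).1 ≍ (GraphHom.mapCell F (strJoin c).1).1
  | _, _, .nil, .nil, _ => HEq.rfl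
  | _, _, .snoc p a, .snoc q b, c => by
    have h := (strJoin c.1.1).2.2.trans c.2
    have h' := ((GraphHom.mapCell F (strJoin c.1.1).1).2.2.trans
      (congrArg (fun f => (GraphHom.F₀ F).map f) h)).trans (GraphHom.mapCell F c.1.2).2.1.symm
    exact (heq_append (join_mapStr F p) (join_mapStr F q) rfl rfl (strJoin_mapCell F c.1.1)
      HEq.rfl _ h').trans (mapCell_append F (strJoin c.1.1).1 c.1.2 h h').symm
  | _, _, .nil, .snoc _ _, c => c.elim
  | _, _, .snoc _ _, .nil, c => c.elim

theorem nil_append {x : A.Ob} : ∀ {y : A.Ob} (p : Str A.Hor x y), Str.nil.append p = p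
  | _, .nil => rfl
  | _, .snoc p r => congrArg (fun t => Str.snoc t r) (nil_append p)

theorem strAppend_nil {x x' : A.Ob} (f : x ⟶ x') : ∀ {y y' : A.Ob} {p : Str A.Hor x y}
    {q : Str A.Hor x' y'} (c : (strCell A p q).T) (h : f = (strCell A p q).dom c),
    (strAppend (p := Str.nil) (p' := Str.nil)
      (show (strCell A (Str.nil (x := x)) (Str.nil (x := x'))).T from f) c h).1 ≍ c
  | _, _, .nil, .nil, _, h => heq_of_eq h
  | _, _, .snoc p _, .snoc q _, c, h =>
    heq_snoc (nil_append p) (nil_append q) (strAppend_nil f c.1.1 h) c.1.2 _ _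
  | _, _, .nil, .snoc _ _, c, _ => c.elim
  | _, _, .snoc _ _, .nil, c, _ => c.elim

theorem join_unit {x : A.Ob} : ∀ {y : A.Ob} (p : Str A.Hor x y),
    (Str.join (GraphHom.mapStr (freeUnit A) p) : Str A.Hor x y) = p
  | _, .nil => rfl
  | _, .snoc p r => congrArg (fun t => Str.snoc t r) (join_unit p)

theorem strJoin_unit {x x' : A.Ob} : ∀ {y y' : A.Ob} {p : Str A.Hor x y} {q : Str A.Hor x' y'}
    (c : (strCell A p q).T), (strJoin (GraphHom.mapCell (freeUnit A) c).1).1 ≍ c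
  | _, _, .nil, .nil, _ => HEq.rfl
  | _, _, .snoc p _, .snoc q _, c =>
    heq_snoc (join_unit p) (join_unit q) (strJoin_unit c.1.1) c.1.2 _ _
  | _, _, .nil, .snoc _ _, c => c.elim
  | _, _, .snoc _ _, .nil, c => c.elim

theorem append_assoc {x y z : A.Ob} (p : Str A.Hor x y) (q : Str A.Hor y z) : ∀ {w : A.Ob}
    (t : Str A.Hor z w), (p.append q).append t = p.append (q.append t)
  | _, .nil => rfl
  | _, .snoc t r => congrArg (fun t => Str.snoc t r) (append_assoc p q t)

theorem strAppend_assoc {x y z x' y' z' : A.Ob} {p : Str A.Hor x y} {q : Str A.Hor y z}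
    {p' : Str A.Hor x' y'} {q' : Str A.Hor y' z'} (c : (strCell A p p').T)
    (d : (strCell A q q').T) (h : (strCell A p p').cod c = (strCell A q q').dom d) :
    ∀ {w w' : A.Ob} {t : Str A.Hor z w} {t' : Str A.Hor z' w'} (e : (strCell A t t').T)
    (h₁ : (strCell A (p.append q) (p'.append q')).cod (strAppend c d h).1 = (strCell A t t').dom e)
    (h₂ : (strCell A q q').cod d = (strCell A t t').dom e)
    (h₃ : (strCell A p p').cod c =
      (strCell A (q.append t) (q'.append t')).dom (strAppend d e h₂).1),
    (strAppend (strAppend c d h).1 e h₁).1 ≍ (strAppend c (strAppend d e h₂).1 h₃).1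
  | _, _, .nil, .nil, _, _, _, _ => HEq.rfl
  | _, _, .snoc t _, .snoc t' _, e, h₁, h₂, h₃ =>
    heq_snoc (append_assoc p q t) (append_assoc p' q' t') (strAppend_assoc c d h e.1.1 h₁ h₂ h₃)
      e.1.2 _ _
  | _, _, .nil, .snoc _ _, e, _, _, _ => e.elim
  | _, _, .snoc _ _, .nil, e, _, _, _ => e.elim

theorem join_append {x y : A.Ob} (p : Str (freeGraph A).Hor x y) : ∀ {z : A.Ob}
    (q : Str (freeGraph A).Hor y z), (Str.join (p.append q) : Str A.Hor x z) =
      (Str.join p).append (Str.join q)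
  | _, .nil => rfl
  | _, .snoc q t => (congrArg (fun a => Str.append a t) (join_append p q)).trans
      (append_assoc (Str.join p) (Str.join q) t)

theorem strJoin_append {x y x' y' : A.Ob} {p : Str (freeGraph A).Hor x y}
    {p' : Str (freeGraph A).Hor x' y'} (c : (strCell (freeGraph A) p p').T) :
    ∀ {z z' : A.Ob} {q : Str (freeGraph A).Hor y z} {q' : Str (freeGraph A).Hor y' z'}
    (d : (strCell (freeGraph A) q q').T)
    (h : (strCell (freeGraph A) p p').cod c = (strCell (freeGraph A) q q').dom d)
    (h' : (strCell A p.join p'.join).cod (strJoin c).1 =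
      (strCell A q.join q'.join).dom (strJoin d).1),
    (strJoin (strAppend c d h).1).1 ≍ (strAppend (strJoin c).1 (strJoin d).1 h').1
  | _, _, .nil, .nil, _, _, _ => HEq.rfl
  | _, _, .snoc q t, .snoc q' t', d, h, h' => by
    have k : (strCell A p.join p'.join).cod (strJoin c).1 =
        (strCell A q.join q'.join).dom (strJoin d.1.1).1 :=
      (strJoin c).2.2.trans (Eq.trans h (strJoin d.1.1).2.1.symm)
    have k₁ := (strJoin d.1.1).2.2.trans d.2
    exact (heq_append (join_append p q) (join_append p' q') rfl rfl (strJoin_append c d.1.1 h k)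
      HEq.rfl _ ((strAppend (strJoin c).1 (strJoin d.1.1).1 k).2.2.trans k₁)).trans
      (strAppend_assoc (strJoin c).1 (strJoin d.1.1).1 k d.1.2 _ k₁ h')
  | _, _, .nil, .snoc _ _, d, _, _ => d.elim
  | _, _, .snoc _ _, .nil, d, _, _ => d.elim

theorem join_join {x : A.Ob} : ∀ {y : A.Ob} (p : Str (freeGraph (freeGraph A)).Hor x y),
    (Str.join (GraphHom.mapStr (freeMul A) p) : Str A.Hor x y) =
      Str.join (Str.join p : Str (freeGraph A).Hor x y)
  | _, .nil => rfl
  | _, .snoc p q => (congrArg (fun a => Str.append a (Str.join q)) (join_join p)).trans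
      (join_append (Str.join p) q).symm

theorem strJoin_strJoin {x x' : A.Ob} : ∀ {y y' : A.Ob}
    {p : Str (freeGraph (freeGraph A)).Hor x y} {q : Str (freeGraph (freeGraph A)).Hor x' y'}
    (c : (strCell (freeGraph (freeGraph A)) p q).T),
    (strJoin (GraphHom.mapCell (freeMul A) c).1).1 ≍
      (strJoin (D := A) (strJoin (D := freeGraph A) c).1).1
  | _, _, .nil, .nil, _ => HEq.rfl
  | _, _, .snoc p a, .snoc q b, c => by
    have h := (strJoin (D := freeGraph A) c.1.1).2.2.trans c.2
    have h' := (strJoin (D := A) (strJoin (D := freeGraph A) c.1.1).1).2.2.trans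
      (h.trans (strJoin (D := A) c.1.2).2.1.symm)
    exact (heq_append (join_join p) (join_join q) rfl rfl (strJoin_strJoin c.1.1)
      HEq.rfl _ h').trans (strJoin_append (strJoin (D := freeGraph A) c.1.1).1 c.1.2 h h').symm
  | _, _, .nil, .snoc _ _, c => c.elim
  | _, _, .snoc _ _, .nil, c => c.elim

theorem strApp_append {F K : A ⟶ B} (θ : F ⟶ K) {x y : A.Ob} (p : Str A.Hor x y) : ∀ {z : A.Ob}
    (q : Str A.Hor y z) (h : (strCell B (GraphHom.mapStr F p) (GraphHom.mapStr K p)).cod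
      (GraphCell.strApp θ p).1 = (strCell B (GraphHom.mapStr F q) (GraphHom.mapStr K q)).dom
        (GraphCell.strApp θ q).1),
    (GraphCell.strApp θ (p.append q)).1 ≍
      (strAppend (GraphCell.strApp θ p).1 (GraphCell.strApp θ q).1 h).1
  | _, .nil, _ => HEq.rfl
  | _, .snoc q r, h => heq_snoc (mapStr_append F p q) (mapStr_append K p q)
      (strApp_append θ p q h) (GraphCell.app₁ θ ⟨r⟩) _ _

theorem strApp_strApp {F K : A ⟶ B} (θ : F ⟶ K) {x : A.Ob} : ∀ {y : A.Ob}
    (p : Str (freeGraph A).Hor x y),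
    (strJoin (GraphCell.strApp (freeMap₂ θ) p).1).1 ≍ (GraphCell.strApp θ (Str.join p)).1
  | _, .nil => HEq.rfl
  | _, .snoc p q => by
    have h := (GraphCell.strApp θ (Str.join p)).2.2.trans (GraphCell.strApp θ q).2.1.symm
    exact (heq_append (join_mapStr F p) (join_mapStr K p) rfl rfl (strApp_strApp θ p) HEq.rfl
      _ h).trans (strApp_append θ (Str.join p) q h).symm

theorem freeUnit_nat (F : A ⟶ B) : F ≫ freeUnit B = freeUnit A ≫ freeMap F :=
  graphHom_ext rfl (fun _ => HEq.rfl)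
    (fun {_ _} φ => heq_of_eq (Subtype.ext (Prod.ext (GraphHom.dom_map₁ F φ) rfl)))

theorem freeMul_nat (F : A ⟶ B) : freeMap (freeMap F) ≫ freeMul B = freeMul A ≫ freeMap F :=
  graphHom_ext rfl (fun p => heq_of_eq (join_mapStr F p)) (fun c => strJoin_mapCell F c)

theorem graphCell_comp_eqToHom {F F' K K' : A ⟶ B} (hF : F = F')
    (hK : K = K') (θ : F ⟶ K) (κ : F' ⟶ K')
    (h₀ : ∀ x, GraphCell.app₀ θ x ≍ GraphCell.app₀ κ x)
    (h₁ : ∀ r, GraphCell.app₁ θ r ≍ GraphCell.app₁ κ r) :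
    θ ≫ eqToHom hK = eqToHom hF ≫ κ := by
  rw [graphCell_eq_conj hF hK θ κ h₀ h₁]
  simp

/-- The free internal category 2-monad `𝔉` on `Grph(Cat)`. -/
def freeMonad : TwoMonad Grph.{u, v} where
  T := freeFunctor
  e := freeUnit
  m := freeMul
  e_nat F := freeUnit_nat F
  e_nat₂ θ := graphCell_comp_eqToHom (freeUnit_nat _) (freeUnit_nat _) _ _ (fun _ => HEq.rfl)
    (fun r => heq_of_eq (Subtype.ext (Prod.ext (GraphCell.dom_app θ r) rfl)))
  m_nat F := freeMul_nat F
  m_nat₂ θ := graphCell_comp_eqToHom (freeMul_nat _) (freeMul_nat _) _ _ (fun _ => HEq.rfl)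
    (fun p => strApp_strApp θ p.hom)
  e_m _ := graphHom_ext rfl (fun p => heq_of_eq (nil_append p))
    (fun c => strAppend_nil _ c rfl)
  map_e_m _ := graphHom_ext rfl (fun p => heq_of_eq (join_unit p)) (fun c => strJoin_unit c)
  m_m _ := graphHom_ext rfl (fun p => heq_of_eq (join_join p)) (fun c => strJoin_strJoin c)

end monad


section comparison

variable {D E : Grph.{u, v}}

/-- The horizontal composite `rₙ · (⋯ (r₂ · (r₁ · 1)))` of a string. -/
def PseudoDblStr.eval (P : PseudoDblStr D) {x : D.Ob} : ∀ {y : D.Ob}, Str D.Hor x y → D.Hor x y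
  | _, .nil => P.one x
  | _, .snoc p r => P.comp r (P.eval p)

/-- The horizontal composite of a string of 2-cells. -/
def PseudoDblStr.evalCell (P : PseudoDblStr D) {x x' : D.Ob} : ∀ {y y' : D.Ob} {p : Str D.Hor x y}
    {q : Str D.Hor x' y'} (c : (strCell D p q).T),
    { φ : HObj.mk (P.eval p) ⟶ HObj.mk (P.eval q) // D.cod φ = (strCell D p q).cod c }
  | _, _, .nil, .nil, c => ⟨P.oneMap (x := x) (y := x') c, P.cod_oneMap _⟩
  | _, _, .snoc _ _, .snoc _ _, c => ⟨P.hcomp c.1.2 (P.evalCell c.1.1).1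
      (c.2.symm.trans (P.evalCell c.1.1).2.symm), P.cod_hcomp _ _ _⟩
  | _, _, .nil, .snoc _ _, c => c.elim
  | _, _, .snoc _ _, .nil, c => c.elim

/-- The comparison 2-cell of a lax functor for the composite of a string. -/
def LaxStr.eval {P : PseudoDblStr D} {Q : PseudoDblStr E} {F : D ⟶ E} (f : LaxStr P Q F)
    {x : D.Ob} : ∀ {y : D.Ob} (p : Str D.Hor x y),
    { φ : HObj.mk (Q.eval (GraphHom.mapStr F p)) ⟶ HObj.mk (F.obj₁ (P.eval p)) //
      E.cod φ = 𝟙 (F.F₀.obj y) }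
  | _, .nil => ⟨f.unit x, f.cod_unit x⟩
  | _, .snoc p r => ⟨Q.hcomp (𝟙 (HObj.mk (F.obj₁ r))) (f.eval p).1
      ((E.dom_id _).trans (f.eval p).2.symm) ≫ f.mul r (P.eval p),
      (E.cod_comp _ _).trans ((congrArg₂ (· ≫ ·) ((Q.cod_hcomp _ _ _).trans (E.cod_id _))
        (f.cod_mul r (P.eval p))).trans (Category.comp_id _))⟩

/-- The comparison 2-cell of an oplax functor for the composite of a string. -/
def OplaxStr.eval {P : PseudoDblStr D} {Q : PseudoDblStr E} {F : D ⟶ E} (f : OplaxStr P Q F)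
    {x : D.Ob} : ∀ {y : D.Ob} (p : Str D.Hor x y),
    { φ : HObj.mk (F.obj₁ (P.eval p)) ⟶ HObj.mk (Q.eval (GraphHom.mapStr F p)) //
      E.cod φ = 𝟙 (F.F₀.obj y) }
  | _, .nil => ⟨f.unit x, f.cod_unit x⟩
  | _, .snoc p r => ⟨f.mul r (P.eval p) ≫ Q.hcomp (𝟙 (HObj.mk (F.obj₁ r))) (f.eval p).1
      ((E.dom_id _).trans (f.eval p).2.symm),
      (E.cod_comp _ _).trans ((congrArg₂ (· ≫ ·) (f.cod_mul r (P.eval p))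
        ((Q.cod_hcomp _ _ _).trans (E.cod_id _))).trans (Category.comp_id _))⟩

/-- A double functor from pseudodouble categories to pseudo-`𝔉`-algebras, identical on underlying
graphs, graph morphisms and squares, is given by the usual formulas: `a` sends a string of
horizontal 1-cells or of 2-cells to its horizontal composite `rₙ · (⋯ (r₁ · 1))`, `η` is the inverse
right unitor, and the algebra morphism of an (op)lax functor is its comparison 2-cell for the
composites of strings. -/
structure IsEvalFunctor (Φ : DispDbl.DFunctor psDb.{u, v} (psAlg freeMonad.{u, v})) : Prop where
  obj₁ : ∀ {D : Grph.{u, v}} (P : PseudoDblStr D) {x y : D.Ob} (p : Str D.Hor x y),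
    GraphHom.obj₁ (D := freeGraph D) (Φ.obj P).1.a p ≍ P.eval p
  map₁ : ∀ {D : Grph.{u, v}} (P : PseudoDblStr D) {x y x' y' : D.Ob} {p : Str D.Hor x y}
    {q : Str D.Hor x' y'} (c : (strCell D p q).T),
    GraphHom.map₁ (D := freeGraph D) (Φ.obj P).1.a
      (show (HObj.mk p : (freeGraph D).One) ⟶ HObj.mk q from c) ≍ (P.evalCell c).1
  η₁ : ∀ {D : Grph.{u, v}} (P : PseudoDblStr D) {x y : D.Ob} (r : D.Hor x y),
    GraphCell.app₁ (Φ.obj P).1.η ⟨r⟩ ≍ (P.rho r).inv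
  φ₁ : ∀ {D E : Grph.{u, v}} {P : PseudoDblStr D} {Q : PseudoDblStr E} {F : D ⟶ E}
    (f : LaxStr P Q F) {x y : D.Ob} (p : Str D.Hor x y),
    GraphCell.app₁ (D := freeGraph D) (Φ.hmap f).φ ⟨p⟩ ≍ (f.eval p).1
  ζ₁ : ∀ {D E : Grph.{u, v}} {P : PseudoDblStr D} {Q : PseudoDblStr E} {F : D ⟶ E}
    (f : OplaxStr P Q F) {x y : D.Ob} (p : Str D.Hor x y),
    GraphCell.app₁ (D := freeGraph D) (Φ.vmap f).ζ ⟨p⟩ ≍ (f.eval p).1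

/-- An algebra for `𝔉` is normal if its structure map is the identity on 0-cells and vertical
1-cells and its unit 2-cell `η` is the identity there. -/
structure LaxAlg.IsNormal (A : LaxAlg freeMonad D) : Prop where
  a_eq : GraphHom.F₀ (D := freeGraph D) (E := D) A.a = 𝟭 D.Ob
  η_eq : ∀ x : D.Ob, GraphCell.app₀ A.η x ≍ 𝟙 x

/-- A double functor whose values on objects satisfy `p` corestricts to the full sub-double
category given by `p`. -/
def DispDbl.DFunctor.corestrict {𝒳 𝒴 : DispDbl.{u, v}} (Φ : DispDbl.DFunctor 𝒳 𝒴)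
    (p : ∀ A : Grph.{u, v}, 𝒴.Ob A → Prop) (h : ∀ {A : Grph.{u, v}} (X : 𝒳.Ob A), p A (Φ.obj X)) :
    DispDbl.DFunctor 𝒳 (𝒴.full p) where
  obj X := ⟨Φ.obj X, h X⟩
  hmap f := Φ.hmap f
  hmap_id X := Φ.hmap_id X
  hmap_comp f k := Φ.hmap_comp f k
  vmap f := Φ.vmap f
  vmap_id X := Φ.vmap_id X
  vmap_comp f k := Φ.vmap_comp f k
  cell c := Φ.cell c

/-- Algebra 2-cells between lax algebra morphisms. -/
def IsAlgTransf {M : TwoMonad Grph.{u, v}} {A : LaxAlg M D} {A' : LaxAlg M E} {F K : D ⟶ E}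
    (f : LaxMor A A' F) (k : LaxMor A A' K) (θ : F ⟶ K) : Prop :=
  IsAlgCell f (OplaxMor.id A) (OplaxMor.id A') k θ

/-- Two algebras are equivalent: there are pseudomorphisms `f : A → A'`, `k : A' → A` and
invertible algebra 2-cells `1 ≅ k f`, `f k ≅ 1`. -/
def LaxAlg.Equivalent {M : TwoMonad Grph.{u, v}} (A : LaxAlg M D) (A' : LaxAlg M E) : Prop :=
  ∃ (F : D ⟶ E) (K : E ⟶ D) (f : LaxMor A A' F) (k : LaxMor A' A K), IsIso f.φ ∧ IsIso k.φ ∧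
    (∃ θ : 𝟙 D ≅ F ≫ K, IsAlgTransf (LaxMor.id A) (f.comp k) θ.hom) ∧
    (∃ κ : K ≫ F ≅ 𝟙 E, IsAlgTransf (k.comp f) (LaxMor.id A') κ.hom)

end comparison

end DblPsAlg

open DblPsAlg

attribute [reducible] DblPsAlg.PseudoDblStr.eval DblPsAlg.Str.append DblPsAlg.Str.join
  DblPsAlg.GraphHom.mapStr DblPsAlg.strCell DblPsAlg.freeGraph DblPsAlg.freeUnit DblPsAlg.freeMul
  DblPsAlg.freeMap

namespace DblPsAlg

section basic

variable {D : CatGraph.{u₀, v₀, u₁, v₁}}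

/-- The vertically globular 2-cell between equal horizontal 1-cells. -/
def eqCell {x y : D.Ob} {r s : D.Hor x y} (h : r = s) : HObj.mk r ⟶ HObj.mk s :=
  eqToHom (congrArg HObj.mk h)

@[simp] theorem eqCell_refl {x y : D.Ob} (r : D.Hor x y) : eqCell (rfl : r = r) = 𝟙 _ := rfl

@[simp] theorem dom_eqCell {x y : D.Ob} {r s : D.Hor x y} (h : r = s) :
    D.dom (eqCell h) = 𝟙 x := by subst h; simp

@[simp] theorem cod_eqCell {x y : D.Ob} {r s : D.Hor x y} (h : r = s) :
    D.cod (eqCell h) = 𝟙 y := by subst h; simp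

@[simp] theorem eqCell_trans {x y : D.Ob} {r s t : D.Hor x y} (h : r = s) (h' : s = t) :
    eqCell h ≫ eqCell h' = eqCell (h.trans h') := by subst h h'; simp

@[simp] theorem eqCell_trans_assoc {x y : D.Ob} {r s t : D.Hor x y} (h : r = s) (h' : s = t)
    {w : D.One} (f : HObj.mk t ⟶ w) :
    eqCell h ≫ eqCell h' ≫ f = eqCell (h.trans h') ≫ f := by subst h h'; simp

instance {x y : D.Ob} {r s : D.Hor x y} (h : r = s) : IsIso (eqCell h) := by
  subst h; rw [eqCell_refl]; infer_instance

theorem CatGraph.dom_inv_eq_cod_inv {x y z x' y' z' : D.Ob} {s : D.Hor y z} {r : D.Hor x y}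
    {s' : D.Hor y' z'} {r' : D.Hor x' y'} (ψ : HObj.mk s ⟶ HObj.mk s')
    (φ : HObj.mk r ⟶ HObj.mk r') [IsIso ψ] [IsIso φ] (h : D.dom ψ = D.cod φ) :
    D.dom (inv ψ) = D.cod (inv φ) := by
  have e : D.domFunctor.map ψ = D.codFunctor.map φ := h
  change D.domFunctor.map (inv ψ) = D.codFunctor.map (inv φ)
  rw [Functor.map_inv, Functor.map_inv]
  congr 1

theorem CatGraph.dom_isoInv {x y z : D.Ob} {r : D.Hor x y} {s : D.Hor x z}
    (φ : HObj.mk r ≅ HObj.mk s) (h : D.dom φ.hom = 𝟙 x) : D.dom φ.inv = 𝟙 x := by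
  have e := congrArg D.dom φ.hom_inv_id
  rw [D.dom_comp, h, D.dom_id] at e
  exact (Category.id_comp _).symm.trans e

theorem CatGraph.cod_isoInv {x y z : D.Ob} {r : D.Hor y x} {s : D.Hor z x}
    (φ : HObj.mk r ≅ HObj.mk s) (h : D.cod φ.hom = 𝟙 x) : D.cod φ.inv = 𝟙 x := by
  have e := congrArg D.cod φ.hom_inv_id
  rw [D.cod_comp, h, D.cod_id] at e
  exact (Category.id_comp _).symm.trans e

theorem eqToHom_app₀ {E : CatGraph.{u₀, v₀, u₁, v₁}} {F K : D ⟶ E} (h : F = K) (x : D.Ob) :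
    GraphCell.app₀ (eqToHom h) x = eqToHom (by rw [h]) := by
  subst h; rfl

theorem eqToHom_app₁ {E : CatGraph.{u₀, v₀, u₁, v₁}} {F K : D ⟶ E} (h : F = K) (r : D.One) :
    GraphCell.app₁ (eqToHom h) r = eqToHom (by rw [h]) := by
  subst h; rfl

/-- A 2-cell of graphs is invertible if its components are. -/
theorem GraphCell.isIso_of_app {E : CatGraph.{u₀, v₀, u₁, v₁}} {F K : D ⟶ E} (θ : F ⟶ K)
    (h₀ : ∀ x, IsIso (GraphCell.app₀ θ x)) (h₁ : ∀ r, IsIso (GraphCell.app₁ θ r)) : IsIso θ := by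
  refine ⟨⟨{ app₀ := fun x => inv (GraphCell.app₀ θ x)
             app₁ := fun r => inv (GraphCell.app₁ θ r)
             nat₀ := fun f => ?_
             nat₁ := fun φ => ?_
             dom_app := fun r => ?_
             cod_app := fun r => ?_ }, ?_, ?_⟩⟩
  · rw [IsIso.comp_inv_eq, Category.assoc, IsIso.eq_inv_comp]
    exact (GraphCell.nat₀ θ f).symm
  · rw [IsIso.comp_inv_eq, Category.assoc, IsIso.eq_inv_comp]
    exact (GraphCell.nat₁ θ φ).symm
  · refine (E.domFunctor.map_inv (GraphCell.app₁ θ r)).trans ?_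
    congr 1
    exact GraphCell.dom_app θ r
  · refine (E.codFunctor.map_inv (GraphCell.app₁ θ r)).trans ?_
    congr 1
    exact GraphCell.cod_app θ r
  · exact graphCell_ext (fun x => IsIso.hom_inv_id _) (fun r => IsIso.hom_inv_id _)
  · exact graphCell_ext (fun x => IsIso.inv_hom_id _) (fun r => IsIso.inv_hom_id _)

instance GraphCell.isIso_app₀ {E : CatGraph.{u₀, v₀, u₁, v₁}} {F K : D ⟶ E} (θ : F ⟶ K) [IsIso θ]
    (x : D.Ob) : IsIso (GraphCell.app₀ θ x) :=
  ⟨⟨GraphCell.app₀ (inv θ) x,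
    congrArg (fun κ : F ⟶ F => GraphCell.app₀ κ x) (IsIso.hom_inv_id θ),
    congrArg (fun κ : K ⟶ K => GraphCell.app₀ κ x) (IsIso.inv_hom_id θ)⟩⟩

instance GraphCell.isIso_app₁ {E : CatGraph.{u₀, v₀, u₁, v₁}} {F K : D ⟶ E} (θ : F ⟶ K) [IsIso θ]
    (r : D.One) : IsIso (GraphCell.app₁ θ r) :=
  ⟨⟨GraphCell.app₁ (inv θ) r,
    congrArg (fun κ : F ⟶ F => GraphCell.app₁ κ r) (IsIso.hom_inv_id θ),
    congrArg (fun κ : K ⟶ K => GraphCell.app₁ κ r) (IsIso.inv_hom_id θ)⟩⟩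

namespace PseudoDblStr

variable (P : PseudoDblStr D)

theorem hcomp_hcomp {x y z x' y' z' x'' y'' z'' : D.Ob} {s : D.Hor y z} {r : D.Hor x y}
    {s' : D.Hor y' z'} {r' : D.Hor x' y'} {s'' : D.Hor y'' z''} {r'' : D.Hor x'' y''}
    (ψ : HObj.mk s ⟶ HObj.mk s') (φ : HObj.mk r ⟶ HObj.mk r') (h : D.dom ψ = D.cod φ)
    (ψ' : HObj.mk s' ⟶ HObj.mk s'') (φ' : HObj.mk r' ⟶ HObj.mk r'') (h' : D.dom ψ' = D.cod φ') :
    P.hcomp ψ φ h ≫ P.hcomp ψ' φ' h' = P.hcomp (ψ ≫ ψ') (φ ≫ φ') (by simp [h, h']) :=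
  (P.hcomp_comp ψ φ h ψ' φ' h').symm

theorem hcomp_hcomp_assoc {x y z x' y' z' x'' y'' z'' : D.Ob} {s : D.Hor y z} {r : D.Hor x y}
    {s' : D.Hor y' z'} {r' : D.Hor x' y'} {s'' : D.Hor y'' z''} {r'' : D.Hor x'' y''}
    (ψ : HObj.mk s ⟶ HObj.mk s') (φ : HObj.mk r ⟶ HObj.mk r') (h : D.dom ψ = D.cod φ)
    (ψ' : HObj.mk s' ⟶ HObj.mk s'') (φ' : HObj.mk r' ⟶ HObj.mk r'') (h' : D.dom ψ' = D.cod φ')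
    {w : D.One} (χ : HObj.mk (P.comp s'' r'') ⟶ w) :
    P.hcomp ψ φ h ≫ P.hcomp ψ' φ' h' ≫ χ =
      P.hcomp (ψ ≫ ψ') (φ ≫ φ') (by simp [h, h']) ≫ χ := by
  rw [P.hcomp_comp ψ φ h ψ' φ' h', Category.assoc]

instance isIso_hcomp {x y z x' y' z' : D.Ob} {s : D.Hor y z} {r : D.Hor x y}
    {s' : D.Hor y' z'} {r' : D.Hor x' y'}
    (ψ : HObj.mk s ⟶ HObj.mk s') (φ : HObj.mk r ⟶ HObj.mk r') (h : D.dom ψ = D.cod φ)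
    [IsIso ψ] [IsIso φ] : IsIso (P.hcomp ψ φ h) := by
  refine ⟨⟨P.hcomp (inv ψ) (inv φ) (CatGraph.dom_inv_eq_cod_inv ψ φ h), ?_, ?_⟩⟩
  · rw [P.hcomp_hcomp]; simp
  · rw [P.hcomp_hcomp]; simp

@[simp] theorem dom_rho_inv {x y : D.Ob} (r : D.Hor x y) : D.dom (P.rho r).inv = 𝟙 x :=
  CatGraph.dom_isoInv _ (P.dom_rho r)

@[simp] theorem cod_rho_inv {x y : D.Ob} (r : D.Hor x y) : D.cod (P.rho r).inv = 𝟙 y :=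
  CatGraph.cod_isoInv _ (P.cod_rho r)

end PseudoDblStr

end basic

section evaluation

variable {D : Grph.{u, v}}

namespace PseudoDblStr

theorem dom_evalCell (P : PseudoDblStr D) {x x' : D.Ob} : ∀ {y y' : D.Ob} {p : Str D.Hor x y}
    {q : Str D.Hor x' y'} (c : (strCell D p q).T), D.dom (P.evalCell c).1 = (strCell D p q).dom c
  | _, _, .nil, .nil, _ => P.dom_oneMap _
  | _, _, .snoc _ _, .snoc _ _, c => (P.dom_hcomp _ _ _).trans (P.dom_evalCell c.1.1)
  | _, _, .nil, .snoc _ _, c => c.elim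
  | _, _, .snoc _ _, .nil, c => c.elim

theorem evalCell_id (P : PseudoDblStr D) {x : D.Ob} : ∀ {y : D.Ob} (p : Str D.Hor x y),
    (P.evalCell (strId p).1).1 = 𝟙 _
  | _, .nil => P.oneMap_id x
  | _, .snoc p r => (P.hcomp_congr rfl (P.evalCell_id p) _
      ((D.dom_id ⟨r⟩).trans (D.cod_id ⟨P.eval p⟩).symm)).trans (P.hcomp_id _ _)

theorem evalCell_comp (P : PseudoDblStr D) {x x' x'' : D.Ob} : ∀ {y y' y'' : D.Ob}
    {p : Str D.Hor x y} {q : Str D.Hor x' y'} {t : Str D.Hor x'' y''} (c : (strCell D p q).T)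
    (d : (strCell D q t).T),
    (P.evalCell (strComp c d).1).1 = (P.evalCell c).1 ≫ (P.evalCell d).1
  | _, _, _, .nil, .nil, .nil, c, d => P.oneMap_comp (x := _) (y := _) (z := _) c d
  | _, _, _, .snoc _ _, .snoc _ _, .snoc _ _, c, d =>
    (P.hcomp_congr rfl (P.evalCell_comp c.1.1 d.1.1) _
      ((D.dom_comp c.1.2 d.1.2).trans (by
        rw [D.cod_comp, (P.evalCell c.1.1).2, (P.evalCell d.1.1).2, c.2, d.2]))).trans
      (P.hcomp_comp _ _ _ _ _ _)
  | _, _, _, .nil, .snoc _ _, _, c, _ => c.elim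
  | _, _, _, .snoc _ _, .nil, _, c, _ => c.elim
  | _, _, _, .nil, .nil, .snoc _ _, _, d => d.elim
  | _, _, _, .snoc _ _, .snoc _ _, .nil, _, d => d.elim

/-- Composition of strings, as a morphism of graphs. -/
abbrev evalHom (P : PseudoDblStr D) : freeGraph D ⟶ D where
  F₀ := { obj := fun x => x, map := fun f => f }
  obj₁ p := P.eval p
  map₁ c := (P.evalCell c).1
  map₁_id p := P.evalCell_id p.hom
  map₁_comp c d := P.evalCell_comp c d
  dom_map₁ c := P.dom_evalCell c
  cod_map₁ c := (P.evalCell c).2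

/-- The 2-cell between the composites of equal strings. -/
abbrev evalEq (P : PseudoDblStr D) {x y : D.Ob} {p q : Str D.Hor x y} (h : p = q) :
    HObj.mk (P.eval p) ⟶ HObj.mk (P.eval q) := eqCell (congrArg P.eval h)

theorem evalEq_snoc (P : PseudoDblStr D) {x y z : D.Ob} {p q : Str D.Hor x y} (r : D.Hor y z) (h : p = q)
    (h' : p.snoc r = q.snoc r) :
    P.evalEq h' = P.hcomp (𝟙 (HObj.mk r)) (P.evalEq h) (by simp) := by
  subst h; exact (P.hcomp_id _ _).symm

/-- The comparison between the composite of the composites of two strings and the composite of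
their concatenation. -/
def nu (P : PseudoDblStr D) {x y : D.Ob} (p : Str D.Hor x y) : ∀ {z : D.Ob} (q : Str D.Hor y z),
    { φ : HObj.mk (P.comp (P.eval q) (P.eval p)) ⟶ HObj.mk (P.eval (p.append q)) //
      D.dom φ = 𝟙 x ∧ D.cod φ = 𝟙 z }
  | _, .nil => ⟨(P.lam _).hom, P.dom_lam _, P.cod_lam _⟩
  | _, .snoc q r => ⟨(P.alpha r (P.eval q) (P.eval p)).hom ≫
      P.hcomp (𝟙 (HObj.mk r)) (P.nu p q).1 ((D.dom_id _).trans (P.nu p q).2.2.symm),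
      by
        rw [D.dom_comp, P.dom_alpha, P.dom_hcomp, (P.nu p q).2.1]; exact Category.id_comp _, by
        rw [D.cod_comp, P.cod_alpha, P.cod_hcomp, D.cod_id]; exact Category.id_comp _⟩

@[simp] theorem dom_nu (P : PseudoDblStr D) {x y z : D.Ob} (p : Str D.Hor x y) (q : Str D.Hor y z) :
    D.dom (P.nu p q).1 = 𝟙 x := (P.nu p q).2.1

@[simp] theorem cod_nu (P : PseudoDblStr D) {x y z : D.Ob} (p : Str D.Hor x y) (q : Str D.Hor y z) :
    D.cod (P.nu p q).1 = 𝟙 z := (P.nu p q).2.2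

theorem nu_snoc (P : PseudoDblStr D) {x y z w : D.Ob} (p : Str D.Hor x y) (q : Str D.Hor y z) (r : D.Hor z w) :
    (P.nu p (q.snoc r)).1 = (P.alpha r (P.eval q) (P.eval p)).hom ≫
      P.hcomp (𝟙 (HObj.mk r)) (P.nu p q).1 (by simp) := rfl

instance isIso_nu (P : PseudoDblStr D) {x y : D.Ob} (p : Str D.Hor x y) : ∀ {z : D.Ob} (q : Str D.Hor y z),
    IsIso (P.nu p q).1
  | _, .nil => inferInstanceAs (IsIso (P.lam _).hom)
  | _, .snoc q r => by
    have := P.isIso_nu p q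
    rw [nu_snoc]
    infer_instance

theorem nu_nat (P : PseudoDblStr D) {x y x' y' : D.Ob} {p : Str D.Hor x y} {p' : Str D.Hor x' y'}
    (c : (strCell D p p').T) : ∀ {z z' : D.Ob} {q : Str D.Hor y z} {q' : Str D.Hor y' z'}
    (d : (strCell D q q').T) (h : (strCell D p p').cod c = (strCell D q q').dom d)
    (h' : D.dom (P.evalCell d).1 = D.cod (P.evalCell c).1),
    P.hcomp (P.evalCell d).1 (P.evalCell c).1 h' ≫ (P.nu p' q').1 =
      (P.nu p q).1 ≫ (P.evalCell (strAppend c d h).1).1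
  | _, _, .nil, .nil, d, h, h' => by
    refine Eq.trans ?_ (P.lam_nat (P.evalCell c).1)
    refine congrArg (· ≫ _) (P.hcomp_congr ?_ rfl _ _)
    exact congrArg P.oneMap (h.symm.trans (P.evalCell c).2.symm)
  | _, _, .snoc q r, .snoc q' r', d, h, h' => by
    have k : D.dom (P.evalCell d.1.1).1 = D.cod (P.evalCell c).1 :=
      (P.dom_evalCell d.1.1).trans (h.symm.trans (P.evalCell c).2.symm)
    have k' : D.dom d.1.2 = D.cod (P.evalCell d.1.1).1 := d.2.symm.trans (P.evalCell d.1.1).2.symm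
    have k'' : D.dom d.1.2 = D.cod (P.evalCell (strAppend c d.1.1 h).1).1 :=
      d.2.symm.trans ((strAppend c d.1.1 h).2.2.symm.trans (P.evalCell _).2.symm)
    have e := P.nu_nat c d.1.1 h k
    change P.hcomp (P.hcomp d.1.2 (P.evalCell d.1.1).1 k') (P.evalCell c).1 _ ≫
      (P.alpha _ _ _).hom ≫ P.hcomp (𝟙 _) (P.nu p' q').1 _ =
      ((P.alpha _ _ _).hom ≫ P.hcomp (𝟙 _) (P.nu p q).1 _) ≫
      P.hcomp d.1.2 (P.evalCell (strAppend c d.1.1 h).1).1 k''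
    rw [← Category.assoc, P.alpha_nat _ _ _ k' k, Category.assoc, Category.assoc,
      P.hcomp_hcomp, P.hcomp_hcomp]
    refine congrArg (_ ≫ ·) (P.hcomp_congr ?_ e _ _)
    rw [Category.comp_id, Category.id_comp]
  | _, _, .nil, .snoc _ _, d, _, _ => d.elim
  | _, _, .snoc _ _, .nil, d, _, _ => d.elim

theorem nu_nil_left (P : PseudoDblStr D) {x : D.Ob} : ∀ {y : D.Ob} (p : Str D.Hor x y),
    (P.nu .nil p).1 = (P.rho (P.eval p)).hom ≫ P.evalEq (nil_append p).symm
  | _, .nil => by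
    have e := P.unit_unit x
    rw [Iso.comp_inv_eq, Category.id_comp] at e
    exact e.trans (Category.comp_id _).symm
  | _, .snoc p r => by
    rw [nu_snoc, P.evalEq_snoc r (nil_append p).symm]
    simp only [P.nu_nil_left p]
    have e := P.right_right r (P.eval p)
    change _ ≫ P.hcomp _ (_ ≫ _) _ = (P.rho (P.comp r (P.eval p))).hom ≫ _
    rw [← e, Category.assoc, P.hcomp_hcomp]
    refine congrArg (_ ≫ ·) (P.hcomp_congr ?_ rfl _ _)
    rw [Category.comp_id]

theorem nu_singleton (P : PseudoDblStr D) {x y z : D.Ob} (p : Str D.Hor x y) (r : D.Hor y z) :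
    (P.nu p (Str.nil.snoc r)).1 = P.hcomp (P.rho r).hom (𝟙 (HObj.mk (P.eval p))) (by simp) :=
  P.triangle r (P.eval p)

theorem nu_eqCell (P : PseudoDblStr D) {x y z : D.Ob} {p p' : Str D.Hor x y} {q q' : Str D.Hor y z} (h : p = p')
    (h' : q = q') (h'' : D.dom (P.evalEq h') = D.cod (P.evalEq h)) :
    P.hcomp (P.evalEq h') (P.evalEq h) h'' ≫ (P.nu p' q').1 =
      (P.nu p q).1 ≫ P.evalEq (congrArg₂ (fun a b => Str.append a b) h h') := by
  subst h h'
  simp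

theorem nu_assoc (P : PseudoDblStr D) {x y z : D.Ob} (p : Str D.Hor x y) (q : Str D.Hor y z) : ∀ {w : D.Ob}
    (t : Str D.Hor z w),
    P.hcomp (P.nu q t).1 (𝟙 (HObj.mk (P.eval p))) (by simp) ≫ (P.nu p (q.append t)).1 =
    (P.alpha (P.eval t) (P.eval q) (P.eval p)).hom ≫
      P.hcomp (𝟙 (HObj.mk (P.eval t))) (P.nu p q).1 (by simp) ≫ (P.nu (p.append q) t).1 ≫
      P.evalEq (append_assoc p q t)
  | _, .nil => by
    have e₁ := P.lam_nat (P.nu p q).1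
    have e₂ := P.left_left (P.eval q) (P.eval p)
    change P.hcomp (P.lam _).hom (𝟙 _) _ ≫ (P.nu p q).1 = (P.alpha (P.one _) _ _).hom ≫
      P.hcomp (𝟙 (HObj.mk (P.one _))) (P.nu p q).1 _ ≫ (P.lam _).hom ≫ 𝟙 _
    rw [← e₂, Category.assoc, ← e₁, Category.comp_id]
    refine congrArg (fun t => _ ≫ t ≫ _) (P.hcomp_congr ?_ rfl _ _)
    rw [cod_nu, P.oneMap_id]
  | _, .snoc t r => by
    have e := P.nu_assoc p q t
    have e₁ := P.pentagon r (P.eval t) (P.eval q) (P.eval p)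
    have e₂ := P.alpha_nat (𝟙 (HObj.mk r)) (P.nu q t).1 (𝟙 (HObj.mk (P.eval p))) (by simp)
      (by simp)
    rw [P.evalEq_snoc r (append_assoc p q t)]
    change P.hcomp ((P.alpha _ _ _).hom ≫ P.hcomp (𝟙 (HObj.mk r)) (P.nu q t).1 _) (𝟙 _) _ ≫
      (P.alpha _ _ _).hom ≫ P.hcomp (𝟙 (HObj.mk r)) (P.nu p (q.append t)).1 _ =
      (P.alpha _ _ _).hom ≫ P.hcomp (𝟙 (HObj.mk (P.comp r (P.eval t)))) (P.nu p q).1 _ ≫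
      ((P.alpha _ _ _).hom ≫ P.hcomp (𝟙 (HObj.mk r)) (P.nu (p.append q) t).1 _) ≫
      P.hcomp (𝟙 (HObj.mk r)) _ _
    have e₃ := P.alpha_nat (𝟙 (HObj.mk r)) (𝟙 (HObj.mk (P.eval t))) (P.nu p q).1 (by simp)
      (by simp)
    simp only [P.hcomp_id] at e₃
    have e₄ : P.hcomp ((P.alpha r (P.eval t) (P.eval q)).hom ≫
        P.hcomp (𝟙 (HObj.mk r)) (P.nu q t).1 (by simp)) (𝟙 (HObj.mk (P.eval p))) (by simp) =
      P.hcomp (P.alpha r (P.eval t) (P.eval q)).hom (𝟙 (HObj.mk (P.eval p))) (by simp) ≫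
      P.hcomp (P.hcomp (𝟙 (HObj.mk r)) (P.nu q t).1 (by simp)) (𝟙 (HObj.mk (P.eval p)))
        (by simp) := by
      rw [P.hcomp_hcomp]
      exact P.hcomp_congr rfl (Category.comp_id _).symm _ _
    rw [e₄, Category.assoc, reassoc_of% e₂, Category.assoc, reassoc_of% e₃, reassoc_of% e₁]
    refine congrArg (fun t => _ ≫ _ ≫ t) ?_
    rw [P.hcomp_hcomp, P.hcomp_hcomp, P.hcomp_hcomp, P.hcomp_hcomp]
    refine P.hcomp_congr ?_ ?_ _ _
    · simp
    · rw [e]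

end PseudoDblStr

end evaluation

section evaluation

variable {D : Grph.{u, v}}

namespace PseudoDblStr

/-- The comparison between the composite of the composites of a string of strings and the composite
of its concatenation. -/
def mu (P : PseudoDblStr D) {x : D.Ob} : ∀ {y : D.Ob} (S : Str (freeGraph D).Hor x y),
    { φ : HObj.mk (P.eval (GraphHom.mapStr P.evalHom S)) ⟶ HObj.mk (P.eval S.join) //
      D.dom φ = 𝟙 x ∧ D.cod φ = 𝟙 y }
  | _, .nil => ⟨𝟙 _, D.dom_id _, D.cod_id _⟩
  | _, .snoc S q => ⟨P.hcomp (𝟙 (HObj.mk (P.eval q))) (P.mu S).1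
        ((D.dom_id _).trans (P.mu S).2.2.symm) ≫ (P.nu S.join q).1, by
      rw [D.dom_comp, P.dom_hcomp, (P.mu S).2.1, dom_nu]; exact Category.id_comp _, by
      rw [D.cod_comp, P.cod_hcomp, D.cod_id, cod_nu]; exact Category.id_comp _⟩

@[simp] theorem dom_mu (P : PseudoDblStr D) {x y : D.Ob} (S : Str (freeGraph D).Hor x y) :
    D.dom (P.mu S).1 = 𝟙 x := (P.mu S).2.1

@[simp] theorem cod_mu (P : PseudoDblStr D) {x y : D.Ob} (S : Str (freeGraph D).Hor x y) :
    D.cod (P.mu S).1 = 𝟙 y := (P.mu S).2.2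

theorem mu_snoc (P : PseudoDblStr D) {x y z : D.Ob} (S : Str (freeGraph D).Hor x y)
    (q : Str D.Hor y z) : (P.mu (S.snoc q)).1 =
      P.hcomp (𝟙 (HObj.mk (P.eval q))) (P.mu S).1 (by simp) ≫ (P.nu S.join q).1 := rfl

instance isIso_mu (P : PseudoDblStr D) {x : D.Ob} : ∀ {y : D.Ob} (S : Str (freeGraph D).Hor x y),
    IsIso (P.mu S).1
  | _, .nil => inferInstanceAs (IsIso (𝟙 _))
  | _, .snoc S q => by
    have := P.isIso_mu S
    rw [mu_snoc]
    infer_instance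

theorem mu_nat (P : PseudoDblStr D) {x x' : D.Ob} : ∀ {y y' : D.Ob}
    {S : Str (freeGraph D).Hor x y} {S' : Str (freeGraph D).Hor x' y'}
    (c : (strCell (freeGraph D) S S').T),
    (P.evalCell (GraphHom.mapCell P.evalHom c).1).1 ≫ (P.mu S').1 =
      (P.mu S).1 ≫ (P.evalCell (strJoin c).1).1
  | _, _, .nil, .nil, _ => (Category.comp_id _).trans (Category.id_comp _).symm
  | _, _, .snoc S q, .snoc S' q', c => by
    have k₁ : (strCell D S.join S'.join).cod (strJoin c.1.1).1 = (strCell D q q').dom c.1.2 :=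
      (strJoin c.1.1).2.2.trans c.2
    have k₂ : D.dom (P.evalCell c.1.2).1 = D.cod (P.evalCell (strJoin c.1.1).1).1 :=
      (P.dom_evalCell c.1.2).trans (k₁.symm.trans (P.evalCell _).2.symm)
    have k₃ : D.dom (P.evalCell c.1.2).1 =
        D.cod (P.evalCell (GraphHom.mapCell P.evalHom c.1.1).1).1 :=
      (P.dom_evalCell c.1.2).trans (c.2.symm.trans
        ((GraphHom.mapCell P.evalHom c.1.1).2.2.symm.trans (P.evalCell _).2.symm))
    have e₁ := P.mu_nat c.1.1
    have e₂ := P.nu_nat (strJoin c.1.1).1 c.1.2 k₁ k₂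
    change P.hcomp (P.evalCell c.1.2).1 (P.evalCell (GraphHom.mapCell P.evalHom c.1.1).1).1 k₃ ≫
      P.hcomp (𝟙 _) (P.mu S').1 (by simp) ≫ (P.nu S'.join q').1 =
      (P.hcomp (𝟙 _) (P.mu S).1 (by simp) ≫ (P.nu S.join q).1) ≫
        (P.evalCell (strAppend (strJoin c.1.1).1 c.1.2 k₁).1).1
    rw [Category.assoc, ← e₂, P.hcomp_hcomp_assoc, P.hcomp_hcomp_assoc]
    refine congrArg (· ≫ _) (P.hcomp_congr ?_ e₁ _ _)
    rw [Category.comp_id, Category.id_comp]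
  | _, _, .nil, .snoc _ _, c => c.elim
  | _, _, .snoc _ _, .nil, c => c.elim

theorem mu_append (P : PseudoDblStr D) {x y : D.Ob} (S : Str (freeGraph D).Hor x y) :
    ∀ {z : D.Ob} (S' : Str (freeGraph D).Hor y z),
    P.hcomp (P.mu S').1 (P.mu S).1 (by simp) ≫ (P.nu S.join S'.join).1 =
      (P.nu (GraphHom.mapStr P.evalHom S) (GraphHom.mapStr P.evalHom S')).1 ≫
        P.evalEq (mapStr_append P.evalHom S S').symm ≫ (P.mu (S.append S')).1 ≫
          P.evalEq (join_append S S')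
  | _, .nil => by
    have e := P.lam_nat (P.mu S).1
    simp only [cod_mu, oneMap_id] at e
    exact e.trans (congrArg (_ ≫ ·) ((Category.id_comp _).trans (Category.comp_id _)).symm)
  | _, .snoc S' q => by
    have e₁ := P.mu_append S S'
    have e₂ := P.nu_assoc S.join S'.join q
    have e₃ := P.alpha_nat (𝟙 (HObj.mk (P.eval q))) (P.mu S').1 (P.mu S).1 (by simp) (by simp)
    have e₄ := P.nu_eqCell (join_append S S') (rfl : q = q) (by simp)
    have e₅ : P.hcomp (P.hcomp (𝟙 (HObj.mk (P.eval q))) (P.mu S').1 (by simp) ≫ (P.nu S'.join q).1)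
        (P.mu S).1 (by simp) = P.hcomp (P.hcomp (𝟙 (HObj.mk (P.eval q))) (P.mu S').1 (by simp))
        (P.mu S).1 (by simp) ≫ P.hcomp (P.nu S'.join q).1 (𝟙 _) (by simp) := by
      rw [P.hcomp_hcomp]
      exact P.hcomp_congr rfl (Category.comp_id _).symm _ _
    have e₆ : P.evalEq (join_append S (S'.snoc q)) =
      P.evalEq (congrArg (fun a => Str.append a q) (join_append S S')) ≫
        P.evalEq (append_assoc S.join S'.join q) := (eqCell_trans _ _).symm
    rw [e₆, P.evalEq_snoc (P.eval q) (mapStr_append P.evalHom S S').symm]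
    change P.hcomp (P.hcomp (𝟙 (HObj.mk (P.eval q))) (P.mu S').1 (by simp) ≫ (P.nu S'.join q).1)
        (P.mu S).1 (by simp) ≫ _ = ((P.alpha (P.eval q) _ _).hom ≫ P.hcomp (𝟙 _) (P.nu _ _).1 (by simp)) ≫ _ ≫
      (P.hcomp (𝟙 _) (P.mu (S.append S')).1 (by simp) ≫ (P.nu (Str.join (S.append S')) q).1) ≫ _ ≫ _
    rw [e₅]
    simp only [Category.assoc]
    rw [← reassoc_of% e₄]
    refine (congrArg (_ ≫ ·) e₂).trans ?_
    rw [reassoc_of% e₃, P.hcomp_hcomp_assoc, P.hcomp_hcomp_assoc, P.hcomp_hcomp_assoc,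
      P.hcomp_hcomp_assoc]
    refine congrArg (_ ≫ ·) (congrArg (· ≫ _) (P.hcomp_congr ?_ ?_ _ _))
    · simp
    · rw [e₁]; simp only [Category.assoc]

theorem mu_singleton (P : PseudoDblStr D) {x y : D.Ob} (p : Str D.Hor x y) :
    (P.rho (P.eval p)).inv ≫ (P.mu (Str.nil.snoc p)).1 = P.evalEq (nil_append p).symm := by
  rw [mu_snoc]
  change _ ≫ P.hcomp (𝟙 _) (𝟙 (HObj.mk (P.one x))) _ ≫ (P.nu .nil p).1 = _
  rw [P.hcomp_id, P.nu_nil_left]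
  simp

theorem mu_units (P : PseudoDblStr D) (η : 𝟙 D ⟶ freeUnit D ≫ P.evalHom)
    (hη : ∀ {x y : D.Ob} (r : D.Hor x y), GraphCell.app₁ η ⟨r⟩ = (P.rho r).inv)
    (hη₀ : ∀ x, GraphCell.app₀ η x = 𝟙 x) {x : D.Ob} : ∀ {y : D.Ob} (p : Str D.Hor x y),
    (P.evalCell (GraphCell.strApp η p).1).1 ≫ P.evalEq (mapStr_comp (freeUnit D) P.evalHom p) ≫
      (P.mu (GraphHom.mapStr (freeUnit D) p)).1 ≫ P.evalEq (join_unit p) =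
    P.evalEq (mapStr_id p)
  | _, .nil => by
    change P.oneMap (GraphCell.app₀ η x) ≫ 𝟙 _ ≫ 𝟙 _ ≫ 𝟙 _ = 𝟙 _
    have h : P.oneMap (GraphCell.app₀ η x) = 𝟙 _ :=
      (congrArg P.oneMap (hη₀ x)).trans (P.oneMap_id x)
    rw [h]
    simp only [Category.comp_id]
  | _, .snoc p r => by
    have e := P.mu_units η hη hη₀ p
    have k : D.dom (GraphCell.app₁ η ⟨r⟩) = D.cod (P.evalCell (GraphCell.strApp η p).1).1 :=
      (GraphCell.dom_app η ⟨r⟩).trans ((GraphCell.strApp η p).2.2.symm.trans (P.evalCell _).2.symm)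
    rw [P.evalEq_snoc r (mapStr_id p), P.evalEq_snoc r (join_unit p),
      P.evalEq_snoc (P.eval (Str.nil.snoc r)) (mapStr_comp (freeUnit D) P.evalHom p)]
    change P.hcomp (GraphCell.app₁ η ⟨r⟩) (P.evalCell (GraphCell.strApp η p).1).1 k ≫ _ ≫
      (P.hcomp (𝟙 _) (P.mu (GraphHom.mapStr (freeUnit D) p)).1 (by simp) ≫
        (P.nu (Str.join (GraphHom.mapStr (freeUnit D) p)) (Str.nil.snoc r)).1) ≫ _ = _
    rw [nu_singleton]
    simp only [P.hcomp_hcomp]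
    refine P.hcomp_congr ?_ ?_ _ _
    · rw [hη]
      change _ ≫ 𝟙 _ ≫ (𝟙 _ ≫ _) ≫ 𝟙 _ = 𝟙 _
      simp
    · rw [← e]
      simp

theorem mu_assoc (P : PseudoDblStr D) (μ : freeMap P.evalHom ≫ P.evalHom ⟶ freeMul D ≫ P.evalHom)
    (hμ : ∀ {x y : D.Ob} (S : Str (freeGraph D).Hor x y), GraphCell.app₁ μ ⟨S⟩ = (P.mu S).1)
    (hμ₀ : ∀ x, GraphCell.app₀ μ x = 𝟙 x) {x : D.Ob} : ∀ {y : D.Ob}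
    (S : Str (freeGraph (freeGraph D)).Hor x y),
    (P.mu (GraphHom.mapStr (freeMap P.evalHom) S)).1 ≫ P.evalEq (join_mapStr P.evalHom S) ≫
      (P.mu S.join).1 =
    P.evalEq (mapStr_comp (freeMap P.evalHom) P.evalHom S).symm ≫
      (P.evalCell (GraphCell.strApp μ S).1).1 ≫
      P.evalEq (mapStr_comp (freeMul D) P.evalHom S) ≫
      (P.mu (GraphHom.mapStr (freeMul D) S)).1 ≫ P.evalEq (join_join S)
  | _, .nil => by
    change 𝟙 _ ≫ 𝟙 _ ≫ 𝟙 _ = 𝟙 _ ≫ P.oneMap (GraphCell.app₀ μ x) ≫ 𝟙 _ ≫ 𝟙 _ ≫ 𝟙 _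
    have h : P.oneMap (GraphCell.app₀ μ x) = 𝟙 _ :=
      (congrArg P.oneMap (hμ₀ x)).trans (P.oneMap_id x)
    rw [h]
    simp only [Category.comp_id]
  | _, .snoc S T => by
    have e := P.mu_assoc μ hμ hμ₀ S
    have k : D.dom (P.mu T).1 = D.cod (P.evalCell (GraphCell.strApp μ S).1).1 :=
      (P.dom_mu T).trans ((hμ₀ _).symm.trans ((GraphCell.strApp μ S).2.2.symm.trans (P.evalCell _).2.symm))
    have e₁ := P.nu_eqCell (join_mapStr P.evalHom S)
      (rfl : GraphHom.mapStr P.evalHom T = GraphHom.mapStr P.evalHom T) (by simp)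
    have e₂ := P.mu_append S.join T
    have e₃ := P.nu_eqCell (join_join S) (rfl : T.join = T.join) (by simp)
    have e₄ : P.evalEq (join_mapStr P.evalHom (S.snoc T)) =
        P.evalEq (congrArg (fun a => Str.append a (GraphHom.mapStr P.evalHom T))
          (join_mapStr P.evalHom S)) ≫
        P.evalEq (mapStr_append P.evalHom S.join T).symm := (eqCell_trans _ _).symm
    have e₅ : P.evalEq (join_join (S.snoc T)) ≫ P.evalEq (join_append S.join T) =
        P.evalEq (congrArg (fun a => Str.append a T.join) (join_join S)) := eqCell_trans _ _
    rw [← cancel_mono (P.evalEq (join_append S.join T))]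
    simp only [Category.assoc]
    change (P.hcomp (𝟙 _) (P.mu (GraphHom.mapStr (freeMap P.evalHom) S)).1 (by simp) ≫
        (P.nu _ (GraphHom.mapStr P.evalHom T)).1) ≫ P.evalEq (join_mapStr P.evalHom (S.snoc T)) ≫
        (P.mu (S.join.append T)).1 ≫ P.evalEq (join_append S.join T) =
      _ ≫ (P.evalCell (GraphCell.strApp μ (S.snoc T)).1).1 ≫ _ ≫
        (P.hcomp (𝟙 _) (P.mu (GraphHom.mapStr (freeMul D) S)).1 (by simp) ≫
          (P.nu _ T.join).1) ≫ P.evalEq (join_join (S.snoc T)) ≫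
            P.evalEq (join_append S.join T)
    rw [e₅, e₄]
    simp only [Category.assoc]
    rw [← reassoc_of% e₁]
    refine (congrArg (fun t => _ ≫ _ ≫ t) e₂.symm).trans ?_
    refine Eq.trans ?_ (congrArg (fun t => _ ≫ _ ≫ _ ≫ _ ≫ t) e₃)
    rw [P.evalEq_snoc (P.eval (GraphHom.mapStr P.evalHom T))
      (mapStr_comp (freeMap P.evalHom) P.evalHom S).symm, P.evalEq_snoc (P.eval T.join)
      (mapStr_comp (freeMul D) P.evalHom S)]
    have e₆ : (P.evalCell (GraphCell.strApp μ (S.snoc T)).1).1 =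
      P.hcomp (P.mu T).1 (P.evalCell (GraphCell.strApp μ S).1).1 k :=
      P.hcomp_congr (hμ T) rfl _ _
    rw [e₆]
    simp only [P.hcomp_hcomp_assoc]
    refine congrArg (· ≫ _) (P.hcomp_congr ?_ ?_ _ _)
    · simp
    · exact e

/-- The inverse right unitors, as a 2-cell of graphs. -/
def unitCell (P : PseudoDblStr D) : 𝟙 D ⟶ freeUnit D ≫ P.evalHom where
  app₀ x := 𝟙 x
  app₁ r := (P.rho r.hom).inv
  nat₀ f := (Category.comp_id f).trans (Category.id_comp f).symm
  nat₁ {r s} φ := by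
    change φ ≫ (P.rho s.hom).inv = (P.rho r.hom).inv ≫ P.hcomp φ (P.oneMap (D.dom φ)) _
    rw [Iso.comp_inv_eq, Category.assoc, P.rho_nat φ, Iso.inv_hom_id_assoc]
  dom_app r := P.dom_rho_inv r.hom
  cod_app r := P.cod_rho_inv r.hom

/-- The comparisons `mu`, as a 2-cell of graphs. -/
def mulCell (P : PseudoDblStr D) : freeMap P.evalHom ≫ P.evalHom ⟶ freeMul D ≫ P.evalHom where
  app₀ x := 𝟙 x
  app₁ S := (P.mu S.hom).1
  nat₀ f := (Category.comp_id f).trans (Category.id_comp f).symm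
  nat₁ c := P.mu_nat c
  dom_app S := P.dom_mu S.hom
  cod_app S := P.cod_mu S.hom

/-- The algebra of a pseudodouble category. -/
def alg (P : PseudoDblStr D) : LaxAlg freeMonad D where
  a := P.evalHom
  η := P.unitCell
  μ := P.mulCell
  left_unit := by
    refine graphCell_ext (fun x => ?_) (fun p => ?_) <;>
      simp only [comp_app₀, comp_app₁, eqToHom_app₀, eqToHom_app₁]
    · change 𝟙 x ≫ 𝟙 x ≫ 𝟙 x = 𝟙 x
      simp
    · change (P.rho (P.eval p.hom)).inv ≫ 𝟙 _ ≫ (P.mu (Str.nil.snoc p.hom)).1 = _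
      exact (congrArg (_ ≫ ·) (Category.id_comp _)).trans (P.mu_singleton p.hom)
  right_unit := by
    refine graphCell_ext (fun x => ?_) (fun p => ?_) <;>
      simp only [comp_app₀, comp_app₁, eqToHom_app₀, eqToHom_app₁]
    · change 𝟙 x ≫ 𝟙 x ≫ 𝟙 x = 𝟙 x
      simp
    · have e := P.mu_units P.unitCell (fun r => rfl) (fun x => rfl) p.hom
      have e' := congrArg (· ≫ P.evalEq (join_unit p.hom).symm) e
      simp only [Category.assoc, eqCell_trans, eqCell_refl, Category.comp_id] at e'
      exact e'
  assoc := by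
    refine graphCell_ext (fun x => ?_) (fun S => ?_) <;>
      simp only [comp_app₀, comp_app₁, eqToHom_app₀, eqToHom_app₁]
    · change 𝟙 x ≫ 𝟙 x ≫ 𝟙 x = 𝟙 x ≫ 𝟙 x ≫ 𝟙 x ≫ 𝟙 x ≫ 𝟙 x
      simp
    · exact P.mu_assoc P.mulCell (fun r => rfl) (fun x => rfl) S.hom

theorem alg_isPseudo (P : PseudoDblStr D) : P.alg.IsPseudo where
  isIso_η := GraphCell.isIso_of_app _ (fun _ => inferInstanceAs (IsIso (𝟙 _)))
    (fun r => inferInstanceAs (IsIso (P.rho r.hom).inv))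
  isIso_μ := GraphCell.isIso_of_app _ (fun _ => inferInstanceAs (IsIso (𝟙 _)))
    (fun S => P.isIso_mu S.hom)

theorem alg_isNormal (P : PseudoDblStr D) : P.alg.IsNormal where
  a_eq := rfl
  η_eq _ := HEq.rfl

end PseudoDblStr

end evaluation

section laxalg

variable {D E : Grph.{u, v}}

theorem LaxStr.mul_nat_right {P : PseudoDblStr D} {Q : PseudoDblStr E} {F : D ⟶ E}
    (f : LaxStr P Q F) {x y z x' : D.Ob} (s : D.Hor y z) {r : D.Hor x y} {r' : D.Hor x' y}
    (φ : HObj.mk r ⟶ HObj.mk r') (h : D.cod φ = 𝟙 y) :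
    Q.hcomp (𝟙 (HObj.mk (F.obj₁ s))) (F.map₁ φ) (by simp [h]) ≫ f.mul s r' =
      f.mul s r ≫ F.map₁ (P.hcomp (𝟙 (HObj.mk s)) φ (by simp [h])) := by
  rw [← f.mul_nat]
  exact congrArg (· ≫ _) (Q.hcomp_congr (F.map₁_id ⟨s⟩).symm rfl _ _)

theorem LaxStr.dom_eval {P : PseudoDblStr D} {Q : PseudoDblStr E} {F : D ⟶ E} (f : LaxStr P Q F)
    {x : D.Ob} : ∀ {y : D.Ob} (p : Str D.Hor x y), E.dom (f.eval p).1 = 𝟙 (F.F₀.obj x)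
  | _, .nil => f.dom_unit x
  | _, .snoc p r => (E.dom_comp _ _).trans ((congrArg₂ (· ≫ ·)
      ((Q.dom_hcomp _ _ _).trans (f.dom_eval p)) (f.dom_mul r (P.eval p))).trans
        (Category.comp_id _))

@[simp] theorem LaxStr.dom_eval_val {P : PseudoDblStr D} {Q : PseudoDblStr E} {F : D ⟶ E}
    (f : LaxStr P Q F) {x y : D.Ob} (p : Str D.Hor x y) :
    E.dom (f.eval p).val = 𝟙 (F.F₀.obj x) := f.dom_eval p

@[simp] theorem LaxStr.cod_eval_val {P : PseudoDblStr D} {Q : PseudoDblStr E} {F : D ⟶ E}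
    (f : LaxStr P Q F) {x y : D.Ob} (p : Str D.Hor x y) :
    E.cod (f.eval p).val = 𝟙 (F.F₀.obj y) := (f.eval p).2

theorem LaxStr.eval_snoc {P : PseudoDblStr D} {Q : PseudoDblStr E} {F : D ⟶ E}
    (f : LaxStr P Q F) {x y z : D.Ob} (p : Str D.Hor x y) (r : D.Hor y z) :
    (f.eval (p.snoc r)).1 = Q.hcomp (𝟙 (HObj.mk (F.obj₁ r))) (f.eval p).1 (by simp) ≫
      f.mul r (P.eval p) := rfl

theorem LaxStr.eval_nat {P : PseudoDblStr D} {Q : PseudoDblStr E} {F : D ⟶ E} (f : LaxStr P Q F)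
    {x x' : D.Ob} : ∀ {y y' : D.Ob} {p : Str D.Hor x y} {q : Str D.Hor x' y'}
    (c : (strCell D p q).T),
    (Q.evalCell (GraphHom.mapCell F c).1).1 ≫ (f.eval q).1 =
      (f.eval p).1 ≫ F.map₁ (P.evalCell c).1
  | _, _, .nil, .nil, c => f.unit_nat (x := x) (y := x') c
  | _, _, .snoc p r, .snoc q s, c => by
    have e := f.eval_nat c.1.1
    have k : D.dom c.1.2 = D.cod (P.evalCell c.1.1).1 := c.2.symm.trans (P.evalCell c.1.1).2.symm
    have k' : E.dom (F.map₁ c.1.2) = E.cod (Q.evalCell (GraphHom.mapCell F c.1.1).1).1 :=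
      (F.dom_map₁ _).trans ((congrArg F.F₀.map c.2.symm).trans
        ((GraphHom.mapCell F c.1.1).2.2.symm.trans (Q.evalCell _).2.symm))
    change Q.hcomp (F.map₁ c.1.2) (Q.evalCell (GraphHom.mapCell F c.1.1).1).1 k' ≫
      Q.hcomp (𝟙 (HObj.mk (F.obj₁ s))) (f.eval q).1 (by simp) ≫ f.mul s (P.eval q) =
      (Q.hcomp (𝟙 (HObj.mk (F.obj₁ r))) (f.eval p).1 (by simp) ≫ f.mul r (P.eval p)) ≫
        F.map₁ (P.hcomp c.1.2 (P.evalCell c.1.1).1 k)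
    rw [Category.assoc, ← f.mul_nat _ _ k, Q.hcomp_hcomp_assoc, Q.hcomp_hcomp_assoc]
    refine congrArg (· ≫ _) (Q.hcomp_congr ?_ e _ _)
    rw [Category.comp_id, Category.id_comp]
  | _, _, .nil, .snoc _ _, c => c.elim
  | _, _, .snoc _ _, .nil, c => c.elim

theorem LaxStr.eval_append {P : PseudoDblStr D} {Q : PseudoDblStr E} {F : D ⟶ E}
    (f : LaxStr P Q F) {x y : D.Ob} (p : Str D.Hor x y) : ∀ {z : D.Ob} (q : Str D.Hor y z),
    Q.hcomp (f.eval q).1 (f.eval p).1 (by simp) ≫ f.mul (P.eval q) (P.eval p) ≫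
        F.map₁ (P.nu p q).1 =
      (Q.nu (GraphHom.mapStr F p) (GraphHom.mapStr F q)).1 ≫
        Q.evalEq (mapStr_append F p q).symm ≫ (f.eval (p.append q)).1
  | _, .nil => by
    have e := f.left (P.eval p)
    have e₁ := Q.lam_nat (f.eval p).1
    have e₂ : Q.hcomp (f.unit y) (f.eval p).1 (by simp) = Q.hcomp (𝟙 _) (f.eval p).1 (by simp) ≫
      Q.hcomp (f.unit y) (𝟙 _) (by simp) := by
      rw [Q.hcomp_hcomp]
      exact Q.hcomp_congr (Category.id_comp _).symm (Category.comp_id _).symm _ _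
    have e₃ : Q.hcomp (𝟙 (HObj.mk (Q.one _))) (f.eval p).1 (by simp) ≫ (Q.lam _).hom =
        (Q.lam _).hom ≫ (f.eval p).1 := by
      rw [← e₁]
      refine congrArg (· ≫ _) (Q.hcomp_congr ?_ rfl _ _)
      rw [LaxStr.cod_eval_val, Q.oneMap_id]
    change Q.hcomp (f.unit y) (f.eval p).1 (by simp) ≫ f.mul (P.one y) (P.eval p) ≫
      F.map₁ (P.lam _).hom = (Q.lam _).hom ≫ 𝟙 _ ≫ (f.eval p).1
    rw [e₂, Category.assoc, reassoc_of% e, ← F.map₁_comp, Iso.inv_hom_id, F.map₁_id,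
      Category.comp_id, e₃, Category.id_comp]
  | _, .snoc q r => by
    have e := f.eval_append p q
    have e₁ := f.assoc r (P.eval q) (P.eval p)
    have e₂ := Q.alpha_nat (𝟙 (HObj.mk (F.obj₁ r))) (f.eval q).1 (f.eval p).1 (by simp)
      (by simp)
    have e₃ := f.mul_nat_right r (P.nu p q).1 (by simp)
    have e₄ : Q.hcomp (f.eval (q.snoc r)).1 (f.eval p).1 (by simp) =
      Q.hcomp (Q.hcomp (𝟙 (HObj.mk (F.obj₁ r))) (f.eval q).1 (by simp)) (f.eval p).1 (by simp) ≫
        Q.hcomp (f.mul r (P.eval q)) (𝟙 (HObj.mk (F.obj₁ (P.eval p)))) (by simp) := by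
      rw [Q.hcomp_hcomp]
      exact Q.hcomp_congr rfl (Category.comp_id _).symm _ _
    rw [e₄, P.nu_snoc, F.map₁_comp, Q.evalEq_snoc (F.obj₁ r) (mapStr_append F p q).symm]
    change _ = ((Q.alpha _ _ _).hom ≫ Q.hcomp (𝟙 (HObj.mk (F.obj₁ r)))
      (Q.nu (GraphHom.mapStr F p) (GraphHom.mapStr F q)).1 (by simp)) ≫
      Q.hcomp (𝟙 _) _ _ ≫ Q.hcomp (𝟙 _) (f.eval (p.append q)).1 (by simp) ≫
        f.mul r (P.eval (p.append q))
    simp only [Category.assoc]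
    change _ ≫ _ ≫ f.mul (P.comp r (P.eval q)) (P.eval p) ≫ _ = _
    rw [reassoc_of% e₁, ← e₃, reassoc_of% e₂]
    simp only [Q.hcomp_hcomp_assoc]
    refine congrArg (_ ≫ ·) (congrArg (· ≫ _) (Q.hcomp_congr ?_ ?_ _ _))
    · simp
    · rw [← e]

/-- The comparison of a lax functor for composites of strings, as a 2-cell of graphs. -/
def LaxStr.evalGraphCell {P : PseudoDblStr D} {Q : PseudoDblStr E} {F : D ⟶ E}
    (f : LaxStr P Q F) : freeMap F ≫ Q.evalHom ⟶ P.evalHom ≫ F where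
  app₀ x := 𝟙 (F.F₀.obj x)
  app₁ p := (f.eval p.hom).1
  nat₀ g := (Category.comp_id (F.F₀.map g)).trans (Category.id_comp (F.F₀.map g)).symm
  nat₁ c := f.eval_nat c
  dom_app p := f.dom_eval p.hom
  cod_app p := (f.eval p.hom).2

theorem LaxStr.eval_join {P : PseudoDblStr D} {Q : PseudoDblStr E} {F : D ⟶ E}
    (f : LaxStr P Q F) {x : D.Ob} : ∀ {y : D.Ob} (S : Str (freeGraph D).Hor x y),
    (Q.mu (GraphHom.mapStr (freeMap F) S)).1 ≫ Q.evalEq (join_mapStr F S) ≫ (f.eval S.join).1 =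
      Q.evalEq (mapStr_comp (freeMap F) Q.evalHom S).symm ≫
        (Q.evalCell (GraphCell.strApp f.evalGraphCell S).1).1 ≫
        Q.evalEq (mapStr_comp P.evalHom F S) ≫
        (f.eval (GraphHom.mapStr P.evalHom S)).1 ≫ F.map₁ (P.mu S).1
  | _, .nil => by
    change 𝟙 _ ≫ 𝟙 _ ≫ f.unit x =
      𝟙 _ ≫ Q.oneMap (𝟙 (F.F₀.obj x)) ≫ 𝟙 _ ≫ f.unit x ≫ F.map₁ (𝟙 (HObj.mk (P.one x)))
    rw [Q.oneMap_id, F.map₁_id]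
    simp only [Category.id_comp, Category.comp_id]
  | _, .snoc S q => by
    have e := f.eval_join S
    have e₁ := Q.nu_eqCell (join_mapStr F S) (rfl : GraphHom.mapStr F q = GraphHom.mapStr F q)
      (by simp)
    have e₂ := f.eval_append S.join q
    have e₃ := f.mul_nat_right (P.eval q) (P.mu S).1 (by simp)
    have e₄ : Q.evalEq (join_mapStr F (S.snoc q)) =
        Q.evalEq (congrArg (fun a => Str.append a (GraphHom.mapStr F q)) (join_mapStr F S)) ≫
        Q.evalEq (mapStr_append F S.join q).symm := (eqCell_trans _ _).symm
    have k : E.dom (f.eval q).1 =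
        E.cod (Q.evalCell (GraphCell.strApp f.evalGraphCell S).1).1 :=
      (f.dom_eval q).trans ((GraphCell.strApp f.evalGraphCell S).2.2.symm.trans
        (Q.evalCell _).2.symm)
    have k' : E.cod (Q.evalCell (GraphCell.strApp f.evalGraphCell S).1).1 = 𝟙 _ :=
      k.symm.trans (f.dom_eval q)
    rw [P.mu_snoc, F.map₁_comp, Q.evalEq_snoc (Q.eval (GraphHom.mapStr F q))
      (mapStr_comp (freeMap F) Q.evalHom S).symm, Q.evalEq_snoc (F.obj₁ (P.eval q))
      (mapStr_comp P.evalHom F S), e₄]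
    change (Q.hcomp (𝟙 (HObj.mk (Q.eval (GraphHom.mapStr F q))))
        (Q.mu (GraphHom.mapStr (freeMap F) S)).1 (by simp) ≫ (Q.nu _ (GraphHom.mapStr F q)).1) ≫
      (_ ≫ _) ≫ (f.eval (S.join.append q)).1 = _ ≫ Q.hcomp (f.eval q).1
        (Q.evalCell (GraphCell.strApp f.evalGraphCell S).1).1 k ≫ _ ≫
        (Q.hcomp (𝟙 _) (f.eval (GraphHom.mapStr P.evalHom S)).1 (by simp) ≫
          f.mul (P.eval q) (P.eval (GraphHom.mapStr P.evalHom S))) ≫ _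
    simp only [Category.assoc]
    rw [← reassoc_of% e₁, ← e₂, ← reassoc_of% e₃]
    simp only [Q.hcomp_hcomp_assoc]
    refine congrArg (· ≫ _) (Q.hcomp_congr ?_ ?_ _ _)
    · simp
    · rw [← e]

/-- The lax algebra morphism of a lax functor. -/
def LaxStr.algMor {P : PseudoDblStr D} {Q : PseudoDblStr E} {F : D ⟶ E} (f : LaxStr P Q F) :
    LaxMor P.alg Q.alg F where
  φ := f.evalGraphCell
  unit := by
    refine graphCell_ext (fun x => ?_) (fun r => ?_) <;>
      simp only [comp_app₀, comp_app₁, eqToHom_app₀, eqToHom_app₁]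
    · change 𝟙 (F.F₀.obj x) ≫ 𝟙 (F.F₀.obj x) ≫ 𝟙 (F.F₀.obj x) =
        𝟙 (F.F₀.obj x) ≫ F.F₀.map (𝟙 x) ≫ 𝟙 (F.F₀.obj x)
      simp
    · change (Q.rho (F.obj₁ r.hom)).inv ≫ 𝟙 _ ≫ (Q.hcomp (𝟙 (HObj.mk (F.obj₁ r.hom)))
        (f.unit r.src) (by simp) ≫ f.mul r.hom (P.one r.src)) =
        𝟙 _ ≫ F.map₁ (P.rho r.hom).inv ≫ 𝟙 _
      rw [f.right]
      simp only [Category.id_comp, Category.comp_id, Iso.inv_hom_id_assoc]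
  mul := by
    refine graphCell_ext (fun x => ?_) (fun S => ?_) <;>
      simp only [comp_app₀, comp_app₁, eqToHom_app₀, eqToHom_app₁]
    · have e : ∀ x : D.Ob, 𝟙 (F.F₀.obj x) ≫ 𝟙 (F.F₀.obj x) ≫ 𝟙 (F.F₀.obj x) =
        𝟙 (F.F₀.obj x) ≫ 𝟙 (F.F₀.obj x) ≫ 𝟙 (F.F₀.obj x) ≫ 𝟙 (F.F₀.obj x) ≫
          𝟙 (F.F₀.obj x) ≫ F.F₀.map (𝟙 x) ≫ 𝟙 (F.F₀.obj x) := fun x => by simp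
      exact e x
    · refine (f.eval_join S.hom).trans ?_
      change _ = Q.evalEq (mapStr_comp (freeMap F) Q.evalHom S.hom).symm ≫ _ ≫
        Q.evalEq (mapStr_comp P.evalHom F S.hom) ≫ _ ≫ 𝟙 _ ≫ F.map₁ (P.mu S.hom).1 ≫ 𝟙 _
      exact congrArg (fun t => _ ≫ _ ≫ _ ≫ _ ≫ t)
        ((Category.id_comp _).trans (Category.comp_id _)).symm

end laxalg

section laxinv

variable {D E : Grph.{u, v}}

theorem PseudoDblStr.mu_pair (P : PseudoDblStr D) {x y z : D.Ob} (p : Str D.Hor x y)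
    (q : Str D.Hor y z) : (P.mu ((Str.nil.snoc p).snoc q)).1 =
      P.hcomp (𝟙 (HObj.mk (P.eval q))) (P.rho (P.eval p)).hom (by simp) ≫ (P.nu p q).1 ≫
        P.evalEq (congrArg (fun a => Str.append a q) (nil_append p).symm) := by
  have e := P.nu_eqCell (nil_append p).symm (rfl : q = q) (by simp)
  have e₁ := P.mu_singleton p
  rw [Iso.inv_comp_eq] at e₁
  rw [P.mu_snoc]
  simp only [e₁]
  rw [← e]
  simp only [P.hcomp_hcomp_assoc]
  refine congrArg (· ≫ _) (P.hcomp_congr ?_ rfl _ _)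
  simp

theorem PseudoDblStr.rho_nat_of_id (P : PseudoDblStr D) {x y y' : D.Ob} {r : D.Hor x y}
    {r' : D.Hor x y'} (φ : HObj.mk r ⟶ HObj.mk r') (h : D.dom φ = 𝟙 x) :
    P.hcomp φ (𝟙 (HObj.mk (P.one x))) (by simp [h]) ≫ (P.rho r').hom = (P.rho r).hom ≫ φ := by
  rw [← P.rho_nat]
  exact congrArg (· ≫ _) (P.hcomp_congr rfl ((P.oneMap_id x).symm.trans
    (congrArg P.oneMap h.symm)) _ _)

theorem PseudoDblStr.lam_nat_of_id (P : PseudoDblStr D) {x x' y : D.Ob} {r : D.Hor x y}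
    {r' : D.Hor x' y} (φ : HObj.mk r ⟶ HObj.mk r') (h : D.cod φ = 𝟙 y) :
    P.hcomp (𝟙 (HObj.mk (P.one y))) φ (by simp [h]) ≫ (P.lam r').hom = (P.lam r).hom ≫ φ := by
  rw [← P.lam_nat]
  exact congrArg (· ≫ _) (P.hcomp_congr ((P.oneMap_id y).symm.trans
    (congrArg P.oneMap h.symm)) rfl _ _)

/-- A family of globular 2-cells comparing composites of strings, with the properties of the
structure 2-cell of a lax algebra morphism. -/
structure LaxFamily (P : PseudoDblStr D) (Q : PseudoDblStr E) (F : D ⟶ E) where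
  φ : ∀ {x y : D.Ob} (p : Str D.Hor x y),
    HObj.mk (Q.eval (GraphHom.mapStr F p)) ⟶ HObj.mk (F.obj₁ (P.eval p))
  dom_φ : ∀ {x y : D.Ob} (p : Str D.Hor x y), E.dom (φ p) = 𝟙 (F.F₀.obj x)
  cod_φ : ∀ {x y : D.Ob} (p : Str D.Hor x y), E.cod (φ p) = 𝟙 (F.F₀.obj y)
  nat : ∀ {x x' y y' : D.Ob} {p : Str D.Hor x y} {q : Str D.Hor x' y'} (c : (strCell D p q).T),
    (Q.evalCell (GraphHom.mapCell F c).1).1 ≫ φ q = φ p ≫ F.map₁ (P.evalCell c).1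
  unit : ∀ {x y : D.Ob} (r : D.Hor x y),
    φ (Str.nil.snoc r) = (Q.rho (F.obj₁ r)).hom ≫ F.map₁ (P.rho r).inv
  pair : ∀ {x y z : D.Ob} (p : Str D.Hor x y) (q : Str D.Hor y z),
    (Q.mu ((Str.nil.snoc (GraphHom.mapStr F p)).snoc (GraphHom.mapStr F q))).1 ≫
      Q.evalEq (join_mapStr F ((Str.nil.snoc p).snoc q)) ≫ φ (Str.append (Str.append .nil p) q) =
    Q.hcomp (φ q) (Q.hcomp (φ p) (𝟙 (HObj.mk (Q.one _))) (by simp [dom_φ]))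
        (by simp [dom_φ, cod_φ]) ≫
      φ ((Str.nil.snoc (P.eval p)).snoc (P.eval q)) ≫ F.map₁ (P.mu ((Str.nil.snoc p).snoc q)).1

attribute [simp] LaxFamily.dom_φ LaxFamily.cod_φ

namespace LaxFamily

variable {P : PseudoDblStr D} {Q : PseudoDblStr E} {F : D ⟶ E} (g : LaxFamily P Q F)

/-- The comparison for binary composites. -/
def mul {x y z : D.Ob} (s : D.Hor y z) (r : D.Hor x y) :
    HObj.mk (Q.comp (F.obj₁ s) (F.obj₁ r)) ⟶ HObj.mk (F.obj₁ (P.comp s r)) :=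
  Q.hcomp (𝟙 (HObj.mk (F.obj₁ s))) (Q.rho (F.obj₁ r)).inv (by simp) ≫
    g.φ ((Str.nil.snoc r).snoc s) ≫
      F.map₁ (P.hcomp (𝟙 (HObj.mk s)) (P.rho r).hom (by simp))

@[simp] theorem dom_mul {x y z : D.Ob} (s : D.Hor y z) (r : D.Hor x y) :
    E.dom (g.mul s r) = 𝟙 _ := by
  rw [mul, E.dom_comp, E.dom_comp, Q.dom_hcomp, g.dom_φ, F.dom_map₁, P.dom_hcomp]
  simp

@[simp] theorem cod_mul {x y z : D.Ob} (s : D.Hor y z) (r : D.Hor x y) :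
    E.cod (g.mul s r) = 𝟙 _ := by
  rw [mul, E.cod_comp, E.cod_comp, Q.cod_hcomp, g.cod_φ, F.cod_map₁, P.cod_hcomp]
  simp

theorem mul_nat {x y z x' y' z' : D.Ob} {s : D.Hor y z} {r : D.Hor x y} {s' : D.Hor y' z'}
    {r' : D.Hor x' y'} (ψ : HObj.mk s ⟶ HObj.mk s') (φ : HObj.mk r ⟶ HObj.mk r')
    (h : D.dom ψ = D.cod φ) :
    Q.hcomp (F.map₁ ψ) (F.map₁ φ) (by simp [h]) ≫ g.mul s' r' =
      g.mul s r ≫ F.map₁ (P.hcomp ψ φ h) := by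
  have k : (strCell D (Str.nil.snoc r) (Str.nil.snoc r')).cod ⟨(D.dom φ, φ), rfl⟩ = D.dom ψ := h.symm
  have e := g.nat (p := (Str.nil.snoc r).snoc s) (q := (Str.nil.snoc r').snoc s')
    ⟨(⟨(D.dom φ, φ), rfl⟩, ψ), k⟩
  have e₁ : Q.hcomp (F.map₁ ψ) (Q.hcomp (F.map₁ φ) (Q.oneMap (F.F₀.map (D.dom φ))) (by simp))
      (by simp [h]) ≫ g.φ ((Str.nil.snoc r').snoc s') = g.φ ((Str.nil.snoc r).snoc s) ≫
      F.map₁ (P.hcomp ψ (P.hcomp φ (P.oneMap (D.dom φ)) (by simp)) (by simp [h])) := e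
  have e₂ := P.rho_nat φ
  have e₃ : F.map₁ φ ≫ (Q.rho (F.obj₁ r')).inv = (Q.rho (F.obj₁ r)).inv ≫
      Q.hcomp (F.map₁ φ) (Q.oneMap (F.F₀.map (D.dom φ))) (by simp) := by
    have e := Q.rho_nat (F.map₁ φ)
    rw [Iso.comp_inv_eq, Category.assoc, Iso.eq_inv_comp, ← e]
    exact congrArg (· ≫ _) (Q.hcomp_congr rfl (congrArg Q.oneMap (F.dom_map₁ φ)) _ _)
  have e₄ : Q.hcomp (F.map₁ ψ) (F.map₁ φ) (by simp [h]) ≫ Q.hcomp (𝟙 (HObj.mk (F.obj₁ s')))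
      (Q.rho (F.obj₁ r')).inv (by simp) = Q.hcomp (𝟙 (HObj.mk (F.obj₁ s)))
      (Q.rho (F.obj₁ r)).inv (by simp) ≫ Q.hcomp (F.map₁ ψ)
      (Q.hcomp (F.map₁ φ) (Q.oneMap (F.F₀.map (D.dom φ))) (by simp)) (by simp [h]) := by
    rw [Q.hcomp_hcomp, Q.hcomp_hcomp]
    exact Q.hcomp_congr (by simp) e₃ _ _
  rw [mul, reassoc_of% e₄, reassoc_of% e₁, mul, Category.assoc, Category.assoc, ← F.map₁_comp,
    ← F.map₁_comp, P.hcomp_hcomp, P.hcomp_hcomp]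
  refine congrArg (fun t => _ ≫ _ ≫ F.map₁ t) (P.hcomp_congr ?_ e₂ _ _)
  simp

theorem mul_nat_right {x y z x' : D.Ob} (s : D.Hor y z) {r : D.Hor x y} {r' : D.Hor x' y}
    (φ : HObj.mk r ⟶ HObj.mk r') (h : D.cod φ = 𝟙 y) :
    Q.hcomp (𝟙 (HObj.mk (F.obj₁ s))) (F.map₁ φ) (by simp [h]) ≫ g.mul s r' =
      g.mul s r ≫ F.map₁ (P.hcomp (𝟙 (HObj.mk s)) φ (by simp [h])) := by
  rw [← g.mul_nat]
  exact congrArg (· ≫ _) (Q.hcomp_congr (F.map₁_id ⟨s⟩).symm rfl _ _)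

theorem mul_nat_left {x y z z' : D.Ob} {s : D.Hor y z} {s' : D.Hor y z'} (r : D.Hor x y)
    (ψ : HObj.mk s ⟶ HObj.mk s') (h : D.dom ψ = 𝟙 y) :
    Q.hcomp (F.map₁ ψ) (𝟙 (HObj.mk (F.obj₁ r))) (by simp [h]) ≫ g.mul s' r =
      g.mul s r ≫ F.map₁ (P.hcomp ψ (𝟙 (HObj.mk r)) (by simp [h])) := by
  rw [← g.mul_nat]
  exact congrArg (· ≫ _) (Q.hcomp_congr rfl (F.map₁_id ⟨r⟩).symm _ _)

theorem φ_eqCell {x y : D.Ob} {p q : Str D.Hor x y} (h : p = q) :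
    Q.evalEq (congrArg (fun p => GraphHom.mapStr F p) h) ≫ g.φ q =
      g.φ p ≫ F.map₁ (P.evalEq h) := by
  subst h
  exact (Category.id_comp _).trans ((Category.comp_id _).symm.trans
    (congrArg (_ ≫ ·) (F.map₁_id ⟨P.eval p⟩).symm))

theorem φ_append {x y z : D.Ob} (p : Str D.Hor x y) (q : Str D.Hor y z) :
    Q.hcomp (g.φ q) (g.φ p) (by simp) ≫ g.mul (P.eval q) (P.eval p) ≫ F.map₁ (P.nu p q).1 =
      (Q.nu (GraphHom.mapStr F p) (GraphHom.mapStr F q)).1 ≫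
        Q.evalEq (mapStr_append F p q).symm ≫ g.φ (p.append q) := by
  have e := g.pair p q
  have e₁ := Q.rho_nat_of_id (g.φ p) (g.dom_φ p)
  have e₂ := g.φ_eqCell (congrArg (fun a => Str.append a q) (nil_append p).symm)
  have e₃ : Q.evalEq (congrArg (fun a => Str.append a (GraphHom.mapStr F q))
      (nil_append (GraphHom.mapStr F p)).symm) ≫
      Q.evalEq (join_mapStr F ((Str.nil.snoc p).snoc q)) =
      Q.evalEq (mapStr_append F p q).symm ≫ Q.evalEq (congrArg (fun p => GraphHom.mapStr F p)
        (congrArg (fun a => Str.append a q) (nil_append p).symm)) := by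
    rw [eqCell_trans, eqCell_trans]
  rw [P.mu_pair, Q.mu_pair] at e
  simp only [F.map₁_comp, Category.assoc] at e
  rw [reassoc_of% e₃] at e
  have e₄ : F.map₁ (P.evalEq (congrArg (fun a => Str.append a q) (nil_append p).symm)) ≫
      F.map₁ (P.evalEq (congrArg (fun a => Str.append a q) (nil_append p))) = 𝟙 _ := by
    rw [← F.map₁_comp, eqCell_trans]; exact F.map₁_id _
  have e' := congrArg (· ≫ F.map₁ (P.evalEq (congrArg (fun a => Str.append a q) (nil_append p)))) e
  simp only [Category.assoc] at e'
  rw [reassoc_of% e₂, e₄] at e'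
  simp only [Category.comp_id] at e'
  rw [← cancel_epi (Q.hcomp (𝟙 (HObj.mk (Q.eval (GraphHom.mapStr F q))))
    (Q.rho (Q.eval (GraphHom.mapStr F p))).hom (by simp)), e', mul]
  simp only [Q.hcomp_hcomp_assoc, Category.assoc]
  refine congrArg (· ≫ _) (Q.hcomp_congr ?_ ?_ _ _)
  · simp
  · rw [← reassoc_of% e₁]
    simp

theorem φ_snoc {x y z : D.Ob} (p : Str D.Hor x y) (r : D.Hor y z) :
    g.φ (p.snoc r) = Q.hcomp (𝟙 (HObj.mk (F.obj₁ r))) (g.φ p) (by simp) ≫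
      g.mul r (P.eval p) := by
  have e := g.φ_append p (Str.nil.snoc r)
  have e₁ := g.mul_nat_left (P.eval p) (P.rho r).hom (by simp)
  have e₂ := Q.nu_singleton (GraphHom.mapStr F p) (F.obj₁ r)
  have e₃ : F.map₁ (P.rho r).inv ≫ F.map₁ (P.rho r).hom = 𝟙 _ := by
    rw [← F.map₁_comp, Iso.inv_hom_id]; exact F.map₁_id _
  rw [P.nu_singleton] at e
  change Q.hcomp (g.φ (Str.nil.snoc r)) (g.φ p) _ ≫ g.mul (P.comp r (P.one y)) (P.eval p) ≫ _ =
    (Q.nu _ (Str.nil.snoc (F.obj₁ r))).1 ≫ 𝟙 _ ≫ g.φ (p.snoc r) at e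
  rw [e₂, ← e₁] at e
  simp only [Q.hcomp_hcomp_assoc, g.unit, Category.assoc, e₃, Category.comp_id,
    Category.id_comp] at e
  rw [← cancel_epi (Q.hcomp (Q.rho (F.obj₁ r)).hom
    (𝟙 (HObj.mk (Q.eval (GraphHom.mapStr F p)))) (by simp)), ← e, Q.hcomp_hcomp_assoc]
  exact congrArg (· ≫ _) (Q.hcomp_congr (Category.comp_id _).symm (Category.id_comp _).symm _ _)

theorem isIso_singleton {x y : D.Ob} (r : D.Hor x y) : IsIso (g.φ (Str.nil.snoc r)) := by
  rw [g.unit]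
  have : IsIso (F.map₁ (P.rho r).inv) :=
    inferInstanceAs (IsIso ((GraphHom.F₁ F).map (P.rho r).inv))
  infer_instance

theorem left {x y : D.Ob} (r : D.Hor x y) :
    Q.hcomp (g.φ .nil) (𝟙 (HObj.mk (F.obj₁ r))) (by simp) ≫ g.mul (P.one y) r =
      (Q.lam (F.obj₁ r)).hom ≫ F.map₁ (P.lam r).inv := by
  have e := g.φ_append (Str.nil.snoc r) .nil
  change Q.hcomp (g.φ .nil) (g.φ (Str.nil.snoc r)) _ ≫ g.mul (P.one y) (P.comp r (P.one x)) ≫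
    F.map₁ (P.lam (P.comp r (P.one x))).hom = (Q.lam _).hom ≫ 𝟙 _ ≫ g.φ (Str.nil.snoc r) at e
  have e₁ := Q.lam_nat_of_id (Q.rho (F.obj₁ r)).hom (by simp)
  have e₂ := g.mul_nat_right (P.one y) (P.rho r).inv (by simp)
  have e₃ := P.lam_nat_of_id (P.rho r).inv (by simp)
  have e₄ : Q.hcomp (g.φ .nil) (g.φ (Str.nil.snoc r)) (by simp) =
    Q.hcomp (𝟙 _) (Q.rho (F.obj₁ r)).hom (by simp) ≫
      Q.hcomp (g.φ .nil) (𝟙 (HObj.mk (F.obj₁ r))) (by simp) ≫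
        Q.hcomp (𝟙 (HObj.mk (F.obj₁ (P.one y)))) (F.map₁ (P.rho r).inv) (by simp) := by
    rw [Q.hcomp_hcomp, Q.hcomp_hcomp]
    exact Q.hcomp_congr (by simp) (by simp [g.unit]) _ _
  rw [e₄] at e
  simp only [Category.assoc] at e
  rw [reassoc_of% e₂, ← F.map₁_comp, e₃, g.unit, Category.id_comp, ← reassoc_of% e₁] at e
  rw [cancel_epi, F.map₁_comp, ← Category.assoc, ← Category.assoc] at e
  have : IsIso (F.map₁ (P.rho r).inv) :=
    inferInstanceAs (IsIso ((GraphHom.F₁ F).map (P.rho r).inv))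
  rw [cancel_mono] at e
  rw [← e]
  simp only [Category.assoc]
  rw [← F.map₁_comp, Iso.hom_inv_id, F.map₁_id, Category.comp_id]

theorem right {x y : D.Ob} (r : D.Hor x y) :
    Q.hcomp (𝟙 (HObj.mk (F.obj₁ r))) (g.φ .nil) (by simp) ≫ g.mul r (P.one x) =
      (Q.rho (F.obj₁ r)).hom ≫ F.map₁ (P.rho r).inv :=
  (g.φ_snoc .nil r).symm.trans (g.unit r)

theorem assoc_eval {w x y z : D.Ob} (p : Str D.Hor w x) (q : Str D.Hor x y) (t : D.Hor y z)
    [IsIso (g.φ p)] [IsIso (g.φ q)] :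
    Q.hcomp (g.mul t (P.eval q)) (𝟙 (HObj.mk (F.obj₁ (P.eval p)))) (by simp) ≫
      g.mul (P.comp t (P.eval q)) (P.eval p) ≫
        F.map₁ (P.alpha t (P.eval q) (P.eval p)).hom =
      (Q.alpha (F.obj₁ t) (F.obj₁ (P.eval q)) (F.obj₁ (P.eval p))).hom ≫
        Q.hcomp (𝟙 (HObj.mk (F.obj₁ t))) (g.mul (P.eval q) (P.eval p)) (by simp) ≫
          g.mul t (P.comp (P.eval q) (P.eval p)) := by
  have e := g.φ_append p (q.snoc t)
  have e₁ := g.φ_append p q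
  have e₂ := Q.alpha_nat (𝟙 (HObj.mk (F.obj₁ t))) (g.φ q) (g.φ p) (by simp) (by simp)
  have e₃ := g.mul_nat_right t (P.nu p q).1 (by simp)
  have e₄ : Q.hcomp (g.φ (q.snoc t)) (g.φ p) (by simp) =
      Q.hcomp (Q.hcomp (𝟙 (HObj.mk (F.obj₁ t))) (g.φ q) (by simp)) (g.φ p) (by simp) ≫
        Q.hcomp (g.mul t (P.eval q)) (𝟙 (HObj.mk (F.obj₁ (P.eval p)))) (by simp) := by
    rw [Q.hcomp_hcomp]
    exact Q.hcomp_congr (g.φ_snoc q t) (Category.comp_id _).symm _ _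
  rw [e₄, P.nu_snoc, F.map₁_comp, Q.evalEq_snoc (F.obj₁ t) (mapStr_append F p q).symm] at e
  change _ = ((Q.alpha _ _ _).hom ≫ Q.hcomp (𝟙 (HObj.mk (F.obj₁ t)))
      (Q.nu (GraphHom.mapStr F p) (GraphHom.mapStr F q)).1 (by simp)) ≫ _ ≫
        g.φ ((p.append q).snoc t) at e
  rw [g.φ_snoc] at e
  simp only [Category.assoc] at e
  have e₆ : Q.hcomp (𝟙 (HObj.mk (F.obj₁ t)))
      (Q.nu (GraphHom.mapStr F p) (GraphHom.mapStr F q)).1 (by simp) ≫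
      Q.hcomp (𝟙 (HObj.mk (F.obj₁ t))) (Q.evalEq (mapStr_append F p q).symm) (by simp) ≫
      Q.hcomp (𝟙 (HObj.mk (F.obj₁ t))) (g.φ (p.append q)) (by simp) ≫
        g.mul t (P.eval (p.append q)) =
      Q.hcomp (𝟙 (HObj.mk (F.obj₁ t))) (Q.hcomp (g.φ q) (g.φ p) (by simp) ≫
        g.mul (P.eval q) (P.eval p) ≫ F.map₁ (P.nu p q).1) (by simp) ≫
        g.mul t (P.eval (p.append q)) := by
    rw [Q.hcomp_hcomp_assoc, Q.hcomp_hcomp_assoc]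
    refine congrArg (· ≫ _) (Q.hcomp_congr ?_ ?_ _ _)
    · simp
    · rw [e₁, Category.assoc]
  have e₅ : Q.hcomp (𝟙 (HObj.mk (F.obj₁ t))) (Q.hcomp (g.φ q) (g.φ p) (by simp) ≫
      g.mul (P.eval q) (P.eval p) ≫ F.map₁ (P.nu p q).1) (by simp) ≫
        g.mul t (P.eval (p.append q)) =
      Q.hcomp (𝟙 (HObj.mk (F.obj₁ t))) (Q.hcomp (g.φ q) (g.φ p) (by simp)) (by simp) ≫
      Q.hcomp (𝟙 (HObj.mk (F.obj₁ t))) (g.mul (P.eval q) (P.eval p)) (by simp) ≫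
      g.mul t (P.comp (P.eval q) (P.eval p)) ≫
        F.map₁ (P.hcomp (𝟙 (HObj.mk t)) (P.nu p q).1 (by simp)) := by
    rw [← e₃, Q.hcomp_hcomp_assoc, Q.hcomp_hcomp_assoc]
    exact congrArg (· ≫ _) (Q.hcomp_congr (by simp) (by simp) _ _)
  rw [e₆, e₅, ← reassoc_of% e₂, cancel_epi] at e
  simp only [← Category.assoc] at e
  have : IsIso (F.map₁ (P.hcomp (𝟙 (HObj.mk t)) (P.nu p q).1 (by simp))) :=
    inferInstanceAs (IsIso ((GraphHom.F₁ F).map (P.hcomp (𝟙 (HObj.mk t)) (P.nu p q).1 (by simp))))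
  rw [cancel_mono] at e
  simp only [Category.assoc] at e
  exact e

theorem assoc {w x y z : D.Ob} (t : D.Hor y z) (s : D.Hor x y) (r : D.Hor w x) :
    Q.hcomp (g.mul t s) (𝟙 (HObj.mk (F.obj₁ r))) (by simp) ≫ g.mul (P.comp t s) r ≫
        F.map₁ (P.alpha t s r).hom =
      (Q.alpha (F.obj₁ t) (F.obj₁ s) (F.obj₁ r)).hom ≫
        Q.hcomp (𝟙 (HObj.mk (F.obj₁ t))) (g.mul s r) (by simp) ≫ g.mul t (P.comp s r) := by
  have := g.isIso_singleton r
  have := g.isIso_singleton s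
  have e := g.assoc_eval (Str.nil.snoc r) (Str.nil.snoc s) t
  change Q.hcomp (g.mul t (P.comp s (P.one x))) (𝟙 (HObj.mk (F.obj₁ (P.comp r (P.one w))))) _ ≫
    g.mul (P.comp t (P.comp s (P.one x))) (P.comp r (P.one w)) ≫
      F.map₁ (P.alpha t (P.comp s (P.one x)) (P.comp r (P.one w))).hom = (Q.alpha _ _ _).hom ≫
      Q.hcomp (𝟙 _) (g.mul (P.comp s (P.one x)) (P.comp r (P.one w))) _ ≫
        g.mul t (P.comp (P.comp s (P.one x)) (P.comp r (P.one w))) at e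
  have k : D.dom (P.rho s).hom = D.cod (P.rho r).hom := by simp
  have k' : D.dom (P.hcomp (𝟙 (HObj.mk t)) (P.rho s).hom (by simp)) = D.cod (P.rho r).hom := by simp
  have e₁ := Q.alpha_nat (𝟙 (HObj.mk (F.obj₁ t))) (F.map₁ (P.rho s).hom) (F.map₁ (P.rho r).hom)
    (by simp) (by simp)
  have e₂ := g.mul_nat (P.rho s).hom (P.rho r).hom k
  have e₃ := g.mul_nat_right t (P.rho s).hom (by simp)
  have e₄ := g.mul_nat_right t (P.hcomp (P.rho s).hom (P.rho r).hom k) (by simp)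
  have e₅ := g.mul_nat (P.hcomp (𝟙 (HObj.mk t)) (P.rho s).hom (by simp)) (P.rho r).hom k'
  have e₆ := P.alpha_nat (𝟙 (HObj.mk t)) (P.rho s).hom (P.rho r).hom (by simp) k
  have i₁ : IsIso (F.map₁ (P.rho r).hom) :=
    inferInstanceAs (IsIso ((GraphHom.F₁ F).map (P.rho r).hom))
  have i₂ : IsIso (F.map₁ (P.rho s).hom) :=
    inferInstanceAs (IsIso ((GraphHom.F₁ F).map (P.rho s).hom))
  have e₇ : Q.hcomp (Q.hcomp (𝟙 (HObj.mk (F.obj₁ t))) (F.map₁ (P.rho s).hom) (by simp))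
      (F.map₁ (P.rho r).hom) (by simp) ≫ Q.hcomp (g.mul t s) (𝟙 (HObj.mk (F.obj₁ r))) (by simp) =
      Q.hcomp (g.mul t (P.comp s (P.one x))) (𝟙 (HObj.mk (F.obj₁ (P.comp r (P.one w))))) (by simp) ≫
      Q.hcomp (F.map₁ (P.hcomp (𝟙 (HObj.mk t)) (P.rho s).hom (by simp))) (F.map₁ (P.rho r).hom)
        (by simp) := by
    rw [Q.hcomp_hcomp, Q.hcomp_hcomp]
    exact Q.hcomp_congr e₃ (by simp) _ _
  have e₈ : Q.hcomp (𝟙 (HObj.mk (F.obj₁ t)))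
      (Q.hcomp (F.map₁ (P.rho s).hom) (F.map₁ (P.rho r).hom) (by simp)) (by simp) ≫
      Q.hcomp (𝟙 (HObj.mk (F.obj₁ t))) (g.mul s r) (by simp) =
      Q.hcomp (𝟙 (HObj.mk (F.obj₁ t))) (g.mul (P.comp s (P.one x)) (P.comp r (P.one w))) (by simp) ≫
      Q.hcomp (𝟙 (HObj.mk (F.obj₁ t))) (F.map₁ (P.hcomp (P.rho s).hom (P.rho r).hom k))
        (by simp) := by
    rw [Q.hcomp_hcomp, Q.hcomp_hcomp]
    exact Q.hcomp_congr rfl e₂ _ _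
  rw [← cancel_epi (Q.hcomp (Q.hcomp (𝟙 (HObj.mk (F.obj₁ t))) (F.map₁ (P.rho s).hom) (by simp))
    (F.map₁ (P.rho r).hom) (by simp)), reassoc_of% e₇, reassoc_of% e₅, ← F.map₁_comp, e₆,
    F.map₁_comp, reassoc_of% e, reassoc_of% e₁, reassoc_of% e₈, e₄]

/-- The lax functor of a family of comparisons. -/
def laxStr : LaxStr P Q F where
  unit x := g.φ (Str.nil (x := x))
  dom_unit _ := g.dom_φ _
  cod_unit _ := g.cod_φ _
  unit_nat {x y} f := g.nat (p := Str.nil (x := x)) (q := Str.nil (x := y)) f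
  mul s r := g.mul s r
  dom_mul s r := g.dom_mul s r
  cod_mul s r := g.cod_mul s r
  mul_nat ψ φ h := g.mul_nat ψ φ h
  left r := g.left r
  right r := g.right r
  assoc t s r := g.assoc t s r

theorem eval_laxStr (g : LaxFamily P Q F) {x : D.Ob} : ∀ {y : D.Ob} (p : Str D.Hor x y),
    (g.laxStr.eval p).1 = g.φ p
  | _, .nil => rfl
  | _, .snoc p r => (congrArg (· ≫ g.mul r (P.eval p)) (Q.hcomp_congr rfl (g.eval_laxStr p) _
      ((E.dom_id _).trans (g.cod_φ p).symm))).trans (g.φ_snoc p r).symm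

end LaxFamily

theorem LaxStr.mul_eq_eval {P : PseudoDblStr D} {Q : PseudoDblStr E} {F : D ⟶ E}
    (f : LaxStr P Q F) {x y z : D.Ob} (s : D.Hor y z) (r : D.Hor x y) :
    f.mul s r = Q.hcomp (𝟙 (HObj.mk (F.obj₁ s))) (Q.rho (F.obj₁ r)).inv (by simp) ≫
    (f.eval ((Str.nil.snoc r).snoc s)).1 ≫
      F.map₁ (P.hcomp (𝟙 (HObj.mk s)) (P.rho r).hom (by simp)) := by
  have e := f.right r
  have e₁ := f.mul_nat_right s (P.rho r).hom (by simp)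
  change _ = _ ≫ (Q.hcomp _ (Q.hcomp (𝟙 _) (f.unit x) (by simp) ≫ f.mul r (P.one x)) (by simp) ≫
    f.mul s (P.comp r (P.one x))) ≫ _
  simp only [Category.assoc, ← e₁]
  simp only [Q.hcomp_hcomp_assoc, f.right, Category.assoc, Iso.inv_hom_id_assoc]
  have e₂ : Q.hcomp (𝟙 (HObj.mk (F.obj₁ s)) ≫ 𝟙 _ ≫ 𝟙 _)
    (F.map₁ (P.rho r).inv ≫ F.map₁ (P.rho r).hom) (by simp) = 𝟙 _ := by
    rw [← Q.hcomp_id]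
    refine Q.hcomp_congr (by simp) ?_ _ _
    rw [← F.map₁_comp, Iso.inv_hom_id]
    exact F.map₁_id _
  rw [e₂, Category.id_comp]

theorem LaxStr.ext_eval {P : PseudoDblStr D} {Q : PseudoDblStr E} {F : D ⟶ E}
    {f g : LaxStr P Q F} (h : ∀ {x y : D.Ob} (p : Str D.Hor x y), (f.eval p).1 = (g.eval p).1) :
    f = g := by
  apply LaxStr.ext
  · funext x
    exact h (Str.nil (x := x))
  · funext x y z s r
    rw [f.mul_eq_eval, g.mul_eq_eval, h]

end laxinv

section formulas

open Bicategory

variable {B : Type u} [Bicategory.{w, v} B] [Bicategory.Strict B] {M : TwoMonad B}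

theorem LaxMor.id_φ {X : B} (A : LaxAlg M X) : (LaxMor.id A).φ =
    eqToHom (by rw [M.T.map_id, Strict.id_comp, Strict.comp_id]) := rfl

theorem LaxMor.comp_φ {X Y Z : B} {A : LaxAlg M X} {A' : LaxAlg M Y} {A'' : LaxAlg M Z}
    {f : X ⟶ Y} {g : Y ⟶ Z} (p : LaxMor A A' f) (q : LaxMor A' A'' g) : (p.comp q).φ =
    eqToHom (M.map_comp_assoc _ _ _) ≫ M.T.map f ◁ q.φ ≫ eqToHom (Strict.assoc _ _ _).symm ≫
      p.φ ▷ g ≫ eqToHom (Strict.assoc _ _ _) := rfl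

theorem OplaxMor.id_ζ {X : B} (A : LaxAlg M X) : (OplaxMor.id A).ζ =
    eqToHom (by rw [M.T.map_id, Strict.id_comp, Strict.comp_id]) := rfl

theorem OplaxMor.comp_ζ {X Y Z : B} {A : LaxAlg M X} {A' : LaxAlg M Y} {A'' : LaxAlg M Z}
    {f : X ⟶ Y} {g : Y ⟶ Z} (p : OplaxMor A A' f) (q : OplaxMor A' A'' g) : (p.comp q).ζ =
    eqToHom (Strict.assoc _ _ _).symm ≫ p.ζ ▷ g ≫ eqToHom (Strict.assoc _ _ _) ≫
      M.T.map f ◁ q.ζ ≫ eqToHom (M.map_comp_assoc _ _ _).symm := rfl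

end formulas

section laxbij

variable {D E : Grph.{u, v}} {P : PseudoDblStr D} {Q : PseudoDblStr E} {F : D ⟶ E}

/-- The component of the structure 2-cell of a lax algebra morphism at a string. -/
abbrev LaxMor.at (g : LaxMor P.alg Q.alg F) {x y : D.Ob} (p : Str D.Hor x y) :
    HObj.mk (Q.eval (GraphHom.mapStr F p)) ⟶ HObj.mk (F.obj₁ (P.eval p)) :=
  GraphCell.app₁ (D := freeGraph D) g.φ ⟨p⟩

theorem LaxMor.app₀_alg (g : LaxMor P.alg Q.alg F) (x : D.Ob) :
    GraphCell.app₀ (D := freeGraph D) g.φ x = 𝟙 (F.F₀.obj x) := by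
  have e := congrArg (fun θ => GraphCell.app₀ θ x) g.unit
  simp only [comp_app₀, eqToHom_app₀] at e
  have e' : 𝟙 (F.F₀.obj x) ≫ 𝟙 (F.F₀.obj x) ≫ GraphCell.app₀ (D := freeGraph D) g.φ x =
    𝟙 (F.F₀.obj x) ≫ F.F₀.map (𝟙 x) ≫ 𝟙 (F.F₀.obj x) := e
  rw [F.F₀.map_id, Category.comp_id, Category.comp_id] at e'
  exact ((Category.id_comp _).trans (Category.id_comp _)).symm.trans e'

/-- The family of comparisons of a lax algebra morphism. -/
def LaxMor.family (g : LaxMor P.alg Q.alg F) : LaxFamily P Q F where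
  φ p := g.at p
  dom_φ {x _} p := (GraphCell.dom_app (D := freeGraph D) g.φ ⟨p⟩).trans (g.app₀_alg x)
  cod_φ {_ y} p := (GraphCell.cod_app (D := freeGraph D) g.φ ⟨p⟩).trans (g.app₀_alg y)
  nat {_ _ _ _ p q} c := GraphCell.nat₁ (D := freeGraph D) g.φ (r := ⟨p⟩) (s := ⟨q⟩) c
  unit r := by
    have e := congrArg (fun θ => GraphCell.app₁ θ ⟨r⟩) g.unit
    simp only [comp_app₁, eqToHom_app₁] at e
    have e' : (Q.rho (F.obj₁ r)).inv ≫ 𝟙 _ ≫ g.at (Str.nil.snoc r) =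
      𝟙 _ ≫ F.map₁ (P.rho r).inv ≫ 𝟙 _ := e
    rw [Category.id_comp, Category.id_comp, Category.comp_id, Iso.inv_comp_eq] at e'
    exact e'
  pair {x y z} p q := by
    have e := congrArg (fun θ => GraphCell.app₁ θ
      ⟨((Str.nil.snoc p).snoc q : Str (freeGraph D).Hor x z)⟩) g.mul
    simp only [comp_app₁, eqToHom_app₁] at e
    have k : E.dom (g.at p) = E.cod (Q.oneMap (GraphCell.app₀ (D := freeGraph D) g.φ x)) :=
      (GraphCell.dom_app (D := freeGraph D) g.φ ⟨p⟩).trans (Q.cod_oneMap _).symm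
    have k' : E.dom (g.at q) =
        E.cod (Q.hcomp (g.at p) (Q.oneMap (GraphCell.app₀ (D := freeGraph D) g.φ x)) k) :=
      (GraphCell.dom_app (D := freeGraph D) g.φ ⟨q⟩).trans
        ((GraphCell.cod_app (D := freeGraph D) g.φ ⟨p⟩).symm.trans (Q.cod_hcomp _ _ _).symm)
    have e' : (Q.mu ((Str.nil.snoc (GraphHom.mapStr F p)).snoc (GraphHom.mapStr F q))).1 ≫
      Q.evalEq (join_mapStr F ((Str.nil.snoc p).snoc q)) ≫ g.at (Str.append (Str.append .nil p) q) =
      𝟙 _ ≫ Q.hcomp (g.at q) (Q.hcomp (g.at p)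
        (Q.oneMap (GraphCell.app₀ (D := freeGraph D) g.φ x)) k) k' ≫ 𝟙 _ ≫
      g.at ((Str.nil.snoc (P.eval p)).snoc (P.eval q)) ≫ 𝟙 _ ≫
        F.map₁ (P.mu ((Str.nil.snoc p).snoc q)).1 ≫ 𝟙 _ := e
    simp only [g.app₀_alg, Q.oneMap_id, Category.id_comp, Category.comp_id] at e'
    exact e'

theorem LaxMor.algMor_family (g : LaxMor P.alg Q.alg F) : g.family.laxStr.algMor = g :=
  LaxMor.ext (graphCell_ext (fun x => (g.app₀_alg x).symm) (fun p => g.family.eval_laxStr p.hom))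

theorem LaxStr.family_algMor (f : LaxStr P Q F) : f.algMor.family.laxStr = f :=
  LaxStr.ext_eval (fun p => f.algMor.family.eval_laxStr p)

theorem LaxStr.bijective_algMor :
    Function.Bijective (fun f : LaxStr P Q F => f.algMor) :=
  Function.bijective_iff_has_inverse.mpr
    ⟨fun g => g.family.laxStr, fun f => f.family_algMor, fun g => g.algMor_family⟩

theorem LaxStr.eval_id (P : PseudoDblStr D) {x : D.Ob} : ∀ {y : D.Ob} (p : Str D.Hor x y),
    ((LaxStr.id P).eval p).1 = P.evalEq (mapStr_id p)
  | _, .nil => rfl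
  | _, .snoc p r => by
    rw [P.evalEq_snoc r (mapStr_id p)]
    exact (Category.comp_id _).trans (P.hcomp_congr rfl (LaxStr.eval_id P p) _ _)

theorem LaxStr.algMor_id (P : PseudoDblStr D) :
    (LaxStr.id P).algMor = LaxMor.id P.alg := by
  refine LaxMor.ext (graphCell_ext (fun x => ?_) (fun p => ?_))
  · rw [LaxMor.id_φ, eqToHom_app₀]
    rfl
  · rw [LaxMor.id_φ, eqToHom_app₁]
    exact LaxStr.eval_id P p.hom

theorem LaxStr.eval_comp {C : Grph.{u, v}} {R : PseudoDblStr C} {K : E ⟶ C} (f : LaxStr P Q F)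
    (k : LaxStr Q R K) {x : D.Ob} : ∀ {y : D.Ob} (p : Str D.Hor x y),
    ((f.comp k).eval p).1 = R.evalEq (mapStr_comp F K p) ≫ (k.eval (GraphHom.mapStr F p)).1 ≫
      K.map₁ (f.eval p).1
  | _, .nil => (Category.id_comp _).symm
  | _, .snoc p r => by
    have e := f.eval_comp k p
    have e₁ := k.mul_nat_right (F.obj₁ r) (f.eval p).1 (by simp)
    rw [R.evalEq_snoc (K.obj₁ (F.obj₁ r)) (mapStr_comp F K p), f.eval_snoc, K.map₁_comp]
    change R.hcomp (𝟙 (HObj.mk (K.obj₁ (F.obj₁ r)))) ((f.comp k).eval p).1 (by simp; rfl) ≫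
      k.mul (F.obj₁ r) (F.obj₁ (P.eval p)) ≫ K.map₁ (f.mul r (P.eval p)) = _ ≫
      (R.hcomp (𝟙 (HObj.mk (K.obj₁ (F.obj₁ r)))) (k.eval (GraphHom.mapStr F p)).1 (by simp) ≫
        k.mul (F.obj₁ r) (Q.eval (GraphHom.mapStr F p))) ≫ _
    rw [Category.assoc, ← reassoc_of% e₁]
    simp only [R.hcomp_hcomp_assoc]
    refine congrArg (· ≫ _) (R.hcomp_congr ?_ ?_ _ _)
    · rw [Category.id_comp, Category.id_comp]
    · rw [e]

theorem LaxStr.algMor_comp {C : Grph.{u, v}} {R : PseudoDblStr C} {K : E ⟶ C} (f : LaxStr P Q F)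
    (k : LaxStr Q R K) : (f.comp k).algMor = f.algMor.comp k.algMor := by
  refine LaxMor.ext (graphCell_ext (fun x => ?_) (fun p => ?_))
  · have e : 𝟙 (K.F₀.obj (F.F₀.obj x)) = 𝟙 _ ≫ 𝟙 (K.F₀.obj (F.F₀.obj x)) ≫ 𝟙 _ ≫
      K.F₀.map (𝟙 (F.F₀.obj x)) ≫ 𝟙 _ := by simp
    refine e.trans ?_
    rw [LaxMor.comp_φ]
    simp only [comp_app₀, eqToHom_app₀]
    rfl
  · refine (f.eval_comp k p.hom).trans ?_
    rw [LaxMor.comp_φ]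
    simp only [comp_app₁, eqToHom_app₁]
    change _ = R.evalEq (mapStr_comp F K p.hom) ≫ (k.eval (GraphHom.mapStr F p.hom)).1 ≫
      𝟙 _ ≫ K.map₁ (f.eval p.hom).1 ≫ 𝟙 _
    exact congrArg (fun t => _ ≫ _ ≫ t) ((Category.id_comp _).trans (Category.comp_id _)).symm

end laxbij

section oplaxalg

variable {D E : Grph.{u, v}}

section naturality

variable {P : PseudoDblStr D} {Q : PseudoDblStr E} {F : D ⟶ E} (f : OplaxStr P Q F)

theorem OplaxStr.mul_nat_right {x y z x' : D.Ob} (s : D.Hor y z) {r : D.Hor x y} {r' : D.Hor x' y}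
    (φ : HObj.mk r ⟶ HObj.mk r') (h : D.cod φ = 𝟙 y) :
    F.map₁ (P.hcomp (𝟙 (HObj.mk s)) φ (by simp [h])) ≫ f.mul s r' =
      f.mul s r ≫ Q.hcomp (𝟙 (HObj.mk (F.obj₁ s))) (F.map₁ φ) (by simp [h]) := by
  rw [f.mul_nat]
  exact congrArg (_ ≫ ·) (Q.hcomp_congr (F.map₁_id ⟨s⟩) rfl _ _)

theorem OplaxStr.left' {x y : D.Ob} (r : D.Hor x y) :
    f.mul (P.one y) r ≫ Q.hcomp (f.unit y) (𝟙 (HObj.mk (F.obj₁ r))) (by simp) ≫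
      (Q.lam (F.obj₁ r)).hom = F.map₁ (P.lam r).hom := by
  rw [← Category.assoc, f.left, Category.assoc, Iso.inv_hom_id, Category.comp_id]

theorem OplaxStr.right' {x y : D.Ob} (r : D.Hor x y) :
    f.mul r (P.one x) ≫ Q.hcomp (𝟙 (HObj.mk (F.obj₁ r))) (f.unit x) (by simp) ≫
      (Q.rho (F.obj₁ r)).hom = F.map₁ (P.rho r).hom := by
  rw [← Category.assoc, f.right, Category.assoc, Iso.inv_hom_id, Category.comp_id]

theorem OplaxStr.assoc' {w x y z : D.Ob} (t : D.Hor y z) (s : D.Hor x y) (r : D.Hor w x) :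
    F.map₁ (P.alpha t s r).hom ≫ f.mul t (P.comp s r) ≫
      Q.hcomp (𝟙 (HObj.mk (F.obj₁ t))) (f.mul s r) (by simp) =
    f.mul (P.comp t s) r ≫ Q.hcomp (f.mul t s) (𝟙 (HObj.mk (F.obj₁ r))) (by simp) ≫
      (Q.alpha (F.obj₁ t) (F.obj₁ s) (F.obj₁ r)).hom := by
  have e := f.assoc t s r
  rw [← Category.assoc, ← Category.assoc, Iso.eq_comp_inv] at e
  simp only [Category.assoc] at e
  rw [← e, ← Category.assoc, ← F.map₁_comp, Iso.hom_inv_id, F.map₁_id, Category.id_comp]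

end naturality

theorem OplaxStr.dom_eval {P : PseudoDblStr D} {Q : PseudoDblStr E} {F : D ⟶ E}
    (f : OplaxStr P Q F) {x : D.Ob} : ∀ {y : D.Ob} (p : Str D.Hor x y),
    E.dom (f.eval p).val = 𝟙 (F.F₀.obj x)
  | _, .nil => f.dom_unit x
  | _, .snoc p r => (E.dom_comp _ _).trans ((congrArg₂ (· ≫ ·) (f.dom_mul r (P.eval p))
      ((Q.dom_hcomp _ _ _).trans (f.dom_eval p))).trans (Category.comp_id _))

theorem OplaxStr.cod_eval {P : PseudoDblStr D} {Q : PseudoDblStr E} {F : D ⟶ E}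
    (f : OplaxStr P Q F) {x y : D.Ob} (p : Str D.Hor x y) :
    E.cod (f.eval p).val = 𝟙 (F.F₀.obj y) := (f.eval p).2

attribute [simp] OplaxStr.dom_eval OplaxStr.cod_eval

theorem OplaxStr.eval_snoc {P : PseudoDblStr D} {Q : PseudoDblStr E} {F : D ⟶ E}
    (f : OplaxStr P Q F) {x y z : D.Ob} (p : Str D.Hor x y) (r : D.Hor y z) :
    (f.eval (p.snoc r)).1 = f.mul r (P.eval p) ≫
      Q.hcomp (𝟙 (HObj.mk (F.obj₁ r))) (f.eval p).1 (by simp) := rfl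

theorem OplaxStr.eval_nat {P : PseudoDblStr D} {Q : PseudoDblStr E} {F : D ⟶ E}
    (f : OplaxStr P Q F) {x x' : D.Ob} : ∀ {y y' : D.Ob} {p : Str D.Hor x y}
    {q : Str D.Hor x' y'} (c : (strCell D p q).T),
    F.map₁ (P.evalCell c).1 ≫ (f.eval q).1 =
      (f.eval p).1 ≫ (Q.evalCell (GraphHom.mapCell F c).1).1
  | _, _, .nil, .nil, c => f.unit_nat (x := x) (y := x') c
  | _, _, .snoc p r, .snoc q s, c => by
    have e := f.eval_nat c.1.1
    have k : D.dom c.1.2 = D.cod (P.evalCell c.1.1).1 := c.2.symm.trans (P.evalCell c.1.1).2.symm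
    have k' : E.dom (F.map₁ c.1.2) = E.cod (Q.evalCell (GraphHom.mapCell F c.1.1).1).1 :=
      (F.dom_map₁ _).trans ((congrArg F.F₀.map c.2.symm).trans
        ((GraphHom.mapCell F c.1.1).2.2.symm.trans (Q.evalCell _).2.symm))
    change F.map₁ (P.hcomp c.1.2 (P.evalCell c.1.1).1 k) ≫ f.mul s (P.eval q) ≫
      Q.hcomp (𝟙 (HObj.mk (F.obj₁ s))) (f.eval q).1 (by simp) =
      (f.mul r (P.eval p) ≫ Q.hcomp (𝟙 (HObj.mk (F.obj₁ r))) (f.eval p).1 (by simp)) ≫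
        Q.hcomp (F.map₁ c.1.2) (Q.evalCell (GraphHom.mapCell F c.1.1).1).1 k'
    rw [Category.assoc, f.mul_nat_assoc _ _ k, Q.hcomp_hcomp, Q.hcomp_hcomp]
    refine congrArg (_ ≫ ·) (Q.hcomp_congr ?_ e _ _)
    rw [Category.comp_id, Category.id_comp]
  | _, _, .nil, .snoc _ _, c => c.elim
  | _, _, .snoc _ _, .nil, c => c.elim

theorem OplaxStr.eval_append {P : PseudoDblStr D} {Q : PseudoDblStr E} {F : D ⟶ E}
    (f : OplaxStr P Q F) {x y : D.Ob} (p : Str D.Hor x y) : ∀ {z : D.Ob} (q : Str D.Hor y z),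
    F.map₁ (P.nu p q).1 ≫ (f.eval (p.append q)).1 =
      f.mul (P.eval q) (P.eval p) ≫ Q.hcomp (f.eval q).1 (f.eval p).1 (by simp) ≫
        (Q.nu (GraphHom.mapStr F p) (GraphHom.mapStr F q)).1 ≫
        Q.evalEq (mapStr_append F p q).symm
  | _, .nil => by
    have e := f.left' (P.eval p)
    have e₁ := Q.lam_nat_of_id (f.eval p).1 (by simp)
    have e₂ : Q.hcomp (f.unit y) (f.eval p).1 (by simp) =
      Q.hcomp (f.unit y) (𝟙 _) (by simp) ≫ Q.hcomp (𝟙 _) (f.eval p).1 (by simp) := by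
      rw [Q.hcomp_hcomp]
      exact Q.hcomp_congr (Category.comp_id _).symm (Category.id_comp _).symm _ _
    change F.map₁ (P.lam _).hom ≫ (f.eval p).1 = f.mul (P.one y) (P.eval p) ≫
      Q.hcomp (f.unit y) (f.eval p).1 (by simp) ≫ (Q.lam _).hom ≫ 𝟙 _
    rw [e₂, Category.comp_id, Category.assoc, e₁, ← e]
    simp only [Category.assoc]
  | _, .snoc q r => by
    have e := f.eval_append p q
    have e₁ := f.assoc' r (P.eval q) (P.eval p)
    have e₂ := Q.alpha_nat (𝟙 (HObj.mk (F.obj₁ r))) (f.eval q).1 (f.eval p).1 (by simp)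
      (by simp)
    have e₃ := f.mul_nat_right r (P.nu p q).1 (by simp)
    have e₄ : Q.hcomp (f.eval (q.snoc r)).1 (f.eval p).1 (by simp) =
      Q.hcomp (f.mul r (P.eval q)) (𝟙 (HObj.mk (F.obj₁ (P.eval p)))) (by simp) ≫
      Q.hcomp (Q.hcomp (𝟙 (HObj.mk (F.obj₁ r))) (f.eval q).1 (by simp)) (f.eval p).1 (by simp) := by
      rw [Q.hcomp_hcomp]
      exact Q.hcomp_congr rfl (Category.id_comp _).symm _ _
    have e₅ : Q.hcomp (𝟙 (HObj.mk (F.obj₁ r))) (F.map₁ (P.nu p q).1) (by simp) ≫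
        Q.hcomp (𝟙 (HObj.mk (F.obj₁ r))) (f.eval (p.append q)).1 (by simp) =
      Q.hcomp (𝟙 (HObj.mk (F.obj₁ r))) (f.mul (P.eval q) (P.eval p)) (by simp) ≫
        Q.hcomp (𝟙 (HObj.mk (F.obj₁ r))) (Q.hcomp (f.eval q).1 (f.eval p).1 (by simp)) (by simp) ≫
        Q.hcomp (𝟙 (HObj.mk (F.obj₁ r)))
          (Q.nu (GraphHom.mapStr F p) (GraphHom.mapStr F q)).1 (by simp) ≫
        Q.hcomp (𝟙 (HObj.mk (F.obj₁ r))) (Q.evalEq (mapStr_append F p q).symm) (by simp) := by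
      rw [Q.hcomp_hcomp, Q.hcomp_hcomp, Q.hcomp_hcomp, Q.hcomp_hcomp]
      refine Q.hcomp_congr ?_ e _ _
      simp
    rw [e₄, P.nu_snoc, F.map₁_comp, Q.evalEq_snoc (F.obj₁ r) (mapStr_append F p q).symm]
    change (_ ≫ _) ≫ f.mul r (P.eval (p.append q)) ≫
        Q.hcomp (𝟙 _) (f.eval (p.append q)).1 (by simp) =
      f.mul (P.comp r (P.eval q)) (P.eval p) ≫ (_ ≫ _) ≫ ((Q.alpha _ _ _).hom ≫
        Q.hcomp (𝟙 (HObj.mk (F.obj₁ r)))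
          (Q.nu (GraphHom.mapStr F p) (GraphHom.mapStr F q)).1 (by simp)) ≫
      Q.hcomp (𝟙 _) _ _
    simp only [Category.assoc]
    rw [reassoc_of% e₃, e₅, reassoc_of% e₁, reassoc_of% e₂]

/-- The comparison of an oplax functor for composites of strings, as a 2-cell of graphs. -/
def OplaxStr.evalGraphCell {P : PseudoDblStr D} {Q : PseudoDblStr E} {F : D ⟶ E}
    (f : OplaxStr P Q F) : P.evalHom ≫ F ⟶ freeMap F ≫ Q.evalHom where
  app₀ x := 𝟙 (F.F₀.obj x)
  app₁ p := (f.eval p.hom).1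
  nat₀ g := (Category.comp_id (F.F₀.map g)).trans (Category.id_comp (F.F₀.map g)).symm
  nat₁ c := f.eval_nat c
  dom_app p := f.dom_eval p.hom
  cod_app p := (f.eval p.hom).2

theorem OplaxStr.eval_join {P : PseudoDblStr D} {Q : PseudoDblStr E} {F : D ⟶ E}
    (f : OplaxStr P Q F) {x : D.Ob} : ∀ {y : D.Ob} (S : Str (freeGraph D).Hor x y),
    F.map₁ (P.mu S).1 ≫ (f.eval S.join).1 =
      (f.eval (GraphHom.mapStr P.evalHom S)).1 ≫
        Q.evalEq (mapStr_comp P.evalHom F S).symm ≫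
        (Q.evalCell (GraphCell.strApp f.evalGraphCell S).1).1 ≫
        Q.evalEq (mapStr_comp (freeMap F) Q.evalHom S) ≫
        (Q.mu (GraphHom.mapStr (freeMap F) S)).1 ≫ Q.evalEq (join_mapStr F S)
  | _, .nil => by
    change F.map₁ (𝟙 (HObj.mk (P.one x))) ≫ f.unit x =
      f.unit x ≫ 𝟙 _ ≫ Q.oneMap (𝟙 (F.F₀.obj x)) ≫ 𝟙 _ ≫ 𝟙 _ ≫ 𝟙 _
    rw [Q.oneMap_id, F.map₁_id]
    simp only [Category.id_comp, Category.comp_id]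
  | _, .snoc S q => by
    have e := f.eval_join S
    have e₁ := Q.nu_eqCell (join_mapStr F S) (rfl : GraphHom.mapStr F q = GraphHom.mapStr F q)
      (by simp)
    have e₂ := f.eval_append S.join q
    have e₃ := f.mul_nat_right (P.eval q) (P.mu S).1 (by simp)
    have e₄ : Q.evalEq (join_mapStr F (S.snoc q)) =
        Q.evalEq (congrArg (fun a => Str.append a (GraphHom.mapStr F q)) (join_mapStr F S)) ≫
        Q.evalEq (mapStr_append F S.join q).symm := (eqCell_trans _ _).symm
    have k : E.dom (f.eval q).1 =
        E.cod (Q.evalCell (GraphCell.strApp f.evalGraphCell S).1).1 :=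
      (f.dom_eval q).trans ((GraphCell.strApp f.evalGraphCell S).2.2.symm.trans
        (Q.evalCell _).2.symm)
    have k' : E.cod (Q.evalCell (GraphCell.strApp f.evalGraphCell S).1).1 = 𝟙 _ :=
      k.symm.trans (f.dom_eval q)
    rw [P.mu_snoc, F.map₁_comp, Q.evalEq_snoc (Q.eval (GraphHom.mapStr F q))
      (mapStr_comp (freeMap F) Q.evalHom S), Q.evalEq_snoc (F.obj₁ (P.eval q))
      (mapStr_comp P.evalHom F S).symm, e₄]
    change (_ ≫ _) ≫ (f.eval (S.join.append q)).1 =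
      (f.mul (P.eval q) (P.eval (GraphHom.mapStr P.evalHom S)) ≫
        Q.hcomp (𝟙 _) (f.eval (GraphHom.mapStr P.evalHom S)).1 (by simp)) ≫ _ ≫
      Q.hcomp (f.eval q).1 (Q.evalCell (GraphCell.strApp f.evalGraphCell S).1).1 k ≫ _ ≫
      (Q.hcomp (𝟙 (HObj.mk (Q.eval (GraphHom.mapStr F q))))
        (Q.mu (GraphHom.mapStr (freeMap F) S)).1 (by simp) ≫ (Q.nu _ (GraphHom.mapStr F q)).1) ≫ _
    simp only [Category.assoc]
    rw [← reassoc_of% e₁, e₂, reassoc_of% e₃]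
    simp only [Q.hcomp_hcomp_assoc]
    refine congrArg (_ ≫ ·) (congrArg (· ≫ _) (Q.hcomp_congr ?_ ?_ _ _))
    · simp
    · rw [e]

/-- The oplax algebra morphism of an oplax functor. -/
def OplaxStr.algMor {P : PseudoDblStr D} {Q : PseudoDblStr E} {F : D ⟶ E} (f : OplaxStr P Q F) :
    OplaxMor P.alg Q.alg F where
  ζ := f.evalGraphCell
  unit := by
    refine graphCell_ext (fun x => ?_) (fun r => ?_) <;>
      simp only [comp_app₀, comp_app₁, eqToHom_app₀, eqToHom_app₁]
    · change F.F₀.map (𝟙 x) ≫ 𝟙 (F.F₀.obj x) ≫ 𝟙 (F.F₀.obj x) =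
        𝟙 (F.F₀.obj x) ≫ 𝟙 (F.F₀.obj x) ≫ 𝟙 (F.F₀.obj x)
      simp
    · have e := f.right' r.hom
      change F.map₁ (P.rho r.hom).inv ≫ 𝟙 _ ≫ (f.mul r.hom (P.one r.src) ≫
        Q.hcomp (𝟙 (HObj.mk (F.obj₁ r.hom))) (f.unit r.src) (by simp)) =
        𝟙 _ ≫ (Q.rho (F.obj₁ r.hom)).inv ≫ 𝟙 _
      rw [f.right, Category.id_comp, Category.id_comp, Category.comp_id, ← Category.assoc,
        ← F.map₁_comp, Iso.inv_hom_id, F.map₁_id, Category.id_comp]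
  mul := by
    refine graphCell_ext (fun x => ?_) (fun S => ?_) <;>
      simp only [comp_app₀, comp_app₁, eqToHom_app₀, eqToHom_app₁]
    · have e : ∀ x : D.Ob, F.F₀.map (𝟙 x) ≫ 𝟙 (F.F₀.obj x) ≫ 𝟙 (F.F₀.obj x) =
        𝟙 (F.F₀.obj x) ≫ 𝟙 (F.F₀.obj x) ≫ 𝟙 (F.F₀.obj x) ≫ 𝟙 (F.F₀.obj x) ≫
          𝟙 (F.F₀.obj x) ≫ 𝟙 (F.F₀.obj x) ≫ 𝟙 (F.F₀.obj x) := fun x => by simp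
      exact e x
    · refine Eq.trans ?_ ((f.eval_join S.hom).trans ?_)
      · exact congrArg (_ ≫ ·) (Category.id_comp _)
      · exact (Category.id_comp _).symm

theorem OplaxStr.mul_eq_eval {P : PseudoDblStr D} {Q : PseudoDblStr E} {F : D ⟶ E}
    (f : OplaxStr P Q F) {x y z : D.Ob} (s : D.Hor y z) (r : D.Hor x y) :
    f.mul s r = F.map₁ (P.hcomp (𝟙 (HObj.mk s)) (P.rho r).inv (by simp)) ≫
      (f.eval ((Str.nil.snoc r).snoc s)).1 ≫
        Q.hcomp (𝟙 (HObj.mk (F.obj₁ s))) (Q.rho (F.obj₁ r)).hom (by simp) := by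
  have e := f.right' r
  have e₁ := f.mul_nat_right s (P.rho r).inv (by simp)
  change _ = _ ≫ (f.mul s (P.comp r (P.one x)) ≫ Q.hcomp _ (f.mul r (P.one x) ≫
    Q.hcomp (𝟙 _) (f.unit x) (by simp)) (by simp)) ≫ _
  simp only [Category.assoc]
  rw [reassoc_of% e₁]
  simp only [Q.hcomp_hcomp, Category.assoc, e]
  have e₂ : Q.hcomp (𝟙 (HObj.mk (F.obj₁ s)) ≫ 𝟙 _ ≫ 𝟙 _)
    (F.map₁ (P.rho r).inv ≫ F.map₁ (P.rho r).hom) (by simp) = 𝟙 _ := by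
    rw [← Q.hcomp_id]
    refine Q.hcomp_congr (by simp) ?_ _ _
    rw [← F.map₁_comp, Iso.inv_hom_id]
    exact F.map₁_id _
  rw [e₂, Category.comp_id]

theorem OplaxStr.ext_eval {P : PseudoDblStr D} {Q : PseudoDblStr E} {F : D ⟶ E}
    {f g : OplaxStr P Q F} (h : ∀ {x y : D.Ob} (p : Str D.Hor x y), (f.eval p).1 = (g.eval p).1) :
    f = g := by
  apply OplaxStr.ext
  · funext x
    exact h (Str.nil (x := x))
  · funext x y z s r
    rw [f.mul_eq_eval, g.mul_eq_eval, h]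

theorem OplaxStr.eval_id (P : PseudoDblStr D) {x : D.Ob} : ∀ {y : D.Ob} (p : Str D.Hor x y),
    ((OplaxStr.id P).eval p).1 = P.evalEq (mapStr_id p).symm
  | _, .nil => rfl
  | _, .snoc p r => by
    rw [P.evalEq_snoc r (mapStr_id p).symm]
    exact (Category.id_comp _).trans (P.hcomp_congr rfl (OplaxStr.eval_id P p) _ _)

theorem OplaxStr.algMor_id (P : PseudoDblStr D) :
    (OplaxStr.id P).algMor = OplaxMor.id P.alg := by
  refine OplaxMor.ext (graphCell_ext (fun x => ?_) (fun p => ?_))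
  · rw [OplaxMor.id_ζ, eqToHom_app₀]
    rfl
  · rw [OplaxMor.id_ζ, eqToHom_app₁]
    exact OplaxStr.eval_id P p.hom

theorem OplaxStr.eval_comp {P : PseudoDblStr D} {Q : PseudoDblStr E} {F : D ⟶ E}
    {C : Grph.{u, v}} {R : PseudoDblStr C} {K : E ⟶ C} (f : OplaxStr P Q F)
    (k : OplaxStr Q R K) {x : D.Ob} : ∀ {y : D.Ob} (p : Str D.Hor x y),
    ((f.comp k).eval p).1 = K.map₁ (f.eval p).1 ≫ (k.eval (GraphHom.mapStr F p)).1 ≫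
      R.evalEq (mapStr_comp F K p).symm
  | _, .nil => congrArg (_ ≫ ·) (Category.comp_id _).symm
  | _, .snoc p r => by
    have e := f.eval_comp k p
    have e₁ := k.mul_nat_right (F.obj₁ r) (f.eval p).1 (by simp)
    rw [R.evalEq_snoc (K.obj₁ (F.obj₁ r)) (mapStr_comp F K p).symm, f.eval_snoc, K.map₁_comp]
    change (K.map₁ (f.mul r (P.eval p)) ≫ k.mul (F.obj₁ r) (F.obj₁ (P.eval p))) ≫
      R.hcomp (𝟙 (HObj.mk (K.obj₁ (F.obj₁ r)))) ((f.comp k).eval p).1 (by simp; rfl) = _ ≫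
      (k.mul (F.obj₁ r) (Q.eval (GraphHom.mapStr F p)) ≫
        R.hcomp (𝟙 (HObj.mk (K.obj₁ (F.obj₁ r)))) (k.eval (GraphHom.mapStr F p)).1 (by simp)) ≫ _
    simp only [Category.assoc]
    rw [reassoc_of% e₁]
    simp only [R.hcomp_hcomp]
    refine congrArg (fun t => _ ≫ _ ≫ t) (R.hcomp_congr ?_ ?_ _ _)
    · rw [Category.id_comp, Category.id_comp]
    · rw [e]

theorem OplaxStr.algMor_comp {P : PseudoDblStr D} {Q : PseudoDblStr E} {F : D ⟶ E}
    {C : Grph.{u, v}} {R : PseudoDblStr C} {K : E ⟶ C} (f : OplaxStr P Q F)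
    (k : OplaxStr Q R K) : (f.comp k).algMor = f.algMor.comp k.algMor := by
  refine OplaxMor.ext (graphCell_ext (fun x => ?_) (fun p => ?_))
  · have e : 𝟙 (K.F₀.obj (F.F₀.obj x)) = 𝟙 _ ≫ K.F₀.map (𝟙 (F.F₀.obj x)) ≫ 𝟙 _ ≫
      𝟙 (K.F₀.obj (F.F₀.obj x)) ≫ 𝟙 _ := by simp
    refine e.trans ?_
    rw [OplaxMor.comp_ζ]
    simp only [comp_app₀, eqToHom_app₀]
    rfl
  · refine (f.eval_comp k p.hom).trans ?_
    rw [OplaxMor.comp_ζ]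
    simp only [comp_app₁, eqToHom_app₁]
    change _ = 𝟙 _ ≫ K.map₁ (f.eval p.hom).1 ≫ 𝟙 _ ≫ (k.eval (GraphHom.mapStr F p.hom)).1 ≫
      R.evalEq (mapStr_comp F K p.hom).symm
    exact ((Category.id_comp _).trans (congrArg (_ ≫ ·) (Category.id_comp _))).symm

end oplaxalg

section oplaxinv

variable {D E : Grph.{u, v}}

/-- A family of globular 2-cells comparing composites of strings, with the properties of the
structure 2-cell of an oplax algebra morphism. -/
structure OplaxFamily (P : PseudoDblStr D) (Q : PseudoDblStr E) (F : D ⟶ E) where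
  φ : ∀ {x y : D.Ob} (p : Str D.Hor x y),
    HObj.mk (F.obj₁ (P.eval p)) ⟶ HObj.mk (Q.eval (GraphHom.mapStr F p))
  dom_φ : ∀ {x y : D.Ob} (p : Str D.Hor x y), E.dom (φ p) = 𝟙 (F.F₀.obj x)
  cod_φ : ∀ {x y : D.Ob} (p : Str D.Hor x y), E.cod (φ p) = 𝟙 (F.F₀.obj y)
  nat : ∀ {x x' y y' : D.Ob} {p : Str D.Hor x y} {q : Str D.Hor x' y'} (c : (strCell D p q).T),
    F.map₁ (P.evalCell c).1 ≫ φ q = φ p ≫ (Q.evalCell (GraphHom.mapCell F c).1).1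
  unit : ∀ {x y : D.Ob} (r : D.Hor x y),
    φ (Str.nil.snoc r) = F.map₁ (P.rho r).hom ≫ (Q.rho (F.obj₁ r)).inv
  pair : ∀ {x y z : D.Ob} (p : Str D.Hor x y) (q : Str D.Hor y z),
    F.map₁ (P.mu ((Str.nil.snoc p).snoc q)).1 ≫ φ (Str.append (Str.append .nil p) q) =
    φ ((Str.nil.snoc (P.eval p)).snoc (P.eval q)) ≫
      Q.hcomp (φ q) (Q.hcomp (φ p) (𝟙 (HObj.mk (Q.one _))) (by simp [dom_φ]))
        (by simp [dom_φ, cod_φ]) ≫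
      (Q.mu ((Str.nil.snoc (GraphHom.mapStr F p)).snoc (GraphHom.mapStr F q))).1 ≫
      Q.evalEq (join_mapStr F ((Str.nil.snoc p).snoc q))

attribute [simp] OplaxFamily.dom_φ OplaxFamily.cod_φ

namespace OplaxFamily

variable {P : PseudoDblStr D} {Q : PseudoDblStr E} {F : D ⟶ E} (g : OplaxFamily P Q F)

/-- The comparison for binary composites. -/
def mul {x y z : D.Ob} (s : D.Hor y z) (r : D.Hor x y) :
    HObj.mk (F.obj₁ (P.comp s r)) ⟶ HObj.mk (Q.comp (F.obj₁ s) (F.obj₁ r)) :=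
  F.map₁ (P.hcomp (𝟙 (HObj.mk s)) (P.rho r).inv (by simp)) ≫ g.φ ((Str.nil.snoc r).snoc s) ≫
    Q.hcomp (𝟙 (HObj.mk (F.obj₁ s))) (Q.rho (F.obj₁ r)).hom (by simp)

@[simp] theorem dom_mul {x y z : D.Ob} (s : D.Hor y z) (r : D.Hor x y) :
    E.dom (g.mul s r) = 𝟙 _ := by
  rw [mul, E.dom_comp, E.dom_comp, Q.dom_hcomp, g.dom_φ, F.dom_map₁, P.dom_hcomp]
  simp

@[simp] theorem cod_mul {x y z : D.Ob} (s : D.Hor y z) (r : D.Hor x y) :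
    E.cod (g.mul s r) = 𝟙 _ := by
  rw [mul, E.cod_comp, E.cod_comp, Q.cod_hcomp, g.cod_φ, F.cod_map₁, P.cod_hcomp]
  simp

theorem mul_nat {x y z x' y' z' : D.Ob} {s : D.Hor y z} {r : D.Hor x y} {s' : D.Hor y' z'}
    {r' : D.Hor x' y'} (ψ : HObj.mk s ⟶ HObj.mk s') (φ : HObj.mk r ⟶ HObj.mk r')
    (h : D.dom ψ = D.cod φ) :
    F.map₁ (P.hcomp ψ φ h) ≫ g.mul s' r' =
      g.mul s r ≫ Q.hcomp (F.map₁ ψ) (F.map₁ φ) (by simp [h]) := by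
  have k : (strCell D (Str.nil.snoc r) (Str.nil.snoc r')).cod ⟨(D.dom φ, φ), rfl⟩ = D.dom ψ := h.symm
  have e := g.nat (p := (Str.nil.snoc r).snoc s) (q := (Str.nil.snoc r').snoc s')
    ⟨(⟨(D.dom φ, φ), rfl⟩, ψ), k⟩
  have e₁ : F.map₁ (P.hcomp ψ (P.hcomp φ (P.oneMap (D.dom φ)) (by simp)) (by simp [h])) ≫
      g.φ ((Str.nil.snoc r').snoc s') = g.φ ((Str.nil.snoc r).snoc s) ≫
      Q.hcomp (F.map₁ ψ) (Q.hcomp (F.map₁ φ) (Q.oneMap (F.F₀.map (D.dom φ))) (by simp))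
      (by simp [h]) := e
  have e₂ : P.hcomp ψ φ h ≫ P.hcomp (𝟙 (HObj.mk s')) (P.rho r').inv (by simp) =
      P.hcomp (𝟙 (HObj.mk s)) (P.rho r).inv (by simp) ≫
        P.hcomp ψ (P.hcomp φ (P.oneMap (D.dom φ)) (by simp)) (by simp [h]) := by
    rw [P.hcomp_hcomp, P.hcomp_hcomp]
    refine P.hcomp_congr (by simp) ?_ _ _
    rw [Iso.comp_inv_eq, Category.assoc, Iso.eq_inv_comp, ← P.rho_nat]
  have e₃ : Q.hcomp (F.map₁ φ) (Q.oneMap (F.F₀.map (D.dom φ))) (by simp) ≫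
      (Q.rho (F.obj₁ r')).hom = (Q.rho (F.obj₁ r)).hom ≫ F.map₁ φ := by
    rw [← Q.rho_nat]
    exact congrArg (· ≫ _) (Q.hcomp_congr rfl (congrArg Q.oneMap (F.dom_map₁ φ)).symm _ _)
  have e₄ := congrArg F.map₁ e₂
  rw [F.map₁_comp, F.map₁_comp] at e₄
  rw [mul, reassoc_of% e₄, reassoc_of% e₁, mul, Category.assoc, Category.assoc,
    Q.hcomp_hcomp, Q.hcomp_hcomp]
  refine congrArg (fun t => _ ≫ _ ≫ t) (Q.hcomp_congr ?_ e₃ _ _)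
  simp

theorem mul_nat_right {x y z x' : D.Ob} (s : D.Hor y z) {r : D.Hor x y} {r' : D.Hor x' y}
    (φ : HObj.mk r ⟶ HObj.mk r') (h : D.cod φ = 𝟙 y) :
    F.map₁ (P.hcomp (𝟙 (HObj.mk s)) φ (by simp [h])) ≫ g.mul s r' =
      g.mul s r ≫ Q.hcomp (𝟙 (HObj.mk (F.obj₁ s))) (F.map₁ φ) (by simp [h]) := by
  rw [g.mul_nat]
  exact congrArg (_ ≫ ·) (Q.hcomp_congr (F.map₁_id ⟨s⟩) rfl _ _)

theorem mul_nat_left {x y z z' : D.Ob} {s : D.Hor y z} {s' : D.Hor y z'} (r : D.Hor x y)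
    (ψ : HObj.mk s ⟶ HObj.mk s') (h : D.dom ψ = 𝟙 y) :
    F.map₁ (P.hcomp ψ (𝟙 (HObj.mk r)) (by simp [h])) ≫ g.mul s' r =
      g.mul s r ≫ Q.hcomp (F.map₁ ψ) (𝟙 (HObj.mk (F.obj₁ r))) (by simp [h]) := by
  rw [g.mul_nat]
  exact congrArg (_ ≫ ·) (Q.hcomp_congr rfl (F.map₁_id ⟨r⟩) _ _)

theorem φ_eqCell {x y : D.Ob} {p q : Str D.Hor x y} (h : p = q) :
    F.map₁ (P.evalEq h) ≫ g.φ q =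
      g.φ p ≫ Q.evalEq (congrArg (fun p => GraphHom.mapStr F p) h) := by
  subst h
  exact (congrArg (· ≫ _) (F.map₁_id ⟨P.eval p⟩)).trans
    ((Category.id_comp _).trans (Category.comp_id _).symm)

theorem φ_append {x y z : D.Ob} (p : Str D.Hor x y) (q : Str D.Hor y z) :
    F.map₁ (P.nu p q).1 ≫ g.φ (p.append q) = g.mul (P.eval q) (P.eval p) ≫
      Q.hcomp (g.φ q) (g.φ p) (by simp) ≫
      (Q.nu (GraphHom.mapStr F p) (GraphHom.mapStr F q)).1 ≫
        Q.evalEq (mapStr_append F p q).symm := by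
  have e := g.pair p q
  have e₁ := Q.rho_nat_of_id (g.φ p) (g.dom_φ p)
  have e₂ := g.φ_eqCell (congrArg (fun a => Str.append a q) (nil_append p).symm)
  have e₃ : Q.evalEq (congrArg (fun a => Str.append a (GraphHom.mapStr F q))
      (nil_append (GraphHom.mapStr F p)).symm) ≫
      Q.evalEq (join_mapStr F ((Str.nil.snoc p).snoc q)) =
      Q.evalEq (mapStr_append F p q).symm ≫ Q.evalEq (congrArg (fun p => GraphHom.mapStr F p)
        (congrArg (fun a => Str.append a q) (nil_append p).symm)) := by
    rw [eqCell_trans, eqCell_trans]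
  have e₄ : F.map₁ (P.hcomp (𝟙 (HObj.mk (P.eval q))) (P.rho (P.eval p)).inv (by simp)) ≫
      F.map₁ (P.hcomp (𝟙 (HObj.mk (P.eval q))) (P.rho (P.eval p)).hom (by simp)) = 𝟙 _ := by
    rw [← F.map₁_comp, P.hcomp_hcomp, ← F.map₁_id, ← P.hcomp_id]
    exact congrArg F.map₁ (P.hcomp_congr (by simp) (by simp) _ _)
  rw [P.mu_pair, Q.mu_pair] at e
  simp only [F.map₁_comp, Category.assoc] at e
  rw [e₃, e₂] at e
  have e' := congrArg
    (F.map₁ (P.hcomp (𝟙 (HObj.mk (P.eval q))) (P.rho (P.eval p)).inv (by simp)) ≫ ·) e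
  simp only [reassoc_of% e₄] at e'
  rw [← cancel_mono (Q.evalEq (congrArg (fun p => GraphHom.mapStr F p)
        (congrArg (fun a => Str.append a q) (nil_append p).symm))), Category.assoc, e', mul]
  simp only [Q.hcomp_hcomp_assoc, Category.assoc]
  refine congrArg (fun t => _ ≫ _ ≫ t) (congrArg (· ≫ _) (Q.hcomp_congr ?_ ?_ _ _))
  · simp
  · rw [← e₁]

theorem φ_snoc {x y z : D.Ob} (p : Str D.Hor x y) (r : D.Hor y z) :
    g.φ (p.snoc r) = g.mul r (P.eval p) ≫
      Q.hcomp (𝟙 (HObj.mk (F.obj₁ r))) (g.φ p) (by simp) := by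
  have e := g.φ_append p (Str.nil.snoc r)
  have e₁ := g.mul_nat_left (P.eval p) (P.rho r).hom (by simp)
  have e₂ := Q.nu_singleton (GraphHom.mapStr F p) (F.obj₁ r)
  rw [P.nu_singleton] at e
  change _ ≫ g.φ (p.snoc r) = g.mul (P.comp r (P.one y)) (P.eval p) ≫
    Q.hcomp (g.φ (Str.nil.snoc r)) (g.φ p) _ ≫ (Q.nu _ (Str.nil.snoc (F.obj₁ r))).1 ≫ 𝟙 _ at e
  rw [e₂, Category.comp_id, Q.hcomp_hcomp] at e
  have : IsIso (F.map₁ (P.hcomp (P.rho r).hom (𝟙 (HObj.mk (P.eval p))) (by simp))) :=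
    inferInstanceAs (IsIso ((GraphHom.F₁ F).map
      (P.hcomp (P.rho r).hom (𝟙 (HObj.mk (P.eval p))) (by simp))))
  rw [← cancel_epi (F.map₁ (P.hcomp (P.rho r).hom (𝟙 (HObj.mk (P.eval p))) (by simp))), e,
    reassoc_of% e₁, Q.hcomp_hcomp]
  exact congrArg (_ ≫ ·) (Q.hcomp_congr (by simp [g.unit]) (by simp) _ _)

theorem isIso_singleton {x y : D.Ob} (r : D.Hor x y) : IsIso (g.φ (Str.nil.snoc r)) := by
  rw [g.unit]
  have : IsIso (F.map₁ (P.rho r).hom) :=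
    inferInstanceAs (IsIso ((GraphHom.F₁ F).map (P.rho r).hom))
  infer_instance

theorem left {x y : D.Ob} (r : D.Hor x y) :
    g.mul (P.one y) r ≫ Q.hcomp (g.φ .nil) (𝟙 (HObj.mk (F.obj₁ r))) (by simp) =
      F.map₁ (P.lam r).hom ≫ (Q.lam (F.obj₁ r)).inv := by
  have e := g.φ_append (Str.nil.snoc r) .nil
  change F.map₁ (P.lam (P.comp r (P.one x))).hom ≫ g.φ (Str.nil.snoc r) =
    g.mul (P.one y) (P.comp r (P.one x)) ≫ Q.hcomp (g.φ .nil) (g.φ (Str.nil.snoc r)) _ ≫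
      (Q.lam _).hom ≫ 𝟙 _ at e
  have e₁ := Q.lam_nat_of_id (Q.rho (F.obj₁ r)).inv (by simp)
  have e₂ := g.mul_nat_right (P.one y) (P.rho r).hom (by simp)
  have e₃ := P.lam_nat_of_id (P.rho r).hom (by simp)
  have e₄ : Q.hcomp (g.φ .nil) (g.φ (Str.nil.snoc r)) (by simp) =
    Q.hcomp (𝟙 (HObj.mk (F.obj₁ (P.one y)))) (F.map₁ (P.rho r).hom) (by simp) ≫
      Q.hcomp (g.φ .nil) (𝟙 (HObj.mk (F.obj₁ r))) (by simp) ≫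
        Q.hcomp (𝟙 _) (Q.rho (F.obj₁ r)).inv (by simp) := by
    rw [Q.hcomp_hcomp, Q.hcomp_hcomp]
    exact Q.hcomp_congr (by simp) (by simp [g.unit]) _ _
  rw [e₄, Category.comp_id] at e
  simp only [Category.assoc] at e
  rw [e₁, ← reassoc_of% e₂, g.unit, ← Category.assoc (F.map₁ _), ← F.map₁_comp, ← e₃, F.map₁_comp,
    Category.assoc] at e
  have : IsIso (F.map₁ (P.hcomp (𝟙 (HObj.mk (P.one y))) (P.rho r).hom (by simp))) :=
    inferInstanceAs (IsIso ((GraphHom.F₁ F).map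
      (P.hcomp (𝟙 (HObj.mk (P.one y))) (P.rho r).hom (by simp))))
  rw [cancel_epi, ← Category.assoc, ← Category.assoc, cancel_mono] at e
  rw [Iso.eq_comp_inv, e]

theorem right {x y : D.Ob} (r : D.Hor x y) :
    g.mul r (P.one x) ≫ Q.hcomp (𝟙 (HObj.mk (F.obj₁ r))) (g.φ .nil) (by simp) =
      F.map₁ (P.rho r).hom ≫ (Q.rho (F.obj₁ r)).inv :=
  (g.φ_snoc .nil r).symm.trans (g.unit r)

theorem assoc_eval {w x y z : D.Ob} (p : Str D.Hor w x) (q : Str D.Hor x y) (t : D.Hor y z)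
    [IsIso (g.φ p)] [IsIso (g.φ q)] :
    F.map₁ (P.alpha t (P.eval q) (P.eval p)).hom ≫ g.mul t (P.comp (P.eval q) (P.eval p)) ≫
      Q.hcomp (𝟙 (HObj.mk (F.obj₁ t))) (g.mul (P.eval q) (P.eval p)) (by simp) =
      g.mul (P.comp t (P.eval q)) (P.eval p) ≫
      Q.hcomp (g.mul t (P.eval q)) (𝟙 (HObj.mk (F.obj₁ (P.eval p)))) (by simp) ≫
      (Q.alpha (F.obj₁ t) (F.obj₁ (P.eval q)) (F.obj₁ (P.eval p))).hom := by
  have e := g.φ_append p (q.snoc t)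
  have e₁ := g.φ_append p q
  have e₂ := Q.alpha_nat (𝟙 (HObj.mk (F.obj₁ t))) (g.φ q) (g.φ p) (by simp) (by simp)
  have e₃ := g.mul_nat_right t (P.nu p q).1 (by simp)
  have e₄ : Q.hcomp (g.φ (q.snoc t)) (g.φ p) (by simp) =
      Q.hcomp (g.mul t (P.eval q)) (𝟙 (HObj.mk (F.obj₁ (P.eval p)))) (by simp) ≫
      Q.hcomp (Q.hcomp (𝟙 (HObj.mk (F.obj₁ t))) (g.φ q) (by simp)) (g.φ p) (by simp) := by
    rw [Q.hcomp_hcomp]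
    exact Q.hcomp_congr (g.φ_snoc q t) (Category.id_comp _).symm _ _
  rw [e₄, P.nu_snoc, F.map₁_comp, Q.evalEq_snoc (F.obj₁ t) (mapStr_append F p q).symm] at e
  change _ ≫ g.φ ((p.append q).snoc t) = _ ≫ _ ≫ ((Q.alpha _ _ _).hom ≫
    Q.hcomp (𝟙 (HObj.mk (F.obj₁ t)))
      (Q.nu (GraphHom.mapStr F p) (GraphHom.mapStr F q)).1 (by simp)) ≫ _ at e
  have e₅ : Q.hcomp (𝟙 (HObj.mk (F.obj₁ t))) (F.map₁ (P.nu p q).1) (by simp) ≫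
      Q.hcomp (𝟙 (HObj.mk (F.obj₁ t))) (g.φ (p.append q)) (by simp) =
      Q.hcomp (𝟙 (HObj.mk (F.obj₁ t))) (g.mul (P.eval q) (P.eval p)) (by simp) ≫
      Q.hcomp (𝟙 (HObj.mk (F.obj₁ t))) (Q.hcomp (g.φ q) (g.φ p) (by simp)) (by simp) ≫
      Q.hcomp (𝟙 (HObj.mk (F.obj₁ t)))
        (Q.nu (GraphHom.mapStr F p) (GraphHom.mapStr F q)).1 (by simp) ≫
      Q.hcomp (𝟙 (HObj.mk (F.obj₁ t))) (Q.evalEq (mapStr_append F p q).symm) (by simp) := by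
    rw [Q.hcomp_hcomp, Q.hcomp_hcomp, Q.hcomp_hcomp, Q.hcomp_hcomp]
    refine Q.hcomp_congr ?_ e₁ _ _
    simp
  rw [g.φ_snoc] at e
  simp only [Category.assoc] at e
  rw [reassoc_of% e₃, e₅, reassoc_of% e₂] at e
  simp only [← Category.assoc] at e
  rw [cancel_mono, cancel_mono, cancel_mono] at e
  simp only [Category.assoc] at e
  exact e

theorem assoc_hom {w x y z : D.Ob} (t : D.Hor y z) (s : D.Hor x y) (r : D.Hor w x) :
    F.map₁ (P.alpha t s r).hom ≫ g.mul t (P.comp s r) ≫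
      Q.hcomp (𝟙 (HObj.mk (F.obj₁ t))) (g.mul s r) (by simp) =
    g.mul (P.comp t s) r ≫ Q.hcomp (g.mul t s) (𝟙 (HObj.mk (F.obj₁ r))) (by simp) ≫
      (Q.alpha (F.obj₁ t) (F.obj₁ s) (F.obj₁ r)).hom := by
  have := g.isIso_singleton r
  have := g.isIso_singleton s
  have e := g.assoc_eval (Str.nil.snoc r) (Str.nil.snoc s) t
  change F.map₁ (P.alpha t (P.comp s (P.one x)) (P.comp r (P.one w))).hom ≫
      g.mul t (P.comp (P.comp s (P.one x)) (P.comp r (P.one w))) ≫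
      Q.hcomp (𝟙 _) (g.mul (P.comp s (P.one x)) (P.comp r (P.one w))) _ =
    g.mul (P.comp t (P.comp s (P.one x))) (P.comp r (P.one w)) ≫
    Q.hcomp (g.mul t (P.comp s (P.one x))) (𝟙 (HObj.mk (F.obj₁ (P.comp r (P.one w))))) _ ≫
      (Q.alpha _ _ _).hom at e
  have k : D.dom (P.rho s).hom = D.cod (P.rho r).hom := by simp
  have k' : D.dom (P.hcomp (𝟙 (HObj.mk t)) (P.rho s).hom (by simp)) = D.cod (P.rho r).hom := by simp
  have e₁ := Q.alpha_nat (𝟙 (HObj.mk (F.obj₁ t))) (F.map₁ (P.rho s).hom) (F.map₁ (P.rho r).hom)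
    (by simp) (by simp)
  have e₂ := g.mul_nat (P.rho s).hom (P.rho r).hom k
  have e₃ := g.mul_nat_right t (P.rho s).hom (by simp)
  have e₄ := g.mul_nat_right t (P.hcomp (P.rho s).hom (P.rho r).hom k) (by simp)
  have e₅ := g.mul_nat (P.hcomp (𝟙 (HObj.mk t)) (P.rho s).hom (by simp)) (P.rho r).hom k'
  have e₆ := congrArg F.map₁ (P.alpha_nat (𝟙 (HObj.mk t)) (P.rho s).hom (P.rho r).hom (by simp) k)
  rw [F.map₁_comp, F.map₁_comp] at e₆
  have e₇ : Q.hcomp (F.map₁ (P.hcomp (𝟙 (HObj.mk t)) (P.rho s).hom (by simp)))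
      (F.map₁ (P.rho r).hom) (by simp) ≫
        Q.hcomp (g.mul t s) (𝟙 (HObj.mk (F.obj₁ r))) (by simp) =
      Q.hcomp (g.mul t (P.comp s (P.one x))) (𝟙 (HObj.mk (F.obj₁ (P.comp r (P.one w))))) (by simp) ≫
      Q.hcomp (Q.hcomp (𝟙 (HObj.mk (F.obj₁ t))) (F.map₁ (P.rho s).hom) (by simp))
        (F.map₁ (P.rho r).hom) (by simp) := by
    rw [Q.hcomp_hcomp, Q.hcomp_hcomp]
    exact Q.hcomp_congr e₃ (by simp) _ _
  have e₈ : Q.hcomp (𝟙 (HObj.mk (F.obj₁ t)))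
      (F.map₁ (P.hcomp (P.rho s).hom (P.rho r).hom k)) (by simp) ≫
      Q.hcomp (𝟙 (HObj.mk (F.obj₁ t))) (g.mul s r) (by simp) =
      Q.hcomp (𝟙 (HObj.mk (F.obj₁ t))) (g.mul (P.comp s (P.one x)) (P.comp r (P.one w))) (by simp) ≫
      Q.hcomp (𝟙 (HObj.mk (F.obj₁ t)))
      (Q.hcomp (F.map₁ (P.rho s).hom) (F.map₁ (P.rho r).hom) (by simp)) (by simp) := by
    rw [Q.hcomp_hcomp, Q.hcomp_hcomp]
    exact Q.hcomp_congr rfl e₂ _ _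
  have : IsIso (F.map₁ (P.hcomp (P.hcomp (𝟙 (HObj.mk t)) (P.rho s).hom (by simp)) (P.rho r).hom k')) :=
    inferInstanceAs (IsIso ((GraphHom.F₁ F).map (P.hcomp (P.hcomp (𝟙 (HObj.mk t)) (P.rho s).hom
      (by simp)) (P.rho r).hom k')))
  rw [← cancel_epi (F.map₁ (P.hcomp (P.hcomp (𝟙 (HObj.mk t)) (P.rho s).hom (by simp))
    (P.rho r).hom k')), reassoc_of% e₆, reassoc_of% e₄, e₈, reassoc_of% e, ← e₁,
    reassoc_of% e₅, reassoc_of% e₇]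

theorem assoc {w x y z : D.Ob} (t : D.Hor y z) (s : D.Hor x y) (r : D.Hor w x) :
    F.map₁ (P.alpha t s r).inv ≫ g.mul (P.comp t s) r ≫
      Q.hcomp (g.mul t s) (𝟙 (HObj.mk (F.obj₁ r))) (by simp) =
    g.mul t (P.comp s r) ≫ Q.hcomp (𝟙 (HObj.mk (F.obj₁ t))) (g.mul s r) (by simp) ≫
      (Q.alpha (F.obj₁ t) (F.obj₁ s) (F.obj₁ r)).inv := by
  have e := g.assoc_hom t s r
  rw [← Category.assoc, ← Category.assoc, Iso.eq_comp_inv]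
  simp only [Category.assoc]
  rw [← e, ← Category.assoc, ← F.map₁_comp, Iso.inv_hom_id, F.map₁_id, Category.id_comp]

/-- The oplax functor of a family of comparisons. -/
def oplaxStr : OplaxStr P Q F where
  unit x := g.φ (Str.nil (x := x))
  dom_unit _ := g.dom_φ _
  cod_unit _ := g.cod_φ _
  unit_nat {x y} f := g.nat (p := Str.nil (x := x)) (q := Str.nil (x := y)) f
  mul s r := g.mul s r
  dom_mul s r := g.dom_mul s r
  cod_mul s r := g.cod_mul s r
  mul_nat ψ φ h := g.mul_nat ψ φ h
  left r := g.left r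
  right r := g.right r
  assoc t s r := g.assoc t s r

theorem eval_oplaxStr (g : OplaxFamily P Q F) {x : D.Ob} : ∀ {y : D.Ob} (p : Str D.Hor x y),
    (g.oplaxStr.eval p).1 = g.φ p
  | _, .nil => rfl
  | _, .snoc p r => (congrArg (g.mul r (P.eval p) ≫ ·) (Q.hcomp_congr rfl (g.eval_oplaxStr p) _
      ((E.dom_id _).trans (g.cod_φ p).symm))).trans (g.φ_snoc p r).symm

end OplaxFamily

end oplaxinv

section oplaxbij

variable {D E : Grph.{u, v}} {P : PseudoDblStr D} {Q : PseudoDblStr E} {F : D ⟶ E}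

/-- The component of the structure 2-cell of an oplax algebra morphism at a string. -/
abbrev OplaxMor.at (g : OplaxMor P.alg Q.alg F) {x y : D.Ob} (p : Str D.Hor x y) :
    HObj.mk (F.obj₁ (P.eval p)) ⟶ HObj.mk (Q.eval (GraphHom.mapStr F p)) :=
  GraphCell.app₁ (D := freeGraph D) g.ζ ⟨p⟩

theorem OplaxMor.app₀_alg (g : OplaxMor P.alg Q.alg F) (x : D.Ob) :
    GraphCell.app₀ (D := freeGraph D) g.ζ x = 𝟙 (F.F₀.obj x) := by
  have e := congrArg (fun θ => GraphCell.app₀ θ x) g.unit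
  simp only [comp_app₀, eqToHom_app₀] at e
  have e' : F.F₀.map (𝟙 x) ≫ 𝟙 (F.F₀.obj x) ≫ GraphCell.app₀ (D := freeGraph D) g.ζ x =
    𝟙 (F.F₀.obj x) ≫ 𝟙 (F.F₀.obj x) ≫ 𝟙 (F.F₀.obj x) := e
  rw [F.F₀.map_id, Category.comp_id, Category.comp_id] at e'
  exact ((Category.id_comp _).trans (Category.id_comp _)).symm.trans e'

/-- The family of comparisons of an oplax algebra morphism. -/
def OplaxMor.family (g : OplaxMor P.alg Q.alg F) : OplaxFamily P Q F where
  φ p := g.at p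
  dom_φ {x _} p := (GraphCell.dom_app (D := freeGraph D) g.ζ ⟨p⟩).trans (g.app₀_alg x)
  cod_φ {_ y} p := (GraphCell.cod_app (D := freeGraph D) g.ζ ⟨p⟩).trans (g.app₀_alg y)
  nat {_ _ _ _ p q} c := GraphCell.nat₁ (D := freeGraph D) g.ζ (r := ⟨p⟩) (s := ⟨q⟩) c
  unit r := by
    have e := congrArg (fun θ => GraphCell.app₁ θ ⟨r⟩) g.unit
    simp only [comp_app₁, eqToHom_app₁] at e
    have e' : F.map₁ (P.rho r).inv ≫ 𝟙 _ ≫ g.at (Str.nil.snoc r) =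
      𝟙 _ ≫ (Q.rho (F.obj₁ r)).inv ≫ 𝟙 _ := e
    rw [Category.id_comp, Category.id_comp, Category.comp_id] at e'
    rw [← e', ← Category.assoc, ← F.map₁_comp, Iso.hom_inv_id, F.map₁_id]
    exact (Category.id_comp _).symm
  pair {x y z} p q := by
    have e := congrArg (fun θ => GraphCell.app₁ θ
      ⟨((Str.nil.snoc p).snoc q : Str (freeGraph D).Hor x z)⟩) g.mul
    simp only [comp_app₁, eqToHom_app₁] at e
    have k : E.dom (g.at p) = E.cod (Q.oneMap (GraphCell.app₀ (D := freeGraph D) g.ζ x)) :=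
      (GraphCell.dom_app (D := freeGraph D) g.ζ ⟨p⟩).trans (Q.cod_oneMap _).symm
    have k' : E.dom (g.at q) =
        E.cod (Q.hcomp (g.at p) (Q.oneMap (GraphCell.app₀ (D := freeGraph D) g.ζ x)) k) :=
      (GraphCell.dom_app (D := freeGraph D) g.ζ ⟨q⟩).trans
        ((GraphCell.cod_app (D := freeGraph D) g.ζ ⟨p⟩).symm.trans (Q.cod_hcomp _ _ _).symm)
    have e' : F.map₁ (P.mu ((Str.nil.snoc p).snoc q)).1 ≫ 𝟙 _ ≫
        g.at (Str.append (Str.append .nil p) q) =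
      𝟙 _ ≫ g.at ((Str.nil.snoc (P.eval p)).snoc (P.eval q)) ≫ 𝟙 _ ≫ Q.hcomp (g.at q)
        (Q.hcomp (g.at p) (Q.oneMap (GraphCell.app₀ (D := freeGraph D) g.ζ x)) k) k' ≫ 𝟙 _ ≫
      (Q.mu ((Str.nil.snoc (GraphHom.mapStr F p)).snoc (GraphHom.mapStr F q))).1 ≫
      Q.evalEq (join_mapStr F ((Str.nil.snoc p).snoc q)) := e
    simp only [g.app₀_alg, Q.oneMap_id, Category.id_comp] at e'
    exact e'

theorem OplaxMor.algMor_family (g : OplaxMor P.alg Q.alg F) : g.family.oplaxStr.algMor = g :=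
  OplaxMor.ext
    (graphCell_ext (fun x => (g.app₀_alg x).symm) (fun p => g.family.eval_oplaxStr p.hom))

theorem OplaxStr.family_algMor (f : OplaxStr P Q F) : f.algMor.family.oplaxStr = f :=
  OplaxStr.ext_eval (fun p => f.algMor.family.eval_oplaxStr p)

theorem OplaxStr.bijective_algMor :
    Function.Bijective (fun f : OplaxStr P Q F => f.algMor) :=
  Function.bijective_iff_has_inverse.mpr
    ⟨fun g => g.family.oplaxStr, fun f => f.family_algMor, fun g => g.algMor_family⟩

end oplaxbij

section transf

variable {A B C D : Grph.{u, v}} {P : PseudoDblStr A} {Q : PseudoDblStr B} {R : PseudoDblStr C}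
  {S : PseudoDblStr D} {H : A ⟶ B} {F : A ⟶ C} {G : B ⟶ D} {K : C ⟶ D} (h : LaxStr P Q H)
  (f : OplaxStr P R F) (g : OplaxStr Q S G) (k : LaxStr R S K) (ω : H ≫ G ⟶ F ≫ K)

/-- The condition on a generalized 2-cell of algebras, at a string. -/
def GenTransfAt {x y : A.Ob} (p : Str A.Hor x y) : Prop :=
  G.map₁ (h.eval p).1 ≫ GraphCell.app₁ ω ⟨P.eval p⟩ ≫ K.map₁ (f.eval p).1 =
    (g.eval (GraphHom.mapStr H p)).1 ≫ S.evalEq (mapStr_comp H G p).symm ≫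
      (S.evalCell (GraphCell.strApp ω p).1).1 ≫ S.evalEq (mapStr_comp F K p) ≫
        (k.eval (GraphHom.mapStr F p)).1

variable {h f g k ω}

theorem GenTransfAt.mul_conj {x y z : A.Ob} (s : A.Hor y z) {r : A.Hor x y}
    {b : B.Hor (H.F₀.obj x) (H.F₀.obj y)} (β : HObj.mk b ⟶ HObj.mk (H.obj₁ r))
    (hβ : B.cod β = 𝟙 _) {c : C.Hor (F.F₀.obj x) (F.F₀.obj y)}
    (γ : HObj.mk (F.obj₁ r) ⟶ HObj.mk c) (hγ : C.cod γ = 𝟙 _)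
    (e : D.dom (GraphCell.app₁ ω ⟨s⟩) = D.cod (G.map₁ β ≫ GraphCell.app₁ ω ⟨r⟩ ≫ K.map₁ γ)) :
    G.map₁ (Q.hcomp (𝟙 (HObj.mk (H.obj₁ s))) β (by simp [hβ])) ≫
      (g.mul (H.obj₁ s) (H.obj₁ r) ≫
        S.hcomp (GraphCell.app₁ ω ⟨s⟩) (GraphCell.app₁ ω ⟨r⟩) (by simp) ≫
          k.mul (F.obj₁ s) (F.obj₁ r)) ≫
      K.map₁ (R.hcomp (𝟙 (HObj.mk (F.obj₁ s))) γ (by simp [hγ])) =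
    g.mul (H.obj₁ s) b ≫ S.hcomp (GraphCell.app₁ ω ⟨s⟩)
      (G.map₁ β ≫ GraphCell.app₁ ω ⟨r⟩ ≫ K.map₁ γ) e ≫ k.mul (F.obj₁ s) c := by
  simp only [Category.assoc]
  rw [reassoc_of% g.mul_nat_right (H.obj₁ s) β hβ, ← k.mul_nat_right (F.obj₁ s) γ hγ]
  have e' : S.hcomp (GraphCell.app₁ ω ⟨s⟩) (G.map₁ β ≫ GraphCell.app₁ ω ⟨r⟩ ≫ K.map₁ γ) e =
      S.hcomp (𝟙 (HObj.mk (G.obj₁ (H.obj₁ s)))) (G.map₁ β) (by simp [hβ]) ≫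
      S.hcomp (GraphCell.app₁ ω ⟨s⟩) (GraphCell.app₁ ω ⟨r⟩) (by simp) ≫
      S.hcomp (𝟙 (HObj.mk (K.obj₁ (F.obj₁ s)))) (K.map₁ γ)
        (by simp [hγ]; exact D.dom_id _) := by
    rw [S.hcomp_hcomp, S.hcomp_hcomp]
    exact S.hcomp_congr ((Category.comp_id _).symm.trans (Category.id_comp _).symm) rfl _ _
  rw [e']
  simp only [Category.assoc]

/-- At a string `p.snoc s`, the condition is that on binary composites. -/
theorem GenTransfAt.snoc_iff {x y z : A.Ob} {p : Str A.Hor x y} (s : A.Hor y z)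
    (hp : GenTransfAt h f g k ω p) :
    GenTransfAt h f g k ω (p.snoc s) ↔
    G.map₁ (Q.hcomp (𝟙 (HObj.mk (H.obj₁ s))) (h.eval p).1 (by simp)) ≫
      (G.map₁ (h.mul s (P.eval p)) ≫ GraphCell.app₁ ω ⟨P.comp s (P.eval p)⟩ ≫
        K.map₁ (f.mul s (P.eval p))) ≫
      K.map₁ (R.hcomp (𝟙 (HObj.mk (F.obj₁ s))) (f.eval p).1 (by simp)) =
    G.map₁ (Q.hcomp (𝟙 (HObj.mk (H.obj₁ s))) (h.eval p).1 (by simp)) ≫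
      (g.mul (H.obj₁ s) (H.obj₁ (P.eval p)) ≫
        S.hcomp (GraphCell.app₁ ω ⟨s⟩) (GraphCell.app₁ ω ⟨P.eval p⟩) (by simp) ≫
          k.mul (F.obj₁ s) (F.obj₁ (P.eval p))) ≫
      K.map₁ (R.hcomp (𝟙 (HObj.mk (F.obj₁ s))) (f.eval p).1 (by simp)) := by
  have e₀ : D.dom (GraphCell.app₁ ω ⟨s⟩) = D.cod (G.map₁ (h.eval p).1 ≫
      GraphCell.app₁ ω ⟨P.eval p⟩ ≫ K.map₁ (f.eval p).1) := by
    simp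
    exact (Category.comp_id _).symm
  rw [GenTransfAt.mul_conj s _ (by simp) _ (by simp) e₀]
  have e₁ : S.hcomp (GraphCell.app₁ ω ⟨s⟩)
      (G.map₁ (h.eval p).1 ≫ GraphCell.app₁ ω ⟨P.eval p⟩ ≫ K.map₁ (f.eval p).1) e₀ =
      S.hcomp (𝟙 (HObj.mk (G.obj₁ (H.obj₁ s)))) (g.eval (GraphHom.mapStr H p)).1 (by simp) ≫
      S.hcomp (𝟙 (HObj.mk (G.obj₁ (H.obj₁ s)))) (S.evalEq (mapStr_comp H G p).symm) (by simp) ≫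
      S.hcomp (GraphCell.app₁ ω ⟨s⟩) (S.evalCell (GraphCell.strApp ω p).1).1
        ((GraphCell.dom_app ω ⟨s⟩).trans ((S.evalCell (GraphCell.strApp ω p).1).2.trans
          (GraphCell.strApp ω p).2.2).symm) ≫
      S.hcomp (𝟙 (HObj.mk (K.obj₁ (F.obj₁ s)))) (S.evalEq (mapStr_comp F K p))
        (by simp; exact D.dom_id _) ≫
      S.hcomp (𝟙 (HObj.mk (K.obj₁ (F.obj₁ s)))) (k.eval (GraphHom.mapStr F p)).1 (by simp) := by
    rw [S.hcomp_hcomp, S.hcomp_hcomp, S.hcomp_hcomp, S.hcomp_hcomp]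
    refine S.hcomp_congr ?_ hp _ _
    exact ((Category.id_comp _).trans ((Category.id_comp _).trans ((congrArg (_ ≫ ·)
      (Category.id_comp _)).trans (Category.comp_id _)))).symm
  rw [e₁, GenTransfAt, h.eval_snoc, f.eval_snoc, G.map₁_comp, K.map₁_comp]
  change _ = (g.mul (H.obj₁ s) (Q.eval (GraphHom.mapStr H p)) ≫
    S.hcomp (𝟙 (HObj.mk (G.obj₁ (H.obj₁ s)))) (g.eval (GraphHom.mapStr H p)).1 (by simp)) ≫
    S.evalEq (mapStr_comp H G (p.snoc s)).symm ≫ _ ≫ S.evalEq (mapStr_comp F K (p.snoc s)) ≫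
    S.hcomp (𝟙 (HObj.mk (K.obj₁ (F.obj₁ s)))) (k.eval (GraphHom.mapStr F p)).1 (by simp) ≫
    k.mul (F.obj₁ s) (R.eval (GraphHom.mapStr F p)) ↔ _
  have a₁ := S.evalEq_snoc (G.obj₁ (H.obj₁ s)) (mapStr_comp H G p).symm
    (mapStr_comp H G (p.snoc s)).symm
  have a₂ := S.evalEq_snoc (K.obj₁ (F.obj₁ s)) (mapStr_comp F K p) (mapStr_comp F K (p.snoc s))
  rw [show S.evalEq (mapStr_comp H G (p.snoc s)).symm = _ from a₁,
    show S.evalEq (mapStr_comp F K (p.snoc s)) = _ from a₂]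
  simp only [Category.assoc]
  rfl

theorem IsGenTransf.at (hω : IsGenTransf h f g k ω) {x : A.Ob} : ∀ {y : A.Ob} (p : Str A.Hor x y),
    GenTransfAt h f g k ω p
  | _, .nil => by
    refine (hω.unit x).symm.trans (congrArg (_ ≫ ·) ?_)
    exact ((Category.id_comp _).trans (congrArg (_ ≫ ·) (Category.id_comp _))).symm
  | _, .snoc p s => (GenTransfAt.snoc_iff s (hω.at p)).2
      (congrArg (fun t => _ ≫ t ≫ _) (hω.mul s (P.eval p)).symm)

theorem IsGenTransf.of_at
    (hω : ∀ {x y : A.Ob} (p : Str A.Hor x y), GenTransfAt h f g k ω p) :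
    IsGenTransf h f g k ω where
  unit x := by
    refine Eq.symm ((hω (Str.nil (x := x))).trans (congrArg (_ ≫ ·) ?_))
    exact (Category.id_comp _).trans (congrArg (_ ≫ ·) (Category.id_comp _))
  mul {x y z} s r := by
    have e := (GenTransfAt.snoc_iff s (hω (Str.nil.snoc r))).1 (hω ((Str.nil.snoc r).snoc s))
    have i₁ : IsIso (G.map₁ (Q.hcomp (𝟙 (HObj.mk (H.obj₁ s))) (h.eval (Str.nil.snoc r)).1
        (by simp))) := by
      have : IsIso (h.eval (Str.nil.snoc r)).1 := h.algMor.family.isIso_singleton r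
      exact inferInstanceAs (IsIso ((GraphHom.F₁ G).map
        (Q.hcomp (𝟙 (HObj.mk (H.obj₁ s))) (h.eval (Str.nil.snoc r)).1 (by simp))))
    have i₂ : IsIso (K.map₁ (R.hcomp (𝟙 (HObj.mk (F.obj₁ s))) (f.eval (Str.nil.snoc r)).1
        (by simp))) := by
      have : IsIso (f.eval (Str.nil.snoc r)).1 := f.algMor.family.isIso_singleton r
      exact inferInstanceAs (IsIso ((GraphHom.F₁ K).map
        (R.hcomp (𝟙 (HObj.mk (F.obj₁ s))) (f.eval (Str.nil.snoc r)).1 (by simp))))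
    rw [cancel_epi, cancel_mono] at e
    have b₁ : B.cod (H.map₁ (P.rho r).inv) = 𝟙 _ := by simp
    have b₂ : C.cod (F.map₁ (P.rho r).hom) = 𝟙 _ := by simp
    have e₀ : G.map₁ (H.map₁ (P.rho r).inv) ≫ GraphCell.app₁ ω ⟨P.comp r (P.one x)⟩ ≫
        K.map₁ (F.map₁ (P.rho r).hom) = GraphCell.app₁ ω ⟨r⟩ := by
      refine (congrArg (_ ≫ ·) (GraphCell.nat₁ ω (P.rho r).hom).symm).trans ?_
      refine (Category.assoc _ _ _).symm.trans ?_
      refine (congrArg (· ≫ _) ((GraphHom.map₁_comp (H ≫ G) _ _).symm.trans ((congrArg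
        (fun φ => GraphHom.map₁ (H ≫ G) φ) (P.rho r).inv_hom_id).trans
          (GraphHom.map₁_id (H ≫ G) ⟨r⟩)))).trans (Category.id_comp _)
    have e₁ := congrArg (fun t => G.map₁ (Q.hcomp (𝟙 (HObj.mk (H.obj₁ s)))
      (H.map₁ (P.rho r).inv) (by simp)) ≫ t ≫ K.map₁ (R.hcomp (𝟙 (HObj.mk (F.obj₁ s)))
      (F.map₁ (P.rho r).hom) (by simp))) e
    have e₂ := GenTransfAt.mul_conj (g := g) (k := k) (ω := ω) (Q := Q) (R := R) (S := S) s
      (H.map₁ (P.rho r).inv) b₁ (F.map₁ (P.rho r).hom) b₂ (by rw [e₀]; simp)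
    refine Eq.trans ?_ (e₂.symm.trans (e₁.symm.trans ?_))
    · exact congrArg (fun t => _ ≫ t ≫ _) (S.hcomp_congr rfl e₀.symm _ _)
    · have e₃ := h.mul_nat_right s (P.rho r).inv (by simp)
      have e₄ := f.mul_nat_right s (P.rho r).hom (by simp)
      have e₅ : P.hcomp (𝟙 (HObj.mk s)) (P.rho r).inv (by simp) ≫
          P.hcomp (𝟙 (HObj.mk s)) (P.rho r).hom (by simp) = 𝟙 _ := by
        rw [P.hcomp_hcomp, ← P.hcomp_id]
        exact P.hcomp_congr (Category.comp_id _) (P.rho r).inv_hom_id _ _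
      have e₆ := GraphCell.nat₁ ω (P.hcomp (𝟙 (HObj.mk s)) (P.rho r).inv (by simp))
      have e₇ : K.map₁ (F.map₁ (P.hcomp (𝟙 (HObj.mk s)) (P.rho r).inv (by simp))) ≫
          K.map₁ (F.map₁ (P.hcomp (𝟙 (HObj.mk s)) (P.rho r).hom (by simp))) = 𝟙 _ := by
        rw [← K.map₁_comp, ← F.map₁_comp, e₅, F.map₁_id, K.map₁_id]
      simp only [Category.assoc]
      rw [← K.map₁_comp, ← e₄, ← Category.assoc, ← G.map₁_comp, e₃, G.map₁_comp, K.map₁_comp,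
        Category.assoc]
      refine congrArg (_ ≫ ·) ((Category.assoc _ _ _).symm.trans ((congrArg (· ≫ _) e₆).trans
        ((Category.assoc _ _ _).trans (congrArg (_ ≫ ·) ?_))))
      exact (Category.assoc _ _ _).symm.trans ((congrArg (· ≫ _) e₇).trans (Category.id_comp _))

theorem isAlgCell_iff : IsAlgCell h.algMor f.algMor g.algMor k.algMor ω ↔
    ∀ {x y : A.Ob} (p : Str A.Hor x y), GenTransfAt h f g k ω p := by
  have e₁ : ∀ {x y : A.Ob} (p : Str A.Hor x y), G.map₁ (h.eval p).1 ≫ 𝟙 _ ≫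
      GraphCell.app₁ ω ⟨P.eval p⟩ ≫ 𝟙 _ ≫ K.map₁ (f.eval p).1 =
        G.map₁ (h.eval p).1 ≫ GraphCell.app₁ ω ⟨P.eval p⟩ ≫ K.map₁ (f.eval p).1 := fun p =>
    congrArg (_ ≫ ·) ((Category.id_comp _).trans (congrArg (_ ≫ ·) (Category.id_comp _)))
  have e₂ : ∀ {x y : A.Ob} (p : Str A.Hor x y), 𝟙 _ ≫ (g.eval (GraphHom.mapStr H p)).1 ≫
      S.evalEq (mapStr_comp H G p).symm ≫ (S.evalCell (GraphCell.strApp ω p).1).1 ≫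
      S.evalEq (mapStr_comp F K p) ≫ (k.eval (GraphHom.mapStr F p)).1 ≫ 𝟙 _ =
      (g.eval (GraphHom.mapStr H p)).1 ≫
      S.evalEq (mapStr_comp H G p).symm ≫ (S.evalCell (GraphCell.strApp ω p).1).1 ≫
      S.evalEq (mapStr_comp F K p) ≫ (k.eval (GraphHom.mapStr F p)).1 := fun p =>
    (Category.id_comp _).trans (congrArg (fun t => _ ≫ _ ≫ _ ≫ _ ≫ t) (Category.comp_id _))
  constructor
  · intro e x y p
    have e' := congrArg (fun θ => GraphCell.app₁ θ ⟨p⟩) e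
    simp only [comp_app₁, eqToHom_app₁] at e'
    exact (e₁ p).symm.trans (Eq.trans e' (e₂ p))
  · intro e
    refine graphCell_ext (fun x => ?_) (fun p => ?_) <;>
      simp only [comp_app₀, comp_app₁, eqToHom_app₀, eqToHom_app₁]
    · have e' : ∀ x : A.Ob, G.F₀.map (𝟙 (H.F₀.obj x)) ≫ 𝟙 _ ≫ GraphCell.app₀ ω x ≫ 𝟙 _ ≫
        K.F₀.map (𝟙 (F.F₀.obj x)) = 𝟙 _ ≫ 𝟙 _ ≫ 𝟙 _ ≫ GraphCell.app₀ ω x ≫ 𝟙 _ ≫ 𝟙 _ ≫ 𝟙 _ :=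
        fun x => by
          rw [G.F₀.map_id, K.F₀.map_id]
          simp
          exact Category.comp_id _
      exact e' x
    · exact (e₁ p.hom).trans ((e p.hom).trans (e₂ p.hom).symm)

theorem isGenTransf_iff_isAlgCell : IsGenTransf h f g k ω ↔
    IsAlgCell h.algMor f.algMor g.algMor k.algMor ω :=
  ⟨fun e => isAlgCell_iff.2 e.at, fun e => IsGenTransf.of_at (isAlgCell_iff.1 e)⟩

end transf

/-- The double functor from pseudodouble categories to pseudo-algebras. -/
def algFunctor : DispDbl.DFunctor psDb.{u, v} (psAlg freeMonad.{u, v}) where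
  obj P := ⟨PseudoDblStr.alg P, PseudoDblStr.alg_isPseudo P⟩
  hmap f := LaxStr.algMor f
  hmap_id P := LaxStr.algMor_id P
  hmap_comp f k := LaxStr.algMor_comp f k
  vmap f := OplaxStr.algMor f
  vmap_id P := OplaxStr.algMor_id P
  vmap_comp f k := OplaxStr.algMor_comp f k
  cell c := isGenTransf_iff_isAlgCell.1 c

theorem isEvalFunctor_algFunctor : IsEvalFunctor algFunctor.{u, v} where
  obj₁ _ _ _ _ := HEq.rfl
  map₁ _ _ _ _ _ _ _ _ := HEq.rfl
  η₁ _ _ _ _ := HEq.rfl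
  φ₁ _ _ _ _ := HEq.rfl
  ζ₁ _ _ _ _ := HEq.rfl

namespace DispDbl

section equiv

variable {𝒳 𝒴 𝒵 : DispDbl.{u, v}}

/-- The identity double functor. -/
def DFunctor.id (𝒳 : DispDbl.{u, v}) : DFunctor 𝒳 𝒳 where
  obj X := X
  hmap f := f
  hmap_id _ := rfl
  hmap_comp _ _ := rfl
  vmap f := f
  vmap_id _ := rfl
  vmap_comp _ _ := rfl
  cell c := c

/-- The composite of double functors. -/
def DFunctor.comp (Φ : DFunctor 𝒳 𝒴) (Ψ : DFunctor 𝒴 𝒵) : DFunctor 𝒳 𝒵 where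
  obj X := Ψ.obj (Φ.obj X)
  hmap f := Ψ.hmap (Φ.hmap f)
  hmap_id X := (congrArg (fun f => Ψ.hmap f) (Φ.hmap_id X)).trans (Ψ.hmap_id _)
  hmap_comp f k := (congrArg (fun f => Ψ.hmap f) (Φ.hmap_comp f k)).trans (Ψ.hmap_comp _ _)
  vmap f := Ψ.vmap (Φ.vmap f)
  vmap_id X := (congrArg (fun f => Ψ.vmap f) (Φ.vmap_id X)).trans (Ψ.vmap_id _)
  vmap_comp f k := (congrArg (fun f => Ψ.vmap f) (Φ.vmap_comp f k)).trans (Ψ.vmap_comp _ _)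
  cell c := Ψ.cell (Φ.cell c)

theorem DFunctor.laxStr_id (𝒳 : DispDbl.{u, v}) :
    (DFunctor.id 𝒳).laxStr = LaxStr.id 𝒳.dbl := by
  apply LaxStr.ext
  · rfl
  · rfl

theorem DFunctor.laxStr_comp (Φ : DFunctor 𝒳 𝒴) (Ψ : DFunctor 𝒴 𝒵) :
    (Φ.comp Ψ).laxStr = Φ.laxStr.comp Ψ.laxStr := by
  apply LaxStr.ext
  · funext X
    exact (((congrArg (_ ≫ ·) (Ψ.map₁_ofEq (X := Φ.F₀.obj X) (Y := Φ.F₀.obj X)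
      (Φ.hmap_id X.str).symm))).trans
      (Cell.ofEq_ofEq (X := Ψ.F₀.obj (Φ.F₀.obj X)) (Y := Ψ.F₀.obj (Φ.F₀.obj X))
        (Ψ.hmap_id (Φ.obj X.str)).symm _)).symm
  · funext X Y Z s r
    exact (((congrArg (_ ≫ ·) (Ψ.map₁_ofEq (X := Φ.F₀.obj X) (Y := Φ.F₀.obj Z)
      (Φ.hmap_comp r.str s.str).symm))).trans
      (Cell.ofEq_ofEq (X := Ψ.F₀.obj (Φ.F₀.obj X)) (Y := Ψ.F₀.obj (Φ.F₀.obj Z))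
        (Ψ.hmap_comp (Φ.hmap r.str) (Φ.hmap s.str)).symm _)).symm

theorem DFunctor.isStrong_laxStr (Φ : DFunctor 𝒳 𝒴) : Φ.laxStr.IsStrong where
  isIso_unit X := ⟨(Cell.isoOfEq (X := Φ.F₀.obj X) (Y := Φ.F₀.obj X) (Φ.hmap_id X.str)).hom,
    (Cell.isoOfEq (X := Φ.F₀.obj X) (Y := Φ.F₀.obj X) (Φ.hmap_id X.str)).inv_hom_id,
    (Cell.isoOfEq (X := Φ.F₀.obj X) (Y := Φ.F₀.obj X) (Φ.hmap_id X.str)).hom_inv_id⟩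
  isIso_mul {X _ Z} s r := ⟨(Cell.isoOfEq (X := Φ.F₀.obj X) (Y := Φ.F₀.obj Z)
      (Φ.hmap_comp r.str s.str)).hom,
    (Cell.isoOfEq (X := Φ.F₀.obj X) (Y := Φ.F₀.obj Z) (Φ.hmap_comp r.str s.str)).inv_hom_id,
    (Cell.isoOfEq (X := Φ.F₀.obj X) (Y := Φ.F₀.obj Z) (Φ.hmap_comp r.str s.str)).hom_inv_id⟩

/-- A vertical transformation between double functors whose squares are identities. -/
structure VTrans (Φ Ψ : DFunctor 𝒳 𝒴) where
  app : ∀ {A : Grph.{u, v}} (X : 𝒳.Ob A), 𝒴.Ver (Φ.obj X) (Ψ.obj X) (𝟙 A)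
  nat : ∀ {A B : Grph.{u, v}} {X : 𝒳.Ob A} {Y : 𝒳.Ob B} {F : A ⟶ B} (f : 𝒳.Ver X Y F),
    𝒴.vcomp (K := 𝟙 B) (Φ.vmap f) (app Y) = 𝒴.vcomp (F := 𝟙 A) (app X) (Ψ.vmap f)
  cell : ∀ {A B : Grph.{u, v}} {X : 𝒳.Ob A} {Y : 𝒳.Ob B} {F : A ⟶ B} (r : 𝒳.Hor X Y F),
    𝒴.IsCell (Φ.hmap r) (app X) (app Y) (Ψ.hmap r) (𝟙 F)

namespace VTrans

variable {Φ Ψ : DFunctor 𝒳 𝒴} (t : VTrans Φ Ψ)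

/-- The underlying 2-cell of graphs. -/
def graphCell : Φ.graphHom ⟶ Ψ.graphHom where
  app₀ X := (⟨t.app X.str⟩ : 𝒴.VHom (Φ.F₀.obj X) (Ψ.F₀.obj X))
  app₁ r := (⟨⟨t.app r.src.str⟩, ⟨t.app r.tgt.str⟩, 𝟙 r.hom.mor, t.cell r.hom.str⟩ :
    𝒴.Cell ⟨(⟨Φ.hmap r.hom.str⟩ : 𝒴.HHom (Φ.F₀.obj r.src) (Φ.F₀.obj r.tgt))⟩
      ⟨(⟨Ψ.hmap r.hom.str⟩ : 𝒴.HHom (Ψ.F₀.obj r.src) (Ψ.F₀.obj r.tgt))⟩)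
  nat₀ {X Y} f := congrArg (VHom.mk (X := Φ.F₀.obj X) (Y := Ψ.F₀.obj Y) (mor := f.mor))
    (t.nat f.str)
  nat₁ {r s} φ := Cell.ext
    (congrArg (VHom.mk (X := Φ.F₀.obj r.src) (Y := Ψ.F₀.obj s.src) (mor := (Cell.left φ).mor))
      (t.nat (Cell.left φ).str))
    (congrArg (VHom.mk (X := Φ.F₀.obj r.tgt) (Y := Ψ.F₀.obj s.tgt) (mor := (Cell.right φ).mor))
      (t.nat (Cell.right φ).str))
    (heq_of_eq ((vpaste_id (Cell.sq φ)).trans (id_vpaste (Cell.sq φ)).symm))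
  dom_app _ := rfl
  cod_app _ := rfl

theorem isVertTransf : IsVertTransf Φ.laxStr Ψ.laxStr t.graphCell where
  unit X := by
    refine ((Category.id_comp _).trans (Cell.comp_ofEq (X' := Ψ.F₀.obj X) (Y' := Ψ.F₀.obj X)
      (Ψ.hmap_id X.str).symm (Cell.hid (⟨t.app X.str⟩ : 𝒴.VHom (Φ.F₀.obj X) (Ψ.F₀.obj X))))).trans
      (Eq.trans ?_ (congrArg (fun c => Φ.laxStr.unit X ≫ c)
        ((congrArg (fun c => GraphCell.app₁ t.graphCell ⟨𝒳.dbl.one X⟩ ≫ c)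
          (Ψ.graphHom.map₁_id ⟨𝒳.dbl.one X⟩)).trans (Category.comp_id _))).symm)
    exact (Cell.ofEq_comp (X := Φ.F₀.obj X) (Y := Φ.F₀.obj X) (Φ.hmap_id X.str).symm
      (GraphCell.app₁ t.graphCell ⟨(⟨𝒳.hid X.str⟩ : 𝒳.HHom X X)⟩)).symm
  mul {X Y Z} s r := by
    have e := Cell.hcomp_mk (X := Φ.F₀.obj X) (Y := Φ.F₀.obj Y) (Z := Φ.F₀.obj Z)
      (X' := Ψ.F₀.obj X) (Y' := Ψ.F₀.obj Y) (Z' := Ψ.F₀.obj Z) (s := ⟨Φ.hmap s.str⟩)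
      (r := ⟨Φ.hmap r.str⟩) (s' := ⟨Ψ.hmap s.str⟩) (r' := ⟨Ψ.hmap r.str⟩)
      (GraphCell.app₁ t.graphCell ⟨s⟩) (⟨t.app X.str⟩ : 𝒴.VHom (Φ.F₀.obj X) (Ψ.F₀.obj X))
      (𝟙 r.mor) (t.cell r.str)
    refine ((Category.id_comp _).trans ((congrArg (· ≫ _) e).trans (Cell.comp_ofEq
      (X' := Ψ.F₀.obj X) (Y' := Ψ.F₀.obj Z) (Ψ.hmap_comp r.str s.str).symm _))).trans
      (Eq.trans ?_ (congrArg (fun c => Φ.laxStr.mul s r ≫ c)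
        ((congrArg (fun c => GraphCell.app₁ t.graphCell ⟨𝒳.dbl.comp s r⟩ ≫ c)
          (Ψ.graphHom.map₁_id ⟨𝒳.dbl.comp s r⟩)).trans (Category.comp_id _))).symm)
    refine Eq.trans ?_ (Cell.ofEq_comp (X := Φ.F₀.obj X)
      (Y := Φ.F₀.obj Z) (Φ.hmap_comp r.str s.str).symm
      (GraphCell.app₁ t.graphCell ⟨HHom.comp s r⟩)).symm
    refine Cell.ext rfl rfl (heq_of_eq ?_)
    change hpaste (H := r.mor) (K := r.mor) (F := 𝟙 X.gr) (G := 𝟙 Y.gr) (H' := s.mor)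
      (K' := s.mor) (L := 𝟙 Z.gr) (𝟙 r.mor) (𝟙 s.mor) = 𝟙 (r.mor ≫ s.mor)
    apply graphCell_ext <;> intro x
    · exact (Category.id_comp _).trans (s.mor.F₀.map_id _)
    · exact (Category.id_comp _).trans (s.mor.map₁_id _)

/-- Mutually inverse transformations give an isomorphism. -/
def graphIso (t : VTrans Φ Ψ) (t' : VTrans Ψ Φ)
    (h : ∀ {A : Grph.{u, v}} (X : 𝒳.Ob A), 𝒴.vcomp (F := 𝟙 A) (K := 𝟙 A) (t.app X) (t'.app X) =
      𝒴.vid (Φ.obj X))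
    (h' : ∀ {A : Grph.{u, v}} (X : 𝒳.Ob A), 𝒴.vcomp (F := 𝟙 A) (K := 𝟙 A) (t'.app X) (t.app X) =
      𝒴.vid (Ψ.obj X)) : Φ.graphHom ≅ Ψ.graphHom where
  hom := t.graphCell
  inv := t'.graphCell
  hom_inv_id := graphCell_ext
    (fun X => congrArg (VHom.mk (X := Φ.F₀.obj X) (Y := Φ.F₀.obj X) (mor := 𝟙 X.gr)) (h X.str))
    (fun r => Cell.ext
      (congrArg (VHom.mk (X := Φ.F₀.obj r.src) (Y := Φ.F₀.obj r.src) (mor := 𝟙 _)) (h r.src.str))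
      (congrArg (VHom.mk (X := Φ.F₀.obj r.tgt) (Y := Φ.F₀.obj r.tgt) (mor := 𝟙 _)) (h r.tgt.str))
      (heq_of_eq (vpaste_id (F := 𝟙 r.src.gr) (G := 𝟙 r.tgt.gr) (H := r.hom.mor)
        (K := r.hom.mor) (𝟙 r.hom.mor))))
  inv_hom_id := graphCell_ext
    (fun X => congrArg (VHom.mk (X := Ψ.F₀.obj X) (Y := Ψ.F₀.obj X) (mor := 𝟙 X.gr)) (h' X.str))
    (fun r => Cell.ext
      (congrArg (VHom.mk (X := Ψ.F₀.obj r.src) (Y := Ψ.F₀.obj r.src) (mor := 𝟙 _)) (h' r.src.str))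
      (congrArg (VHom.mk (X := Ψ.F₀.obj r.tgt) (Y := Ψ.F₀.obj r.tgt) (mor := 𝟙 _)) (h' r.tgt.str))
      (heq_of_eq (vpaste_id (F := 𝟙 r.src.gr) (G := 𝟙 r.tgt.gr) (H := r.hom.mor)
        (K := r.hom.mor) (𝟙 r.hom.mor))))

end VTrans

/-- An isomorphism of structures on the same graph, given by mutually inverse horizontal and
vertical 1-cells over the identity, and the squares which bind these together. -/
structure IsoOver {A : Grph.{u, v}} (X Y : 𝒴.Ob A) where
  h : 𝒴.Hor X Y (𝟙 A)
  h' : 𝒴.Hor Y X (𝟙 A)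
  h_h' : 𝒴.hcomp (F := 𝟙 A) (K := 𝟙 A) h h' = 𝒴.hid X
  h'_h : 𝒴.hcomp (F := 𝟙 A) (K := 𝟙 A) h' h = 𝒴.hid Y
  v : 𝒴.Ver X Y (𝟙 A)
  v' : 𝒴.Ver Y X (𝟙 A)
  v_v' : 𝒴.vcomp (F := 𝟙 A) (K := 𝟙 A) v v' = 𝒴.vid X
  v'_v : 𝒴.vcomp (F := 𝟙 A) (K := 𝟙 A) v' v = 𝒴.vid Y
  cell_h_v : 𝒴.IsCell h v (𝒴.vid Y) (𝒴.hid Y) (𝟙 (𝟙 A))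
  cell_h'_v : 𝒴.IsCell h' (𝒴.vid Y) v (𝒴.hid Y) (𝟙 (𝟙 A))
  cell_v'_h : 𝒴.IsCell (𝒴.hid Y) v' (𝒴.vid Y) h (𝟙 (𝟙 A))
  cell_v'_h' : 𝒴.IsCell (𝒴.hid Y) (𝒴.vid Y) v' h' (𝟙 (𝟙 A))

namespace IsoOver

variable {A B C D : Grph.{u, v}} {X Y : 𝒴.Ob A} {X₁ Y₁ : 𝒴.Ob B} {X₂ Y₂ : 𝒴.Ob C}
  {X₃ Y₃ : 𝒴.Ob D} (i : IsoOver X Y) (i₁ : IsoOver X₁ Y₁) (i₂ : IsoOver X₂ Y₂)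
  (i₃ : IsoOver X₃ Y₃)

/-- Transport of a horizontal 1-cell along isomorphisms. -/
def hconj {F : A ⟶ B} (f : 𝒴.Hor Y Y₁ F) : 𝒴.Hor X X₁ F :=
  𝒴.hcomp (F := F) (K := 𝟙 B) (𝒴.hcomp (F := 𝟙 A) (K := F) i.h f) i₁.h'

/-- Transport of a vertical 1-cell along isomorphisms. -/
def vconj {F : A ⟶ B} (f : 𝒴.Ver Y Y₁ F) : 𝒴.Ver X X₁ F :=
  𝒴.vcomp (F := F) (K := 𝟙 B) (𝒴.vcomp (F := 𝟙 A) (K := F) i.v f) i₁.v'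

theorem hconj_hid : i.hconj i (𝒴.hid Y) = 𝒴.hid X :=
  (congrArg (fun f => 𝒴.hcomp (F := 𝟙 A) (K := 𝟙 A) f i.h') (𝒴.hcomp_hid i.h)).trans i.h_h'

theorem vconj_vid : i.vconj i (𝒴.vid Y) = 𝒴.vid X :=
  (congrArg (fun f => 𝒴.vcomp (F := 𝟙 A) (K := 𝟙 A) f i.v') (𝒴.vcomp_vid i.v)).trans i.v_v'

theorem h'_hconj {F : A ⟶ B} (f : 𝒴.Hor Y Y₁ F) :
    𝒴.hcomp (F := 𝟙 A) (K := F) i.h' (i.hconj i₁ f) = 𝒴.hcomp (F := F) (K := 𝟙 B) f i₁.h' := by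
  refine (𝒴.hcomp_assoc (F := 𝟙 A) (K := F) (L := 𝟙 B) i.h' (𝒴.hcomp (F := 𝟙 A) (K := F) i.h f)
    i₁.h').symm.trans (congrArg (fun t => 𝒴.hcomp (F := F) (K := 𝟙 B) t i₁.h') ?_)
  refine (𝒴.hcomp_assoc (F := 𝟙 A) (K := 𝟙 A) (L := F) i.h' i.h f).symm.trans ?_
  exact (congrArg (fun t => 𝒴.hcomp (F := 𝟙 A) (K := F) t f) i.h'_h).trans (𝒴.hid_hcomp f)

theorem v'_vconj {F : A ⟶ B} (f : 𝒴.Ver Y Y₁ F) :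
    𝒴.vcomp (F := 𝟙 A) (K := F) i.v' (i.vconj i₁ f) = 𝒴.vcomp (F := F) (K := 𝟙 B) f i₁.v' := by
  refine (𝒴.vcomp_assoc (F := 𝟙 A) (K := F) (L := 𝟙 B) i.v' (𝒴.vcomp (F := 𝟙 A) (K := F) i.v f)
    i₁.v').symm.trans (congrArg (fun t => 𝒴.vcomp (F := F) (K := 𝟙 B) t i₁.v') ?_)
  refine (𝒴.vcomp_assoc (F := 𝟙 A) (K := 𝟙 A) (L := F) i.v' i.v f).symm.trans ?_
  exact (congrArg (fun t => 𝒴.vcomp (F := 𝟙 A) (K := F) t f) i.v'_v).trans (𝒴.vid_vcomp f)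

theorem vconj_v {F : A ⟶ B} (f : 𝒴.Ver Y Y₁ F) :
    𝒴.vcomp (F := F) (K := 𝟙 B) (i.vconj i₁ f) i₁.v = 𝒴.vcomp (F := 𝟙 A) (K := F) i.v f :=
  (𝒴.vcomp_assoc (F := F) (K := 𝟙 B) (L := 𝟙 B) (𝒴.vcomp (F := 𝟙 A) (K := F) i.v f) i₁.v' i₁.v).trans
    ((congrArg (fun t => 𝒴.vcomp (F := F) (K := 𝟙 B) (𝒴.vcomp (F := 𝟙 A) (K := F) i.v f) t) i₁.v'_v).trans
      (𝒴.vcomp_vid (F := F) (𝒴.vcomp (F := 𝟙 A) (K := F) i.v f)))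

theorem hconj_hcomp {F : A ⟶ B} {K : B ⟶ C} (f : 𝒴.Hor Y Y₁ F) (k : 𝒴.Hor Y₁ Y₂ K) :
    i.hconj i₂ (𝒴.hcomp f k) = 𝒴.hcomp (i.hconj i₁ f) (i₁.hconj i₂ k) := by
  refine Eq.trans ?_ ((𝒴.hcomp_assoc (F := F) (K := 𝟙 B) (L := K) (𝒴.hcomp (F := 𝟙 A) (K := F) i.h f) i₁.h'
    (i₁.hconj i₂ k)).trans (congrArg (fun t => 𝒴.hcomp (F := F) (K := K) (𝒴.hcomp (F := 𝟙 A) (K := F) i.h f) t)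
      (i₁.h'_hconj i₂ k))).symm
  refine Eq.trans ?_ (𝒴.hcomp_assoc (F := F) (K := K) (L := 𝟙 C) (𝒴.hcomp (F := 𝟙 A) (K := F) i.h f) k
    i₂.h')
  exact congrArg (fun t => 𝒴.hcomp (F := F ≫ K) (K := 𝟙 C) t i₂.h')
    (𝒴.hcomp_assoc (F := 𝟙 A) i.h f k).symm

theorem vconj_vcomp {F : A ⟶ B} {K : B ⟶ C} (f : 𝒴.Ver Y Y₁ F) (k : 𝒴.Ver Y₁ Y₂ K) :
    i.vconj i₂ (𝒴.vcomp f k) = 𝒴.vcomp (i.vconj i₁ f) (i₁.vconj i₂ k) := by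
  refine Eq.trans ?_ ((𝒴.vcomp_assoc (F := F) (K := 𝟙 B) (L := K) (𝒴.vcomp (F := 𝟙 A) (K := F) i.v f) i₁.v'
    (i₁.vconj i₂ k)).trans (congrArg (fun t => 𝒴.vcomp (F := F) (K := K) (𝒴.vcomp (F := 𝟙 A) (K := F) i.v f) t)
      (i₁.v'_vconj i₂ k))).symm
  refine Eq.trans ?_ (𝒴.vcomp_assoc (F := F) (K := K) (L := 𝟙 C) (𝒴.vcomp (F := 𝟙 A) (K := F) i.v f) k
    i₂.v')
  exact congrArg (fun t => 𝒴.vcomp (F := F ≫ K) (K := 𝟙 C) t i₂.v')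
    (𝒴.vcomp_assoc (F := 𝟙 A) i.v f k).symm

theorem isCell_of_eq {X : 𝒴.Ob A} {Z : 𝒴.Ob B} {W : 𝒴.Ob C} {V : 𝒴.Ob D} {H : A ⟶ B} {F : A ⟶ C}
    {G : B ⟶ D} {K : C ⟶ D} {h h₁ : 𝒴.Hor X Z H} {f f₁ : 𝒴.Ver X W F} {g g₁ : 𝒴.Ver Z V G}
    {k k₁ : 𝒴.Hor W V K} {θ θ₁ : H ≫ G ⟶ F ≫ K} (c : 𝒴.IsCell h f g k θ) (eh : h = h₁)
    (ef : f = f₁) (eg : g = g₁) (ek : k = k₁) (eθ : θ = θ₁) : 𝒴.IsCell h₁ f₁ g₁ k₁ θ₁ := by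
  subst eh ef eg ek eθ
  exact c

/-- The square from a transported horizontal 1-cell to the original. -/
theorem cell_v {F : A ⟶ B} (f : 𝒴.Hor Y Y₁ F) :
    𝒴.IsCell (i.hconj i₁ f) i.v i₁.v f (𝟙 F) := by
  have c₁ : 𝒴.IsCell (𝒴.hcomp (F := 𝟙 A) (K := F) i.h f) i.v (𝒴.vid Y₁) f (𝟙 F) := by
    refine isCell_of_eq (𝒴.isCell_hpaste (H := 𝟙 A) (F := 𝟙 A) (G := 𝟙 A) (K := 𝟙 A) (H' := F)
      (L := 𝟙 B) (K' := F) i.cell_h_v (𝒴.isCell_vid f)) rfl rfl rfl (𝒴.hid_hcomp f) ?_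
    apply graphCell_ext <;> intro x
    · exact (Category.id_comp _).trans (F.F₀.map_id _)
    · exact (Category.id_comp _).trans (F.map₁_id _)
  refine isCell_of_eq (𝒴.isCell_hpaste (H := F) (F := 𝟙 A) (G := 𝟙 B) (K := F) (H' := 𝟙 B)
    (L := 𝟙 B) (K' := 𝟙 B) c₁ i₁.cell_h'_v) rfl rfl rfl (𝒴.hcomp_hid f) ?_
  apply graphCell_ext <;> intro x <;> exact Category.id_comp _

/-- The square from a horizontal 1-cell to its transport. -/
theorem cell_v' {F : A ⟶ B} (f : 𝒴.Hor Y Y₁ F) :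
    𝒴.IsCell f i.v' i₁.v' (i.hconj i₁ f) (𝟙 F) := by
  have c₁ : 𝒴.IsCell f i.v' (𝒴.vid Y₁) (𝒴.hcomp (F := 𝟙 A) (K := F) i.h f) (𝟙 F) := by
    refine isCell_of_eq (𝒴.isCell_hpaste (H := 𝟙 A) (F := 𝟙 A) (G := 𝟙 A) (K := 𝟙 A) (H' := F)
      (L := 𝟙 B) (K' := F) i.cell_v'_h (𝒴.isCell_vid f)) (𝒴.hid_hcomp f) rfl rfl rfl ?_
    apply graphCell_ext <;> intro x
    · exact (Category.id_comp _).trans (F.F₀.map_id _)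
    · exact (Category.id_comp _).trans (F.map₁_id _)
  refine isCell_of_eq (𝒴.isCell_hpaste (H := F) (F := 𝟙 A) (G := 𝟙 B) (K := F) (H' := 𝟙 B)
    (L := 𝟙 B) (K' := 𝟙 B) c₁ i₁.cell_v'_h') (𝒴.hcomp_hid f) rfl rfl rfl ?_
  apply graphCell_ext <;> intro x <;> exact Category.id_comp _

theorem cell_conj {H : A ⟶ B} {F : A ⟶ C} {G : B ⟶ D} {K : C ⟶ D} {h : 𝒴.Hor Y Y₁ H}
    {f : 𝒴.Ver Y Y₂ F} {g : 𝒴.Ver Y₁ Y₃ G} {k : 𝒴.Hor Y₂ Y₃ K} {θ : H ≫ G ⟶ F ≫ K}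
    (c : 𝒴.IsCell h f g k θ) :
    𝒴.IsCell (i.hconj i₁ h) (i.vconj i₂ f) (i₁.vconj i₃ g) (i₂.hconj i₃ k) θ := by
  refine isCell_of_eq (𝒴.isCell_vpaste (F := F) (G := G) (K := K) (F' := 𝟙 C) (G' := 𝟙 D) (L := K)
    (𝒴.isCell_vpaste (F := 𝟙 A) (G := 𝟙 B) (K := H) (F' := F) (G' := G) (L := K)
      (i.cell_v i₁ h) c) (i₂.cell_v' i₃ k)) rfl rfl rfl rfl ?_
  exact (vpaste_id _).trans (id_vpaste θ)

end IsoOver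

namespace DFunctor

variable (Φ : DFunctor 𝒳 𝒴)
  (hbij : ∀ {A B : Grph.{u, v}} (X : 𝒳.Ob A) (Y : 𝒳.Ob B) (F : A ⟶ B),
    Function.Bijective (fun f : 𝒳.Hor X Y F => Φ.hmap f))
  (vbij : ∀ {A B : Grph.{u, v}} (X : 𝒳.Ob A) (Y : 𝒳.Ob B) (F : A ⟶ B),
    Function.Bijective (fun f : 𝒳.Ver X Y F => Φ.vmap f))
  (hcell : ∀ {A B C D : Grph.{u, v}} {X : 𝒳.Ob A} {Y : 𝒳.Ob B} {Z : 𝒳.Ob C} {W : 𝒳.Ob D}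
    {H : A ⟶ B} {F : A ⟶ C} {G : B ⟶ D} {K : C ⟶ D} (h : 𝒳.Hor X Y H) (f : 𝒳.Ver X Z F)
    (g : 𝒳.Ver Y W G) (k : 𝒳.Hor Z W K) (θ : H ≫ G ⟶ F ≫ K),
    𝒴.IsCell (Φ.hmap h) (Φ.vmap f) (Φ.vmap g) (Φ.hmap k) θ → 𝒳.IsCell h f g k θ)
  (o : ∀ {A : Grph.{u, v}}, 𝒴.Ob A → 𝒳.Ob A)
  (i : ∀ {A : Grph.{u, v}} (Y : 𝒴.Ob A), IsoOver (Φ.obj (o Y)) Y)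

/-- The inverse of `hmap`. -/
noncomputable def hinv {A B : Grph.{u, v}} {X : 𝒳.Ob A} {Y : 𝒳.Ob B} {F : A ⟶ B}
    (f : 𝒴.Hor (Φ.obj X) (Φ.obj Y) F) : 𝒳.Hor X Y F := ((hbij X Y F).2 f).choose

theorem hmap_hinv {A B : Grph.{u, v}} {X : 𝒳.Ob A} {Y : 𝒳.Ob B} {F : A ⟶ B}
    (f : 𝒴.Hor (Φ.obj X) (Φ.obj Y) F) : Φ.hmap (Φ.hinv hbij f) = f :=
  ((hbij X Y F).2 f).choose_spec

/-- The inverse of `vmap`. -/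
noncomputable def vinv {A B : Grph.{u, v}} {X : 𝒳.Ob A} {Y : 𝒳.Ob B} {F : A ⟶ B}
    (f : 𝒴.Ver (Φ.obj X) (Φ.obj Y) F) : 𝒳.Ver X Y F := ((vbij X Y F).2 f).choose

theorem vmap_vinv {A B : Grph.{u, v}} {X : 𝒳.Ob A} {Y : 𝒳.Ob B} {F : A ⟶ B}
    (f : 𝒴.Ver (Φ.obj X) (Φ.obj Y) F) : Φ.vmap (Φ.vinv vbij f) = f :=
  ((vbij X Y F).2 f).choose_spec

/-- The quasi-inverse of a double functor which is bijective on 1-cells and squares and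
essentially surjective over identities. -/
noncomputable def quasiInverse : DFunctor 𝒴 𝒳 where
  obj Y := o Y
  hmap {_ _ X Y _} f := Φ.hinv hbij ((i X).hconj (i Y) f)
  hmap_id X := (hbij _ _ _).1 ((Φ.hmap_hinv hbij _).trans ((i X).hconj_hid.trans
    (Φ.hmap_id _).symm))
  hmap_comp {_ _ _ X Y Z _ _} f k := (hbij _ _ _).1 ((Φ.hmap_hinv hbij _).trans
    (((i X).hconj_hcomp (i Y) (i Z) f k).trans ((Φ.hmap_comp _ _).trans
      (congrArg₂ (fun a b => 𝒴.hcomp a b) (Φ.hmap_hinv hbij _) (Φ.hmap_hinv hbij _))).symm))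
  vmap {_ _ X Y _} f := Φ.vinv vbij ((i X).vconj (i Y) f)
  vmap_id X := (vbij _ _ _).1 ((Φ.vmap_vinv vbij _).trans ((i X).vconj_vid.trans
    (Φ.vmap_id _).symm))
  vmap_comp {_ _ _ X Y Z _ _} f k := (vbij _ _ _).1 ((Φ.vmap_vinv vbij _).trans
    (((i X).vconj_vcomp (i Y) (i Z) f k).trans ((Φ.vmap_comp _ _).trans
      (congrArg₂ (fun a b => 𝒴.vcomp a b) (Φ.vmap_vinv vbij _) (Φ.vmap_vinv vbij _))).symm))
  cell c := hcell _ _ _ _ _ (IsoOver.isCell_of_eq ((i _).cell_conj (i _) (i _) (i _) c)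
    (Φ.hmap_hinv hbij _).symm (Φ.vmap_vinv vbij _).symm (Φ.vmap_vinv vbij _).symm
    (Φ.hmap_hinv hbij _).symm rfl)

/-- The counit of the quasi-inverse. -/
noncomputable def counit :
    VTrans ((Φ.quasiInverse hbij vbij hcell o i).comp Φ) (DFunctor.id 𝒴) where
  app Y := (i Y).v
  nat {_ _ X Y _} f := (congrArg (fun a => 𝒴.vcomp a (i Y).v) (Φ.vmap_vinv vbij _)).trans
    ((i X).vconj_v (i Y) f)
  cell {_ _ X Y _} r := IsoOver.isCell_of_eq ((i X).cell_v (i Y) r) (Φ.hmap_hinv hbij _).symm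
    rfl rfl rfl rfl

/-- The inverse of the counit of the quasi-inverse. -/
noncomputable def counitInv :
    VTrans (DFunctor.id 𝒴) ((Φ.quasiInverse hbij vbij hcell o i).comp Φ) where
  app Y := (i Y).v'
  nat {A _ X Y _} f := ((congrArg (fun a => 𝒴.vcomp (F := 𝟙 A) (i X).v' a)
    (Φ.vmap_vinv vbij _)).trans ((i X).v'_vconj (i Y) f)).symm
  cell {_ _ X Y _} r := IsoOver.isCell_of_eq ((i X).cell_v' (i Y) r) rfl rfl rfl
    (Φ.hmap_hinv hbij _).symm rfl

/-- The unit of the quasi-inverse. -/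
noncomputable def unit :
    VTrans (DFunctor.id 𝒳) (Φ.comp (Φ.quasiInverse hbij vbij hcell o i)) where
  app X := Φ.vinv vbij (i (Φ.obj X)).v'
  nat {A B X Y F} f := (vbij _ _ _).1 (by
    refine (Φ.vmap_comp (F := F) (K := 𝟙 B) _ _).trans (Eq.trans ?_
      (Φ.vmap_comp (F := 𝟙 A) (K := F) _ _).symm)
    exact (congrArg (fun a => 𝒴.vcomp (F := F) (K := 𝟙 B) (Φ.vmap f) a)
      (Φ.vmap_vinv vbij _)).trans (((Φ.counitInv hbij vbij hcell o i).nat (Φ.vmap f)).trans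
        (congrArg (fun a => 𝒴.vcomp (F := 𝟙 A) (K := F) a _) (Φ.vmap_vinv vbij _).symm))
    )
  cell {_ _ X Y _} r := hcell _ _ _ _ _ (IsoOver.isCell_of_eq
    ((Φ.counitInv hbij vbij hcell o i).cell (Φ.hmap r)) rfl (Φ.vmap_vinv vbij _).symm
    (Φ.vmap_vinv vbij _).symm rfl rfl)

/-- The inverse of the unit of the quasi-inverse. -/
noncomputable def unitInv :
    VTrans (Φ.comp (Φ.quasiInverse hbij vbij hcell o i)) (DFunctor.id 𝒳) where
  app X := Φ.vinv vbij (i (Φ.obj X)).v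
  nat {A B X Y F} f := (vbij _ _ _).1 (by
    refine (Φ.vmap_comp (F := F) (K := 𝟙 B) _ _).trans (Eq.trans ?_
      (Φ.vmap_comp (F := 𝟙 A) (K := F) _ _).symm)
    exact (congrArg (fun a => 𝒴.vcomp (F := F) (K := 𝟙 B) _ a)
      (Φ.vmap_vinv vbij _)).trans (((Φ.counit hbij vbij hcell o i).nat (Φ.vmap f)).trans
        (congrArg (fun a => 𝒴.vcomp (F := 𝟙 A) (K := F) a _) (Φ.vmap_vinv vbij _).symm)))
  cell {_ _ X Y _} r := hcell _ _ _ _ _ (IsoOver.isCell_of_eq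
    ((Φ.counit hbij vbij hcell o i).cell (Φ.hmap r)) rfl (Φ.vmap_vinv vbij _).symm
    (Φ.vmap_vinv vbij _).symm rfl rfl)

include hbij vbij hcell i in
theorem isDblEquivalence : IsDblEquivalence Φ.laxStr := by
  let Ψ := Φ.quasiInverse hbij vbij hcell o i
  have e : ∀ {A : Grph.{u, v}} {X Y Z : 𝒳.Ob A} (a : 𝒴.Ver (Φ.obj X) (Φ.obj Y) (𝟙 A))
      (b : 𝒴.Ver (Φ.obj Y) (Φ.obj Z) (𝟙 A)),
      Φ.vmap (𝒳.vcomp (F := 𝟙 A) (K := 𝟙 A) (Φ.vinv vbij a) (Φ.vinv vbij b)) =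
        𝒴.vcomp (F := 𝟙 A) (K := 𝟙 A) a b := fun a b =>
    (Φ.vmap_comp _ _).trans (congrArg₂ (fun a b => 𝒴.vcomp a b) (Φ.vmap_vinv vbij a)
      (Φ.vmap_vinv vbij b))
  refine ⟨Φ.isStrong_laxStr, Ψ.graphHom, Ψ.laxStr, Ψ.isStrong_laxStr,
    ⟨(Φ.unit hbij vbij hcell o i).graphIso (Φ.unitInv hbij vbij hcell o i)
      (fun X => (vbij _ _ _).1 ((e _ _).trans ((i (Φ.obj X)).v'_v.trans (Φ.vmap_id X).symm)))
      (fun X => (vbij _ _ _).1 ((e _ _).trans ((i (Φ.obj X)).v_v'.trans (Φ.vmap_id _).symm))), ?_⟩,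
    ⟨(Φ.counit hbij vbij hcell o i).graphIso (Φ.counitInv hbij vbij hcell o i)
      (fun Y => (i Y).v_v') (fun Y => (i Y).v'_v), ?_⟩⟩
  · have := (Φ.unit hbij vbij hcell o i).isVertTransf
    rw [laxStr_id, laxStr_comp] at this
    exact this
  · have := (Φ.counit hbij vbij hcell o i).isVertTransf
    rw [laxStr_id, laxStr_comp] at this
    exact this

end DFunctor

end equiv

end DispDbl

section transport

variable {D E : Grph.{u, v}}

namespace PseudoDblStr

/-- Whiskering of a 2-cell by a horizontal 1-cell after it. -/
abbrev wL (P : PseudoDblStr D) {x y z x' : D.Ob} (s : D.Hor y z) {r : D.Hor x y} {r' : D.Hor x' y}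
    (φ : HObj.mk r ⟶ HObj.mk r') (h : D.cod φ = 𝟙 y) :
    HObj.mk (P.comp s r) ⟶ HObj.mk (P.comp s r') :=
  P.hcomp (𝟙 (HObj.mk s)) φ (by simp [h])

/-- Whiskering of a 2-cell by a horizontal 1-cell before it. -/
abbrev wR (P : PseudoDblStr D) {x y z z' : D.Ob} {s : D.Hor y z} {s' : D.Hor y z'}
    (ψ : HObj.mk s ⟶ HObj.mk s') (r : D.Hor x y) (h : D.dom ψ = 𝟙 y) :
    HObj.mk (P.comp s r) ⟶ HObj.mk (P.comp s' r) :=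
  P.hcomp ψ (𝟙 (HObj.mk r)) (by simp [h])

section

variable (P : PseudoDblStr D)

theorem wL_comp {x y z x' x'' : D.Ob} (s : D.Hor y z) {r : D.Hor x y} {r' : D.Hor x' y}
    {r'' : D.Hor x'' y} (φ : HObj.mk r ⟶ HObj.mk r') (h : D.cod φ = 𝟙 y)
    (ψ : HObj.mk r' ⟶ HObj.mk r'') (h' : D.cod ψ = 𝟙 y) :
    P.wL s (φ ≫ ψ) (by simp [h, h']) = P.wL s φ h ≫ P.wL s ψ h' := by
  rw [P.hcomp_hcomp]
  exact P.hcomp_congr (Category.comp_id _).symm rfl _ _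

theorem wR_comp {x y z z' z'' : D.Ob} {s : D.Hor y z} {s' : D.Hor y z'} {s'' : D.Hor y z''}
    (φ : HObj.mk s ⟶ HObj.mk s') (h : D.dom φ = 𝟙 y) (ψ : HObj.mk s' ⟶ HObj.mk s'')
    (h' : D.dom ψ = 𝟙 y) (r : D.Hor x y) :
    P.wR (φ ≫ ψ) r (by simp [h, h']) = P.wR φ r h ≫ P.wR ψ r h' := by
  rw [P.hcomp_hcomp]
  exact P.hcomp_congr rfl (Category.comp_id _).symm _ _

theorem wL_hom_inv {x y z x' : D.Ob} (s : D.Hor y z) {r : D.Hor x y} {r' : D.Hor x' y}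
    (i : HObj.mk r ≅ HObj.mk r') (h : D.cod i.hom = 𝟙 y) (h' : D.cod i.inv = 𝟙 y) :
    P.wL s i.hom h ≫ P.wL s i.inv h' = 𝟙 _ := by
  rw [P.hcomp_hcomp, ← P.hcomp_id]
  exact P.hcomp_congr (Category.comp_id _) i.hom_inv_id _ _

theorem wR_hom_inv {x y z z' : D.Ob} {s : D.Hor y z} {s' : D.Hor y z'}
    (i : HObj.mk s ≅ HObj.mk s') (h : D.dom i.hom = 𝟙 y) (h' : D.dom i.inv = 𝟙 y) (r : D.Hor x y) :
    P.wR i.hom r h ≫ P.wR i.inv r h' = 𝟙 _ := by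
  rw [P.hcomp_hcomp, ← P.hcomp_id]
  exact P.hcomp_congr i.hom_inv_id (Category.comp_id _) _ _

theorem wL_wR {x y z x' z' : D.Ob} {s : D.Hor y z} {s' : D.Hor y z'} {r : D.Hor x y}
    {r' : D.Hor x' y} (φ : HObj.mk r ⟶ HObj.mk r') (h : D.cod φ = 𝟙 y)
    (ψ : HObj.mk s ⟶ HObj.mk s') (h' : D.dom ψ = 𝟙 y) :
    P.wL s φ h ≫ P.wR ψ r' h' = P.wR ψ r h' ≫ P.wL s' φ h := by
  rw [P.hcomp_hcomp, P.hcomp_hcomp]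
  exact P.hcomp_congr ((Category.id_comp _).trans (Category.comp_id _).symm)
    ((Category.comp_id _).trans (Category.id_comp _).symm) _ _

theorem wL_wL {w x y z w' : D.Ob} (t : D.Hor y z) (s : D.Hor x y) {r : D.Hor w x}
    {r' : D.Hor w' x} (φ : HObj.mk r ⟶ HObj.mk r') (h : D.cod φ = 𝟙 x) :
    P.wL (P.comp t s) φ h ≫ (P.alpha t s r').hom =
      (P.alpha t s r).hom ≫ P.wL t (P.wL s φ h) (by simp) := by
  rw [← P.alpha_nat _ _ _ (by simp)]
  exact congrArg (· ≫ _) (P.hcomp_congr (P.hcomp_id t s).symm rfl _ _)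

theorem wR_wR {w x y z z' : D.Ob} {t : D.Hor y z} {t' : D.Hor y z'} (s : D.Hor x y)
    (r : D.Hor w x) (φ : HObj.mk t ⟶ HObj.mk t') (h : D.dom φ = 𝟙 y) :
    P.wR (P.wR φ s h) r (by simp) ≫ (P.alpha t' s r).hom =
      (P.alpha t s r).hom ≫ P.wR φ (P.comp s r) h := by
  rw [P.alpha_nat _ _ _ _ (by simp)]
  exact congrArg (_ ≫ ·) (P.hcomp_congr rfl (P.hcomp_id s r) _ _)

theorem wL_wR_alpha {w x y z : D.Ob} (t : D.Hor y z) {s s' : D.Hor x y} (r : D.Hor w x)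
    (φ : HObj.mk s ⟶ HObj.mk s') (h : D.dom φ = 𝟙 x) (h' : D.cod φ = 𝟙 y) :
    P.wR (P.wL t φ h') r (by simp [h]) ≫ (P.alpha t s' r).hom =
      (P.alpha t s r).hom ≫ P.wL t (P.wR φ r h) (by simp [h']) :=
  P.alpha_nat _ _ _ _ _

end

end PseudoDblStr

/-- The data for transporting a pseudodouble category along a fully faithful morphism of graphs:
units and composites which are taken to the given ones up to globular isomorphism. -/
structure TransportData (Q : PseudoDblStr E) (F : D ⟶ E) where
  faithful : ∀ {x y : D.Ob} {f g : x ⟶ y}, F.F₀.map f = F.F₀.map g → f = g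
  pre : ∀ {r s : D.One}, (HObj.mk (F.obj₁ r.hom) ⟶ HObj.mk (F.obj₁ s.hom)) → (r ⟶ s)
  map_pre : ∀ {r s : D.One} (ψ : HObj.mk (F.obj₁ r.hom) ⟶ HObj.mk (F.obj₁ s.hom)),
    F.map₁ (pre ψ) = ψ
  pre_map : ∀ {r s : D.One} (φ : r ⟶ s), pre (F.map₁ φ) = φ
  one : ∀ x : D.Ob, D.Hor x x
  u : ∀ x : D.Ob, HObj.mk (Q.one (F.F₀.obj x)) ≅ HObj.mk (F.obj₁ (one x))
  dom_u : ∀ x, E.dom (u x).hom = 𝟙 _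
  cod_u : ∀ x, E.cod (u x).hom = 𝟙 _
  comp : ∀ {x y z : D.Ob}, D.Hor y z → D.Hor x y → D.Hor x z
  m : ∀ {x y z : D.Ob} (s : D.Hor y z) (r : D.Hor x y),
    HObj.mk (Q.comp (F.obj₁ s) (F.obj₁ r)) ≅ HObj.mk (F.obj₁ (comp s r))
  dom_m : ∀ {x y z : D.Ob} (s : D.Hor y z) (r : D.Hor x y), E.dom (m s r).hom = 𝟙 _
  cod_m : ∀ {x y z : D.Ob} (s : D.Hor y z) (r : D.Hor x y), E.cod (m s r).hom = 𝟙 _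

namespace TransportData

attribute [simp] map_pre pre_map dom_u cod_u dom_m cod_m

variable {Q : PseudoDblStr E} {F : D ⟶ E} (d : TransportData Q F)

@[simp] theorem dom_u_inv (x : D.Ob) : E.dom (d.u x).inv = 𝟙 _ :=
  CatGraph.dom_isoInv (d.u x) (d.dom_u x)

@[simp] theorem cod_u_inv (x : D.Ob) : E.cod (d.u x).inv = 𝟙 _ :=
  CatGraph.cod_isoInv (d.u x) (d.cod_u x)

@[simp] theorem dom_m_inv {x y z : D.Ob} (s : D.Hor y z) (r : D.Hor x y) :
    E.dom (d.m s r).inv = 𝟙 _ :=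
  CatGraph.dom_isoInv (d.m s r) (d.dom_m s r)

@[simp] theorem cod_m_inv {x y z : D.Ob} (s : D.Hor y z) (r : D.Hor x y) :
    E.cod (d.m s r).inv = 𝟙 _ :=
  CatGraph.cod_isoInv (d.m s r) (d.cod_m s r)

include d in
theorem map_inj {r s : D.One} {φ ψ : r ⟶ s} (h : F.map₁ φ = F.map₁ ψ) : φ = ψ := by
  rw [← d.pre_map φ, h, d.pre_map]

/-- An isomorphism lifted along the fully faithful morphism. -/
def preIso {r s : D.One} (i : HObj.mk (F.obj₁ r.hom) ≅ HObj.mk (F.obj₁ s.hom)) : r ≅ s where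
  hom := d.pre i.hom
  inv := d.pre i.inv
  hom_inv_id := d.map_inj (by rw [F.map₁_comp, d.map_pre, d.map_pre, i.hom_inv_id, F.map₁_id])
  inv_hom_id := d.map_inj (by rw [F.map₁_comp, d.map_pre, d.map_pre, i.inv_hom_id, F.map₁_id])

theorem dom_pre {r s : D.One} (ψ : HObj.mk (F.obj₁ r.hom) ⟶ HObj.mk (F.obj₁ s.hom))
    (f : r.src ⟶ s.src) (h : E.dom ψ = F.F₀.map f) : D.dom (d.pre ψ) = f :=
  d.faithful (by rw [← F.dom_map₁, d.map_pre, h])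

theorem cod_pre {r s : D.One} (ψ : HObj.mk (F.obj₁ r.hom) ⟶ HObj.mk (F.obj₁ s.hom))
    (f : r.tgt ⟶ s.tgt) (h : E.cod ψ = F.F₀.map f) : D.cod (d.pre ψ) = f :=
  d.faithful (by rw [← F.cod_map₁, d.map_pre, h])

/-- Horizontal composition of 2-cells, transported. -/
def hcomp {x y z x' y' z' : D.Ob} {s : D.Hor y z} {r : D.Hor x y} {s' : D.Hor y' z'}
    {r' : D.Hor x' y'} (ψ : HObj.mk s ⟶ HObj.mk s') (φ : HObj.mk r ⟶ HObj.mk r')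
    (h : D.dom ψ = D.cod φ) : HObj.mk (d.comp s r) ⟶ HObj.mk (d.comp s' r') :=
  d.pre ((d.m s r).inv ≫ Q.hcomp (F.map₁ ψ) (F.map₁ φ) (by simp [h]) ≫ (d.m s' r').hom)

theorem map_hcomp {x y z x' y' z' : D.Ob} {s : D.Hor y z} {r : D.Hor x y} {s' : D.Hor y' z'}
    {r' : D.Hor x' y'} (ψ : HObj.mk s ⟶ HObj.mk s') (φ : HObj.mk r ⟶ HObj.mk r')
    (h : D.dom ψ = D.cod φ) : F.map₁ (d.hcomp ψ φ h) =
    (d.m s r).inv ≫ Q.hcomp (F.map₁ ψ) (F.map₁ φ) (by simp [h]) ≫ (d.m s' r').hom := d.map_pre _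

theorem map_hcomp_of {x y z x' y' z' : D.Ob} {s : D.Hor y z} {r : D.Hor x y} {s' : D.Hor y' z'}
    {r' : D.Hor x' y'} (ψ : HObj.mk s ⟶ HObj.mk s') (φ : HObj.mk r ⟶ HObj.mk r')
    (h : D.dom ψ = D.cod φ) {ψ' φ'} (eψ : F.map₁ ψ = ψ') (eφ : F.map₁ φ = φ') (h') :
    F.map₁ (d.hcomp ψ φ h) =
      (d.m s r).inv ≫ Q.hcomp ψ' φ' h' ≫ (d.m s' r').hom := by
  subst eψ eφ
  exact d.map_pre _

/-- The transported left unitor. -/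
noncomputable def lam {x y : D.Ob} (r : D.Hor x y) : HObj.mk (d.comp (d.one y) r) ≅ HObj.mk r :=
  d.preIso ((d.m (d.one y) r).symm ≪≫
    asIso (Q.wR (d.u y).inv (F.obj₁ r) (by simp)) ≪≫ Q.lam (F.obj₁ r))

theorem map_lam {x y : D.Ob} (r : D.Hor x y) : F.map₁ (d.lam r).hom =
    (d.m (d.one y) r).inv ≫ Q.wR (d.u y).inv (F.obj₁ r) (by simp) ≫ (Q.lam (F.obj₁ r)).hom :=
  d.map_pre _

/-- The transported right unitor. -/
noncomputable def rho {x y : D.Ob} (r : D.Hor x y) : HObj.mk (d.comp r (d.one x)) ≅ HObj.mk r :=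
  d.preIso ((d.m r (d.one x)).symm ≪≫
    asIso (Q.wL (F.obj₁ r) (d.u x).inv (by simp)) ≪≫ Q.rho (F.obj₁ r))

theorem map_rho {x y : D.Ob} (r : D.Hor x y) : F.map₁ (d.rho r).hom =
    (d.m r (d.one x)).inv ≫ Q.wL (F.obj₁ r) (d.u x).inv (by simp) ≫ (Q.rho (F.obj₁ r)).hom :=
  d.map_pre _

/-- The transported associator. -/
noncomputable def alpha {w x y z : D.Ob} (t : D.Hor y z) (s : D.Hor x y) (r : D.Hor w x) :
    HObj.mk (d.comp (d.comp t s) r) ≅ HObj.mk (d.comp t (d.comp s r)) :=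
  d.preIso ((d.m (d.comp t s) r).symm ≪≫ asIso (Q.wR (d.m t s).inv (F.obj₁ r) (by simp)) ≪≫
    Q.alpha (F.obj₁ t) (F.obj₁ s) (F.obj₁ r) ≪≫
    asIso (Q.wL (F.obj₁ t) (d.m s r).hom (by simp)) ≪≫ d.m t (d.comp s r))

theorem map_alpha {w x y z : D.Ob} (t : D.Hor y z) (s : D.Hor x y) (r : D.Hor w x) :
    F.map₁ (d.alpha t s r).hom = (d.m (d.comp t s) r).inv ≫
      Q.wR (d.m t s).inv (F.obj₁ r) (by simp) ≫
      (Q.alpha (F.obj₁ t) (F.obj₁ s) (F.obj₁ r)).hom ≫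
      Q.wL (F.obj₁ t) (d.m s r).hom (by simp) ≫ (d.m t (d.comp s r)).hom :=
  d.map_pre _

theorem map_wL {x y z x' : D.Ob} (s : D.Hor y z) {r : D.Hor x y} {r' : D.Hor x' y}
    (φ : HObj.mk r ⟶ HObj.mk r') (h : D.dom (𝟙 (HObj.mk s)) = D.cod φ)
    {φ'} (e : F.map₁ φ = φ') (h' : E.cod φ' = 𝟙 _) :
    F.map₁ (d.hcomp (𝟙 (HObj.mk s)) φ h) =
      (d.m s r).inv ≫ Q.wL (F.obj₁ s) φ' h' ≫ (d.m s r').hom :=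
  d.map_hcomp_of _ _ _ (F.map₁_id _) e _

theorem map_wR {x y z z' : D.Ob} {s : D.Hor y z} {s' : D.Hor y z'} (r : D.Hor x y)
    (ψ : HObj.mk s ⟶ HObj.mk s') (h : D.dom ψ = D.cod (𝟙 (HObj.mk r)))
    {ψ'} (e : F.map₁ ψ = ψ') (h' : E.dom ψ' = 𝟙 _) :
    F.map₁ (d.hcomp ψ (𝟙 (HObj.mk r)) h) =
      (d.m s r).inv ≫ Q.wR ψ' (F.obj₁ r) h' ≫ (d.m s' r).hom :=
  d.map_hcomp_of _ _ _ e (F.map₁_id _) _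

theorem lam_nat {x y x' y' : D.Ob} {r : D.Hor x y} {r' : D.Hor x' y'}
    (φ : HObj.mk r ⟶ HObj.mk r') {ψ : HObj.mk (d.one y) ⟶ HObj.mk (d.one y')}
    (hψ : F.map₁ ψ = (d.u y).inv ≫ Q.oneMap (F.F₀.map (D.cod φ)) ≫ (d.u y').hom)
    (h : D.dom ψ = D.cod φ) :
    d.hcomp ψ φ h ≫ (d.lam r').hom = (d.lam r).hom ≫ φ := by
  apply d.map_inj
  have e : Q.hcomp (F.map₁ ψ) (F.map₁ φ) (by simp [h]) ≫
      Q.wR (d.u y').inv (F.obj₁ r') (by simp) = Q.wR (d.u y).inv (F.obj₁ r) (by simp) ≫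
        Q.hcomp (Q.oneMap (E.cod (F.map₁ φ))) (F.map₁ φ) (by simp) := by
    rw [Q.hcomp_hcomp, Q.hcomp_hcomp]
    refine Q.hcomp_congr ?_ ((Category.comp_id _).trans (Category.id_comp _).symm) _ _
    rw [hψ, F.cod_map₁]
    simp
  rw [F.map₁_comp, F.map₁_comp, d.map_hcomp, d.map_lam, d.map_lam]
  simp only [Category.assoc, Iso.hom_inv_id_assoc]
  rw [reassoc_of% e, Q.lam_nat]

theorem rho_nat {x y x' y' : D.Ob} {r : D.Hor x y} {r' : D.Hor x' y'}
    (φ : HObj.mk r ⟶ HObj.mk r') {ψ : HObj.mk (d.one x) ⟶ HObj.mk (d.one x')}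
    (hψ : F.map₁ ψ = (d.u x).inv ≫ Q.oneMap (F.F₀.map (D.dom φ)) ≫ (d.u x').hom)
    (h : D.dom φ = D.cod ψ) :
    d.hcomp φ ψ h ≫ (d.rho r').hom = (d.rho r).hom ≫ φ := by
  apply d.map_inj
  have e : Q.hcomp (F.map₁ φ) (F.map₁ ψ) (by simp [h]) ≫
      Q.wL (F.obj₁ r') (d.u x').inv (by simp) = Q.wL (F.obj₁ r) (d.u x).inv (by simp) ≫
        Q.hcomp (F.map₁ φ) (Q.oneMap (E.dom (F.map₁ φ))) (by simp) := by
    rw [Q.hcomp_hcomp, Q.hcomp_hcomp]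
    refine Q.hcomp_congr ((Category.comp_id _).trans (Category.id_comp _).symm) ?_ _ _
    rw [hψ, F.dom_map₁]
    simp
  rw [F.map₁_comp, F.map₁_comp, d.map_hcomp, d.map_rho, d.map_rho]
  simp only [Category.assoc, Iso.hom_inv_id_assoc]
  rw [reassoc_of% e, Q.rho_nat]

theorem alpha_nat {w x y z w' x' y' z' : D.Ob} {t : D.Hor y z} {s : D.Hor x y} {r : D.Hor w x}
    {t' : D.Hor y' z'} {s' : D.Hor x' y'} {r' : D.Hor w' x'} (χ : HObj.mk t ⟶ HObj.mk t')
    (ψ : HObj.mk s ⟶ HObj.mk s') (φ : HObj.mk r ⟶ HObj.mk r') (h : D.dom χ = D.cod ψ)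
    (h' : D.dom ψ = D.cod φ) (k : D.dom (d.hcomp χ ψ h) = D.cod φ)
    (k' : D.dom χ = D.cod (d.hcomp ψ φ h')) :
    d.hcomp (d.hcomp χ ψ h) φ k ≫ (d.alpha t' s' r').hom =
      (d.alpha t s r).hom ≫ d.hcomp χ (d.hcomp ψ φ h') k' := by
  apply d.map_inj
  have e₁ : Q.hcomp (F.map₁ (d.hcomp χ ψ h)) (F.map₁ φ) (by simp [k]) ≫
      Q.wR (d.m t' s').inv (F.obj₁ r') (by simp) = Q.wR (d.m t s).inv (F.obj₁ r) (by simp) ≫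
        Q.hcomp (Q.hcomp (F.map₁ χ) (F.map₁ ψ) (by simp [h])) (F.map₁ φ) (by simp [h']) := by
    rw [Q.hcomp_hcomp, Q.hcomp_hcomp]
    refine Q.hcomp_congr ?_ ((Category.comp_id _).trans (Category.id_comp _).symm) _ _
    rw [d.map_hcomp]
    simp
  have e₂ : Q.wL (F.obj₁ t) (d.m s r).hom (by simp) ≫
      Q.hcomp (F.map₁ χ) (F.map₁ (d.hcomp ψ φ h')) (by simp [k']) =
      Q.hcomp (F.map₁ χ) (Q.hcomp (F.map₁ ψ) (F.map₁ φ) (by simp [h'])) (by simp [h]) ≫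
        Q.wL (F.obj₁ t') (d.m s' r').hom (by simp) := by
    rw [Q.hcomp_hcomp, Q.hcomp_hcomp]
    refine Q.hcomp_congr ((Category.id_comp _).trans (Category.comp_id _).symm) ?_ _ _
    rw [d.map_hcomp]
    simp
  have e₃ := Q.alpha_nat (F.map₁ χ) (F.map₁ ψ) (F.map₁ φ) (by simp [h]) (by simp [h'])
  rw [F.map₁_comp, F.map₁_comp, d.map_hcomp,
    d.map_hcomp χ (d.hcomp ψ φ h'), d.map_alpha, d.map_alpha]
  simp only [Category.assoc, Iso.hom_inv_id_assoc]
  rw [reassoc_of% e₁, reassoc_of% e₃, reassoc_of% e₂]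

theorem left_left {x y z : D.Ob} (s : D.Hor y z) (r : D.Hor x y)
    (h : D.dom (d.lam s).hom = D.cod (𝟙 (HObj.mk r))) :
    (d.alpha (d.one z) s r).hom ≫ (d.lam (d.comp s r)).hom =
      d.hcomp (d.lam s).hom (𝟙 (HObj.mk r)) h := by
  apply d.map_inj
  rw [F.map₁_comp, d.map_alpha, d.map_lam, d.map_wR r _ h (d.map_lam s) (by simp)]
  have e₁ := Q.wL_wR (d.m s r).hom (by simp) (d.u z).inv (by simp)
  have e₂ := Q.lam_nat_of_id (d.m s r).hom (by simp)
  have e₃ := Q.wR_wR (F.obj₁ s) (F.obj₁ r) (d.u z).inv (by simp)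
  have e₄ := Q.wR_comp (d.m (d.one z) s).inv (by simp) (Q.wR (d.u z).inv (F.obj₁ s) (by simp) ≫
    (Q.lam (F.obj₁ s)).hom) (by simp) (F.obj₁ r)
  have e₅ := Q.wR_comp (Q.wR (d.u z).inv (F.obj₁ s) (by simp)) (by simp)
    (Q.lam (F.obj₁ s)).hom (by simp) (F.obj₁ r)
  simp only [Category.assoc, Iso.hom_inv_id_assoc]
  rw [e₄, e₅, reassoc_of% e₁, e₂, ← reassoc_of% e₃, reassoc_of% (Q.left_left (F.obj₁ s) (F.obj₁ r))]
  simp only [Category.assoc]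

theorem right_right {x y z : D.Ob} (s : D.Hor y z) (r : D.Hor x y)
    (h : D.dom (𝟙 (HObj.mk s)) = D.cod (d.rho r).hom) :
    (d.alpha s r (d.one x)).hom ≫ d.hcomp (𝟙 (HObj.mk s)) (d.rho r).hom h =
      (d.rho (d.comp s r)).hom := by
  apply d.map_inj
  rw [F.map₁_comp, d.map_alpha, d.map_rho, d.map_wL s _ h (d.map_rho r) (by simp)]
  have e₁ := Q.wL_wR (d.u x).inv (by simp) (d.m s r).inv (by simp)
  have e₂ := Q.rho_nat_of_id (d.m s r).inv (by simp)
  have e₃ := Q.wL_wL (F.obj₁ s) (F.obj₁ r) (d.u x).inv (by simp)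
  have e₄ := Q.wL_comp (F.obj₁ s) (d.m r (d.one x)).inv (by simp)
    (Q.wL (F.obj₁ r) (d.u x).inv (by simp) ≫ (Q.rho (F.obj₁ r)).hom) (by simp)
  have e₅ := Q.wL_comp (F.obj₁ s) (Q.wL (F.obj₁ r) (d.u x).inv (by simp)) (by simp)
    (Q.rho (F.obj₁ r)).hom (by simp)
  have e₆ := Q.wL_hom_inv (F.obj₁ s) (d.m r (d.one x)) (by simp) (by simp)
  have e₇ := Q.right_right (F.obj₁ s) (F.obj₁ r)
  simp only [Category.assoc, Iso.hom_inv_id_assoc]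
  rw [e₄, e₅]
  simp only [Category.assoc]
  rw [reassoc_of% e₆, ← reassoc_of% e₃, reassoc_of% e₇, ← reassoc_of% e₁, reassoc_of% e₂,
    Iso.inv_hom_id, Category.comp_id]

theorem triangle {x y z : D.Ob} (s : D.Hor y z) (r : D.Hor x y)
    (h : D.dom (𝟙 (HObj.mk s)) = D.cod (d.lam r).hom)
    (h' : D.dom (d.rho s).hom = D.cod (𝟙 (HObj.mk r))) :
    (d.alpha s (d.one y) r).hom ≫ d.hcomp (𝟙 (HObj.mk s)) (d.lam r).hom h =
      d.hcomp (d.rho s).hom (𝟙 (HObj.mk r)) h' := by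
  apply d.map_inj
  rw [F.map₁_comp, d.map_alpha, d.map_wL s _ h (d.map_lam r) (by simp),
    d.map_wR r _ h' (d.map_rho s) (by simp)]
  have e₁ := Q.wL_wR_alpha (F.obj₁ s) (F.obj₁ r) (d.u y).inv (by simp) (by simp)
  have e₂ := Q.triangle (F.obj₁ s) (F.obj₁ r)
  have e₃ := Q.wR_comp (d.m s (d.one y)).inv (by simp) (Q.wL (F.obj₁ s) (d.u y).inv (by simp) ≫
    (Q.rho (F.obj₁ s)).hom) (by simp) (F.obj₁ r)
  have e₃' := Q.wR_comp (Q.wL (F.obj₁ s) (d.u y).inv (by simp)) (by simp)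
    (Q.rho (F.obj₁ s)).hom (by simp) (F.obj₁ r)
  have e₄ := Q.wL_comp (F.obj₁ s) (d.m (d.one y) r).inv (by simp)
    (Q.wR (d.u y).inv (F.obj₁ r) (by simp) ≫ (Q.lam (F.obj₁ r)).hom) (by simp)
  have e₅ := Q.wL_comp (F.obj₁ s) (Q.wR (d.u y).inv (F.obj₁ r) (by simp)) (by simp)
    (Q.lam (F.obj₁ r)).hom (by simp)
  have e₆ := Q.wL_hom_inv (F.obj₁ s) (d.m (d.one y) r) (by simp) (by simp)
  simp only [Category.assoc, Iso.hom_inv_id_assoc]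
  rw [e₄, e₅, e₃, e₃']
  simp only [Category.assoc]
  rw [reassoc_of% e₆, ← reassoc_of% e₁, reassoc_of% e₂]

theorem pentagon {v w x y z : D.Ob} (t : D.Hor y z) (s : D.Hor x y) (r : D.Hor w x)
    (q : D.Hor v w) (h : D.dom (d.alpha t s r).hom = D.cod (𝟙 (HObj.mk q)))
    (h' : D.dom (𝟙 (HObj.mk t)) = D.cod (d.alpha s r q).hom) :
    (d.alpha (d.comp t s) r q).hom ≫ (d.alpha t s (d.comp r q)).hom =
      d.hcomp (d.alpha t s r).hom (𝟙 (HObj.mk q)) h ≫ (d.alpha t (d.comp s r) q).hom ≫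
        d.hcomp (𝟙 (HObj.mk t)) (d.alpha s r q).hom h' := by
  apply d.map_inj
  simp only [F.map₁_comp]
  rw [d.map_alpha, d.map_alpha, d.map_alpha t (d.comp s r) q,
    d.map_wR q _ h (d.map_alpha t s r) (by simp), d.map_wL t _ h' (d.map_alpha s r q) (by simp)]
  have e₁ := Q.wL_wR (d.m r q).hom (by simp) (d.m t s).inv (by simp)
  have e₂ := Q.wL_wL (F.obj₁ t) (F.obj₁ s) (d.m r q).hom (by simp)
  have e₃ := Q.wR_wR (F.obj₁ r) (F.obj₁ q) (d.m t s).inv (by simp)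
  have e₄ := Q.wR_comp (d.m (d.comp t s) r).inv (by simp) (Q.wR (d.m t s).inv (F.obj₁ r) (by simp) ≫
    (Q.alpha (F.obj₁ t) (F.obj₁ s) (F.obj₁ r)).hom ≫ Q.wL (F.obj₁ t) (d.m s r).hom (by simp) ≫
      (d.m t (d.comp s r)).hom) (by simp) (F.obj₁ q)
  have e₅ := Q.wR_comp (Q.wR (d.m t s).inv (F.obj₁ r) (by simp)) (by simp)
    ((Q.alpha (F.obj₁ t) (F.obj₁ s) (F.obj₁ r)).hom ≫ Q.wL (F.obj₁ t) (d.m s r).hom (by simp) ≫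
      (d.m t (d.comp s r)).hom) (by simp) (F.obj₁ q)
  have e₆ := Q.wR_comp (Q.alpha (F.obj₁ t) (F.obj₁ s) (F.obj₁ r)).hom (by simp)
    (Q.wL (F.obj₁ t) (d.m s r).hom (by simp) ≫ (d.m t (d.comp s r)).hom) (by simp) (F.obj₁ q)
  have e₇ := Q.wR_comp (Q.wL (F.obj₁ t) (d.m s r).hom (by simp)) (by simp)
    (d.m t (d.comp s r)).hom (by simp) (F.obj₁ q)
  have e₈ := Q.wR_hom_inv (d.m t (d.comp s r)) (by simp) (by simp) (F.obj₁ q)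
  have e₉ := Q.wL_wR_alpha (F.obj₁ t) (F.obj₁ q) (d.m s r).hom (by simp) (by simp)
  have f₄ := Q.wL_comp (F.obj₁ t) (d.m (d.comp s r) q).inv (by simp)
    (Q.wR (d.m s r).inv (F.obj₁ q) (by simp) ≫
    (Q.alpha (F.obj₁ s) (F.obj₁ r) (F.obj₁ q)).hom ≫ Q.wL (F.obj₁ s) (d.m r q).hom (by simp) ≫
      (d.m s (d.comp r q)).hom) (by simp)
  have f₅ := Q.wL_comp (F.obj₁ t) (Q.wR (d.m s r).inv (F.obj₁ q) (by simp)) (by simp)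
    ((Q.alpha (F.obj₁ s) (F.obj₁ r) (F.obj₁ q)).hom ≫ Q.wL (F.obj₁ s) (d.m r q).hom (by simp) ≫
      (d.m s (d.comp r q)).hom) (by simp)
  have f₆ := Q.wL_comp (F.obj₁ t) (Q.alpha (F.obj₁ s) (F.obj₁ r) (F.obj₁ q)).hom (by simp)
    (Q.wL (F.obj₁ s) (d.m r q).hom (by simp) ≫ (d.m s (d.comp r q)).hom) (by simp)
  have f₇ := Q.wL_comp (F.obj₁ t) (Q.wL (F.obj₁ s) (d.m r q).hom (by simp)) (by simp)
    (d.m s (d.comp r q)).hom (by simp)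
  have f₈ := Q.wL_hom_inv (F.obj₁ t) (d.m (d.comp s r) q) (by simp) (by simp)
  have f₉ : Q.wL (F.obj₁ t) (Q.wR (d.m s r).hom (F.obj₁ q) (by simp)) (by simp) ≫
      Q.wL (F.obj₁ t) (Q.wR (d.m s r).inv (F.obj₁ q) (by simp)) (by simp) = 𝟙 _ := by
    rw [Q.hcomp_hcomp, ← Q.hcomp_id]
    exact Q.hcomp_congr (Category.comp_id _) (Q.wR_hom_inv (d.m s r) _ _ _) _ _
  have p := Q.pentagon (F.obj₁ t) (F.obj₁ s) (F.obj₁ r) (F.obj₁ q)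
  rw [e₄, e₅, e₆, e₇, f₄, f₅, f₆, f₇]
  simp only [Category.assoc, Iso.hom_inv_id_assoc]
  rw [reassoc_of% e₁, reassoc_of% e₂, ← reassoc_of% e₃, reassoc_of% e₈, reassoc_of% e₉,
    reassoc_of% f₈, reassoc_of% f₉, reassoc_of% p]

/-- The transported pseudodouble category. -/
noncomputable def str : PseudoDblStr D where
  one := d.one
  oneMap {x y} f := d.pre ((d.u x).inv ≫ Q.oneMap (F.F₀.map f) ≫ (d.u y).hom)
  dom_oneMap f := d.dom_pre _ _ (by simp)
  cod_oneMap f := d.cod_pre _ _ (by simp)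
  oneMap_id x := d.map_inj (by rw [d.map_pre, F.F₀.map_id, F.map₁_id]; simp)
  oneMap_comp f g := d.map_inj (by
    rw [F.map₁_comp, d.map_pre, d.map_pre, d.map_pre, F.F₀.map_comp, Q.oneMap_comp]; simp)
  comp := d.comp
  hcomp ψ φ h := d.hcomp ψ φ h
  dom_hcomp ψ φ h := d.dom_pre _ _ (by simp)
  cod_hcomp ψ φ h := d.cod_pre _ _ (by simp)
  hcomp_id s r := d.map_inj (by
    rw [d.map_hcomp_of _ _ _ (F.map₁_id _) (F.map₁_id _) (by simp), F.map₁_id, Q.hcomp_id]; simp)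
  hcomp_comp ψ φ h ψ' φ' h' := d.map_inj (by
    rw [d.map_hcomp_of _ _ _ (F.map₁_comp _ _) (F.map₁_comp _ _) (by simp [h, h']), F.map₁_comp,
      d.map_hcomp, d.map_hcomp, Q.hcomp_comp _ _ (by simp [h]) _ _ (by simp [h'])]
    simp)
  lam := d.lam
  dom_lam r := d.dom_pre _ _ (by simp)
  cod_lam r := d.cod_pre _ _ (by simp)
  lam_nat φ := d.lam_nat φ (d.map_pre _) _
  rho := d.rho
  dom_rho r := d.dom_pre _ _ (by simp)
  cod_rho r := d.cod_pre _ _ (by simp)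
  rho_nat φ := d.rho_nat φ (d.map_pre _) _
  alpha := d.alpha
  dom_alpha t s r := d.dom_pre _ _ (by simp)
  cod_alpha t s r := d.cod_pre _ _ (by simp)
  alpha_nat χ ψ φ h h' := d.alpha_nat χ ψ φ h h' _ _
  unit_unit x := by
    rw [Iso.comp_inv_eq, Category.id_comp]
    apply d.map_inj
    rw [d.map_lam, d.map_rho]
    refine congrArg (_ ≫ ·) ?_
    have e₁ := Q.lam_nat_of_id (d.u x).inv (by simp)
    have e₂ := Q.rho_nat_of_id (d.u x).inv (by simp)
    have e₃ : (Q.lam (Q.one (F.F₀.obj x))).hom = (Q.rho (Q.one (F.F₀.obj x))).hom := by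
      have := Q.unit_unit (F.F₀.obj x)
      rwa [Iso.comp_inv_eq, Category.id_comp] at this
    have e₄ := Q.wL_wR (d.u x).inv (by simp) (d.u x).inv (by simp)
    rw [← cancel_mono (d.u x).inv, Category.assoc, Category.assoc, ← e₁, ← e₂, ← reassoc_of% e₄, e₃]
  left_left s r := d.left_left s r _
  right_right s r := d.right_right s r _
  triangle s r := d.triangle s r _ _
  pentagon t s r q := d.pentagon t s r q _ _

/-- The morphism along which a pseudodouble category is transported, as a strong functor. -/
noncomputable def laxStr : LaxStr d.str Q F where
  unit x := (d.u x).hom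
  dom_unit := d.dom_u
  cod_unit := d.cod_u
  unit_nat {x y} f := by
    rw [show F.map₁ (d.str.oneMap f) = (d.u x).inv ≫ Q.oneMap (F.F₀.map f) ≫ (d.u y).hom from
      d.map_pre _]
    exact (Iso.hom_inv_id_assoc _ _).symm
  mul s r := (d.m s r).hom
  dom_mul := d.dom_m
  cod_mul := d.cod_m
  mul_nat ψ φ h := by
    rw [show F.map₁ (d.str.hcomp ψ φ h) = _ from d.map_hcomp ψ φ h]
    exact (Iso.hom_inv_id_assoc _ _).symm
  left {x y} r := by
    have i : F.map₁ (d.lam r).hom ≫ F.map₁ (d.lam r).inv = 𝟙 _ := by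
      rw [← F.map₁_comp, Iso.hom_inv_id, F.map₁_id]
    have e : Q.wR (d.u y).hom (F.obj₁ r) (by simp) ≫ (d.m (d.one y) r).hom ≫
        F.map₁ (d.lam r).hom = (Q.lam (F.obj₁ r)).hom := by
      rw [d.map_lam, Iso.hom_inv_id_assoc,
        reassoc_of% Q.wR_hom_inv (d.u y) (by simp) (by simp) (F.obj₁ r)]
    rw [← e, Category.assoc, Category.assoc]
    exact congrArg (fun t => _ ≫ t) ((Category.comp_id _).symm.trans (congrArg (_ ≫ ·) i.symm))
  right {x y} r := by
    have i : F.map₁ (d.rho r).hom ≫ F.map₁ (d.rho r).inv = 𝟙 _ := by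
      rw [← F.map₁_comp, Iso.hom_inv_id, F.map₁_id]
    have e : Q.wL (F.obj₁ r) (d.u x).hom (by simp) ≫ (d.m r (d.one x)).hom ≫
        F.map₁ (d.rho r).hom = (Q.rho (F.obj₁ r)).hom := by
      rw [d.map_rho, Iso.hom_inv_id_assoc,
        reassoc_of% Q.wL_hom_inv (F.obj₁ r) (d.u x) (by simp) (by simp)]
    rw [← e, Category.assoc, Category.assoc]
    exact congrArg (fun t => _ ≫ t) ((Category.comp_id _).symm.trans (congrArg (_ ≫ ·) i.symm))
  assoc t s r := by
    refine (congrArg (fun c => _ ≫ _ ≫ c) (d.map_alpha t s r)).trans ?_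
    refine (congrArg (_ ≫ ·) (Iso.hom_inv_id_assoc _ _)).trans ?_
    exact (Category.assoc _ _ _).symm.trans ((congrArg (· ≫ _) (Q.wR_hom_inv (d.m t s) (by simp)
      (by simp) (F.obj₁ r))).trans (Category.id_comp _))

end TransportData

end transport

section strictification

variable {D : Grph.{u, v}}

namespace LaxAlg

/-- The structure map of an algebra for `𝔉`. -/
abbrev act (A : LaxAlg freeMonad D) : freeGraph D ⟶ D := A.a

/-- The unit 2-cell of an algebra for `𝔉`. -/
abbrev actUnit (A : LaxAlg freeMonad D) : 𝟙 D ⟶ freeUnit D ≫ A.act := A.η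

/-- The multiplication 2-cell of an algebra for `𝔉`. -/
abbrev actMul (A : LaxAlg freeMonad D) : freeMap A.act ≫ A.act ⟶ freeMul D ≫ A.act := A.μ

variable (A : LaxAlg freeMonad D)

/-- The unit at a 0-cell. -/
abbrev eta₀ (x : D.Ob) : x ⟶ A.act.F₀.obj x := GraphCell.app₀ A.actUnit x

/-- The unit at a horizontal 1-cell. -/
abbrev eta {x y : D.Ob} (r : D.Hor x y) :
    HObj.mk r ⟶ HObj.mk (A.act.obj₁ (Str.nil.snoc r)) := GraphCell.app₁ A.actUnit ⟨r⟩

/-- The multiplication at a 0-cell. -/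
abbrev mu₀ (x : D.Ob) : A.act.F₀.obj (A.act.F₀.obj x) ⟶ A.act.F₀.obj x :=
  GraphCell.app₀ A.actMul x

/-- The multiplication at a string of strings. -/
abbrev mu₁ {x y : D.Ob} (S : Str (freeGraph D).Hor x y) :
    HObj.mk (A.act.obj₁ (GraphHom.mapStr A.act S)) ⟶ HObj.mk (A.act.obj₁ S.join) :=
  GraphCell.app₁ A.actMul ⟨S⟩

/-- The 2-cell between the values of the structure map at equal strings. -/
abbrev actEq {x y : D.Ob} {p q : Str D.Hor x y} (h : p = q) :
    HObj.mk (A.act.obj₁ p) ⟶ HObj.mk (A.act.obj₁ q) := eqCell (congrArg A.act.obj₁ h)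

/-- The structure map on strings of 2-cells. -/
abbrev actMap {x y x' y' : D.Ob} {p : Str D.Hor x y} {q : Str D.Hor x' y'} (c : (strCell D p q).T) :
    HObj.mk (A.act.obj₁ p) ⟶ HObj.mk (A.act.obj₁ q) :=
  A.act.map₁ (r := ⟨p⟩) (s := ⟨q⟩) c

theorem eta₀_mu₀ (x : D.Ob) : A.eta₀ (A.act.F₀.obj x) ≫ A.mu₀ x = 𝟙 _ := by
  have e : ∀ x : (freeMonad.T.obj D).Ob, A.eta₀ (A.act.F₀.obj x) ≫ 𝟙 _ ≫ A.mu₀ x = 𝟙 _ := by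
    intro x
    have e := congrArg (fun θ => GraphCell.app₀ θ x) A.left_unit
    simp only [comp_app₀, eqToHom_app₀] at e
    exact e
  simpa using e x

theorem map_eta₀_mu₀ (x : D.Ob) : A.act.F₀.map (A.eta₀ x) ≫ A.mu₀ x = 𝟙 _ := by
  have e : ∀ x : (freeMonad.T.obj D).Ob,
      A.act.F₀.map (A.eta₀ x) ≫ 𝟙 _ ≫ A.mu₀ x = 𝟙 _ := by
    intro x
    have e := congrArg (fun θ => GraphCell.app₀ θ x) A.right_unit
    simp only [comp_app₀, eqToHom_app₀] at e
    exact e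
  simpa using e x

theorem eta_mu₁ {x y : D.Ob} (p : Str D.Hor x y) :
    A.eta (A.act.obj₁ p) ≫ A.mu₁ (Str.nil.snoc p) = A.actEq (nil_append p).symm := by
  have e := congrArg (fun θ => GraphCell.app₁ θ ⟨p⟩) A.left_unit
  simp only [comp_app₁, eqToHom_app₁] at e
  exact (congrArg (fun t => A.eta (A.act.obj₁ p) ≫ t) (Category.id_comp _)).symm.trans e

theorem mu₁_assoc {x y : D.Ob} (S : Str (freeGraph (freeGraph D)).Hor x y) :
    A.mu₁ (GraphHom.mapStr (freeMap A.act) S) ≫ A.actEq (join_mapStr A.act S) ≫ A.mu₁ S.join =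
    A.actEq (mapStr_comp (freeMap A.act) A.act S).symm ≫
      A.actMap (GraphCell.strApp A.actMul S).1 ≫
      A.actEq (mapStr_comp (freeMul D) A.act S) ≫
      A.mu₁ (GraphHom.mapStr (freeMul D) S) ≫ A.actEq (join_join S) := by
  have e := congrArg (fun θ => GraphCell.app₁ θ ⟨S⟩) A.assoc
  simp only [comp_app₁, eqToHom_app₁] at e
  exact e

theorem mu₁_nat {x y x' y' : D.Ob} {S : Str (freeGraph D).Hor x y}
    {S' : Str (freeGraph D).Hor x' y'} (c : (strCell (freeGraph D) S S').T) :
    A.actMap (GraphHom.mapCell A.act c).1 ≫ A.mu₁ S' = A.mu₁ S ≫ A.actMap (strJoin c).1 :=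
  GraphCell.nat₁ A.actMul (r := ⟨S⟩) (s := ⟨S'⟩) c

theorem eta_nat {x y x' y' : D.Ob} {r : D.Hor x y} {s : D.Hor x' y'}
    (φ : HObj.mk r ⟶ HObj.mk s) : φ ≫ A.eta s = A.eta r ≫ A.act.map₁ ((freeUnit D).map₁ φ) :=
  GraphCell.nat₁ A.actUnit φ

theorem eta₀_nat {x y : D.Ob} (f : x ⟶ y) :
    f ≫ A.eta₀ y = A.eta₀ x ≫ A.act.F₀.map f := GraphCell.nat₀ A.actUnit f

variable [IsIso A.actUnit] [IsIso A.actMul]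

omit [IsIso A.actUnit] in
theorem map_eta₀ (x : D.Ob) : A.act.F₀.map (A.eta₀ x) = A.eta₀ (A.act.F₀.obj x) := by
  rw [← cancel_mono (A.mu₀ x)]
  exact (A.map_eta₀_mu₀ x).trans (A.eta₀_mu₀ x).symm

theorem map_conj_eta₀ {x y : D.Ob} (f : A.act.F₀.obj x ⟶ A.act.F₀.obj y) :
    A.act.F₀.map (A.eta₀ x ≫ f ≫ inv (A.eta₀ y)) = f := by
  have e : A.act.F₀.map (A.eta₀ x ≫ f ≫ inv (A.eta₀ y)) ≫ A.act.F₀.map (A.eta₀ y) =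
      A.act.F₀.map (A.eta₀ x) ≫ A.act.F₀.map f := by
    rw [← Functor.map_comp, ← Functor.map_comp]
    simp
  rw [A.map_eta₀, A.map_eta₀, ← A.eta₀_nat] at e
  exact (cancel_mono (A.eta₀ (A.act.F₀.obj y))).1 e

/-- The graph of strings for an algebra `A`: its 2-cells between strings are the 2-cells between
their values under the structure map. -/
noncomputable def strGraph : Grph.{u, v} where
  Ob := D.Ob
  Hor := Str D.Hor
  cat₁ :=
    { Hom := fun p q => HObj.mk (A.act.obj₁ p.hom) ⟶ HObj.mk (A.act.obj₁ q.hom)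
      id := fun p => 𝟙 (HObj.mk (A.act.obj₁ p.hom))
      comp := fun φ ψ => CategoryStruct.comp (obj := D.One) φ ψ
      id_comp := fun φ => Category.id_comp (obj := D.One) φ
      comp_id := fun φ => Category.comp_id (obj := D.One) φ
      assoc := fun φ ψ χ => Category.assoc (obj := D.One) φ ψ χ }
  dom {p q} φ := A.eta₀ p.src ≫ D.dom φ ≫ inv (A.eta₀ q.src)
  cod {p q} φ := A.eta₀ p.tgt ≫ D.cod φ ≫ inv (A.eta₀ q.tgt)
  dom_id p := (congrArg (fun t => A.eta₀ p.src ≫ t ≫ inv (A.eta₀ p.src))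
    (D.dom_id ⟨A.act.obj₁ p.hom⟩)).trans (by simp)
  cod_id p := (congrArg (fun t => A.eta₀ p.tgt ≫ t ≫ inv (A.eta₀ p.tgt))
    (D.cod_id ⟨A.act.obj₁ p.hom⟩)).trans (by simp)
  dom_comp {p q t} φ ψ := (congrArg (fun f => A.eta₀ p.src ≫ f ≫ inv (A.eta₀ t.src))
    (D.dom_comp φ ψ)).trans (by simp)
  cod_comp {p q t} φ ψ := (congrArg (fun f => A.eta₀ p.tgt ≫ f ≫ inv (A.eta₀ t.tgt))
    (D.cod_comp φ ψ)).trans (by simp)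

end LaxAlg

end strictification

section strictification

variable {D : Grph.{u, v}}

namespace LaxAlg

variable (A : LaxAlg freeMonad D) [IsIso A.actUnit] [IsIso A.actMul]

/-- The evaluation of strings, as a morphism of graphs. -/
noncomputable abbrev strEval : A.strGraph ⟶ D where
  F₀ := { obj := fun x => A.act.F₀.obj x, map := fun {x y} f => A.act.F₀.map (X := x) (Y := y) f
          map_id := fun x => A.act.F₀.map_id x
          map_comp := fun {x y z} f g => A.act.F₀.map_comp (X := x) (Y := y) (Z := z) f g }
  obj₁ p := A.act.obj₁ p
  map₁ φ := φ
  map₁_id _ := rfl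
  map₁_comp _ _ := rfl
  dom_map₁ _ := (A.map_conj_eta₀ _).symm
  cod_map₁ _ := (A.map_conj_eta₀ _).symm

/-- The inclusion of strings of length one, as a morphism of graphs. -/
noncomputable abbrev strIncl : D ⟶ A.strGraph where
  F₀ := { obj := fun x => x, map := fun f => f }
  obj₁ r := Str.nil.snoc r
  map₁ φ := A.act.map₁ ((freeUnit D).map₁ φ)
  map₁_id r := (congrArg A.act.map₁ ((freeUnit D).map₁_id r)).trans (A.act.map₁_id _)
  map₁_comp φ ψ := (congrArg A.act.map₁ ((freeUnit D).map₁_comp φ ψ)).trans (A.act.map₁_comp _ _)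
  dom_map₁ {r s} φ := by
    have e : A.eta₀ r.src ≫ D.dom (A.act.map₁ ((freeUnit D).map₁ φ)) ≫ inv (A.eta₀ s.src) =
        D.dom φ := by
      rw [A.act.dom_map₁, ← Category.assoc, IsIso.comp_inv_eq]
      exact (A.eta₀_nat (D.dom φ)).symm
    exact e
  cod_map₁ {r s} φ := by
    have e : A.eta₀ r.tgt ≫ D.cod (A.act.map₁ ((freeUnit D).map₁ φ)) ≫ inv (A.eta₀ s.tgt) =
        D.cod φ := by
      rw [A.act.cod_map₁, ← Category.assoc, IsIso.comp_inv_eq]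
      exact (A.eta₀_nat (D.cod φ)).symm
    exact e

theorem mapStr_strEval {x : D.Ob} : ∀ {y : D.Ob} (S : Str (freeGraph D).Hor x y),
    (GraphHom.mapStr A.strEval (show Str A.strGraph.Hor x y from S) : Str D.Hor _ _) =
      GraphHom.mapStr A.act S
  | _, .nil => rfl
  | _, .snoc S q => congrArg (fun T => Str.snoc T (A.act.obj₁ q)) (mapStr_strEval S)

omit [IsIso A.actMul] in
theorem eqCell_strGraph {x y : D.Ob} {p q : Str D.Hor x y} (h : p = q) :
    eqCell (D := A.strGraph) h = A.actEq h := by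
  subst h; rfl

end LaxAlg

namespace LaxAlg

variable (A : LaxAlg freeMonad D)

/-- The structure map on a pair of 2-cells. -/
abbrev pairMap {x y z x' y' z' : D.Ob} {r : D.Hor x y} {s : D.Hor y z} {r' : D.Hor x' y'}
    {s' : D.Hor y' z'} (φ : HObj.mk r ⟶ HObj.mk r') (ψ : HObj.mk s ⟶ HObj.mk s')
    (h : D.cod φ = D.dom ψ) :
    HObj.mk (A.act.obj₁ ((Str.nil.snoc r).snoc s)) ⟶
      HObj.mk (A.act.obj₁ ((Str.nil.snoc r').snoc s')) :=
  A.actMap (p := (Str.nil.snoc r).snoc s) (q := (Str.nil.snoc r').snoc s')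
    ⟨(⟨(D.dom φ, φ), rfl⟩, ψ), h⟩

theorem actMap_comp {x y x' y' x'' y'' : D.Ob} {p : Str D.Hor x y} {q : Str D.Hor x' y'}
    {t : Str D.Hor x'' y''} (c : (strCell D p q).T) (d : (strCell D q t).T) :
    A.actMap (strComp c d).1 = A.actMap c ≫ A.actMap d :=
  A.act.map₁_comp (r := ⟨p⟩) (s := ⟨q⟩) (t := ⟨t⟩) c d

theorem dom_actMap {x y x' y' : D.Ob} {p : Str D.Hor x y} {q : Str D.Hor x' y'}
    (c : (strCell D p q).T) : D.dom (A.actMap c) = A.act.F₀.map ((strCell D p q).dom c) :=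
  A.act.dom_map₁ (r := ⟨p⟩) (s := ⟨q⟩) c

theorem cod_actMap {x y x' y' : D.Ob} {p : Str D.Hor x y} {q : Str D.Hor x' y'}
    (c : (strCell D p q).T) : D.cod (A.actMap c) = A.act.F₀.map ((strCell D p q).cod c) :=
  A.act.cod_map₁ (r := ⟨p⟩) (s := ⟨q⟩) c

theorem actMap_heq {x y x' y' : D.Ob} {p p₁ : Str D.Hor x y} {q q₁ : Str D.Hor x' y'}
    (hp : p = p₁) (hq : q = q₁) {c : (strCell D p q).T} {c₁ : (strCell D p₁ q₁).T} (hc : c ≍ c₁) :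
    A.actMap c ≫ A.actEq hq = A.actEq hp ≫ A.actMap c₁ := by
  subst hp hq
  cases hc
  exact (Category.comp_id _).trans (Category.id_comp _).symm

theorem pairMap_congr {x y z x' y' z' : D.Ob} {r : D.Hor x y} {s : D.Hor y z} {r' : D.Hor x' y'}
    {s' : D.Hor y' z'} {φ φ' : HObj.mk r ⟶ HObj.mk r'} {ψ ψ' : HObj.mk s ⟶ HObj.mk s'}
    (e : φ = φ') (e' : ψ = ψ') (h : D.cod φ = D.dom ψ) (h' : D.cod φ' = D.dom ψ') :
    A.pairMap φ ψ h = A.pairMap φ' ψ' h' := by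
  subst e e'; rfl

theorem pairMap_comp {x y z x' y' z' x'' y'' z'' : D.Ob} {r : D.Hor x y} {s : D.Hor y z}
    {r' : D.Hor x' y'} {s' : D.Hor y' z'} {r'' : D.Hor x'' y''} {s'' : D.Hor y'' z''}
    (φ : HObj.mk r ⟶ HObj.mk r') (ψ : HObj.mk s ⟶ HObj.mk s') (h : D.cod φ = D.dom ψ)
    (φ' : HObj.mk r' ⟶ HObj.mk r'') (ψ' : HObj.mk s' ⟶ HObj.mk s'') (h' : D.cod φ' = D.dom ψ') :
    A.pairMap φ ψ h ≫ A.pairMap φ' ψ' h' = A.pairMap (φ ≫ φ') (ψ ≫ ψ') (by simp [h, h']) := by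
  rw [← A.actMap_comp]
  exact congrArg (fun c => A.actMap c)
    (Subtype.ext (Prod.ext (Subtype.ext (Prod.ext (D.dom_comp φ φ').symm rfl)) rfl))

theorem pairMap_eqCell {x y z : D.Ob} {r r' : D.Hor x y} {s s' : D.Hor y z} (hr : r = r')
    (hs : s = s') : A.pairMap (eqCell hr) (eqCell hs) (by simp) =
      A.actEq (by rw [hr, hs]) := by
  subst hr hs
  refine Eq.trans ?_ (A.act.map₁_id ⟨(Str.nil.snoc r).snoc s⟩)
  exact congrArg (fun c => A.actMap (p := (Str.nil.snoc r).snoc s) c)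
    (Subtype.ext (Prod.ext (Subtype.ext (Prod.ext (D.dom_id ⟨r⟩) rfl)) rfl))

theorem dom_pairMap {x y z x' y' z' : D.Ob} {r : D.Hor x y} {s : D.Hor y z} {r' : D.Hor x' y'}
    {s' : D.Hor y' z'} (φ : HObj.mk r ⟶ HObj.mk r') (ψ : HObj.mk s ⟶ HObj.mk s')
    (h : D.cod φ = D.dom ψ) : D.dom (A.pairMap φ ψ h) = A.act.F₀.map (D.dom φ) :=
  A.act.dom_map₁ _

theorem cod_pairMap {x y z x' y' z' : D.Ob} {r : D.Hor x y} {s : D.Hor y z} {r' : D.Hor x' y'}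
    {s' : D.Hor y' z'} (φ : HObj.mk r ⟶ HObj.mk r') (ψ : HObj.mk s ⟶ HObj.mk s')
    (h : D.cod φ = D.dom ψ) : D.cod (A.pairMap φ ψ h) = A.act.F₀.map (D.cod ψ) :=
  A.act.cod_map₁ _

/-- The multiplication at a pair of strings. -/
def mu₂ {x y z : D.Ob} (p : Str D.Hor x y) (q : Str D.Hor y z) :
    HObj.mk (A.act.obj₁ ((Str.nil.snoc (A.act.obj₁ p)).snoc (A.act.obj₁ q))) ⟶
      HObj.mk (A.act.obj₁ (p.append q)) :=
  A.mu₁ ((Str.nil.snoc p).snoc q) ≫ A.actEq (congrArg (fun t => Str.append t q) (nil_append p))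

theorem dom_mu₂ {x y z : D.Ob} (p : Str D.Hor x y) (q : Str D.Hor y z) :
    D.dom (A.mu₂ p q) = A.mu₀ x := by
  rw [mu₂, D.dom_comp, dom_eqCell]
  exact (Category.comp_id _).trans (GraphCell.dom_app A.actMul ⟨(Str.nil.snoc p).snoc q⟩)

theorem cod_mu₂ {x y z : D.Ob} (p : Str D.Hor x y) (q : Str D.Hor y z) :
    D.cod (A.mu₂ p q) = A.mu₀ z := by
  rw [mu₂, D.cod_comp, cod_eqCell]
  exact (Category.comp_id _).trans (GraphCell.cod_app A.actMul ⟨(Str.nil.snoc p).snoc q⟩)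

instance isIso_mu₂ [IsIso A.actMul] {x y z : D.Ob} (p : Str D.Hor x y) (q : Str D.Hor y z) :
    IsIso (A.mu₂ p q) := by
  have : IsIso (A.mu₁ ((Str.nil.snoc p).snoc q)) := GraphCell.isIso_app₁ _ _
  rw [mu₂]
  infer_instance

theorem mu₂_nat {x y z x' y' z' : D.Ob} {p : Str D.Hor x y} {q : Str D.Hor y z}
    {p' : Str D.Hor x' y'} {q' : Str D.Hor y' z'} (c : (strCell D p p').T) (d : (strCell D q q').T)
    (h : (strCell D p p').cod c = (strCell D q q').dom d)
    (h' : D.cod (A.actMap c) = D.dom (A.actMap d)) :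
    A.pairMap (A.actMap c) (A.actMap d) h' ≫ A.mu₂ p' q' =
      A.mu₂ p q ≫ A.actMap (strAppend c d h).1 := by
  have e := A.mu₁_nat (S := (Str.nil.snoc p).snoc q) (S' := (Str.nil.snoc p').snoc q')
    ⟨(⟨((strCell D p p').dom c, c), rfl⟩, d), h⟩
  have hc : (strAppend (p := Str.nil) (p' := Str.nil) (show (strCell D (Str.nil (x := x))
    (Str.nil (x := x'))).T from (strCell D p p').dom c) c rfl).1 ≍ c := strAppend_nil _ c rfl
  have hd : (strAppend (strAppend (p := Str.nil) (p' := Str.nil) (show (strCell D (Str.nil (x := x))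
    (Str.nil (x := x'))).T from (strCell D p p').dom c) c rfl).1 d
      ((strAppend _ c rfl).2.2.trans h)).1 ≍ (strAppend c d h).1 :=
    heq_append (nil_append p) (nil_append p') rfl rfl hc HEq.rfl _ _
  have e₁ := A.actMap_heq (congrArg (fun t => Str.append t q) (nil_append p))
    (congrArg (fun t => Str.append t q') (nil_append p')) hd
  have e₂ : A.actMap (GraphHom.mapCell A.act (p := (Str.nil.snoc p).snoc q)
      (q := (Str.nil.snoc p').snoc q') (⟨(⟨((strCell D p p').dom c, c), rfl⟩, d), h⟩ :
      (strCell (freeGraph D) ((Str.nil.snoc p).snoc q) ((Str.nil.snoc p').snoc q')).T)).1 =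
      A.pairMap (A.actMap c) (A.actMap d) h' :=
    congrArg (fun c => A.actMap (p := (Str.nil.snoc (A.act.obj₁ p)).snoc (A.act.obj₁ q))
      (q := (Str.nil.snoc (A.act.obj₁ p')).snoc (A.act.obj₁ q')) c)
      (Subtype.ext (Prod.ext (Subtype.ext (Prod.ext (A.act.dom_map₁ (r := ⟨p⟩) (s := ⟨p'⟩) c).symm rfl)) rfl))
  rw [e₂] at e
  rw [mu₂, mu₂, reassoc_of% e, Category.assoc]
  exact congrArg (_ ≫ ·) e₁

theorem mu₂_assoc {x y z : D.Ob} (T : Str (freeGraph D).Hor x y) (U : Str (freeGraph D).Hor y z)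
    (h : D.cod (A.mu₁ T) = D.dom (A.mu₁ U)) :
    A.mu₂ (GraphHom.mapStr A.act T) (GraphHom.mapStr A.act U) ≫
        A.actEq (mapStr_append A.act T U).symm ≫ A.mu₁ (T.append U) ≫
        A.actEq (join_append T U) =
      A.pairMap (A.mu₁ T) (A.mu₁ U) h ≫ A.mu₂ T.join U.join := by
  have e := A.mu₁_assoc ((Str.nil.snoc T).snoc U)
  have e₁ : A.actMap (GraphCell.strApp A.actMul ((Str.nil.snoc T).snoc U)).1 =
      A.pairMap (A.mu₁ T) (A.mu₁ U) h :=
    congrArg (fun c => A.actMap (p := (Str.nil.snoc (A.act.obj₁ (GraphHom.mapStr A.act T))).snoc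
        (A.act.obj₁ (GraphHom.mapStr A.act U)))
      (q := (Str.nil.snoc (A.act.obj₁ T.join)).snoc (A.act.obj₁ U.join)) c)
      (Subtype.ext (Prod.ext (Subtype.ext (Prod.ext
        (GraphCell.dom_app A.actMul ⟨T⟩).symm rfl)) rfl))
  have e₂ : ∀ {S S' : Str (freeGraph D).Hor x z} (hS : S = S'), A.mu₁ S ≫
    A.actEq (congrArg Str.join hS) = A.actEq (congrArg (GraphHom.mapStr A.act) hS) ≫ A.mu₁ S' := by
    intro S S' hS
    subst hS
    exact (Category.comp_id _).trans (Category.id_comp _).symm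
  have e₃ := e₂ (congrArg (fun t => Str.append t U) (nil_append T))
  rw [e₁] at e
  have e₄ : A.actEq (join_mapStr A.act ((Str.nil.snoc T).snoc U)) ≫ A.actEq (congrArg
      (GraphHom.mapStr A.act) (congrArg (fun t => Str.append t U) (nil_append T))) =
      A.actEq (congrArg (fun t => Str.append t (GraphHom.mapStr A.act U))
        (nil_append (GraphHom.mapStr A.act T))) ≫ A.actEq (mapStr_append A.act T U).symm := by
    rw [eqCell_trans, eqCell_trans]
  have e₅ := congrArg (fun t => t ≫ A.actEq (congrArg Str.join
    (congrArg (fun t => Str.append t U) (nil_append T))) ≫ A.actEq (join_append T U)) e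
  simp only [Category.assoc] at e₅
  rw [reassoc_of% e₃, reassoc_of% e₄] at e₅
  rw [mu₂, mu₂]
  simp only [Category.assoc]
  refine e₅.trans ?_
  simp only [eqCell_trans]
  exact (Category.id_comp _).trans (congrArg (_ ≫ ·) (Category.id_comp _))

end LaxAlg

end strictification

section strictification

variable {D : Grph.{u, v}}

theorem eqCell_comm_symm {D : CatGraph.{u₀, v₀, u₁, v₁}} {x y x' y' : D.Ob} {r s : D.Hor x y}
    {r' s' : D.Hor x' y'} (h : r = s) (h' : r' = s') {φ : HObj.mk r ⟶ HObj.mk r'}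
    {ψ : HObj.mk s ⟶ HObj.mk s'} (e : φ ≫ eqCell h' = eqCell h ≫ ψ) :
    ψ ≫ eqCell h'.symm = eqCell h.symm ≫ φ := by
  subst h h'
  simpa using e.symm

theorem pasting_of_square {C : Type u₀} [Category.{v₀} C] {P P' Q Q' M M' N N' K K' J J' : C}
    {s : P ⟶ Q} {s' : P' ⟶ Q'} {a : P ⟶ P'} {b : Q ⟶ Q'} (e₁ : s ≫ b = a ≫ s')
    {m : Q ⟶ M} {m' : Q' ⟶ M'} {χ : M ⟶ M'} (e₂ : m ≫ χ = b ≫ m')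
    {n : P ⟶ N} {n' : P' ⟶ N'} {c : N ⟶ N'} (e₃ : a ≫ n' = n ≫ c)
    {i : N ⟶ K} {i' : N' ⟶ K'} {g : K ⟶ J} {g' : K' ⟶ J'} {j : J ⟶ M} {j' : J' ⟶ M'}
    (e₄ : n ≫ i ≫ g ≫ j = s ≫ m) (e₄' : n' ≫ i' ≫ g' ≫ j' = s' ≫ m')
    {d : K ⟶ K'} (e₅ : c ≫ i' = i ≫ d) {ω : J ⟶ J'} (e₆ : g ≫ ω = d ≫ g')
    [IsIso n] [IsIso i] [IsIso g] : ω ≫ j' = j ≫ χ := by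
  rw [← cancel_epi g, ← cancel_epi i, ← cancel_epi n, reassoc_of% e₆, ← reassoc_of% e₅,
    ← reassoc_of% e₃, e₄', ← reassoc_of% e₁, ← e₂, reassoc_of% e₄]

namespace LaxAlg

variable (A : LaxAlg freeMonad D) [IsIso A.actUnit] [IsIso A.actMul]

/-- The multiplication at a string of horizontal 1-cells of the graph of strings. -/
noncomputable def strMu {x y : D.Ob} (S : Str A.strGraph.Hor x y) :
    HObj.mk (A.act.obj₁ (GraphHom.mapStr A.strEval S)) ⟶
      HObj.mk (A.act.obj₁ (Str.join (H := D.Hor) S)) :=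
  A.actEq (A.mapStr_strEval S) ≫ A.mu₁ S

instance isIso_strMu {x y : D.Ob} (S : Str A.strGraph.Hor x y) : IsIso (A.strMu S) := by
  have : IsIso (A.mu₁ S) := GraphCell.isIso_app₁ _ _
  rw [strMu]
  infer_instance

theorem dom_strMu {x y : D.Ob} (S : Str A.strGraph.Hor x y) : D.dom (A.strMu S) = A.mu₀ x := by
  rw [strMu, D.dom_comp, dom_eqCell]
  exact (Category.id_comp _).trans (GraphCell.dom_app A.actMul ⟨S⟩)

theorem cod_strMu {x y : D.Ob} (S : Str A.strGraph.Hor x y) : D.cod (A.strMu S) = A.mu₀ y := by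
  rw [strMu, D.cod_comp, cod_eqCell]
  exact (Category.id_comp _).trans (GraphCell.cod_app A.actMul ⟨S⟩)

theorem mu₂_strMu {x y z : D.Ob} (T : Str A.strGraph.Hor x y) (U : Str A.strGraph.Hor y z) :
    A.mu₂ (GraphHom.mapStr A.strEval T) (GraphHom.mapStr A.strEval U) ≫
        A.actEq (mapStr_append A.strEval T U).symm ≫ A.strMu (T.append U) ≫
        A.actEq (join_append (A := D) T U) =
      A.pairMap (A.strMu T) (A.strMu U) ((A.cod_strMu T).trans (A.dom_strMu U).symm) ≫
        A.mu₂ (Str.join (H := D.Hor) T) (Str.join (H := D.Hor) U) := by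
  have h : D.cod (A.mu₁ T) = D.dom (A.mu₁ U) :=
    (GraphCell.cod_app A.actMul ⟨T⟩).trans (GraphCell.dom_app A.actMul ⟨U⟩).symm
  have e := A.mu₂_assoc T U h
  have e₁ := A.pairMap_comp (A.actEq (A.mapStr_strEval T)) (A.actEq (A.mapStr_strEval U)) (by simp)
    (A.mu₁ T) (A.mu₁ U) h
  have e₂ : ∀ {x y z : D.Ob} {p p' : Str D.Hor x y} {q q' : Str D.Hor y z} (hp : p = p')
      (hq : q = q'), A.pairMap (A.actEq hp) (A.actEq hq) (by simp) ≫ A.mu₂ p' q' =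
        A.mu₂ p q ≫ A.actEq (by rw [hp, hq]) := by
    intro x y z p p' q q' hp hq
    subst hp hq
    refine (congrArg (· ≫ _) (A.pairMap_eqCell rfl rfl)).trans ?_
    exact (Category.id_comp _).trans (Category.comp_id _).symm
  refine Eq.trans ?_ (congrArg (· ≫ _) e₁)
  rw [Category.assoc, ← e, reassoc_of% e₂, strMu]
  simp only [Category.assoc, eqCell_trans_assoc]
  rfl

/-- The composite of a string of 2-cells of the graph of strings. -/
noncomputable def strMap {x y x' y' : D.Ob} {S : Str A.strGraph.Hor x y}
    {S' : Str A.strGraph.Hor x' y'} (c : (strCell A.strGraph S S').T) :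
    (HObj.mk (Str.join (H := D.Hor) S) : A.strGraph.One) ⟶ HObj.mk (Str.join (H := D.Hor) S') :=
  CategoryStruct.comp (obj := D.One) (inv (A.strMu S))
    (A.actMap (GraphHom.mapCell A.strEval c).1 ≫ A.strMu S')

theorem strMu_strMap {x y x' y' : D.Ob} {S : Str A.strGraph.Hor x y}
    {S' : Str A.strGraph.Hor x' y'} (c : (strCell A.strGraph S S').T) :
    CategoryStruct.comp (obj := D.One) (A.strMu S) (A.strMap c) =
    A.actMap (GraphHom.mapCell A.strEval c).1 ≫ A.strMu S' :=
  IsIso.hom_inv_id_assoc (A.strMu S) _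

/-- Horizontal composition of 2-cells of the graph of strings. -/
noncomputable def strHcomp {x y z x' y' z' : D.Ob} {q : Str D.Hor y z} {p : Str D.Hor x y}
    {q' : Str D.Hor y' z'} {p' : Str D.Hor x' y'}
    (ψ : (HObj.mk q : A.strGraph.One) ⟶ HObj.mk q') (φ : (HObj.mk p : A.strGraph.One) ⟶ HObj.mk p')
    (h : A.strGraph.dom ψ = A.strGraph.cod φ) :
    (HObj.mk (p.append q) : A.strGraph.One) ⟶ HObj.mk (p'.append q') :=
  CategoryStruct.comp (obj := D.One) (inv (A.mu₂ p q))
    (A.pairMap (r := A.act.obj₁ p) (s := A.act.obj₁ q) (r' := A.act.obj₁ p') (s' := A.act.obj₁ q')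
      φ ψ (((A.strEval.cod_map₁ φ).trans (congrArg (fun f => A.act.F₀.map f) h.symm)).trans
        (A.strEval.dom_map₁ ψ).symm) ≫ A.mu₂ p' q')

theorem mu₂_strHcomp {x y z x' y' z' : D.Ob} {q : Str D.Hor y z} {p : Str D.Hor x y}
    {q' : Str D.Hor y' z'} {p' : Str D.Hor x' y'}
    (ψ : (HObj.mk q : A.strGraph.One) ⟶ HObj.mk q') (φ : (HObj.mk p : A.strGraph.One) ⟶ HObj.mk p')
    (h : A.strGraph.dom ψ = A.strGraph.cod φ) :
    CategoryStruct.comp (obj := D.One) (A.mu₂ p q) (A.strHcomp ψ φ h) =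
    A.pairMap (r := A.act.obj₁ p) (s := A.act.obj₁ q) (r' := A.act.obj₁ p') (s' := A.act.obj₁ q')
      φ ψ (((A.strEval.cod_map₁ φ).trans (congrArg (fun f => A.act.F₀.map f) h.symm)).trans
        (A.strEval.dom_map₁ ψ).symm) ≫ A.mu₂ p' q' :=
  IsIso.hom_inv_id_assoc (A.mu₂ p q) _

theorem strHcomp_strMap {x y z x' y' z' : D.Ob} {T : Str A.strGraph.Hor x y}
    {U : Str A.strGraph.Hor y z} {T' : Str A.strGraph.Hor x' y'} {U' : Str A.strGraph.Hor y' z'}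
    (c : (strCell A.strGraph T T').T) (d : (strCell A.strGraph U U').T)
    (h : (strCell A.strGraph T T').cod c = (strCell A.strGraph U U').dom d)
    (h' : A.strGraph.dom (A.strMap d) = A.strGraph.cod (A.strMap c)) :
    A.strHcomp (A.strMap d) (A.strMap c) h' ≫ eqCell (D := A.strGraph) (join_append (A := D) T' U').symm =
      eqCell (D := A.strGraph) (join_append (A := D) T U).symm ≫ A.strMap (strAppend c d h).1 := by
  have key : ∀ (φ : HObj.mk (A.act.obj₁ (Str.join (H := D.Hor) T)) ⟶
        HObj.mk (A.act.obj₁ (Str.join (H := D.Hor) T')))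
      (ψ : HObj.mk (A.act.obj₁ (Str.join (H := D.Hor) U)) ⟶
        HObj.mk (A.act.obj₁ (Str.join (H := D.Hor) U')))
      (χ : HObj.mk (A.act.obj₁ ((Str.join (H := D.Hor) T).append (Str.join (H := D.Hor) U))) ⟶
        HObj.mk (A.act.obj₁ ((Str.join (H := D.Hor) T').append (Str.join (H := D.Hor) U'))))
      (ω : HObj.mk (A.act.obj₁ (Str.join (H := D.Hor) (Str.append T U))) ⟶
        HObj.mk (A.act.obj₁ (Str.join (H := D.Hor) (Str.append T' U'))))
      (k : D.cod φ = D.dom ψ)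
      (eφ : A.strMu T ≫ φ = A.actMap (GraphHom.mapCell A.strEval c).1 ≫ A.strMu T')
      (eψ : A.strMu U ≫ ψ = A.actMap (GraphHom.mapCell A.strEval d).1 ≫ A.strMu U')
      (eχ : A.mu₂ _ _ ≫ χ = A.pairMap φ ψ k ≫ A.mu₂ _ _)
      (eω : A.strMu (Str.append T U) ≫ ω =
        A.actMap (GraphHom.mapCell A.strEval (strAppend c d h).1).1 ≫ A.strMu (Str.append T' U')),
      χ ≫ A.actEq (join_append (A := D) T' U').symm = A.actEq (join_append (A := D) T U).symm ≫ ω := by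
    intro φ ψ χ ω k eφ eψ eχ eω
    have k₁ : D.cod (A.strMu T) = D.dom (A.strMu U) := (A.cod_strMu T).trans (A.dom_strMu U).symm
    have k₁' : D.cod (A.strMu T') = D.dom (A.strMu U') :=
      (A.cod_strMu T').trans (A.dom_strMu U').symm
    have k₂ : (strCell D (GraphHom.mapStr A.strEval T) (GraphHom.mapStr A.strEval T')).cod
        (GraphHom.mapCell A.strEval c).1 =
        (strCell D (GraphHom.mapStr A.strEval U) (GraphHom.mapStr A.strEval U')).dom
        (GraphHom.mapCell A.strEval d).1 :=
      (GraphHom.mapCell A.strEval c).2.2.trans ((congrArg (fun f => A.strEval.F₀.map f) h).trans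
        (GraphHom.mapCell A.strEval d).2.1.symm)
    have k₃ : D.cod (A.actMap (GraphHom.mapCell A.strEval c).1) =
        D.dom (A.actMap (GraphHom.mapCell A.strEval d).1) :=
      (A.cod_actMap _).trans ((congrArg (fun f => A.act.F₀.map f) k₂).trans
        (A.dom_actMap _).symm)
    have e₁ := A.mu₂_strMu T U
    have e₁' := A.mu₂_strMu T' U'
    have e₂ := A.mu₂_nat _ _ k₂ k₃
    have e₃ := A.actMap_heq (mapStr_append A.strEval T U) (mapStr_append A.strEval T' U')
      (mapCell_append A.strEval c d h k₂)
    have e₃' : A.actMap (strAppend (GraphHom.mapCell A.strEval c).1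
          (GraphHom.mapCell A.strEval d).1 k₂).1 ≫ A.actEq (mapStr_append A.strEval T' U').symm =
        A.actEq (mapStr_append A.strEval T U).symm ≫
          A.actMap (GraphHom.mapCell A.strEval (strAppend c d h).1).1 :=
      eqCell_comm_symm _ _ e₃
    have e₄ := A.pairMap_comp (A.strMu T) (A.strMu U) k₁ φ ψ k
    have e₅ := A.pairMap_comp _ _ k₃ (A.strMu T') (A.strMu U') k₁'
    have e₆ := A.pairMap_congr eφ eψ (by simp [k, k₁]) (by simp [k₃, k₁'])
    have i : IsIso (A.strMu T) := A.isIso_strMu T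
    exact eqCell_comm_symm _ _ (pasting_of_square (e₄.trans (e₆.trans e₅.symm)) eχ e₂ e₁ e₁' e₃' eω)
  rw [eqCell_strGraph, eqCell_strGraph]
  exact key (A.strMap c) (A.strMap d) (A.strHcomp (A.strMap d) (A.strMap c) h')
    (A.strMap (strAppend c d h).1) _ (A.strMu_strMap c) (A.strMu_strMap d)
    (A.mu₂_strHcomp _ _ h') (A.strMu_strMap _)

end LaxAlg

end strictification

section strictification

variable {D : Grph.{u, v}}

theorem eqCell_pentagon {D : CatGraph.{u₀, v₀, u₁, v₁}} {x y : D.Ob} {a b c d e : D.Hor x y}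
    (h₁ : a = b) (h₂ : b = c) (h₃ : a = d) (h₄ : d = e) (h₅ : e = c) :
    eqCell h₁ ≫ eqCell h₂ = eqCell h₃ ≫ eqCell h₄ ≫ eqCell h₅ := by
  rw [eqCell_trans, eqCell_trans, eqCell_trans]

namespace LaxAlg

variable (A : LaxAlg freeMonad D) [IsIso A.actUnit] [IsIso A.actMul]

omit [IsIso A.actUnit] [IsIso A.actMul] in
theorem eq_of_mu₀_conj {x x' : D.Ob} {f g : A.act.F₀.obj x ⟶ A.act.F₀.obj x'}
    (h : A.mu₀ x ≫ g = A.act.F₀.map f ≫ A.mu₀ x') : g = f := by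
  have e := A.eta₀_nat f
  have e₁ := congrArg (· ≫ A.mu₀ x') e
  simp only [Category.assoc] at e₁
  rw [A.eta₀_mu₀, ← h, ← Category.assoc, A.eta₀_mu₀, Category.id_comp, Category.comp_id] at e₁
  exact e₁.symm

omit [IsIso A.actMul] in
theorem eta₀_conj {x x' : D.Ob} (f : x ⟶ x') {g : A.act.F₀.obj x ⟶ A.act.F₀.obj x'}
    (h : g = A.act.F₀.map f) : A.eta₀ x ≫ g ≫ inv (A.eta₀ x') = f := by
  rw [h, ← Category.assoc, IsIso.comp_inv_eq]
  exact (A.eta₀_nat f).symm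

theorem dom_strMap {x y x' y' : D.Ob} {S : Str A.strGraph.Hor x y}
    {S' : Str A.strGraph.Hor x' y'} (c : (strCell A.strGraph S S').T) :
    A.strGraph.dom (A.strMap c) = (strCell A.strGraph S S').dom c := by
  have key : ∀ χ : HObj.mk (A.act.obj₁ (Str.join (H := D.Hor) S)) ⟶
      HObj.mk (A.act.obj₁ (Str.join (H := D.Hor) S')),
      A.strMu S ≫ χ = A.actMap (GraphHom.mapCell A.strEval c).1 ≫ A.strMu S' →
      A.mu₀ x ≫ D.dom χ = D.dom (A.actMap (GraphHom.mapCell A.strEval c).1) ≫ A.mu₀ x' := by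
    intro χ e
    have e₁ := congrArg D.dom e
    rwa [D.dom_comp, D.dom_comp, dom_strMu, dom_strMu] at e₁
  refine A.eta₀_conj _ (A.eq_of_mu₀_conj ((key _ (A.strMu_strMap c)).trans ?_))
  exact congrArg (fun t => t ≫ A.mu₀ x') ((A.dom_actMap _).trans
    (congrArg (fun f => A.act.F₀.map f) (GraphHom.mapCell A.strEval c).2.1))

theorem cod_strMap {x y x' y' : D.Ob} {S : Str A.strGraph.Hor x y}
    {S' : Str A.strGraph.Hor x' y'} (c : (strCell A.strGraph S S').T) :
    A.strGraph.cod (A.strMap c) = (strCell A.strGraph S S').cod c := by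
  have key : ∀ χ : HObj.mk (A.act.obj₁ (Str.join (H := D.Hor) S)) ⟶
      HObj.mk (A.act.obj₁ (Str.join (H := D.Hor) S')),
      A.strMu S ≫ χ = A.actMap (GraphHom.mapCell A.strEval c).1 ≫ A.strMu S' →
      A.mu₀ y ≫ D.cod χ = D.cod (A.actMap (GraphHom.mapCell A.strEval c).1) ≫ A.mu₀ y' := by
    intro χ e
    have e₁ := congrArg D.cod e
    rwa [D.cod_comp, D.cod_comp, cod_strMu, cod_strMu] at e₁
  refine A.eta₀_conj _ (A.eq_of_mu₀_conj ((key _ (A.strMu_strMap c)).trans ?_))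
  exact congrArg (fun t => t ≫ A.mu₀ y') ((A.cod_actMap _).trans
    (congrArg (fun f => A.act.F₀.map f) (GraphHom.mapCell A.strEval c).2.2))

section

variable {x y z x' y' z' : D.Ob} {q : Str D.Hor y z} {p : Str D.Hor x y}
    {q' : Str D.Hor y' z'} {p' : Str D.Hor x' y'}
    (ψ : (HObj.mk q : A.strGraph.One) ⟶ HObj.mk q') (φ : (HObj.mk p : A.strGraph.One) ⟶ HObj.mk p')
    (h : A.strGraph.dom ψ = A.strGraph.cod φ)

include h in
theorem pairMap_eq_of_dom_eq : D.cod (r := ⟨A.act.obj₁ p⟩) (s := ⟨A.act.obj₁ p'⟩) φ =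
    D.dom (r := ⟨A.act.obj₁ q⟩) (s := ⟨A.act.obj₁ q'⟩) ψ :=
  ((A.strEval.cod_map₁ φ).trans (congrArg (fun f => A.act.F₀.map f) h.symm)).trans
    (A.strEval.dom_map₁ ψ).symm

theorem dom_strHcomp : A.strGraph.dom (A.strHcomp ψ φ h) = A.strGraph.dom φ := by
  have key : ∀ (φ' : HObj.mk (A.act.obj₁ p) ⟶ HObj.mk (A.act.obj₁ p'))
      (ψ' : HObj.mk (A.act.obj₁ q) ⟶ HObj.mk (A.act.obj₁ q')) (k : D.cod φ' = D.dom ψ')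
      (χ : HObj.mk (A.act.obj₁ (p.append q)) ⟶ HObj.mk (A.act.obj₁ (p'.append q'))),
      A.mu₂ p q ≫ χ = A.pairMap φ' ψ' k ≫ A.mu₂ p' q' →
      A.mu₀ x ≫ D.dom χ = A.act.F₀.map (D.dom φ') ≫ A.mu₀ x' := by
    intro φ' ψ' k χ e
    have e₁ := congrArg D.dom e
    rwa [D.dom_comp, D.dom_comp, dom_mu₂, dom_mu₂, dom_pairMap] at e₁
  have e := key φ ψ (A.pairMap_eq_of_dom_eq ψ φ h) _ (A.mu₂_strHcomp ψ φ h)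
  refine A.eta₀_conj (x := x) (x' := x') _ (A.eq_of_mu₀_conj (x := x) (x' := x') (e.trans ?_))
  exact congrArg (fun t => A.act.F₀.map t ≫ A.mu₀ x') (A.strEval.dom_map₁ φ)

theorem cod_strHcomp : A.strGraph.cod (A.strHcomp ψ φ h) = A.strGraph.cod ψ := by
  have key : ∀ (φ' : HObj.mk (A.act.obj₁ p) ⟶ HObj.mk (A.act.obj₁ p'))
      (ψ' : HObj.mk (A.act.obj₁ q) ⟶ HObj.mk (A.act.obj₁ q')) (k : D.cod φ' = D.dom ψ')
      (χ : HObj.mk (A.act.obj₁ (p.append q)) ⟶ HObj.mk (A.act.obj₁ (p'.append q'))),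
      A.mu₂ p q ≫ χ = A.pairMap φ' ψ' k ≫ A.mu₂ p' q' →
      A.mu₀ z ≫ D.cod χ = A.act.F₀.map (D.cod ψ') ≫ A.mu₀ z' := by
    intro φ' ψ' k χ e
    have e₁ := congrArg D.cod e
    rwa [D.cod_comp, D.cod_comp, cod_mu₂, cod_mu₂, cod_pairMap] at e₁
  have e := key φ ψ (A.pairMap_eq_of_dom_eq ψ φ h) _ (A.mu₂_strHcomp ψ φ h)
  refine A.eta₀_conj (x := z) (x' := z') _ (A.eq_of_mu₀_conj (x := z) (x' := z') (e.trans ?_))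
  exact congrArg (fun t => A.act.F₀.map t ≫ A.mu₀ z') (A.strEval.cod_map₁ ψ)

end

theorem strHcomp_id {x y z : D.Ob} (q : Str D.Hor y z) (p : Str D.Hor x y)
    (h : A.strGraph.dom (𝟙 (HObj.mk q : A.strGraph.One)) =
      A.strGraph.cod (𝟙 (HObj.mk p : A.strGraph.One))) :
    A.strHcomp (𝟙 (HObj.mk q : A.strGraph.One)) (𝟙 (HObj.mk p : A.strGraph.One)) h = 𝟙 _ := by
  have e := A.mu₂_strHcomp (𝟙 (HObj.mk q : A.strGraph.One)) (𝟙 (HObj.mk p : A.strGraph.One)) h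
  refine (cancel_epi (A.mu₂ p q)).1 (e.trans ?_)
  refine (congrArg (fun t => t ≫ A.mu₂ p q) (A.pairMap_eqCell (rfl : A.act.obj₁ p = _)
    (rfl : A.act.obj₁ q = _))).trans ?_
  exact (Category.id_comp _).trans (Category.comp_id _).symm

theorem strHcomp_comp {x y z x' y' z' x'' y'' z'' : D.Ob} {q : Str D.Hor y z} {p : Str D.Hor x y}
    {q' : Str D.Hor y' z'} {p' : Str D.Hor x' y'} {q'' : Str D.Hor y'' z''} {p'' : Str D.Hor x'' y''}
    (ψ : (HObj.mk q : A.strGraph.One) ⟶ HObj.mk q') (φ : (HObj.mk p : A.strGraph.One) ⟶ HObj.mk p')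
    (h : A.strGraph.dom ψ = A.strGraph.cod φ)
    (ψ' : (HObj.mk q' : A.strGraph.One) ⟶ HObj.mk q'')
    (φ' : (HObj.mk p' : A.strGraph.One) ⟶ HObj.mk p'')
    (h' : A.strGraph.dom ψ' = A.strGraph.cod φ') (h'' : A.strGraph.dom (ψ ≫ ψ') =
      A.strGraph.cod (φ ≫ φ')) :
    A.strHcomp (ψ ≫ ψ') (φ ≫ φ') h'' = A.strHcomp ψ φ h ≫ A.strHcomp ψ' φ' h' := by
  have key : ∀ (a : HObj.mk (A.act.obj₁ p) ⟶ HObj.mk (A.act.obj₁ p'))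
      (b : HObj.mk (A.act.obj₁ q) ⟶ HObj.mk (A.act.obj₁ q')) (k : D.cod a = D.dom b)
      (a' : HObj.mk (A.act.obj₁ p') ⟶ HObj.mk (A.act.obj₁ p''))
      (b' : HObj.mk (A.act.obj₁ q') ⟶ HObj.mk (A.act.obj₁ q'')) (k' : D.cod a' = D.dom b')
      (k'' : D.cod (a ≫ a') = D.dom (b ≫ b'))
      (χ : HObj.mk (A.act.obj₁ (p.append q)) ⟶ HObj.mk (A.act.obj₁ (p'.append q')))
      (χ' : HObj.mk (A.act.obj₁ (p'.append q')) ⟶ HObj.mk (A.act.obj₁ (p''.append q'')))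
      (χ'' : HObj.mk (A.act.obj₁ (p.append q)) ⟶ HObj.mk (A.act.obj₁ (p''.append q''))),
      A.mu₂ p q ≫ χ = A.pairMap a b k ≫ A.mu₂ p' q' →
      A.mu₂ p' q' ≫ χ' = A.pairMap a' b' k' ≫ A.mu₂ p'' q'' →
      A.mu₂ p q ≫ χ'' = A.pairMap (a ≫ a') (b ≫ b') k'' ≫ A.mu₂ p'' q'' → χ'' = χ ≫ χ' := by
    intro a b k a' b' k' k'' χ χ' χ'' e e' e''
    rw [← cancel_epi (A.mu₂ p q), e'', reassoc_of% e, e', ← A.pairMap_comp a b k a' b' k',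
      Category.assoc]
  exact key φ ψ (A.pairMap_eq_of_dom_eq ψ φ h) φ' ψ' (A.pairMap_eq_of_dom_eq ψ' φ' h')
    (A.pairMap_eq_of_dom_eq _ _ h'') _ _ _ (A.mu₂_strHcomp ψ φ h) (A.mu₂_strHcomp ψ' φ' h')
    (A.mu₂_strHcomp _ _ h'')

theorem strHcomp_eqCell {x y z : D.Ob} {q q' : Str D.Hor y z} {p p' : Str D.Hor x y} (hq : q = q')
    (hp : p = p') (h : A.strGraph.dom (eqCell (D := A.strGraph) hq) =
      A.strGraph.cod (eqCell (D := A.strGraph) hp)) :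
    A.strHcomp (eqCell (D := A.strGraph) hq) (eqCell (D := A.strGraph) hp) h =
      eqCell (D := A.strGraph) (congrArg₂ (fun a b => Str.append a b) hp hq) := by
  subst hq hp
  exact A.strHcomp_id _ _ h

theorem strMap_singleton {x y x' y' : D.Ob} {p : Str D.Hor x y} {q : Str D.Hor x' y'}
    (φ : (HObj.mk p : A.strGraph.One) ⟶ HObj.mk q) :
    A.strMap (S := Str.nil.snoc p) (S' := Str.nil.snoc q) ((freeUnit A.strGraph).map₁ φ) ≫
      eqCell (D := A.strGraph) (nil_append q) = eqCell (D := A.strGraph) (nil_append p) ≫ φ := by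
  have e₁ : ∀ {x y : D.Ob} (p : Str D.Hor x y),
      A.eta (A.act.obj₁ p) ≫ A.strMu (Str.nil.snoc p) = A.actEq (nil_append p).symm := by
    intro x y p
    refine Eq.trans ?_ (A.eta_mu₁ p)
    exact congrArg (_ ≫ ·) (Category.id_comp _)
  have e₂ := A.strMu_strMap (S := Str.nil.snoc p) (S' := Str.nil.snoc q)
    ((freeUnit A.strGraph).map₁ φ)
  have e₃ : A.actMap (GraphHom.mapCell A.strEval (p := Str.nil.snoc p) (q := Str.nil.snoc q)
      ((freeUnit A.strGraph).map₁ φ)).1 = A.act.map₁ ((freeUnit D).map₁ (r := ⟨A.act.obj₁ p⟩)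
        (s := ⟨A.act.obj₁ q⟩) φ) :=
    congrArg (fun c => A.actMap (p := Str.nil.snoc (A.act.obj₁ p)) (q := Str.nil.snoc (A.act.obj₁ q)) c)
      (Subtype.ext (Prod.ext (A.strEval.dom_map₁ φ).symm rfl))
  have e₄ := A.eta_nat (r := A.act.obj₁ p) (s := A.act.obj₁ q) φ
  have key : ∀ (ψ : HObj.mk (A.act.obj₁ p) ⟶ HObj.mk (A.act.obj₁ q))
      (χ : HObj.mk (A.act.obj₁ (Str.nil.append p)) ⟶ HObj.mk (A.act.obj₁ (Str.nil.append q))) c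
      (_ : A.strMu (Str.nil.snoc p) ≫ χ = c ≫ A.strMu (Str.nil.snoc q))
      (_ : ψ ≫ A.eta (A.act.obj₁ q) = A.eta (A.act.obj₁ p) ≫ c),
      χ ≫ A.actEq (nil_append q) = A.actEq (nil_append p) ≫ ψ := by
    intro ψ χ c h h'
    have e : ψ ≫ A.actEq (nil_append q).symm = A.actEq (nil_append p).symm ≫ χ := by
      rw [← e₁, ← e₁, reassoc_of% h', Category.assoc, h]
    exact (eqCell_comm_symm _ _ e)
  rw [eqCell_strGraph, eqCell_strGraph]
  exact key φ _ _ e₂ (e₄.trans (congrArg (_ ≫ ·) e₃.symm))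

theorem strMu_nil_cancel {x x' : D.Ob} {χ χ' : HObj.mk (A.act.obj₁ (Str.nil (x := x))) ⟶
      HObj.mk (A.act.obj₁ (Str.nil (x := x')))}
    {c : HObj.mk (A.act.obj₁ (Str.nil (x := A.act.F₀.obj x))) ⟶
      HObj.mk (A.act.obj₁ (Str.nil (x := A.act.F₀.obj x')))}
    (e : A.strMu (Str.nil (x := x)) ≫ χ = c ≫ A.strMu (Str.nil (x := x')))
    (e' : c ≫ A.mu₁ (Str.nil (x := x')) = A.mu₁ (Str.nil (x := x)) ≫ χ') : χ = χ' := by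
  have k : ∀ x : D.Ob, A.strMu (Str.nil (x := x)) = A.mu₁ (Str.nil (x := x)) := fun _ =>
    Category.id_comp _
  have i : IsIso (A.mu₁ (Str.nil (x := x))) := GraphCell.isIso_app₁ _ _
  rw [k, k, e'] at e
  exact (cancel_epi _).1 e

theorem strMap_nil {x x' : A.strGraph.Ob} (f : x ⟶ x') :
    A.strMap (S := Str.nil (x := x)) (S' := Str.nil (x := x')) f =
      A.actMap (p := Str.nil (x := x)) (q := Str.nil (x := x')) f :=
  A.strMu_nil_cancel (x := x) (x' := x')
    (A.strMu_strMap (S := Str.nil (x := x)) (S' := Str.nil (x := x')) f)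
    (A.mu₁_nat (S := Str.nil (x := x)) (S' := Str.nil (x := x')) f)

/-- A 2-cell between composites of strings of strings is computed by a string of 2-cells. -/
def IsComposite {x y x' y' : D.Ob} {p : Str D.Hor x y} {q : Str D.Hor x' y'}
    (φ : (HObj.mk p : A.strGraph.One) ⟶ HObj.mk q) {S : Str A.strGraph.Hor x y}
    {S' : Str A.strGraph.Hor x' y'} (hS : Str.join (H := D.Hor) S = p)
    (hS' : Str.join (H := D.Hor) S' = q) (c : (strCell A.strGraph S S').T) : Prop :=
  A.strMap c ≫ eqCell (D := A.strGraph) hS' = eqCell (D := A.strGraph) hS ≫ φ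

theorem IsComposite.eq_strMap {x y x' y' : D.Ob} {S : Str A.strGraph.Hor x y}
    {S' : Str A.strGraph.Hor x' y'}
    {φ : (HObj.mk (Str.join (H := D.Hor) S) : A.strGraph.One) ⟶ HObj.mk (Str.join (H := D.Hor) S')}
    {c : (strCell A.strGraph S S').T} (h : A.IsComposite φ rfl rfl c) : φ = A.strMap c :=
  (Category.id_comp _).symm.trans (h.symm.trans (Category.comp_id _))

theorem isComposite_nil {x x' : A.strGraph.Ob} (f : x ⟶ x') :
    A.IsComposite (A.actMap (p := Str.nil (x := x)) (q := Str.nil (x := x')) f)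
      (S := Str.nil (x := x)) (S' := Str.nil (x := x')) rfl rfl f :=
  (congrArg (fun t => t ≫ eqCell (D := A.strGraph) rfl) (A.strMap_nil (x := x) (x' := x') f)).trans
    ((Category.comp_id _).trans (Category.id_comp _).symm)

section

variable {x y x' y' : D.Ob} {p : Str D.Hor x y} {q : Str D.Hor x' y'}
    {φ : (HObj.mk p : A.strGraph.One) ⟶ HObj.mk q} {S : Str A.strGraph.Hor x y}
    {S' : Str A.strGraph.Hor x' y'} {hS : Str.join (H := D.Hor) S = p}
    {hS' : Str.join (H := D.Hor) S' = q} {c : (strCell A.strGraph S S').T}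

variable {A} in
theorem IsComposite.dom_eq (h : A.IsComposite φ hS hS' c) :
    (strCell A.strGraph S S').dom c = A.strGraph.dom φ := by
  subst hS hS'
  rw [IsComposite.eq_strMap A h]
  exact (A.dom_strMap c).symm

variable {A} in
theorem IsComposite.cod_eq (h : A.IsComposite φ hS hS' c) :
    (strCell A.strGraph S S').cod c = A.strGraph.cod φ := by
  subst hS hS'
  rw [IsComposite.eq_strMap A h]
  exact (A.cod_strMap c).symm

variable {A} in
theorem IsComposite.hcomp {z z' : D.Ob} {p₁ : Str D.Hor y z} {q₁ : Str D.Hor y' z'}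
    {ψ : (HObj.mk p₁ : A.strGraph.One) ⟶ HObj.mk q₁} {T : Str A.strGraph.Hor y z}
    {T' : Str A.strGraph.Hor y' z'} {hT : Str.join (H := D.Hor) T = p₁}
    {hT' : Str.join (H := D.Hor) T' = q₁} {d : (strCell A.strGraph T T').T}
    (h : A.IsComposite φ hS hS' c) (h' : A.IsComposite ψ hT hT' d)
    (k : A.strGraph.dom ψ = A.strGraph.cod φ)
    (k' : (strCell A.strGraph S S').cod c = (strCell A.strGraph T T').dom d) :
    A.IsComposite (A.strHcomp ψ φ k) ((join_append (A := D) S T).trans (congrArg₂ (fun a b => Str.append a b) hS hT))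
      ((join_append (A := D) S' T').trans (congrArg₂ (fun a b => Str.append a b) hS' hT'))
      (strAppend c d k').1 := by
  subst hS hS' hT hT'
  obtain rfl := IsComposite.eq_strMap A h
  obtain rfl := IsComposite.eq_strMap A h'
  have e := A.strHcomp_strMap c d k' k
  exact eqCell_comm_symm (D := A.strGraph) _ _ e

variable {A} in
theorem IsComposite.comm_of_heq {p₁ : Str D.Hor x y} {q₁ : Str D.Hor x' y'}
    {φ₁ : (HObj.mk p₁ : A.strGraph.One) ⟶ HObj.mk q₁} {S₁ : Str A.strGraph.Hor x y}
    {S₁' : Str A.strGraph.Hor x' y'} {hS₁ : Str.join (H := D.Hor) S₁ = p₁}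
    {hS₁' : Str.join (H := D.Hor) S₁' = q₁} {c₁ : (strCell A.strGraph S₁ S₁').T}
    (h : A.IsComposite φ hS hS' c) (h₁ : A.IsComposite φ₁ hS₁ hS₁' c₁) (e : S = S₁) (e' : S' = S₁')
    (hc : c ≍ c₁) (k : p = p₁) (k' : q = q₁) :
    φ ≫ eqCell (D := A.strGraph) k' = eqCell (D := A.strGraph) k ≫ φ₁ := by
  subst e e' hc hS hS' hS₁ hS₁'
  rw [IsComposite.eq_strMap A h, IsComposite.eq_strMap A h₁]
  exact (Category.comp_id _).trans (Category.id_comp _).symm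

end

theorem isComposite_singleton {x y x' y' : D.Ob} {p : Str D.Hor x y} {q : Str D.Hor x' y'}
    (φ : (HObj.mk p : A.strGraph.One) ⟶ HObj.mk q) :
    A.IsComposite φ (S := Str.nil.snoc p) (S' := Str.nil.snoc q) (nil_append p) (nil_append q)
      ((freeUnit A.strGraph).map₁ φ) :=
  A.strMap_singleton φ

omit [IsIso A.actMul] in
theorem dom_eqCell_strGraph {x y z : D.Ob} {q q' : Str D.Hor y z} {p p' : Str D.Hor x y}
    (hq : q = q') (hp : p = p') : A.strGraph.dom (eqCell (D := A.strGraph) hq) =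
      A.strGraph.cod (eqCell (D := A.strGraph) hp) :=
  (dom_eqCell (D := A.strGraph) hq).trans (cod_eqCell (D := A.strGraph) hp).symm

theorem strHcomp_triangle {x y z : D.Ob} (q : Str D.Hor y z) (p : Str D.Hor x y) (h h') :
    eqCell (D := A.strGraph) (append_assoc p Str.nil q).symm ≫
        A.strHcomp (eqCell (D := A.strGraph) (rfl : q = q)) (eqCell (D := A.strGraph) (rfl : p = p))
          h =
      A.strHcomp (eqCell (D := A.strGraph) (nil_append q)) (eqCell (D := A.strGraph) (rfl : p = p))
        h' :=
  (congrArg (fun c => eqCell (D := A.strGraph) (append_assoc p Str.nil q).symm ≫ c)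
    (A.strHcomp_eqCell (rfl : q = q) (rfl : p = p) h)).trans
    ((eqCell_trans (D := A.strGraph) _ _).trans
      (A.strHcomp_eqCell (nil_append q) (rfl : p = p) h').symm)

theorem strHcomp_pentagon {v w x y z : D.Ob} (t : Str D.Hor y z) (s : Str D.Hor x y)
    (r : Str D.Hor w x) (q : Str D.Hor v w) (h h') :
    eqCell (D := A.strGraph) (append_assoc q r (s.append t)).symm ≫
        eqCell (D := A.strGraph) (append_assoc (q.append r) s t).symm =
      A.strHcomp (eqCell (D := A.strGraph) (append_assoc r s t).symm)
          (eqCell (D := A.strGraph) (rfl : q = q)) h ≫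
        eqCell (D := A.strGraph) (append_assoc q (r.append s) t).symm ≫
          A.strHcomp (eqCell (D := A.strGraph) (rfl : t = t))
            (eqCell (D := A.strGraph) (append_assoc q r s).symm) h' := by
  refine (eqCell_pentagon (D := A.strGraph) _ _ _ _ _).trans (congrArg₂ (fun a b => a ≫
    eqCell (D := A.strGraph) (append_assoc q (r.append s) t).symm ≫ b)
    (A.strHcomp_eqCell (append_assoc r s t).symm (rfl : q = q) h).symm
    (A.strHcomp_eqCell (rfl : t = t) (append_assoc q r s).symm h').symm)

/-- The pseudodouble category of strings for a pseudo-algebra. -/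
noncomputable def strDbl : PseudoDblStr A.strGraph where
  one x := Str.nil
  oneMap {x y} f := A.actMap (p := Str.nil (x := x)) (q := Str.nil (x := y)) f
  dom_oneMap {x y} f := A.eta₀_conj (x := x) (x' := y) f
    (A.dom_actMap (p := Str.nil (x := x)) (q := Str.nil (x := y)) f)
  cod_oneMap {x y} f := A.eta₀_conj (x := x) (x' := y) f
    (A.cod_actMap (p := Str.nil (x := x)) (q := Str.nil (x := y)) f)
  oneMap_id x := A.act.map₁_id ⟨Str.nil (x := x)⟩
  oneMap_comp {x y z} f g := A.actMap_comp (p := Str.nil (x := x)) (q := Str.nil (x := y))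
    (t := Str.nil (x := z)) f g
  comp q p := Str.append p q
  hcomp ψ φ h := A.strHcomp ψ φ h
  dom_hcomp ψ φ h := A.dom_strHcomp ψ φ h
  cod_hcomp ψ φ h := A.cod_strHcomp ψ φ h
  hcomp_id q p := A.strHcomp_id q p _
  hcomp_comp ψ φ h ψ' φ' h' := A.strHcomp_comp ψ φ h ψ' φ' h' _
  lam p := eqToIso (congrArg HObj.mk (rfl : p = p))
  dom_lam p := dom_eqCell (D := A.strGraph) (rfl : p = p)
  cod_lam p := cod_eqCell (D := A.strGraph) (rfl : p = p)
  lam_nat {x y x' y' p q} φ := by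
    have h := A.isComposite_singleton φ
    have h₁ := A.isComposite_nil (x := y) (x' := y') (A.strGraph.cod φ)
    have k := h.hcomp h₁ (A.eta₀_conj (A.strGraph.cod φ)
      (A.dom_actMap (p := Str.nil (x := y)) (q := Str.nil (x := y')) (A.strGraph.cod φ))) h.cod_eq
    exact k.comm_of_heq h rfl rfl HEq.rfl rfl rfl
  rho p := eqToIso (congrArg HObj.mk (nil_append p))
  dom_rho p := dom_eqCell (D := A.strGraph) (nil_append p)
  cod_rho p := cod_eqCell (D := A.strGraph) (nil_append p)
  rho_nat {x y x' y' p q} φ := by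
    have h := A.isComposite_singleton φ
    have h₁ := A.isComposite_nil (x := x) (x' := x') (A.strGraph.dom φ)
    have k := h₁.hcomp h (A.eta₀_conj (A.strGraph.dom φ)
      (A.cod_actMap (p := Str.nil (x := x)) (q := Str.nil (x := x')) (A.strGraph.dom φ))).symm
      h.dom_eq.symm
    exact k.comm_of_heq h rfl rfl (strAppend_nil _ _ h.dom_eq.symm) (nil_append p) (nil_append q)
  alpha t s r := eqToIso (congrArg HObj.mk (append_assoc r s t).symm)
  dom_alpha t s r := dom_eqCell (D := A.strGraph) (append_assoc r s t).symm
  cod_alpha t s r := cod_eqCell (D := A.strGraph) (append_assoc r s t).symm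
  alpha_nat {w x y z w' x' y' z' t s r t' s' r'} χ ψ φ h h' := by
    have a := A.isComposite_singleton φ
    have b := A.isComposite_singleton ψ
    have c := A.isComposite_singleton χ
    have bc := b.hcomp c h (b.cod_eq.trans (h.symm.trans c.dom_eq.symm))
    have ab := a.hcomp b h' (a.cod_eq.trans (h'.symm.trans b.dom_eq.symm))
    have k := ab.hcomp c (h.trans (A.cod_strHcomp _ _ _).symm)
      (ab.cod_eq.trans ((A.cod_strHcomp _ _ _).trans (h.symm.trans c.dom_eq.symm)))
    have k' := a.hcomp bc ((A.dom_strHcomp _ _ _).trans h')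
      (a.cod_eq.trans (h'.symm.trans ((A.dom_strHcomp _ _ _).symm.trans bc.dom_eq.symm)))
    exact k'.comm_of_heq k (append_assoc _ _ _).symm (append_assoc _ _ _).symm
      (strAppend_assoc _ _ _ _ _ _ _).symm (append_assoc r s t).symm (append_assoc r' s' t').symm
  unit_unit x := eqCell_trans (D := A.strGraph) (r := Str.nil (x := x)) (s := Str.nil)
    (t := Str.nil) rfl rfl
  left_left q p := (eqCell_trans (D := A.strGraph) (append_assoc p q Str.nil).symm rfl).trans
    (A.strHcomp_eqCell (rfl : q = q) (rfl : p = p) (A.dom_eqCell_strGraph _ _)).symm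
  right_right q p :=
    (congrArg (fun c => eqCell (D := A.strGraph) (append_assoc Str.nil p q).symm ≫ c)
      (A.strHcomp_eqCell (rfl : q = q) (nil_append p) (A.dom_eqCell_strGraph _ _))).trans
      (eqCell_trans (D := A.strGraph) _ _)
  triangle q p := A.strHcomp_triangle q p (A.dom_eqCell_strGraph _ _) (A.dom_eqCell_strGraph _ _)
  pentagon t s r q := A.strHcomp_pentagon t s r q (A.dom_eqCell_strGraph _ _)
    (A.dom_eqCell_strGraph _ _)

end LaxAlg

end strictification

section comparison

open Bicategory

variable {B : Type u} [Bicategory.{w, v} B] [Bicategory.Strict B] {M : TwoMonad B}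

attribute [local simp] Strict.associator_eqToIso Strict.leftUnitor_eqToIso
  Strict.rightUnitor_eqToIso StrictPseudofunctor.mapComp_eq_eqToIso
  PrelaxFunctor.map₂_eqToHom

/-- A 2-cell between the structure maps of two algebras on the same object which is compatible with
the units and multiplications. -/
structure AlgComp {X : B} (A A' : LaxAlg M X) where
  j : A.a ⟶ A'.a
  unit : A.η ≫ M.e X ◁ j = A'.η
  mul : A.μ ≫ M.m X ◁ j = M.T.map₂ j ▷ A.a ≫ M.T.map A'.a ◁ j ≫ A'.μ

namespace AlgComp

variable {X : B} {A A' : LaxAlg M X}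

/-- The inverse of an invertible comparison. -/
noncomputable def symm (c : AlgComp A A') [IsIso c.j] : AlgComp A' A where
  j := inv c.j
  unit := by
    rw [← c.unit, Category.assoc, ← whiskerLeft_comp]
    simp
  mul := by
    have e := whisker_exchange (M.T.map₂ (inv c.j)) (inv c.j)
    have e' : M.m X ◁ c.j ≫ M.m X ◁ inv c.j = 𝟙 _ := by rw [← whiskerLeft_comp]; simp
    have h := congrArg (fun t => M.T.map A'.a ◁ inv c.j ≫ M.T.map₂ (inv c.j) ▷ A.a ≫ t ≫
      M.m X ◁ inv c.j) c.mul
    have e₁ : M.T.map₂ (inv c.j) ▷ A.a ≫ M.T.map₂ c.j ▷ A.a = 𝟙 _ := by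
      rw [← comp_whiskerRight, ← PrelaxFunctor.map₂_comp]; simp
    have e₂ : M.T.map A'.a ◁ inv c.j ≫ M.T.map A'.a ◁ c.j = 𝟙 _ := by
      rw [← whiskerLeft_comp]; simp
    simp only [Category.assoc] at h
    rw [e', Category.comp_id, reassoc_of% e₁, reassoc_of% e₂] at h
    rw [← h, reassoc_of% e]

/-- The lax morphism over the identity given by a comparison. -/
def laxMor (c : AlgComp A' A) : LaxMor A A' (𝟙 X) where
  φ := eqToHom (by rw [M.T.map_id, Strict.id_comp]) ≫ c.j ≫ eqToHom (Strict.comp_id _).symm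
  unit := by
    have e := c.unit
    simp
    rw [← e]
    simp
  mul := by
    have e := c.mul
    have e₁ := whiskerLeft_congr_left (show M.T.map (M.T.map (𝟙 X)) = 𝟙 _ by simp [M.T.map_id]) A'.μ
    simp at e e₁ ⊢
    rw [e₁]
    simp [reassoc_of% e]

/-- The oplax morphism over the identity given by a comparison. -/
def oplaxMor (c : AlgComp A A') : OplaxMor A A' (𝟙 X) where
  ζ := eqToHom (Strict.comp_id _) ≫ c.j ≫ eqToHom (by rw [M.T.map_id, Strict.id_comp])
  unit := by
    have e := c.unit
    simp
    rw [← e]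
    simp
  mul := by
    have e := c.mul
    have e₁ := whiskerLeft_congr_left (show M.T.map (M.T.map (𝟙 X)) = 𝟙 _ by simp [M.T.map_id]) A'.μ
    have e₂ := whisker_exchange (M.T.map₂ c.j) c.j
    simp at e e₁ ⊢
    rw [e₁]
    simp
    rw [reassoc_of% e, ← reassoc_of% e₂]

/-- The comparison given by a lax morphism over the identity. -/
def ofLaxMor (f : LaxMor A A' (𝟙 X)) : AlgComp A' A where
  j := eqToHom (by rw [M.T.map_id, Strict.id_comp]) ≫ f.φ ≫ eqToHom (Strict.comp_id _)
  unit := by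
    have e := f.unit
    simp at e ⊢
    rw [eqToHom_comp_iff] at e
    simp [reassoc_of% e]
  mul := by
    have e := f.mul
    have e₁ := whiskerLeft_congr_left (show M.T.map (M.T.map (𝟙 X)) = 𝟙 _ by simp [M.T.map_id]) A'.μ
    simp at e e₁ ⊢
    rw [e₁] at e
    simp at e
    rw [eqToHom_comp_iff] at e
    simp [reassoc_of% e]

section inverse

variable (c : AlgComp A A') (c' : AlgComp A' A)

theorem laxMor_comp_φ (h : c.j ≫ c'.j = 𝟙 _) : (c'.laxMor.comp c.laxMor).φ =
    eqToHom (by rw [Strict.id_comp]) ≫ (LaxMor.id A).φ ≫ eqToHom (by rw [Strict.id_comp]) := by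
  have e := whiskerLeft_congr_left (M.T.map_id X) c.j
  simp [LaxMor.comp, LaxMor.id, laxMor]
  rw [e]
  simp [reassoc_of% h]

theorem oplaxMor_comp_ζ (h : c.j ≫ c'.j = 𝟙 _) : (c.oplaxMor.comp c'.oplaxMor).ζ =
    eqToHom (by rw [Strict.id_comp]) ≫ (OplaxMor.id A).ζ ≫ eqToHom (by rw [Strict.id_comp]) := by
  have e := whiskerLeft_congr_left (M.T.map_id X) c'.j
  simp [OplaxMor.comp, OplaxMor.id, oplaxMor]
  rw [e]
  simp [reassoc_of% h]

theorem isAlgCell_laxMor_oplaxMor (h : c'.j ≫ c.j = 𝟙 _) :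
    IsAlgCell c'.laxMor c.oplaxMor (OplaxMor.id A') (LaxMor.id A') (𝟙 _) := by
  simp [IsAlgCell, LaxMor.id, laxMor, OplaxMor.id, oplaxMor, reassoc_of% h]

theorem isAlgCell_laxMor_oplaxMor' :
    IsAlgCell c.laxMor (OplaxMor.id A') c.oplaxMor (LaxMor.id A') (𝟙 _) := by
  simp [IsAlgCell, LaxMor.id, laxMor, OplaxMor.id, oplaxMor]
  rw [whiskerLeft_congr_left (M.T.map_id X) c.j]
  simp

theorem isAlgCell_oplaxMor_laxMor :
    IsAlgCell (LaxMor.id A') c'.oplaxMor (OplaxMor.id A') c'.laxMor (𝟙 _) := by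
  simp [IsAlgCell, LaxMor.id, laxMor, OplaxMor.id, oplaxMor]
  rw [whiskerLeft_congr_left (M.T.map_id X) c'.j]
  simp

theorem isAlgCell_oplaxMor_laxMor' (h : c'.j ≫ c.j = 𝟙 _) :
    IsAlgCell (LaxMor.id A') (OplaxMor.id A') c'.oplaxMor c.laxMor (𝟙 _) := by
  simp [IsAlgCell, LaxMor.id, laxMor, OplaxMor.id, oplaxMor]
  rw [whiskerLeft_congr_left (M.T.map_id X) c.j, whiskerLeft_congr_left (M.T.map_id X) c'.j]
  simp [reassoc_of% h]

end inverse

end AlgComp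

/-- Transport of a lax morphism along an isomorphism of the underlying 1-cells. -/
def LaxMor.ofIso {X Y : B} {A : LaxAlg M X} {A' : LaxAlg M Y} {f g : X ⟶ Y} (k : LaxMor A A' g)
    (θ : f ≅ g) : LaxMor A A' f where
  φ := M.T.map₂ θ.hom ▷ A'.a ≫ k.φ ≫ A.a ◁ θ.inv
  unit := by
    have e := k.unit
    have e₁ := congrArg (· ▷ A'.a) (M.e_nat₂ θ.hom)
    have e₂ := whisker_exchange θ.hom A'.η
    have e₃ := whisker_exchange A.η θ.inv
    simp at e e₁ e₂ e₃ ⊢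
    rw [comp_eqToHom_iff] at e₁
    rw [e₁] at e₂
    simp at e₂
    simp only [← Category.assoc] at e₂ e₃
    rw [comp_eqToHom_iff] at e₂
    rw [eq_comm, comp_eqToHom_iff] at e₃
    simp at e₂ e₃
    rw [reassoc_of% e₂, reassoc_of% e, e₃]
    simp
  mul := by
    have e := k.mul
    have e₁ := congrArg (· ▷ A'.a) (M.m_nat₂ θ.hom)
    have e₂ := whisker_exchange (M.T.map₂ (M.T.map₂ θ.hom)) A'.μ
    have e₃ := whisker_exchange A.μ θ.inv
    have e₄ : M.T.map A.a ◁ M.T.map₂ θ.inv ▷ A'.a ≫ M.T.map A.a ◁ M.T.map₂ θ.hom ▷ A'.a = 𝟙 _ := by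
      rw [← whiskerLeft_comp, ← comp_whiskerRight, ← PrelaxFunctor.map₂_comp]
      simp
    simp at e e₁ e₂ e₃ ⊢
    rw [comp_eqToHom_iff] at e₁
    rw [e₁] at e₂
    simp at e₂
    simp only [← Category.assoc] at e₂ e₃
    rw [comp_eqToHom_iff] at e₂
    rw [eq_comm, comp_eqToHom_iff] at e₃
    simp at e₂ e₃
    rw [reassoc_of% e₂, reassoc_of% e, e₃, reassoc_of% e₄]
    simp

end comparison

/-- Algebras on the same graph with an invertible comparison between them are isomorphic over the
identity. -/
noncomputable def AlgComp.isoOver {M : TwoMonad Grph.{u, v}} {p : ∀ A : Grph.{u, v}, (psAlg M).Ob A → Prop}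
    {D : Grph.{u, v}} {X Y : ((psAlg M).full p).Ob D} (c : AlgComp X.1.1 Y.1.1) [IsIso c.j] :
    DispDbl.IsoOver (𝒴 := (psAlg M).full p) X Y :=
  have e : c.j ≫ c.symm.j = 𝟙 _ := IsIso.hom_inv_id c.j
  have e' : c.symm.j ≫ c.j = 𝟙 _ := IsIso.inv_hom_id c.j
  { h := c.symm.laxMor
    h' := c.laxMor
    h_h' := LaxMor.ext ((AlgComp.laxMor_comp_φ c c.symm e).trans
      ((Category.id_comp _).trans (Category.comp_id _)))
    h'_h := LaxMor.ext ((AlgComp.laxMor_comp_φ c.symm c e').trans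
      ((Category.id_comp _).trans (Category.comp_id _)))
    v := c.oplaxMor
    v' := c.symm.oplaxMor
    v_v' := OplaxMor.ext ((AlgComp.oplaxMor_comp_ζ c c.symm e).trans
      ((Category.id_comp _).trans (Category.comp_id _)))
    v'_v := OplaxMor.ext ((AlgComp.oplaxMor_comp_ζ c.symm c e').trans
      ((Category.id_comp _).trans (Category.comp_id _)))
    cell_h_v := AlgComp.isAlgCell_laxMor_oplaxMor c c.symm e'
    cell_h'_v := AlgComp.isAlgCell_laxMor_oplaxMor' c
    cell_v'_h := AlgComp.isAlgCell_oplaxMor_laxMor c.symm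
    cell_v'_h' := AlgComp.isAlgCell_oplaxMor_laxMor' c c.symm e' }

section equivalence

open Bicategory

variable {B : Type u} [Bicategory.{w, v} B] [Bicategory.Strict B] {M : TwoMonad B}

attribute [local simp] Strict.associator_eqToIso Strict.leftUnitor_eqToIso
  Strict.rightUnitor_eqToIso StrictPseudofunctor.mapComp_eq_eqToIso
  PrelaxFunctor.map₂_eqToHom

variable {X Y : B} {A : LaxAlg M X} {A' : LaxAlg M Y} {F : X ⟶ Y} {K : Y ⟶ X}

/-- A lax morphism along `F ≫ K` lifts along a pseudomorphism on `K`, if whiskering with `K` is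
bijective on 2-cells. -/
def LaxMor.lift (k : LaxMor A' A K) [IsIso k.φ]
    (hK : ∀ {Z : B} {U V : Z ⟶ Y} {α β : U ⟶ V}, α ▷ K = β ▷ K → α = β)
    (g : LaxMor A A (F ≫ K)) (φ : M.T.map F ≫ A'.a ⟶ A.a ≫ F)
    (hφ : M.T.map F ◁ k.φ ≫ eqToHom (Strict.assoc _ _ _).symm ≫ φ ▷ K =
      eqToHom (M.map_comp_assoc _ _ _).symm ≫ g.φ ≫ eqToHom (Strict.assoc _ _ _).symm) :
    LaxMor A A' F where
  φ := φ
  unit := by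
    apply hK
    have e := congrArg (F ◁ ·) k.unit
    have e₁ := g.unit
    have e₂ := congrArg (M.e X ◁ ·) hφ
    have e₃ := whiskerLeft_congr_left (M.e_nat F).symm k.φ
    simp at e e₁ e₂ e₃ ⊢
    rw [eq_comm, eqToHom_comp_iff, comp_eqToHom_iff] at e
    rw [eq_comm, eqToHom_comp_iff, comp_eqToHom_iff] at e₃
    rw [eqToHom_comp_iff] at e₁
    rw [e, e₃]
    simp
    rw [reassoc_of% e₂]
    simp
    rw [reassoc_of% e₁]
    simp
  mul := by
    apply hK
    have e := congrArg (M.T.map (M.T.map F) ◁ ·) k.mul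
    have e₁ := g.mul
    have e₂ := congrArg (M.m X ◁ ·) hφ
    have e₃ := whiskerLeft_congr_left (M.m_nat F).symm k.φ
    have e₄ := whisker_exchange (M.T.map₂ φ) k.φ
    have e₅ := congrArg (fun t => M.T.map₂ t ▷ A.a) hφ
    have e₆ := congrArg (M.T.map A.a ◁ ·) hφ
    simp at e e₁ e₂ e₃ e₄ e₅ e₆ ⊢
    have e₇ := whiskerLeft_congr_left (M.T.map_comp (M.T.map F) A'.a).symm k.φ
    have e₈ := whiskerLeft_congr_left (M.T.map_comp A.a F).symm k.φ
    have e₉ := whiskerLeft_congr_left (show M.T.map (M.T.map (F ≫ K)) =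
      M.T.map (M.T.map F) ≫ M.T.map (M.T.map K) by simp [M.T.map_comp]) A.μ
    simp at e₇ e₈ e₉
    rw [eq_comm, eqToHom_comp_iff] at e
    rw [eqToHom_comp_iff] at e₅
    rw [eq_comm, eqToHom_comp_iff, comp_eqToHom_iff] at e₃ e₇ e₈
    rw [e₉] at e₁
    rw [e₇, e₈] at e₄
    simp at e₁ e₄
    rw [eqToHom_comp_iff] at e₁ e₄
    simp only [← Category.assoc] at e e₄ e₅
    rw [comp_eqToHom_iff] at e e₄ e₅
    simp at e e₄ e₅
    refine (cancel_epi (M.T.map (M.T.map F) ◁ M.T.map₂ k.φ ▷ A.a ≫ eqToHom (by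
      simp [M.T.map_comp]) ≫ M.T.map (M.T.map F) ◁ M.T.map A'.a ◁ k.φ ≫
      eqToHom (by simp))).1 ?_
    simp
    rw [reassoc_of% e, e₃]
    simp
    rw [reassoc_of% e₂]
    simp
    rw [reassoc_of% e₁, reassoc_of% e₄]
    simp
    rw [reassoc_of% e₅]
    simp
    rw [reassoc_of% e₆]
    simp

theorem LaxMor.lift_comp (k : LaxMor A' A K) [IsIso k.φ]
    (hK : ∀ {Z : B} {U V : Z ⟶ Y} {α β : U ⟶ V}, α ▷ K = β ▷ K → α = β)
    (g : LaxMor A A (F ≫ K)) (φ : M.T.map F ≫ A'.a ⟶ A.a ≫ F)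
    (hφ : M.T.map F ◁ k.φ ≫ eqToHom (Strict.assoc _ _ _).symm ≫ φ ▷ K =
      eqToHom (M.map_comp_assoc _ _ _).symm ≫ g.φ ≫ eqToHom (Strict.assoc _ _ _).symm) :
    (k.lift hK g φ hφ).comp k = g := by
  ext
  simp [LaxMor.comp, LaxMor.lift]
  rw [reassoc_of% hφ]
  simp

/-- The identity morphism transported along an isomorphism of the underlying 1-cells. -/
theorem LaxMor.isAlgCell_ofIso {G : X ⟶ X} (θ : 𝟙 X ≅ G) :
    IsAlgCell (LaxMor.id A) (OplaxMor.id A) (OplaxMor.id A) ((LaxMor.id A).ofIso θ.symm)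
      (eqToHom (by simp) ≫ θ.hom ≫ eqToHom (by simp)) := by
  simp [IsAlgCell, LaxMor.id, OplaxMor.id, LaxMor.ofIso]
  rw [whiskerLeft_congr_left (M.T.map_id X) (M.T.map₂ θ.inv ▷ A.a),
    whiskerLeft_congr_left (M.T.map_id X) (A.a ◁ θ.hom)]
  have e : M.T.map₂ θ.hom ▷ A.a ≫ M.T.map₂ θ.inv ▷ A.a = 𝟙 _ := by
    rw [← comp_whiskerRight, ← PrelaxFunctor.map₂_comp]
    simp
  simp [reassoc_of% e]

theorem LaxMor.isAlgCell_of_comp (k : LaxMor A' A K) [IsIso k.φ]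
    (hK : ∀ {Z : B} {U V : Z ⟶ Y} {α β : U ⟶ V}, α ▷ K = β ▷ K → α = β) (θ : 𝟙 X ≅ F ≫ K)
    (f : LaxMor A A' F) (hf : f.comp k = (LaxMor.id A).ofIso θ.symm) (κ : K ≫ F ⟶ 𝟙 Y)
    (hκ : κ ▷ K = eqToHom (Strict.assoc _ _ _) ≫ K ◁ θ.inv ≫ eqToHom (by simp)) :
    IsAlgCell (k.comp f) (OplaxMor.id A') (OplaxMor.id A') (LaxMor.id A')
      (eqToHom (by simp) ≫ κ ≫ eqToHom (by simp)) := by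
  have e := congrArg (fun t => M.T.map K ◁ LaxMor.φ t) hf
  have e₁ := whisker_exchange k.φ θ.hom
  have e₂ := congrArg (A'.a ◁ ·) hκ
  have e₃ := whisker_exchange (M.T.map₂ κ) k.φ
  have e₄ := congrArg (fun t => M.T.map₂ t ▷ A.a) hκ
  have e₅ := whiskerLeft_congr_left (M.T.map_comp K F) k.φ
  have e₆ := whiskerLeft_congr_left (M.T.map_id Y) k.φ
  have e₇ : A'.a ◁ K ◁ θ.hom ≫ A'.a ◁ K ◁ θ.inv = 𝟙 _ := by
    rw [← whiskerLeft_comp, ← whiskerLeft_comp]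
    simp
  apply hK
  refine (cancel_epi (M.T.map K ◁ M.T.map F ◁ k.φ ≫ eqToHom (by simp [M.T.map_comp]))).1 ?_
  simp [LaxMor.id, OplaxMor.id, LaxMor.ofIso, LaxMor.comp] at e e₁ e₂ e₃ e₄ e₅ e₆ ⊢
  rw [eqToHom_comp_iff, comp_eqToHom_iff] at e₄
  rw [e₄, e₅, e₆] at e₃
  simp at e₃
  rw [eqToHom_comp_iff] at e e₁ e₃
  simp only [← Category.assoc] at e e₁ e₃
  rw [comp_eqToHom_iff] at e e₁ e₃
  simp at e e₁ e₃
  rw [reassoc_of% e, e₂, reassoc_of% e₃]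
  simp
  rw [reassoc_of% e₁]
  simp [reassoc_of% e₇]

end equivalence

/-- An algebra is equivalent to one which carries a pseudomorphism to it, along a morphism of graphs
which is bijective on 2-cells and has a one-sided inverse. -/
theorem LaxMor.equivalent {M : TwoMonad Grph.{u, v}} {D E : Grph.{u, v}} {A : LaxAlg M D}
    {A' : LaxAlg M E} {F : D ⟶ E} {K : E ⟶ D} (k : LaxMor A' A K) [IsIso k.φ]
    (hK : ∀ {Z : Grph.{u, v}} (U V : Z ⟶ E),
      Function.Bijective (fun α : U ⟶ V => Bicategory.whiskerRight α K))
    (θ : 𝟙 D ≅ F ≫ K) : A.Equivalent A' := by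
  have hK' : ∀ {Z : Grph.{u, v}} {U V : Z ⟶ E} {α β : U ⟶ V}, Bicategory.whiskerRight α K =
    Bicategory.whiskerRight β K → α = β := fun h => (hK _ _).1 h
  have hiso : ∀ {Z : Grph.{u, v}} {U V : Z ⟶ E} (α : U ⟶ V),
      IsIso (Bicategory.whiskerRight α K) → IsIso α := by
    intro Z U V α h
    obtain ⟨β, hβ⟩ := (hK V U).2 (inv (Bicategory.whiskerRight α K))
    refine ⟨β, hK' ?_, hK' ?_⟩ <;>
    rw [Bicategory.comp_whiskerRight, Bicategory.id_whiskerRight]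
    · exact (congrArg (_ ≫ ·) hβ).trans (IsIso.hom_inv_id _)
    · exact (congrArg (· ≫ _) hβ).trans (IsIso.inv_hom_id _)
  let g : LaxMor A A (F ≫ K) := (LaxMor.id A).ofIso θ.symm
  have hg : IsIso g.φ := by
    change IsIso (_ ≫ (LaxMor.id A).φ ≫ _)
    rw [LaxMor.id_φ]
    infer_instance
  obtain ⟨φ, hφ⟩ := (hK (M.T.map F ≫ A'.a) (A.a ≫ F)).2
    (eqToHom (Bicategory.Strict.assoc _ _ _) ≫ inv (Bicategory.whiskerLeft (M.T.map F) k.φ) ≫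
    eqToHom (M.map_comp_assoc _ _ _).symm ≫ g.φ ≫ eqToHom (Bicategory.Strict.assoc _ _ _).symm)
  have hφ' : Bicategory.whiskerLeft (M.T.map F) k.φ ≫
      eqToHom (Bicategory.Strict.assoc _ _ _).symm ≫ Bicategory.whiskerRight φ K =
      eqToHom (M.map_comp_assoc _ _ _).symm ≫ g.φ ≫
        eqToHom (Bicategory.Strict.assoc _ _ _).symm := by
    simp only at hφ
    rw [hφ]
    simp
  obtain ⟨κ, hκ⟩ := (hK (K ≫ F) (𝟙 E)).2 (eqToHom (Bicategory.Strict.assoc _ _ _) ≫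
    Bicategory.whiskerLeft K θ.inv ≫ eqToHom (by simp))
  have i : IsIso κ := hiso κ (by simp only at hκ; rw [hκ]; infer_instance)
  refine ⟨F, K, k.lift hK' g φ hφ', k, hiso φ ?_, inferInstance, ⟨θ, ?_⟩, ⟨asIso κ, ?_⟩⟩
  · simp only at hφ
    rw [hφ]
    infer_instance
  · rw [k.lift_comp hK' g φ hφ']
    have e := LaxMor.isAlgCell_ofIso (A := A) θ
    have e' : eqToHom (by simp) ≫ θ.hom ≫ eqToHom (by simp) = θ.hom :=
      (Category.id_comp _).trans (Category.comp_id _)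
    exact e' ▸ e
  · have e := k.isAlgCell_of_comp hK' θ _ (k.lift_comp hK' g φ hφ') κ hκ
    have e' : eqToHom (by simp) ≫ κ ≫ eqToHom (by simp) = κ :=
      (Category.id_comp _).trans (Category.comp_id _)
    rw [e'] at e
    exact e

section strictification

theorem mul_of_heq {C : Type u₀} [Category.{v₀} C] {X₁ X₂ X₃ X₄ Y₁ Y₂ Y₃ Y₄ : C} {n₁ : X₁ ⟶ X₂}
    {h₁ : X₂ = X₃} {n₂ : X₃ ⟶ X₄} {h₂ : X₁ = Y₁} {b : Y₁ ⟶ Y₂} {h₃ : Y₂ = Y₃} {n₃ : Y₃ ⟶ Y₄}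
    {h₄ : Y₄ = X₄}
    (h : n₁ ≫ eqToHom h₁ ≫ n₂ = eqToHom h₂ ≫ b ≫ eqToHom h₃ ≫ n₃ ≫ eqToHom h₄)
    {X₁' X₂' X₃' X₄' Y₁' Y₂' Y₃' Y₄' : C} (e₁ : X₁' = X₁) (e₂ : X₂' = X₂) (e₃ : X₃' = X₃)
    (e₄ : X₄' = X₄) (d₁ : Y₁' = Y₁) (d₂ : Y₂' = Y₂) (d₃ : Y₃' = Y₃) (d₄ : Y₄' = Y₄)
    {n₁' : X₁' ⟶ X₂'} {n₂' : X₃' ⟶ X₄'} {b' : Y₁' ⟶ Y₂'} {n₃' : Y₃' ⟶ Y₄'} (k₁ : n₁' ≍ n₁)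
    (k₂ : n₂' ≍ n₂) (k₃ : b' ≍ b) (k₄ : n₃' ≍ n₃) (h₁' : X₂' = X₃') (h₂' : X₁' = Y₁')
    (h₃' : Y₂' = Y₃') (h₄' : Y₄' = X₄') :
    n₁' ≫ eqToHom h₁' ≫ n₂' = eqToHom h₂' ≫ b' ≫ eqToHom h₃' ≫ n₃' ≫ 𝟙 _ ≫ eqToHom h₄' ≫ 𝟙 _ := by
  subst e₁ e₂ e₃ e₄ d₁ d₂ d₃ d₄
  cases k₁
  cases k₂
  cases k₃
  cases k₄
  simpa using h

theorem comp_eqCell_heq {D : CatGraph.{u₀, v₀, u₁, v₁}} {x y : D.Ob} {r : D.One} {s t : D.Hor x y}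
    (φ : r ⟶ HObj.mk s) (h : s = t) : φ ≫ eqCell h ≍ φ := by
  subst h
  exact heq_of_eq (Category.comp_id φ)

theorem eqCell_comp_heq {D : CatGraph.{u₀, v₀, u₁, v₁}} {x y : D.Ob} {r : D.One} {s t : D.Hor x y}
    (h : s = t) (φ : HObj.mk t ⟶ r) : eqCell h ≫ φ ≍ φ := by
  subst h
  exact heq_of_eq (Category.id_comp φ)

variable {D : Grph.{u, v}}

theorem heq_snoc_of_heq {x x' y y' z z' : D.Ob} {p p₁ : Str D.Hor x y} {q q₁ : Str D.Hor x' y'}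
    (hp : p = p₁) (hq : q = q₁) {r r₁ : D.Hor y z} {s s₁ : D.Hor y' z'} (hr : r = r₁) (hs : s = s₁)
    {c : (strCell D p q).T} {c₁ : (strCell D p₁ q₁).T} (hc : c ≍ c₁) {φ : HObj.mk r ⟶ HObj.mk s}
    {φ₁ : HObj.mk r₁ ⟶ HObj.mk s₁} (hφ : φ ≍ φ₁)
    (h : (strCell D p q).cod c = D.dom φ) (h₁ : (strCell D p₁ q₁).cod c₁ = D.dom φ₁) :
    (show (strCell D (p.snoc r) (q.snoc s)).T from ⟨(c, φ), h⟩) ≍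
      (show (strCell D (p₁.snoc r₁) (q₁.snoc s₁)).T from ⟨(c₁, φ₁), h₁⟩) := by
  subst hr hs
  cases hφ
  exact heq_snoc hp hq hc φ h h₁

namespace LaxAlg

variable (A : LaxAlg freeMonad D) [IsIso A.actUnit] [IsIso A.actMul]

/-- Conjugation of a vertical 1-cell by the unit. -/
noncomputable abbrev conj {x y : D.Ob} (f : A.act.F₀.obj x ⟶ A.act.F₀.obj y) : x ⟶ y :=
  A.eta₀ x ≫ f ≫ inv (A.eta₀ y)

omit [IsIso A.actMul] in
theorem conj_nat {a b c d : D.Ob} {f : a ⟶ b} {g : c ⟶ d}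
    {s : A.act.F₀.obj b ⟶ A.act.F₀.obj d} {t : A.act.F₀.obj a ⟶ A.act.F₀.obj c}
    (h : A.act.F₀.map f ≫ s = t ≫ A.act.F₀.map g) : f ≫ A.conj s = A.conj t ≫ g := by
  have e : inv (A.eta₀ c) ≫ g = A.act.F₀.map g ≫ inv (A.eta₀ d) := by
    rw [IsIso.inv_comp_eq, ← Category.assoc, IsIso.eq_comp_inv]
    exact A.eta₀_nat g
  rw [← Category.assoc, A.eta₀_nat f]
  simp only [Category.assoc]
  rw [e, reassoc_of% h]

omit [IsIso A.actMul] in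
theorem map_act_injective {x y : D.Ob} {f g : x ⟶ y} (h : A.act.F₀.map f = A.act.F₀.map g) :
    f = g :=
  (A.eta₀_conj f rfl).symm.trans ((congrArg (fun t => A.conj t) h).trans (A.eta₀_conj g rfl))

theorem bijective_whiskerRight_strEval {Z : Grph.{u, v}} (U V : Z ⟶ A.strGraph) :
    Function.Bijective (fun α : U ⟶ V => Bicategory.whiskerRight α A.strEval) := by
  constructor
  · intro α β h
    refine graphCell_ext (fun x => ?_) (fun r => ?_)
    · have e := congrArg (fun t : U ≫ A.strEval ⟶ V ≫ A.strEval => GraphCell.app₀ t x) h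
      exact A.map_act_injective e
    · have e := congrArg (fun t : U ≫ A.strEval ⟶ V ≫ A.strEval => GraphCell.app₁ t r) h
      exact e
  · intro β
    refine ⟨{ app₀ := fun x => A.conj (x := U.F₀.obj x) (y := V.F₀.obj x) (GraphCell.app₀ β x)
              app₁ := fun r => GraphCell.app₁ β r
              nat₀ := fun {x y} f => A.conj_nat (a := U.F₀.obj x) (b := U.F₀.obj y)
                (c := V.F₀.obj x) (d := V.F₀.obj y) (GraphCell.nat₀ β f)
              nat₁ := fun φ => GraphCell.nat₁ β φ
              dom_app := fun r => congrArg (fun t => A.conj (x := U.F₀.obj r.src)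
                (y := V.F₀.obj r.src) t) (GraphCell.dom_app β r)
              cod_app := fun r => congrArg (fun t => A.conj (x := U.F₀.obj r.tgt)
                (y := V.F₀.obj r.tgt) t) (GraphCell.cod_app β r) },
      graphCell_ext (fun x => ?_) (fun r => rfl)⟩
    exact A.map_conj_eta₀ (x := U.F₀.obj x) (y := V.F₀.obj x) (GraphCell.app₀ β x)

theorem join_eq_eval {x : A.strGraph.Ob} : ∀ {y : A.strGraph.Ob} (T : Str A.strGraph.Hor x y),
    (Str.join (H := D.Hor) T : Str D.Hor x y) = A.strDbl.eval T
  | _, .nil => rfl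
  | _, .snoc T p => congrArg (fun t => Str.append t p) (join_eq_eval T)

theorem isComposite_evalCell {x x' : A.strGraph.Ob} : ∀ {y y' : A.strGraph.Ob}
    {T : Str A.strGraph.Hor x y} {T' : Str A.strGraph.Hor x' y'} (c : (strCell A.strGraph T T').T),
    A.IsComposite (A.strDbl.evalCell c).1 (A.join_eq_eval T) (A.join_eq_eval T') c
  | _, _, .nil, .nil, c => A.isComposite_nil c
  | _, _, .snoc _ _, .snoc _ _, c =>
    have h := isComposite_evalCell c.1.1
    have h' := A.isComposite_singleton c.1.2
    h.hcomp h' (c.2.symm.trans (A.strDbl.evalCell c.1.1).2.symm) (c.2.trans h'.dom_eq.symm)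
  | _, _, .nil, .snoc _ _, c => c.elim
  | _, _, .snoc _ _, .nil, c => c.elim

end LaxAlg

end strictification

section strictification

variable {D : Grph.{u, v}}

namespace LaxAlg

section

variable (A : LaxAlg freeMonad D)

theorem actMap_heq' {x y x' y' : D.Ob} {p p₁ : Str D.Hor x y} {q q₁ : Str D.Hor x' y'}
    (hp : p = p₁) (hq : q = q₁) {c : (strCell D p q).T} {c₁ : (strCell D p₁ q₁).T} (hc : c ≍ c₁) :
    A.actMap c ≍ A.actMap c₁ := by
  subst hp hq
  cases hc
  rfl

theorem mu₁_heq {x y : D.Ob} {S S' : Str (freeGraph D).Hor x y} (h : S = S') :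
    A.mu₁ S ≍ A.mu₁ S' := by
  subst h
  rfl

end

variable (A : LaxAlg freeMonad D) [IsIso A.actUnit] [IsIso A.actMul]

theorem IsComposite.comm {x y x' y' : D.Ob} {p : Str D.Hor x y} {q : Str D.Hor x' y'}
    {φ : (HObj.mk p : A.strGraph.One) ⟶ HObj.mk q} {S : Str A.strGraph.Hor x y}
    {S' : Str A.strGraph.Hor x' y'} {hS : Str.join (H := D.Hor) S = p}
    {hS' : Str.join (H := D.Hor) S' = q} {c : (strCell A.strGraph S S').T}
    (h : A.IsComposite φ hS hS' c) :
    CategoryStruct.comp (obj := D.One) (A.strMap c) (A.actEq hS') =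
      CategoryStruct.comp (obj := D.One) (A.actEq hS) φ := by
  rw [← eqCell_strGraph, ← eqCell_strGraph]
  exact h

/-- The comparison between the evaluation of strings and the structure map. -/
noncomputable def strCompare : freeMap A.strEval ≫ A.act ⟶ A.strDbl.evalHom ≫ A.strEval where
  app₀ x := A.mu₀ x
  app₁ T := A.strMu T.hom ≫ A.actEq (A.join_eq_eval T.hom)
  nat₀ f := GraphCell.nat₀ A.actMul f
  nat₁ {S T} c := by
    have e := A.strMu_strMap (S := S.hom) (S' := T.hom) c
    have e' := A.isComposite_evalCell (T := S.hom) (T' := T.hom) c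
    have key : ∀ (χ : HObj.mk (A.act.obj₁ (Str.join (H := D.Hor) S.hom)) ⟶
          HObj.mk (A.act.obj₁ (Str.join (H := D.Hor) T.hom)))
        (ω : HObj.mk (A.act.obj₁ (A.strDbl.eval S.hom)) ⟶
          HObj.mk (A.act.obj₁ (A.strDbl.eval T.hom))) a,
        A.strMu S.hom ≫ χ = a ≫ A.strMu T.hom →
        χ ≫ A.actEq (A.join_eq_eval T.hom) = A.actEq (A.join_eq_eval S.hom) ≫ ω →
        a ≫ A.strMu T.hom ≫ A.actEq (A.join_eq_eval T.hom) =
          (A.strMu S.hom ≫ A.actEq (A.join_eq_eval S.hom)) ≫ ω := by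
      intro χ ω a h h'
      rw [← reassoc_of% h, h', Category.assoc]
    exact key _ _ _ e (IsComposite.comm A e')
  dom_app T := by
    rw [D.dom_comp, dom_eqCell]
    exact (Category.comp_id _).trans (A.dom_strMu T.hom)
  cod_app T := by
    rw [D.cod_comp, cod_eqCell]
    exact (Category.comp_id _).trans (A.cod_strMu T.hom)

instance : IsIso A.strCompare :=
  GraphCell.isIso_of_app _ (fun x => GraphCell.isIso_app₀ A.actMul x) (fun T => by
    have := A.isIso_strMu T.hom
    exact inferInstanceAs (IsIso (A.strMu T.hom ≫ A.actEq (A.join_eq_eval T.hom))))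

theorem strCompare_heq {x y : D.Ob} (T : Str A.strGraph.Hor x y) :
    GraphCell.app₁ A.strCompare ⟨T⟩ ≍ A.mu₁ T :=
  (comp_eqCell_heq _ (congrArg A.act.obj₁ (A.join_eq_eval T))).trans
    (eqCell_comp_heq (congrArg A.act.obj₁ (A.mapStr_strEval T)) (A.mu₁ T))

theorem mapStr_freeMap_strEval {x : D.Ob} : ∀ {y : D.Ob} (S : Str (freeGraph A.strGraph).Hor x y),
    (GraphHom.mapStr (freeMap A.strEval) S : Str (freeGraph D).Hor _ _) =
      GraphHom.mapStr (freeMap A.act) (show Str (freeGraph (freeGraph D)).Hor x y from S)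
  | _, .nil => rfl
  | _, .snoc S T => congrArg₂ (fun a b => Str.snoc a b) (mapStr_freeMap_strEval S)
      (A.mapStr_strEval T)

theorem mapStr_evalHom_strDbl {x : D.Ob} : ∀ {y : D.Ob} (S : Str (freeGraph A.strGraph).Hor x y),
    (GraphHom.mapStr A.strDbl.evalHom S : Str (freeGraph D).Hor x y) =
      GraphHom.mapStr (freeMul D) (show Str (freeGraph (freeGraph D)).Hor x y from S)
  | _, .nil => rfl
  | _, .snoc S T => congrArg₂ (fun a b => Str.snoc a b) (mapStr_evalHom_strDbl S)
      (A.join_eq_eval T).symm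

theorem mapStr_strEval_evalHom {x : D.Ob} : ∀ {y : D.Ob} (S : Str (freeGraph A.strGraph).Hor x y),
    (GraphHom.mapStr (A.strDbl.evalHom ≫ A.strEval) S : Str D.Hor _ _) =
      GraphHom.mapStr (freeMul D ≫ A.act) (show Str (freeGraph (freeGraph D)).Hor x y from S)
  | _, .nil => rfl
  | _, .snoc S T => congrArg₂ (fun a b => Str.snoc a b) (mapStr_strEval_evalHom S)
      (congrArg A.act.obj₁ (A.join_eq_eval T).symm)

theorem mapStr_freeMap_act {x : D.Ob} : ∀ {y : D.Ob} (S : Str (freeGraph A.strGraph).Hor x y),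
    (GraphHom.mapStr (freeMap A.strEval ≫ A.act) S : Str D.Hor _ _) =
      GraphHom.mapStr (freeMap A.act ≫ A.act) (show Str (freeGraph (freeGraph D)).Hor x y from S)
  | _, .nil => rfl
  | _, .snoc S T => congrArg₂ (fun a b => Str.snoc a b) (mapStr_freeMap_act S)
      (congrArg A.act.obj₁ (A.mapStr_strEval T))

theorem strApp_strCompare_heq {x : D.Ob} : ∀ {y : D.Ob} (S : Str (freeGraph A.strGraph).Hor x y),
    (GraphCell.strApp A.strCompare S).1 ≍
      (GraphCell.strApp A.actMul (show Str (freeGraph (freeGraph D)).Hor x y from S)).1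
  | _, .nil => HEq.rfl
  | _, .snoc S T => heq_snoc_of_heq (A.mapStr_freeMap_act S) (A.mapStr_strEval_evalHom S)
      (congrArg A.act.obj₁ (A.mapStr_strEval T)) (congrArg A.act.obj₁ (A.join_eq_eval T).symm)
      (strApp_strCompare_heq S) (A.strCompare_heq T) _ _

theorem eval_append_strDbl {x y : D.Ob} (p : Str A.strGraph.Hor x y) {z : D.Ob}
    (q : Str A.strGraph.Hor y z) :
    (Str.append (A.strDbl.eval p) (A.strDbl.eval q) : Str D.Hor x z) = A.strDbl.eval (p.append q) :=
  (congrArg₂ (fun a b => Str.append a b) (A.join_eq_eval p) (A.join_eq_eval q)).symm.trans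
    ((join_append (A := D) p q).symm.trans (A.join_eq_eval (p.append q)))

theorem nu_strDbl {x y : A.strGraph.Ob} (p : Str A.strGraph.Hor x y) : ∀ {z : A.strGraph.Ob}
    (q : Str A.strGraph.Hor y z), (A.strDbl.nu p q).1 = eqCell (A.eval_append_strDbl p q)
  | _, .nil => rfl
  | _, .snoc q r =>
    (congrArg (fun t => eqCell (D := A.strGraph) (append_assoc (A.strDbl.eval p) (A.strDbl.eval q)
      r).symm ≫ t) ((A.strDbl.hcomp_congr rfl (nu_strDbl p q) _ (A.dom_eqCell_strGraph
        (rfl : r = r) _)).trans (A.strHcomp_eqCell (rfl : r = r) (A.eval_append_strDbl p q)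
          (A.dom_eqCell_strGraph _ _)))).trans (eqCell_trans (D := A.strGraph) _ _)

theorem eval_mapStr_strDbl {x y : D.Ob} (S : Str (freeGraph A.strGraph).Hor x y) :
    A.strDbl.eval (GraphHom.mapStr A.strDbl.evalHom S) = A.strDbl.eval S.join := by
  have e := congrArg Str.join (A.mapStr_evalHom_strDbl S)
  have e' := join_join (show Str (freeGraph (freeGraph D)).Hor x y from S)
  exact (A.join_eq_eval _).symm.trans (e.trans (e'.trans (A.join_eq_eval (Str.join S))))

theorem mu_strDbl {x : A.strGraph.Ob} : ∀ {y : A.strGraph.Ob}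
    (S : Str (freeGraph A.strGraph).Hor x y), (A.strDbl.mu S).1 = eqCell (A.eval_mapStr_strDbl S)
  | _, .nil => rfl
  | _, .snoc S q =>
    (congrArg₂ (fun a b => a ≫ b) ((A.strDbl.hcomp_congr rfl (mu_strDbl S) _ (A.dom_eqCell_strGraph
        rfl _)).trans (A.strHcomp_eqCell rfl (A.eval_mapStr_strDbl S)
          (A.dom_eqCell_strGraph _ _))) (A.nu_strDbl S.join q)).trans
      (eqCell_trans (D := A.strGraph) _ _)

end LaxAlg

end strictification

section strictification

variable {D : Grph.{u, v}}

namespace LaxAlg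

variable (A : LaxAlg freeMonad D) [IsIso A.actUnit] [IsIso A.actMul]

omit [IsIso A.actUnit] [IsIso A.actMul] in
theorem map_act_mu₀_mu₀ (x : D.Ob) : A.mu₀ (A.act.F₀.obj x) ≫ A.mu₀ x =
    A.act.F₀.map (A.mu₀ x) ≫ A.mu₀ x := by
  have e : ∀ x : (freeMonad.T.obj (freeMonad.T.obj (freeMonad.T.obj D))).Ob,
      A.mu₀ (A.act.F₀.obj x) ≫ 𝟙 _ ≫ A.mu₀ x =
        𝟙 _ ≫ A.act.F₀.map (A.mu₀ x) ≫ 𝟙 _ ≫ A.mu₀ x ≫ 𝟙 _ := by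
    intro x
    have e := congrArg (fun θ => GraphCell.app₀ θ x) A.assoc
    simp only [comp_app₀, eqToHom_app₀] at e
    exact e
  simpa using e x

theorem strCompare_unit {x y : D.Ob} (p : Str D.Hor x y) :
    A.eta (A.act.obj₁ p) ≫ 𝟙 _ ≫ A.strMu (Str.nil.snoc p) ≫
        A.actEq (A.join_eq_eval (Str.nil.snoc p)) = 𝟙 _ ≫ A.actEq (nil_append p).symm ≫ 𝟙 _ := by
  have e := A.eta_mu₁ p
  rw [strMu]
  simp only [Category.id_comp, Category.comp_id, Category.assoc]
  refine Eq.trans ?_ e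
  refine congrArg (_ ≫ ·) ?_
  exact (Category.id_comp _).trans (Category.comp_id _)

theorem strCompare_mul {x y : D.Ob} (S : Str (freeGraph A.strGraph).Hor x y) (h₁ h₂ h₃ h₄) :
    A.mu₁ (GraphHom.mapStr (freeMap A.strEval) S) ≫ eqToHom h₁ ≫
        (show HObj.mk (A.act.obj₁ (GraphHom.mapStr A.strEval S.join)) ⟶
          HObj.mk (A.act.obj₁ (A.strDbl.eval S.join)) from GraphCell.app₁ A.strCompare ⟨S.join⟩) =
      eqToHom h₂ ≫ A.actMap (GraphCell.strApp A.strCompare S).1 ≫ eqToHom h₃ ≫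
        (show HObj.mk (A.act.obj₁ (GraphHom.mapStr A.strEval (GraphHom.mapStr A.strDbl.evalHom S))) ⟶
          HObj.mk (A.act.obj₁ (A.strDbl.eval (GraphHom.mapStr A.strDbl.evalHom S))) from
            GraphCell.app₁ A.strCompare ⟨GraphHom.mapStr A.strDbl.evalHom S⟩) ≫ 𝟙 _ ≫
          eqToHom h₄ ≫ 𝟙 _ := by
  have e := A.mu₁_assoc S
  simp only [actEq, eqCell] at e
  refine mul_of_heq e ?_ ?_ ?_ ?_ ?_ ?_ ?_ ?_ (A.mu₁_heq (A.mapStr_freeMap_strEval S))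
    (A.strCompare_heq S.join) (A.actMap_heq' (A.mapStr_freeMap_act S) (A.mapStr_strEval_evalHom S)
      (A.strApp_strCompare_heq S)) ((A.strCompare_heq _).trans
        (A.mu₁_heq (A.mapStr_evalHom_strDbl S))) h₁ h₂ h₃ h₄
  · exact congrArg (fun T => HObj.mk (A.act.obj₁ (GraphHom.mapStr A.act T)))
      (A.mapStr_freeMap_strEval S)
  · exact congrArg (fun T => HObj.mk (A.act.obj₁ (Str.join T))) (A.mapStr_freeMap_strEval S)
  · exact congrArg (fun p => HObj.mk (A.act.obj₁ p)) (A.mapStr_strEval S.join)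
  · exact congrArg (fun p => HObj.mk (A.act.obj₁ p)) (A.join_eq_eval S.join).symm
  · exact congrArg (fun p => HObj.mk (A.act.obj₁ p)) (A.mapStr_freeMap_act S)
  · exact congrArg (fun p => HObj.mk (A.act.obj₁ p)) (A.mapStr_strEval_evalHom S)
  · exact congrArg (fun p => HObj.mk (A.act.obj₁ p)) ((A.mapStr_strEval _).trans
      (congrArg (GraphHom.mapStr A.act) (A.mapStr_evalHom_strDbl S)))
  · exact congrArg (fun p => HObj.mk (A.act.obj₁ p)) ((A.join_eq_eval _).symm.trans
      (congrArg Str.join (A.mapStr_evalHom_strDbl S)))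

/-- The evaluation of strings, as a morphism of algebras. -/
noncomputable def strEvalMor : LaxMor A.strDbl.alg A A.strEval where
  φ := A.strCompare
  unit := by
    refine graphCell_ext (fun x => ?_) (fun p => ?_) <;>
      simp only [comp_app₀, comp_app₁, eqToHom_app₀, eqToHom_app₁]
    · have e : ∀ x : D.Ob, A.eta₀ (A.act.F₀.obj x) ≫ 𝟙 _ ≫ A.mu₀ x =
          𝟙 _ ≫ A.act.F₀.map (𝟙 x) ≫ 𝟙 _ := by
        intro x
        simp [A.eta₀_mu₀]
      exact e x
    · exact A.strCompare_unit p.hom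
  mul := by
    refine graphCell_ext (fun x => ?_) (fun S => ?_) <;>
      simp only [comp_app₀, comp_app₁, eqToHom_app₀, eqToHom_app₁]
    · have e : ∀ x : D.Ob, A.mu₀ (A.act.F₀.obj x) ≫ 𝟙 _ ≫ A.mu₀ x =
          𝟙 _ ≫ A.act.F₀.map (A.mu₀ x) ≫ 𝟙 _ ≫ A.mu₀ x ≫ 𝟙 _ ≫ A.act.F₀.map (𝟙 x) ≫ 𝟙 _ := by
        intro x
        have e := A.map_act_mu₀_mu₀ x
        simpa using e
      exact e x
    · have e := (A.mu_strDbl S.hom).trans (A.eqCell_strGraph _)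
      refine (A.strCompare_mul S.hom _
        (congrArg (fun p => HObj.mk (A.act.obj₁ p)) (mapStr_comp (freeMap A.strEval) A.act S.hom).symm)
        (congrArg (fun p => HObj.mk (A.act.obj₁ p)) (mapStr_comp A.strDbl.evalHom A.strEval S.hom))
        (congrArg (fun p => HObj.mk (A.act.obj₁ p)) (A.eval_mapStr_strDbl S.hom))).trans ?_
      exact congrArg (fun t => _ ≫ _ ≫ _ ≫ _ ≫ 𝟙 _ ≫ t ≫ 𝟙 _) e.symm

instance : IsIso A.strEvalMor.φ := inferInstanceAs (IsIso A.strCompare)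

/-- The unit of a pseudo-algebra, as an isomorphism with the evaluation of singletons. -/
noncomputable def unitIso : 𝟙 D ≅ A.strIncl ≫ A.strEval :=
  show 𝟙 D ≅ freeUnit D ≫ A.act from asIso A.actUnit

theorem equivalent_strDbl : A.Equivalent A.strDbl.alg :=
  A.strEvalMor.equivalent A.bijective_whiskerRight_strEval A.unitIso

end LaxAlg

end strictification

theorem LaxMor.isIso_ofIso {B : Type u} [Bicategory.{w, v} B] [Bicategory.Strict B] {M : TwoMonad B}
    {X Y : B} {A : LaxAlg M X} {A' : LaxAlg M Y} {f g : X ⟶ Y} (k : LaxMor A A' g) (θ : f ≅ g)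
    (h : IsIso k.φ) : IsIso (k.ofIso θ).φ := by
  simp only [LaxMor.ofIso]
  infer_instance

theorem LaxMor.isIso_comp {B : Type u} [Bicategory.{w, v} B] [Bicategory.Strict B] {M : TwoMonad B}
    {X Y Z : B} {A : LaxAlg M X} {A' : LaxAlg M Y} {A'' : LaxAlg M Z} {f : X ⟶ Y} {g : Y ⟶ Z}
    (k : LaxMor A A' f) (l : LaxMor A' A'' g) (h : IsIso k.φ) (h' : IsIso l.φ) :
    IsIso (k.comp l).φ := by
  simp only [LaxMor.comp]
  infer_instance

theorem AlgComp.isIso_ofLaxMor {B : Type u} [Bicategory.{w, v} B] [Bicategory.Strict B]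
    {M : TwoMonad B} {X : B} {A A' : LaxAlg M X} (k : LaxMor A A' (𝟙 X)) (h : IsIso k.φ) :
    IsIso (AlgComp.ofLaxMor k).j := by
  simp only [AlgComp.ofLaxMor]
  infer_instance

section normal

variable {D E : Grph.{u, v}}

theorem exists_iso_of_heq_id {D : CatGraph.{u₀, v₀, u₁, v₁}} {F : D.Ob ⥤ D.Ob} (h : F = 𝟭 _)
    {η : ∀ x, x ⟶ F.obj x} (hη : ∀ x, η x ≍ 𝟙 x) {x y : D.Ob} (r : D.Hor (F.obj x) (F.obj y)) :
    ∃ (t : D.Hor x y) (i : HObj.mk t ≅ HObj.mk r), D.dom i.hom = η x ∧ D.cod i.hom = η y := by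
  subst h
  exact ⟨r, Iso.refl _, (D.dom_id _).trans (eq_of_heq (hη x)).symm,
    (D.cod_id _).trans (eq_of_heq (hη y)).symm⟩

theorem LaxStr.isIso_eval {P : PseudoDblStr D} {Q : PseudoDblStr E} {F : D ⟶ E}
    (f : LaxStr P Q F) (hu : ∀ x, IsIso (f.unit x))
    (hm : ∀ {x y z : D.Ob} (s : D.Hor y z) (r : D.Hor x y), IsIso (f.mul s r)) {x : D.Ob} :
    ∀ {y : D.Ob} (p : Str D.Hor x y), IsIso (f.eval p).1
  | _, .nil => hu x
  | _, .snoc p r => by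
    have := f.isIso_eval hu hm p
    have := hm r (P.eval p)
    rw [f.eval_snoc]
    infer_instance

theorem LaxStr.isIso_algMor {P : PseudoDblStr D} {Q : PseudoDblStr E} {F : D ⟶ E}
    (f : LaxStr P Q F) (hu : ∀ x, IsIso (f.unit x))
    (hm : ∀ {x y z : D.Ob} (s : D.Hor y z) (r : D.Hor x y), IsIso (f.mul s r)) :
    IsIso f.algMor.φ :=
  GraphCell.isIso_of_app _ (fun x => inferInstanceAs (IsIso (𝟙 (F.F₀.obj x))))
    (fun p => f.isIso_eval hu hm p.hom)

namespace LaxAlg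

variable (A : LaxAlg freeMonad D) [IsIso A.actUnit]

instance isIso_eta {x y : D.Ob} (r : D.Hor x y) : IsIso (A.eta r) := GraphCell.isIso_app₁ _ _

theorem exists_iso_singleton (hA : A.IsNormal) {x y : D.Ob} (p : Str D.Hor x y) :
    ∃ (t : D.Hor x y) (i : HObj.mk (A.act.obj₁ p) ≅ HObj.mk (A.act.obj₁ (Str.nil.snoc t))),
      D.dom i.hom = 𝟙 _ ∧ D.cod i.hom = 𝟙 _ := by
  obtain ⟨t, i, hd, hc⟩ := exists_iso_of_heq_id (D := D) hA.a_eq hA.η_eq (A.act.obj₁ p)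
  have hd' : D.dom (A.eta t) = A.eta₀ x := GraphCell.dom_app A.actUnit ⟨t⟩
  have hc' : D.cod (A.eta t) = A.eta₀ y := GraphCell.cod_app A.actUnit ⟨t⟩
  have ed : D.dom (i.symm ≪≫ asIso (A.eta t)).inv = 𝟙 _ := by
    have e : D.dom (A.eta t) ≫ D.dom (i.symm ≪≫ asIso (A.eta t)).inv = A.eta₀ x := by
      rw [← D.dom_comp]
      simpa using hd
    rw [hd'] at e
    exact (cancel_epi (A.eta₀ x)).1 (e.trans (Category.comp_id _).symm)
  have ec : D.cod (i.symm ≪≫ asIso (A.eta t)).inv = 𝟙 _ := by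
    have e : D.cod (A.eta t) ≫ D.cod (i.symm ≪≫ asIso (A.eta t)).inv = A.eta₀ y := by
      rw [← D.cod_comp]
      simpa using hc
    rw [hc'] at e
    exact (cancel_epi (A.eta₀ y)).1 (e.trans (Category.comp_id _).symm)
  exact ⟨t, i.symm ≪≫ asIso (A.eta t), CatGraph.dom_isoInv (i.symm ≪≫ asIso (A.eta t)).symm ed,
    CatGraph.cod_isoInv (i.symm ≪≫ asIso (A.eta t)).symm ec⟩

variable [IsIso A.actMul]

omit [IsIso A.actMul] in
theorem exists_globular_iso (hA : A.IsNormal) {x y : D.Ob} (p : Str D.Hor x y) :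
    ∃ (t : D.Hor x y) (i : (HObj.mk p : A.strGraph.One) ≅ HObj.mk (Str.nil.snoc t)),
      A.strGraph.dom i.hom = 𝟙 _ ∧ A.strGraph.cod i.hom = 𝟙 _ := by
  obtain ⟨t, i, hd, hc⟩ := A.exists_iso_singleton hA p
  exact ⟨t, ⟨i.hom, i.inv, i.hom_inv_id, i.inv_hom_id⟩,
    A.eta₀_conj (𝟙 x) (hd.trans (A.act.F₀.map_id x).symm),
    A.eta₀_conj (𝟙 y) (hc.trans (A.act.F₀.map_id y).symm)⟩

/-- A horizontal 1-cell isomorphic to a string, for a normal algebra. -/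
noncomputable def collapse (hA : A.IsNormal) {x y : D.Ob} (p : Str D.Hor x y) : D.Hor x y :=
  (A.exists_globular_iso hA p).choose

/-- The isomorphism of a string with a horizontal 1-cell, for a normal algebra. -/
noncomputable def collapseIso (hA : A.IsNormal) {x y : D.Ob} (p : Str D.Hor x y) :
    (HObj.mk p : A.strGraph.One) ≅ HObj.mk (Str.nil.snoc (A.collapse hA p)) :=
  (A.exists_globular_iso hA p).choose_spec.choose

omit [IsIso A.actMul] in
theorem dom_collapseIso (hA : A.IsNormal) {x y : D.Ob} (p : Str D.Hor x y) :
    A.strGraph.dom (A.collapseIso hA p).hom = 𝟙 _ :=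
  (A.exists_globular_iso hA p).choose_spec.choose_spec.1

omit [IsIso A.actMul] in
theorem cod_collapseIso (hA : A.IsNormal) {x y : D.Ob} (p : Str D.Hor x y) :
    A.strGraph.cod (A.collapseIso hA p).hom = 𝟙 _ :=
  (A.exists_globular_iso hA p).choose_spec.choose_spec.2

omit [IsIso A.actMul] in
theorem map_conj_eta {x y x' y' : D.Ob} {r : D.Hor x y} {s : D.Hor x' y'}
    (ψ : HObj.mk (A.act.obj₁ (Str.nil.snoc r)) ⟶ HObj.mk (A.act.obj₁ (Str.nil.snoc s))) :
    A.act.map₁ ((freeUnit D).map₁ (r := ⟨r⟩) (s := ⟨s⟩) (A.eta r ≫ ψ ≫ inv (A.eta s))) = ψ := by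
  have e := A.eta_nat (A.eta r ≫ ψ ≫ inv (A.eta s))
  simp only [Category.assoc, IsIso.inv_hom_id, Category.comp_id] at e
  exact ((cancel_epi (A.eta r)).1 e).symm

omit [IsIso A.actMul] in
theorem conj_map_eta {x y x' y' : D.Ob} {r : D.Hor x y} {s : D.Hor x' y'}
    (φ : HObj.mk r ⟶ HObj.mk s) :
    A.eta r ≫ A.act.map₁ ((freeUnit D).map₁ φ) ≫ inv (A.eta s) = φ := by
  rw [← Category.assoc, IsIso.comp_inv_eq]
  exact (A.eta_nat φ).symm

/-- The data for transporting the pseudodouble category of strings to the graph of a normal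
algebra. -/
noncomputable def transportData (hA : A.IsNormal) : TransportData A.strDbl A.strIncl where
  faithful h := h
  pre {r s} ψ := A.eta r.hom ≫ (show HObj.mk (A.act.obj₁ (Str.nil.snoc r.hom)) ⟶
    HObj.mk (A.act.obj₁ (Str.nil.snoc s.hom)) from ψ) ≫ inv (A.eta s.hom)
  map_pre ψ := A.map_conj_eta ψ
  pre_map φ := A.conj_map_eta φ
  one x := A.collapse hA (Str.nil (x := x))
  u x := A.collapseIso hA (Str.nil (x := x))
  dom_u x := A.dom_collapseIso hA (Str.nil (x := x))
  cod_u x := A.cod_collapseIso hA (Str.nil (x := x))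
  comp s r := A.collapse hA ((Str.nil.snoc r).append (Str.nil.snoc s))
  m s r := A.collapseIso hA ((Str.nil.snoc r).append (Str.nil.snoc s))
  dom_m s r := A.dom_collapseIso hA ((Str.nil.snoc r).append (Str.nil.snoc s))
  cod_m s r := A.cod_collapseIso hA ((Str.nil.snoc r).append (Str.nil.snoc s))

/-- The pseudodouble category of a normal algebra. -/
noncomputable def dbl (hA : A.IsNormal) : PseudoDblStr D := (A.transportData hA).str

/-- The comparison of a normal algebra with the algebra of its pseudodouble category. -/
noncomputable def dblMor (hA : A.IsNormal) : LaxMor (A.dbl hA).alg A (𝟙 D) :=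
  ((A.transportData hA).laxStr.algMor.comp A.strEvalMor).ofIso A.unitIso

theorem isIso_dblMor (hA : A.IsNormal) : IsIso (A.dblMor hA).φ :=
  LaxMor.isIso_ofIso _ _ (LaxMor.isIso_comp _ _ (LaxStr.isIso_algMor _
    (fun x => inferInstanceAs (IsIso ((A.transportData hA).u x).hom))
    (fun s r => inferInstanceAs (IsIso ((A.transportData hA).m s r).hom))) inferInstance)

/-- The comparison of the algebra of its pseudodouble category with a normal algebra. -/
noncomputable def dblComp (hA : A.IsNormal) : AlgComp A (A.dbl hA).alg :=
  AlgComp.ofLaxMor (A.dblMor hA)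

theorem isIso_dblComp (hA : A.IsNormal) : IsIso (A.dblComp hA).j :=
  AlgComp.isIso_ofLaxMor _ (A.isIso_dblMor hA)

end LaxAlg

/-- A normal pseudo-algebra is isomorphic to the algebra of its pseudodouble category. -/
noncomputable def normalIsoOver
    (Y : ((psAlg freeMonad.{u, v}).full fun _ A => LaxAlg.IsNormal A.1).Ob D) :
    (P : PseudoDblStr D) × DispDbl.IsoOver
      (𝒴 := (psAlg freeMonad.{u, v}).full fun _ A => LaxAlg.IsNormal A.1)
      ⟨⟨P.alg, P.alg_isPseudo⟩, P.alg_isNormal⟩ Y :=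
  have : IsIso Y.1.1.actUnit := Y.1.2.isIso_η
  have : IsIso Y.1.1.actMul := Y.1.2.isIso_μ
  have : IsIso (Y.1.1.dblComp Y.2).j := Y.1.1.isIso_dblComp Y.2
  have : IsIso (Y.1.1.dblComp Y.2).symm.j := inferInstanceAs (IsIso (inv _))
  ⟨Y.1.1.dbl Y.2, AlgComp.isoOver (X := ⟨⟨(Y.1.1.dbl Y.2).alg, PseudoDblStr.alg_isPseudo _⟩,
    PseudoDblStr.alg_isNormal _⟩) (Y.1.1.dblComp Y.2).symm⟩

theorem isDblEquivalence_algFunctor :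
    IsDblEquivalence (algFunctor.{u, v}.corestrict (fun _ A => LaxAlg.IsNormal A.1)
      fun P => PseudoDblStr.alg_isNormal P).laxStr :=
  DispDbl.DFunctor.isDblEquivalence _ (fun _ _ _ => LaxStr.bijective_algMor)
    (fun _ _ _ => OplaxStr.bijective_algMor)
    (fun _ _ _ _ _ c => isGenTransf_iff_isAlgCell.2 c) (fun Y => (normalIsoOver Y).1)
    (fun Y => (normalIsoOver Y).2)

end normal

end DblPsAlg

theorem mainTheorem10 :
    ∃ (Φ : DispDbl.DFunctor psDb.{u, v} (psAlg freeMonad.{u, v})) (_ : IsEvalFunctor Φ)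
      (hΦ : ∀ {D : Grph.{u, v}} (P : PseudoDblStr D), LaxAlg.IsNormal (Φ.obj P).1),
      -- equivalence of double categories onto the normal pseudo-algebras
      IsDblEquivalence (Φ.corestrict (fun _ A => LaxAlg.IsNormal A.1) hΦ).laxStr ∧
      -- lax functors correspond to lax algebra morphisms, oplax functors to oplax ones
      (∀ {D E : Grph.{u, v}} (P : PseudoDblStr D) (Q : PseudoDblStr E) (F : D ⟶ E),
        Function.Bijective
          (fun f : LaxStr P Q F => (Φ.hmap f : LaxMor (Φ.obj P).1 (Φ.obj Q).1 F)) ∧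
        Function.Bijective
          (fun f : OplaxStr P Q F => (Φ.vmap f : OplaxMor (Φ.obj P).1 (Φ.obj Q).1 F))) ∧
      -- generalized vertical transformations correspond to generalized algebra 2-cells
      (∀ {A B C D : Grph.{u, v}} {P : PseudoDblStr A} {Q : PseudoDblStr B} {R : PseudoDblStr C}
        {S : PseudoDblStr D} {H : A ⟶ B} {F : A ⟶ C} {G : B ⟶ D} {K : C ⟶ D} (h : LaxStr P Q H)
        (f : OplaxStr P R F) (g : OplaxStr Q S G) (k : LaxStr R S K) (ω : H ≫ G ⟶ F ≫ K),
        IsGenTransf h f g k ω ↔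
          IsAlgCell (M := freeMonad) (Φ.hmap h) (Φ.vmap f) (Φ.vmap g) (Φ.hmap k) ω) ∧
      -- every normal pseudo-algebra is isomorphic, by an invertible pseudomorphism over the identity
      -- of its graph, to the algebra of a pseudodouble category on the same graph
      (∀ {D : Grph.{u, v}} (A : LaxAlg freeMonad D), A.IsPseudo → A.IsNormal →
        ∃ (P : PseudoDblStr D) (γ : LaxMor (Φ.obj P).1 A (𝟙 D)), IsIso γ.φ) ∧
      -- every pseudo-algebra is equivalent to the algebra of a pseudodouble category
      (∀ {D : Grph.{u, v}} (A : LaxAlg freeMonad D), A.IsPseudo →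
        ∃ (E : Grph.{u, v}) (P : PseudoDblStr E), A.Equivalent (Φ.obj P).1) := by
  refine ⟨algFunctor, isEvalFunctor_algFunctor, fun P => P.alg_isNormal,
    isDblEquivalence_algFunctor, fun P Q F => ⟨LaxStr.bijective_algMor, OplaxStr.bijective_algMor⟩,
    fun h f g k ω => isGenTransf_iff_isAlgCell, fun {D} A hA hN => ?_, fun {D} A hA => ?_⟩
  · have : IsIso A.actUnit := hA.isIso_η
    have : IsIso A.actMul := hA.isIso_μ
    exact ⟨A.dbl hN, A.dblMor hN, A.isIso_dblMor hN⟩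
  · have : IsIso A.actUnit := hA.isIso_η
    have : IsIso A.actMul := hA.isIso_μ
    exact ⟨A.strGraph, A.strDbl, A.equivalent_strDbl⟩
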